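/- **Setting.** Let $M$ be a $C^{1,1}$ surface (Hausdorff, second countable, with an atlas of charts in $\mathbb R^2$ whose transition maps are $C^1$ with locally Lipschitz first derivative). Let $g$ be a (singular) Riemannian metric on $M$, i.e. a measurable section of $S^2(T^*M)$ that is positive definite almost everywhere. Assume that $(M,g)$ has bounded integral curvature, in the sense that every point of $M$ lies in a chart (an *isothermal* chart) in which, almost everywhere, $g=e^{2\varphi}\big((dx^1)^2+(dx^2)^2\big)$, where $\varphi$ is a difference of two subharmonic functions. *Connections.* A measurable torsion-free connection $\nabla$ on $TM$ is given in charts by measurable Christoffel symbols $\Gamma^i_{jk}=\Gamma^i_{kj}$ that obey the usual transformation law almost everywhere. It is the Levi-Civita connection of $g$ if in every isothermal chart $\varphi$ has weak derivatives $\partial_k\varphi\in L^1_{loc}$ and $$\partial_k g_{ij}=\sum_l\big(g_{lj}\Gamma^l_{ik}+g_{il}\Gamma^l_{jk}\big)\quad\text{a.e.},$$ where $\partial_kg_{ij}:=2(\partial_k\varphi)\,g_{ij}$. *Quadratic form.* Let $\mathcal D$ be the density line bundle of $M$, and let $V,W$ be compactly supported Lipschitz vector-valued half-densities on $M$, i.e.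 Lipschitz sections of $TM\otimes\mathcal D^{1/2}$. Write locally $V=\sum_i v^i\,\partial_i\otimes\sqrt{dx^1dx^2}$ and $$\nabla_iv^j=\partial_iv^j+\sum_k\Gamma^j_{ki}v^k-\tfrac12\sum_k\Gamma^k_{ki}v^j ,$$ $\nabla_iV^j=(\nabla_iv^j)\sqrt{dx^1dx^2}$, and similarly for $W$. Put $$Q(V,W)=\int_M\sum_{i,j}\Big[(\nabla_iV^i)(\nabla_jW^j)-(\nabla_iV^j)(\nabla_jW^i)\Big].$$ The integrand is a density on $M$. The connection $\nabla$ is called *tame* if it is integrable over $M$ for all such $V$ and $W$. *Curvature measure.* A signed Radon measure $K$ on $M$ (a difference of two locally finite Borel measures) is the curvature measure of $g$ if in every isothermal chart $dK=-(\partial_1^2+\partial_2^2)\varphi\,dx^1dx^2$, that is, $\int_M f\,dK=-\int_{\mathbb R^2}(\partial_1^2+\partial_2^2)f\;\varphi\,dx^1dx^2$ for every smooth $f$ with compact support in the chart. **Proposition.** The Levi-Civita connection $\nabla$ of $g$ and the curvature measure $K$ of $g$ exist, and $\nabla$ is tame. For all compactly supported Lipschitz vector-valued half-densities $V$ and $W$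 on $M$, the function $g(V,W)/\mathrm{dvol}_g$, which in a chart is $\sum_{i,j}g_{ij}v^iw^j/\sqrt{\det g}$ almost everywhere, extends to a Lipschitz function on $M$, and with this extension $$Q(V,W)=\int_M\frac{g(V,W)}{\mathrm{dvol}_g}\,dK .$$ -/

import Mathlib

open MeasureTheory Set Topology
open scoped Manifold ContDiff

noncomputable section

namespace TameConn

/-- The Euclidean coordinate space `ℝⁿ`. -/
abbrev Coord (n : ℕ) : Type := EuclideanSpace ℝ (Fin n)

/-- The `i`-th partial derivative of a real function on `ℝⁿ`. -/
def pd {n : ℕ} (i : Fin n) (f : Coord n → ℝ) (y : Coord n) : ℝ :=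
  fderiv ℝ f y (EuclideanSpace.single i 1)

/-! ### Manifolds of class `C^{1,1}` -/

section Manifold

variable {n : ℕ} {M : Type*} [TopologicalSpace M] [ChartedSpace (Coord n) M]

/-- The change of coordinates from the chart `e` to the chart `e'`; its domain is
`(chartTrans e e').source`, the image under `e` of the overlap of the two charts. -/
def chartTrans (e e' : atlas (Coord n) M) : OpenPartialHomeomorph (Coord n) (Coord n) :=
  e.1.symm ≫ₕ e'.1

/-- Writing `y` for the coordinates of `e` and `x` for those of `e'`, this is the Jacobian
matrix `∂xᵃ/∂yᵇ` (row `a`, column `b`) at the point with `e`-coordinates `y`. -/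
def jac (e e' : atlas (Coord n) M) (y : Coord n) : Matrix (Fin n) (Fin n) ℝ :=
  fun a b => pd b (fun z => chartTrans e e' z a) y

/-- The second derivatives `∂²xᵃ/∂yʲ∂yᵏ` of the change of coordinates; for a `C^{1,1}`
manifold they exist almost everywhere. -/
def hess (e e' : atlas (Coord n) M) (y : Coord n) (a j k : Fin n) : ℝ :=
  pd j (fun z => pd k (fun w => chartTrans e e' w a) z) y

variable (n M) in
/-- The atlas of `M` is a `C^{1,1}` atlas: the changes of coordinates are `C¹` and their first
derivatives are locally Lipschitz. -/
def IsC11Manifold : Prop :=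
  ∀ e e' : atlas (Coord n) M,
    ContDiffOn ℝ 1 (chartTrans e e') (chartTrans e e').source ∧
      LocallyLipschitzOn (chartTrans e e').source (fderiv ℝ (chartTrans e e'))

/-! ### Measurable torsion-free connections -/

variable (n M) in
/-- A measurable torsion-free connection on `TM`, given in each chart by its Christoffel symbols:
`Γ e y i j k` is `Γⁱⱼₖ` at the point with `e`-coordinates `y`.  The symbols are measurable,
symmetric in the lower indices, and obey the usual transformation law almost everywhere. -/
structure MeasurableConnection where
  Γ : atlas (Coord n) M → Coord n → Fin n → Fin n → Fin n → ℝ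
  aemeasurable : ∀ e i j k, AEMeasurable (fun y => Γ e y i j k) (volume.restrict e.1.target)
  torsionFree : ∀ e, ∀ᵐ y ∂(volume.restrict e.1.target), ∀ i j k, Γ e y i j k = Γ e y i k j
  transform : ∀ e e', ∀ᵐ y ∂(volume.restrict (chartTrans e e').source), ∀ i j k,
    Γ e y i j k =
      (∑ a, ∑ b, ∑ c, jac e' e (chartTrans e e' y) i a * jac e e' y b j * jac e e' y c k *
        Γ e' (chartTrans e e' y) a b c) +
      ∑ a, jac e' e (chartTrans e e' y) i a * hess e e' y a j k

/-! ### Vector-valued half-densities -/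

variable (n M) in
/-- A compactly supported Lipschitz section `V` of `TM ⊗ 𝓓^{1/2}`.  In the chart `e`, with
coordinates `y`, it is `V = ∑ᵢ (coord e y i) ∂ᵢ ⊗ √(dy¹ ⋯ dyⁿ)`. -/
structure LipHalfDensity where
  coord : atlas (Coord n) M → Coord n → Fin n → ℝ
  locallyLipschitz : ∀ e, LocallyLipschitzOn e.1.target (coord e)
  transform : ∀ e e', ∀ y ∈ (chartTrans e e').source, ∀ i,
    coord e y i = Real.sqrt |(jac e e' y).det| *
      ∑ a, jac e' e (chartTrans e e' y) i a * coord e' (chartTrans e e' y) a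
  compactSupport : ∃ C : Set M, IsCompact C ∧
    ∀ e, ∀ y ∈ e.1.target, e.1.symm y ∉ C → coord e y = 0

/-- The component `∇ᵢ vʲ` of the covariant derivative of a vector-valued half-density:
`∇ᵢ vʲ = ∂ᵢ vʲ + ∑ₖ Γʲₖᵢ vᵏ - ½ ∑ₖ Γᵏₖᵢ vʲ`. -/
def covDeriv (conn : MeasurableConnection n M) (V : LipHalfDensity n M)
    (e : atlas (Coord n) M) (y : Coord n) (i j : Fin n) : ℝ :=
  pd i (fun z => V.coord e z j) y + ∑ k, conn.Γ e y j k i * V.coord e y k -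
    1 / 2 * ∑ k, conn.Γ e y k k i * V.coord e y j

/-! ### Integration of densities

A density on `M` is given by its coefficients `dens e` in the charts: it is `dens e y dy¹ ⋯ dyⁿ`. -/

variable [MeasurableSpace M]

/-- The Borel measure on `M` defined by the positive part of a density `dens`.  On the domain of each
chart `e` it is `max (dens e y) 0 dy¹ ⋯ dyⁿ`; as these measures agree on overlaps, their supremum is
the measure on `M` that they define together. -/
def densityMeasure (dens : atlas (Coord n) M → Coord n → ℝ) : Measure M :=
  ⨆ e : atlas (Coord n) M, Measure.map e.1.symm
    ((volume.restrict e.1.target).withDensity fun y => ENNReal.ofReal (dens e y))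

/-- The density `dens` is integrable over `M`: it is measurable and `∫_M |dens| < ∞`. -/
def DensityIntegrable (dens : atlas (Coord n) M → Coord n → ℝ) : Prop :=
  (∀ e, AEMeasurable (dens e) (volume.restrict e.1.target)) ∧
    densityMeasure (fun e y => |dens e y|) univ < ⊤

/-- The integral of a density over `M`, `∫_M dens⁺ - ∫_M dens⁻`; meaningful if `dens` is integrable. -/
def densityIntegral (dens : atlas (Coord n) M → Coord n → ℝ) : ℝ :=
  (densityMeasure dens univ).toReal - (densityMeasure (fun e y => -dens e y) univ).toReal

/-- The density `∑ᵢⱼ [(∇ᵢ Vⁱ)(∇ⱼ Wʲ) - (∇ᵢ Vʲ)(∇ⱼ Wⁱ)]`. -/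
def integrand (conn : MeasurableConnection n M) (V W : LipHalfDensity n M)
    (e : atlas (Coord n) M) (y : Coord n) : ℝ :=
  ∑ i, ∑ j, (covDeriv conn V e y i i * covDeriv conn W e y j j -
    covDeriv conn V e y i j * covDeriv conn W e y j i)

/-- A connection is tame if the integrand of `Q(V, W)` is integrable for all compactly supported
Lipschitz vector-valued half-densities `V` and `W`. -/
def IsTame (conn : MeasurableConnection n M) : Prop :=
  ∀ V W : LipHalfDensity n M, DensityIntegrable (integrand conn V W)

/-- `Q(V, W) = ∫_M ∑ᵢⱼ [(∇ᵢ Vⁱ)(∇ⱼ Wʲ) - (∇ᵢ Vʲ)(∇ⱼ Wⁱ)]`. -/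
def Q (conn : MeasurableConnection n M) (V W : LipHalfDensity n M) : ℝ :=
  densityIntegral (integrand conn V W)

end Manifold

/-! ### Singular Riemannian metrics -/

section Metric

variable {n : ℕ} {M : Type*} [TopologicalSpace M] [ChartedSpace (Coord n) M]

variable (n M) in
/-- A (singular) Riemannian metric: a measurable section of `S²(T*M)` that is positive definite
almost everywhere.  `toFun e y` is the matrix `gᵢⱼ` in the chart `e`. -/
structure SingularMetric where
  toFun : atlas (Coord n) M → Coord n → Matrix (Fin n) (Fin n) ℝ
  aemeasurable : ∀ e i j, AEMeasurable (fun y => toFun e y i j) (volume.restrict e.1.target)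
  posDef : ∀ e, ∀ᵐ y ∂(volume.restrict e.1.target), (toFun e y).PosDef
  transform : ∀ e e', ∀ᵐ y ∂(volume.restrict (chartTrans e e').source),
    toFun e y = (jac e e' y).transpose * toFun e' (chartTrans e e' y) * jac e e' y

/-- The function `F` on `M` is the (locally) Lipschitz extension of `g(V, W) / dvol_g`: in each
chart it is locally Lipschitz, and it equals `(∑ᵢⱼ gᵢⱼ vⁱ wʲ) / √(det g)` almost everywhere. -/
def IsLipQuotient (g : SingularMetric n M) (V W : LipHalfDensity n M) (F : M → ℝ) : Prop :=
  ∀ e : atlas (Coord n) M,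
    LocallyLipschitzOn e.1.target (fun y => F (e.1.symm y)) ∧
    ∀ᵐ y ∂(volume.restrict e.1.target), F (e.1.symm y) =
      (∑ i, ∑ j, g.toFun e y i j * V.coord e y i * W.coord e y j) /
        Real.sqrt (g.toFun e y).det

end Metric

/-! ### Subharmonic functions and weak derivatives in the plane -/

/-- `u : Ω → [-∞, ∞)` is subharmonic on the open set `Ω ⊆ ℝ²`: it is upper semicontinuous, not
identically `-∞` on any nonempty open subset (equivalently, on any component) of `Ω`, and obeys the
sub-mean value inequality on every closed disk in `Ω`.  As `u` is upper semicontinuous, its mean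
value on a circle is the infimum of the mean values of the continuous functions `c ≥ u` on that
circle; the inequality is stated in this form, which allows the value `-∞` on the circle. -/
structure IsSubharmonicOn (u : Coord 2 → EReal) (Ω : Set (Coord 2)) : Prop where
  lt_top : ∀ y ∈ Ω, u y < ⊤
  upperSemicontinuous : UpperSemicontinuousOn u Ω
  not_bot : ∀ O : Set (Coord 2), IsOpen O → O.Nonempty → O ⊆ Ω → ∃ y ∈ O, u y ≠ ⊥
  subMean : ∀ (x : Coord 2) (r : ℝ), 0 < r → Metric.closedBall x r ⊆ Ω →
    ∀ c : Coord 2 → ℝ, ContinuousOn c (Metric.sphere x r) →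
      (∀ y ∈ Metric.sphere x r, u y ≤ (c y : EReal)) →
      u x ≤ (((2 * Real.pi)⁻¹ *
        ∫ θ in (0 : ℝ)..2 * Real.pi, c (x + r • !₂[Real.cos θ, Real.sin θ]) : ℝ) : EReal)

/-- `φ` is the difference of two subharmonic functions on `Ω`. -/
def IsDeltaSubharmonicOn (φ : Coord 2 → ℝ) (Ω : Set (Coord 2)) : Prop :=
  ∃ u v : Coord 2 → EReal, IsSubharmonicOn u Ω ∧ IsSubharmonicOn v Ω ∧
    ∀ᵐ y ∂(volume.restrict Ω), u y ≠ ⊥ ∧ v y ≠ ⊥ ∧ φ y = (u y).toReal - (v y).toReal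

/-- `φ` and the functions `D k` are locally integrable on `Ω`, and `D k` is the weak partial
derivative `∂ₖ φ`. -/
def IsWeakGradientOn (φ : Coord 2 → ℝ) (D : Fin 2 → Coord 2 → ℝ) (Ω : Set (Coord 2)) : Prop :=
  LocallyIntegrableOn φ Ω ∧ (∀ k, LocallyIntegrableOn (D k) Ω) ∧
    ∀ (k : Fin 2) (f : Coord 2 → ℝ), ContDiff ℝ ∞ f → HasCompactSupport f → tsupport f ⊆ Ω →
      ∫ y in Ω, φ y * pd k f y = -∫ y in Ω, D k y * f y

/-! ### Surfaces of bounded integral curvature -/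

section Surface

variable {M : Type*} [TopologicalSpace M] [ChartedSpace (Coord 2) M]

/-- The chart `e` is isothermal with conformal exponent `φ`: on its target,
`g = e^{2φ} ((dx¹)² + (dx²)²)` with `φ` a difference of two subharmonic functions. -/
def IsIsothermal (g : SingularMetric 2 M) (e : atlas (Coord 2) M) (φ : Coord 2 → ℝ) : Prop :=
  IsDeltaSubharmonicOn φ e.1.target ∧
    ∀ᵐ y ∂(volume.restrict e.1.target),
      g.toFun e y = Real.exp (2 * φ y) • (1 : Matrix (Fin 2) (Fin 2) ℝ)

/-- `(M, g)` has bounded integral curvature: around every point there are isothermal coordinates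
in which `g = e^{2φ} ((dx¹)² + (dx²)²)` with `φ` a difference of two subharmonic functions. -/
def HasBoundedIntegralCurvature (g : SingularMetric 2 M) : Prop :=
  ∀ p : M, ∃ e : atlas (Coord 2) M, p ∈ e.1.source ∧ ∃ φ, IsIsothermal g e φ

/-- A torsion-free connection is the Levi-Civita connection of `g` if it is metric:
`∂ₖ gᵢⱼ = ∑ₗ (gₗⱼ Γˡᵢₖ + gᵢₗ Γˡⱼₖ)` almost everywhere in isothermal coordinates, where the
derivative of `gᵢⱼ = e^{2φ} δᵢⱼ` is `2 (∂ₖφ) gᵢⱼ` with `∂ₖφ` a locally integrable weak derivative.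
As isothermal coordinates cover `M`, this determines the Christoffel symbols in all charts up to
null sets. -/
def IsLeviCivita (g : SingularMetric 2 M) (conn : MeasurableConnection 2 M) : Prop :=
  ∀ (e : atlas (Coord 2) M) (φ : Coord 2 → ℝ), IsIsothermal g e φ →
    ∃ D : Fin 2 → Coord 2 → ℝ, IsWeakGradientOn φ D e.1.target ∧
      ∀ᵐ y ∂(volume.restrict e.1.target), ∀ i j k,
        2 * D k y * g.toFun e y i j =
          ∑ l, (g.toFun e y l j * conn.Γ e y l i k + g.toFun e y i l * conn.Γ e y l j k)

variable [MeasurableSpace M]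

variable (M) in
/-- A signed Radon measure `pos - neg` on `M`, with `pos` and `neg` locally finite Borel
measures. -/
structure SignedRadonMeasure where
  pos : Measure M
  neg : Measure M
  locallyFinite_pos : IsLocallyFiniteMeasure pos
  locallyFinite_neg : IsLocallyFiniteMeasure neg

/-- `K` is the curvature measure of `g`: in isothermal coordinates `dK = -(∂₁² + ∂₂²)φ dx¹dx²`,
that is, `∫ f dK = -∫ (∂₁² + ∂₂²)f φ dx¹dx²` for smooth `f` with compact support in the chart. -/
def IsCurvatureMeasure (g : SingularMetric 2 M) (K : SignedRadonMeasure M) : Prop :=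
  ∀ (e : atlas (Coord 2) M) (φ : Coord 2 → ℝ), IsIsothermal g e φ →
    ∀ f : Coord 2 → ℝ, ContDiff ℝ ∞ f → HasCompactSupport f → tsupport f ⊆ e.1.target →
      (∫ p in e.1.source, f (e.1 p) ∂K.pos) - (∫ p in e.1.source, f (e.1 p) ∂K.neg) =
        -∫ y in e.1.target, (pd 0 (pd 0 f) y + pd 1 (pd 1 f) y) * φ y

end Surface

end TameConn

end

/-!
In isothermal coordinates the identity is an integration by parts. Let `φ` be the conformal exponent
and `D` its weak gradient. Koszul's formula leaves no choice for the Christoffel symbols of the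
Levi-Civita connection, `Γ^i_jk = δ_ij D_k + δ_ik D_j - δ_jk D_i` (`IsLeviCivita.exists_symbol_eq`).
For half-densities the covariant derivative is then `∂_i v^j + δ_ij (D · v) - D_j v_i`, and in the
integrand of `Q` the terms quadratic in `D`, which need not be integrable, cancel
(`integrand_eq_of_symbol`). What remains is a difference of Jacobian determinants of the components of
`V` and `W`, and `D · ∇(v · w)`. The determinants are null Lagrangians and integrate to zero
(`integral_jacobian_eq_zero`). Since the curvature is minus the Laplacian of `φ`, and since this may
be tested against Lipschitz functions once one derivative has been moved to `φ`
(`integral_sub_integral_eq_of_laplacian`), the other term is the integral of `v · w` against `K`. The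
function `v · w` is `g(V, W) / dvol_g`, because the conformal factor cancels. As `D` is locally
integrable and the components are Lipschitz, tameness is part of the same computation. Cutoff functions
reduce the general case to half-densities supported in one chart
(`densityIntegral_integrand_of_finite`).

The analysis behind this is that a subharmonic function is locally integrable, that its Laplacian is a
measure, and that it has a locally integrable weak gradient. Integrability follows from the sub-mean
value property by exhaustion with continuous functions. The property, integrated against a test
function and expanded for small radii, says that the Laplacian is a positive functional, which M.
Riesz's extension theorem turns into a measure (`IsSubharmonicOn.exists_rieszMeasure`). The weak
gradient is the convolution of this measure with the gradient of a cut-off logarithm, up to a smooth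
error; the computation is done with the regularised kernel `½ log (|z|² + e²)` and `e → 0`
(`exists_local_weakGradient`).

For existence, the local constructions have to agree in different isothermal charts. A change of
isothermal charts is conformal of class `C^{1,1}`, and the two exponents differ by
`½ log |det J|`. By the Cauchy–Riemann equations, the symbols above keep their form under such a change
(`transSymbol_conformal`), and the connection is glued from them over a measurable partition; the
transformation law between arbitrary charts is the cocycle property of the change of Christoffel symbols
(`transSymbol_cocycle`). The curvature measure is glued with a partition of unity from the Riesz measures
in the charts. These agree because `½ log |det J|` is weakly harmonic. It is only a Lipschitz function,
so this is seen by writing the pairing of its gradient with that of a test function as a sum of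
Jacobian determinants again (`IsConformal.integral_sum_pd_logFactor`).
-/

namespace TameConn

open Filter

/-! ### Partial derivatives and locally Lipschitz functions -/

section Calculus

variable {d : ℕ} {f g : Coord d → ℝ} {y : Coord d} {i j : Fin d}

lemma pd_congr (h : f =ᶠ[𝓝 y] g) : pd i f y = pd i g y := by
  unfold pd; rw [h.fderiv_eq]

lemma pd_add (hf : DifferentiableAt ℝ f y) (hg : DifferentiableAt ℝ g y) :
    pd i (fun z => f z + g z) y = pd i f y + pd i g y := by
  unfold pd; rw [fderiv_fun_add hf hg]; rfl

lemma pd_sub (hf : DifferentiableAt ℝ f y) (hg : DifferentiableAt ℝ g y) :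
    pd i (fun z => f z - g z) y = pd i f y - pd i g y := by
  unfold pd; rw [fderiv_fun_sub hf hg]; rfl

lemma pd_neg : pd i (fun z => -f z) y = -pd i f y := by
  unfold pd; rw [fderiv_fun_neg]; rfl

lemma pd_mul (hf : DifferentiableAt ℝ f y) (hg : DifferentiableAt ℝ g y) :
    pd i (fun z => f z * g z) y = f y * pd i g y + pd i f y * g y := by
  unfold pd; rw [fderiv_fun_mul hf hg]
  simp [mul_comm]

lemma pd_const (c : ℝ) : pd i (fun _ : Coord d => c) y = 0 := by
  unfold pd; simp

lemma pd_const_mul (c : ℝ) (hf : DifferentiableAt ℝ f y) :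
    pd i (fun z => c * f z) y = c * pd i f y := by
  unfold pd; rw [fderiv_const_mul hf]; rfl

lemma pd_sum {ι : Type*} (s : Finset ι) (F : ι → Coord d → ℝ)
    (h : ∀ k ∈ s, DifferentiableAt ℝ (F k) y) :
    pd i (fun z => ∑ k ∈ s, F k z) y = ∑ k ∈ s, pd i (F k) y := by
  unfold pd; rw [fderiv_fun_sum h]; simp

lemma measurable_pd : Measurable (pd i f) :=
  (measurable_fderiv ℝ f).apply_continuousLinearMap _

lemma abs_pd_le_of_lipschitz {C : NNReal} (hf : LipschitzWith C f) : |pd i f y| ≤ C := by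
  unfold pd
  calc |fderiv ℝ f y (EuclideanSpace.single i 1)|
      ≤ ‖fderiv ℝ f y‖ * ‖(EuclideanSpace.single i (1 : ℝ) : Coord d)‖ :=
        (fderiv ℝ f y).le_opNorm _
    _ ≤ C * 1 := by
        gcongr
        · exact norm_fderiv_le_of_lipschitz ℝ hf
        · simp
    _ = C := mul_one _

lemma contDiff_pd (hf : ContDiff ℝ ∞ f) : ContDiff ℝ ∞ (pd i f) := by
  unfold pd
  exact (hf.fderiv_right (m := ∞) (by simp)).clm_apply contDiff_const

lemma tsupport_pd_subset : tsupport (pd i f) ⊆ tsupport f := by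
  refine (closure_mono ?_).trans (tsupport_fderiv_subset ℝ (f := f))
  intro x hx h
  exact hx (by unfold pd; rw [h]; rfl)

lemma hasCompactSupport_pd (hf : HasCompactSupport f) : HasCompactSupport (pd i f) :=
  hf.of_isClosed_subset (isClosed_tsupport _) tsupport_pd_subset

lemma pd_eq_zero_of_notMem (h : y ∉ tsupport f) : pd i f y = 0 := by
  by_contra h'
  exact h (tsupport_pd_subset (subset_tsupport (pd i f) h'))

lemma pd_comm (hf : ContDiff ℝ ∞ f) : pd i (pd j f) y = pd j (pd i f) y := by
  have h2 : DifferentiableAt ℝ (fderiv ℝ f) y :=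
    ((hf.fderiv_right (m := ∞) (by simp)).differentiable (by simp)) y
  have key : ∀ a b : Fin d, pd a (pd b f) y =
      fderiv ℝ (fderiv ℝ f) y (EuclideanSpace.single a 1) (EuclideanSpace.single b 1) := by
    intro a b
    have : HasFDerivAt (pd b f) ((ContinuousLinearMap.apply ℝ ℝ
        (EuclideanSpace.single b (1 : ℝ))).comp (fderiv ℝ (fderiv ℝ f) y)) y :=
      (ContinuousLinearMap.apply ℝ ℝ
        (EuclideanSpace.single b (1 : ℝ) : Coord d)).hasFDerivAt.comp y h2.hasFDerivAt
    unfold pd at this ⊢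
    rw [this.fderiv]; rfl
  rw [key, key]
  exact second_derivative_symmetric (f' := fderiv ℝ f)
    (fun z => (hf.differentiable (by simp) z).hasFDerivAt) h2.hasFDerivAt _ _

/-- Rademacher's theorem for functions that are locally Lipschitz on an open set. -/
lemma ae_differentiableAt_of_locallyLipschitzOn {F : Type*} [NormedAddCommGroup F]
    [NormedSpace ℝ F] [FiniteDimensional ℝ F] {Ω : Set (Coord d)} (hΩ : IsOpen Ω)
    {f : Coord d → F} (hf : LocallyLipschitzOn Ω f) :
    ∀ᵐ y ∂(volume.restrict Ω), DifferentiableAt ℝ f y := by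
  rw [ae_restrict_iff' hΩ.measurableSet, ae_iff]
  refine measure_null_of_locally_null _ fun x hx => ?_
  have hx' : x ∈ Ω := by
    by_contra h; exact hx fun h' => absurd h' h
  obtain ⟨K, t, ht, hL⟩ := hf hx'
  rw [hΩ.nhdsWithin_eq hx'] at ht
  refine ⟨interior t ∩ _, inter_mem (mem_nhdsWithin_of_mem_nhds (interior_mem_nhds.2 ht))
    self_mem_nhdsWithin, ?_⟩
  have h0 := (hL.mono interior_subset).ae_differentiableWithinAt_of_mem (μ := volume)
  have h0 : ∀ᵐ x, x ∈ interior t → DifferentiableAt ℝ f x := by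
    filter_upwards [h0] with z hz hzt
    exact (hz hzt).differentiableAt (isOpen_interior.mem_nhds hzt)
  rw [ae_iff] at h0
  refine measure_mono_null (fun z hz => ?_) h0
  exact fun h => hz.2 fun _ => h hz.1

end Calculus

section Lipschitz

variable {α β γ : Type*} [PseudoMetricSpace α] [PseudoMetricSpace β] [PseudoMetricSpace γ]

lemma locallyLipschitzOn_comp {s : Set α} {t : Set β} {f : α → β} {g : β → γ}
    (hg : LocallyLipschitzOn t g) (hf : LocallyLipschitzOn s f) (h : MapsTo f s t) :
    LocallyLipschitzOn s (fun x => g (f x)) := by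
  intro x hx
  obtain ⟨Kf, u, hu, hfL⟩ := hf hx
  obtain ⟨Kg, v, hv, hgL⟩ := hg (h hx)
  have h1 : f ⁻¹' v ∈ 𝓝[s] x :=
    (hf.continuousOn x hx).tendsto_nhdsWithin h hv
  refine ⟨Kg * Kf, u ∩ f ⁻¹' v, inter_mem hu h1, ?_⟩
  exact hgL.comp (hfL.mono inter_subset_left) ((mapsTo_preimage f v).mono_left inter_subset_right)

lemma locallyLipschitzOn_congr {s : Set α} {f g : α → β} (hf : LocallyLipschitzOn s f)
    (h : EqOn g f s) : LocallyLipschitzOn s g := by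
  intro x hx
  obtain ⟨K, t, ht, hL⟩ := hf hx
  refine ⟨K, t ∩ s, inter_mem ht self_mem_nhdsWithin, ?_⟩
  intro a ha b hb
  rw [h ha.2, h hb.2]
  exact hL ha.1 hb.1

lemma locallyLipschitzOn_of_forall_isOpen {s : Set α} {f : α → β}
    (h : ∀ x ∈ s, ∃ u, IsOpen u ∧ x ∈ u ∧ LocallyLipschitzOn (s ∩ u) f) :
    LocallyLipschitzOn s f := by
  intro x hx
  obtain ⟨u, hu, hxu, hL⟩ := h x hx
  obtain ⟨K, t, ht, hK⟩ := hL ⟨hx, hxu⟩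
  refine ⟨K, t, ?_, hK⟩
  rwa [nhdsWithin_inter_of_mem' (mem_nhdsWithin_of_mem_nhds (hu.mem_nhds hxu))] at ht

lemma locallyLipschitzOn_const {s : Set α} (b : β) : LocallyLipschitzOn s (fun _ : α => b) :=
  (LocallyLipschitz.const b).locallyLipschitzOn

lemma locallyLipschitzOn_prodMk {s : Set α} {f : α → β} {g : α → γ} (hf : LocallyLipschitzOn s f)
    (hg : LocallyLipschitzOn s g) : LocallyLipschitzOn s (fun x => (f x, g x)) := by
  intro x hx
  obtain ⟨K, t, ht, hL⟩ := hf hx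
  obtain ⟨K', t', ht', hL'⟩ := hg hx
  exact ⟨max K K', t ∩ t', inter_mem ht ht',
    (hL.mono inter_subset_left).prodMk (hL'.mono inter_subset_right)⟩

lemma locallyLipschitzOn_of_contDiffOn {E F : Type*} [NormedAddCommGroup E] [NormedSpace ℝ E]
    [NormedAddCommGroup F] [NormedSpace ℝ F] {s : Set E} (hs : IsOpen s) {f : E → F}
    (hf : ContDiffOn ℝ 1 f s) : LocallyLipschitzOn s f := by
  intro x hx
  obtain ⟨K, t, ht, hL⟩ := (hf.contDiffAt (hs.mem_nhds hx)).exists_lipschitzOnWith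
  exact ⟨K, t, mem_nhdsWithin_of_mem_nhds ht, hL⟩

variable {s : Set α} {f g : α → ℝ}

lemma locallyLipschitzOn_mul (hf : LocallyLipschitzOn s f) (hg : LocallyLipschitzOn s g) :
    LocallyLipschitzOn s (fun x => f x * g x) := by
  have h : LocallyLipschitzOn univ (fun p : ℝ × ℝ => p.1 * p.2) :=
    locallyLipschitzOn_of_contDiffOn isOpen_univ (by fun_prop)
  exact locallyLipschitzOn_comp h (locallyLipschitzOn_prodMk hf hg) (mapsTo_univ _ _)

lemma locallyLipschitzOn_add (hf : LocallyLipschitzOn s f) (hg : LocallyLipschitzOn s g) :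
    LocallyLipschitzOn s (fun x => f x + g x) := hf.add hg

lemma locallyLipschitzOn_sub (hf : LocallyLipschitzOn s f) (hg : LocallyLipschitzOn s g) :
    LocallyLipschitzOn s (fun x => f x - g x) := hf.sub hg

lemma locallyLipschitzOn_inv (hf : LocallyLipschitzOn s f) (h0 : ∀ x ∈ s, f x ≠ 0) :
    LocallyLipschitzOn s (fun x => (f x)⁻¹) := by
  have h : LocallyLipschitzOn ({0}ᶜ : Set ℝ) (fun p : ℝ => p⁻¹) :=
    locallyLipschitzOn_of_contDiffOn isOpen_compl_singleton
      (fun x hx => (contDiffAt_inv ℝ hx).contDiffWithinAt)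
  exact locallyLipschitzOn_comp h hf h0

lemma locallyLipschitzOn_abs (hf : LocallyLipschitzOn s f) :
    LocallyLipschitzOn s (fun x => |f x|) := by
  have h : LocallyLipschitzOn univ (fun p : ℝ => |p|) :=
    (lipschitzWith_one_norm (E := ℝ)).locallyLipschitz.locallyLipschitzOn
  exact locallyLipschitzOn_comp h hf (mapsTo_univ _ _)

lemma locallyLipschitzOn_log (hf : LocallyLipschitzOn s f) (h0 : ∀ x ∈ s, f x ≠ 0) :
    LocallyLipschitzOn s (fun x => Real.log (f x)) := by
  have h : LocallyLipschitzOn ({0}ᶜ : Set ℝ) Real.log :=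
    locallyLipschitzOn_of_contDiffOn isOpen_compl_singleton
      (fun x hx => (Real.contDiffAt_log.2 hx).contDiffWithinAt)
  exact locallyLipschitzOn_comp h hf h0

end Lipschitz


/-! ### Compactly supported Lipschitz functions in the plane -/

section LipTest

/-- `f` is a Lipschitz function on the plane with compact support in `Ω`. -/
def IsLipTest (f : Coord 2 → ℝ) (Ω : Set (Coord 2)) : Prop :=
  (∃ C, LipschitzWith C f) ∧ HasCompactSupport f ∧ tsupport f ⊆ Ω

variable {f g φ : Coord 2 → ℝ} {Ω : Set (Coord 2)} {i j k : Fin 2}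

/-- A compactly supported locally Lipschitz function is globally Lipschitz: the local bound on a
neighbourhood of the support handles nearby points, and boundedness handles points at distance at
least one. -/
lemma isLipTest_of_locallyLipschitzOn (hΩ : IsOpen Ω) (hf : LocallyLipschitzOn Ω f)
    (hc : HasCompactSupport f) (hs : tsupport f ⊆ Ω) : IsLipTest f Ω := by
  refine ⟨?_, hc, hs⟩
  have hloc : LocallyLipschitzOn univ f := by
    refine locallyLipschitzOn_of_forall_isOpen fun x _ => ?_
    by_cases hx : x ∈ Ω
    · exact ⟨Ω, hΩ, hx, by simpa using hf⟩
    · refine ⟨(tsupport f)ᶜ, (isClosed_tsupport f).isOpen_compl, fun h => hx (hs h), ?_⟩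
      refine locallyLipschitzOn_congr (locallyLipschitzOn_const (0 : ℝ)) fun z hz => ?_
      exact image_eq_zero_of_notMem_tsupport hz.2
  have hcont : Continuous f := continuousOn_univ.1 hloc.continuousOn
  obtain ⟨K, hK⟩ := (hloc.mono (subset_univ (Metric.cthickening 1 (tsupport f)))
    ).exists_lipschitzOnWith_of_compact hc.isCompact.cthickening
  obtain ⟨B, hB⟩ := hc.exists_bound_of_continuous hcont
  have hB0 : 0 ≤ B := (norm_nonneg _).trans (hB 0)
  have key : ∀ x y, x ∈ tsupport f → dist (f x) (f y) ≤ (K + 2 * B) * dist x y := by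
    intro x y hx
    by_cases hd : dist y x ≤ 1
    · have h1 := hK.dist_le_mul x (Metric.self_subset_cthickening _ hx) y
        (Metric.mem_cthickening_of_dist_le _ x _ _ hx hd)
      nlinarith [dist_nonneg (x := x) (y := y)]
    · have h1 : dist (f x) (f y) ≤ 2 * B := by
        rw [dist_eq_norm]
        linarith [norm_sub_le (f x) (f y), hB x, hB y]
      rw [dist_comm] at hd
      push Not at hd
      nlinarith [K.coe_nonneg]
  refine ⟨K + 2 * B.toNNReal, LipschitzWith.of_dist_le_mul fun x y => ?_⟩
  have hco : ((K + 2 * B.toNNReal : NNReal) : ℝ) = K + 2 * B := by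
    push_cast; rw [Real.coe_toNNReal _ hB0]
  rw [hco]
  by_cases hx : x ∈ tsupport f
  · exact key x y hx
  by_cases hy : y ∈ tsupport f
  · rw [dist_comm, dist_comm x y]; exact key y x hy
  · rw [image_eq_zero_of_notMem_tsupport hx, image_eq_zero_of_notMem_tsupport hy, dist_self]
    positivity

lemma IsLipTest.locallyLipschitzOn (hf : IsLipTest f Ω) (s : Set (Coord 2)) :
    LocallyLipschitzOn s f := by
  obtain ⟨⟨C, hC⟩, -⟩ := hf
  exact hC.locallyLipschitz.locallyLipschitzOn

lemma IsLipTest.continuous (hf : IsLipTest f Ω) : Continuous f := by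
  obtain ⟨⟨C, hC⟩, -⟩ := hf
  exact hC.continuous

lemma IsLipTest.mono {Ω' : Set (Coord 2)} (hf : IsLipTest f Ω) (h : Ω ⊆ Ω') : IsLipTest f Ω' :=
  ⟨hf.1, hf.2.1, hf.2.2.trans h⟩

lemma IsLipTest.mul (hΩ : IsOpen Ω) (hf : IsLipTest f Ω) (hg : LocallyLipschitzOn Ω g) :
    IsLipTest (fun x => f x * g x) Ω := by
  have hsub : tsupport (fun x => f x * g x) ⊆ tsupport f := tsupport_mul_subset_left
  exact isLipTest_of_locallyLipschitzOn hΩ (locallyLipschitzOn_mul (hf.locallyLipschitzOn _) hg)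
    (hf.2.1.of_isClosed_subset (isClosed_tsupport _) hsub) (hsub.trans hf.2.2)

lemma IsLipTest.add (hΩ : IsOpen Ω) (hf : IsLipTest f Ω) (hg : IsLipTest g Ω) :
    IsLipTest (fun x => f x + g x) Ω := by
  have hsub : tsupport (fun x => f x + g x) ⊆ tsupport f ∪ tsupport g := tsupport_add f g
  exact isLipTest_of_locallyLipschitzOn hΩ
    (locallyLipschitzOn_add (hf.locallyLipschitzOn _) (hg.locallyLipschitzOn _))
    ((hf.2.1.isCompact.union hg.2.1.isCompact).of_isClosed_subset (isClosed_tsupport _) hsub)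
    (hsub.trans (union_subset hf.2.2 hg.2.2))

lemma isLipTest_of_contDiff (hf : ContDiff ℝ ∞ f) (hc : HasCompactSupport f)
    (hs : tsupport f ⊆ Ω) : IsLipTest f Ω :=
  ⟨(isLipTest_of_locallyLipschitzOn isOpen_univ
    (locallyLipschitzOn_of_contDiffOn isOpen_univ (hf.of_le (by simp)).contDiffOn) hc
    (subset_univ _)).1, hc, hs⟩

/-- A smooth cutoff function equal to one near a compact set. -/
lemma exists_cutoff {K : Set (Coord 2)} (hK : IsCompact K) (hΩ : IsOpen Ω) (h : K ⊆ Ω) :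
    ∃ χ : Coord 2 → ℝ, ContDiff ℝ ∞ χ ∧ HasCompactSupport χ ∧ tsupport χ ⊆ Ω ∧
      (∀ᶠ x in 𝓝ˢ K, χ x = 1) ∧ ∀ x, χ x ∈ Icc (0 : ℝ) 1 := by
  obtain ⟨L, hL, hKL, hLΩ⟩ := exists_compact_between hK hΩ h
  obtain ⟨χ, h1, h2, h3⟩ := exists_contMDiffMap_one_nhds_of_subset_interior
    (n := ⊤) (modelWithCornersSelf ℝ (Coord 2)) hK.isClosed hKL
  have hsup : tsupport χ ⊆ L := closure_minimal
    (fun x hx => by by_contra h'; exact hx (h2 x h')) hL.isClosed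
  exact ⟨χ, χ.contMDiff.contDiff, hL.of_isClosed_subset (isClosed_tsupport _) hsup,
    hsup.trans hLΩ, h1, h3⟩

lemma integral_pd_mul (hf : ∃ C, LipschitzWith C f) (hg : ∃ C, LipschitzWith C g)
    (hc : HasCompactSupport g) : ∫ x, pd i f x * g x = -∫ x, f x * pd i g x := by
  obtain ⟨C, hC⟩ := hf
  obtain ⟨D, hD⟩ := hg
  have h := hC.integral_lineDeriv_mul_eq hD hc (EuclideanSpace.single i (1 : ℝ)) (μ := volume)
  have e1 : ∫ x, pd i f x * g x = ∫ x, lineDeriv ℝ f x (EuclideanSpace.single i 1) * g x := by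
    refine integral_congr_ae ?_
    filter_upwards [hC.ae_differentiableAt] with x hx
    rw [hx.lineDeriv_eq_fderiv]; rfl
  rw [e1, h, ← integral_neg]
  refine integral_congr_ae ?_
  filter_upwards [hD.ae_differentiableAt] with x hx
  rw [hx.lineDeriv_eq_fderiv, map_neg]
  unfold pd; ring

/-- Mollification of a compactly supported Lipschitz function. -/
lemma exists_smooth_approx (hΩ : IsOpen Ω) (hf : IsLipTest f Ω) :
    ∃ (F : ℕ → Coord 2 → ℝ) (K : Set (Coord 2)) (B : ℝ), IsCompact K ∧ K ⊆ Ω ∧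
      (∀ n, ContDiff ℝ ∞ (F n)) ∧ (∀ n, tsupport (F n) ⊆ K) ∧ (∀ n x, |F n x| ≤ B) ∧
      (∀ n i x, |pd i (F n) x| ≤ B) ∧ (∀ x, Tendsto (fun n => F n x) atTop (𝓝 (f x))) ∧
      ∀ᵐ x, ∀ i, Tendsto (fun n => pd i (F n) x) atTop (𝓝 (pd i f x)) := by
  have hfc := hf.continuous
  obtain ⟨⟨C, hC⟩, hc, hs⟩ := hf
  obtain ⟨δ, hδ, hδΩ⟩ := hc.isCompact.exists_cthickening_subset_open hΩ hs
  have hr : ∀ n : ℕ, 0 < δ / (n + 1) := fun n => by positivity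
  let ρ : ℕ → ContDiffBump (0 : Coord 2) := fun n =>
    ⟨δ / (n + 1) / 2, δ / (n + 1), half_pos (hr n), half_lt_self (hr n)⟩
  have hρ : Tendsto (fun n => (ρ n).rOut) atTop (𝓝 0) := by
    have := (tendsto_const_div_atTop_nhds_zero_nat δ).comp (tendsto_add_atTop_nat 1)
    refine this.congr fun n => ?_
    simp [ρ]
  let F : ℕ → Coord 2 → ℝ := fun n x => ∫ t, (ρ n).normed volume t * f (x - t)
  have hFconv : ∀ n, F n =
      convolution ((ρ n).normed volume) f (ContinuousLinearMap.lsmul ℝ ℝ) volume := by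
    intro n; ext x; simp [F, convolution_def]
  have hli : LocallyIntegrable f volume := hfc.locallyIntegrable
  have hρi : ∀ n, Integrable ((ρ n).normed volume) volume := fun n => (ρ n).integrable_normed
  have hρ1 : ∀ n, ∫ t, (ρ n).normed volume t = 1 := fun n => (ρ n).integral_normed
  have hρ0 : ∀ n t, 0 ≤ (ρ n).normed volume t := fun n t => (ρ n).nonneg_normed t
  obtain ⟨B, hB⟩ := hc.exists_bound_of_continuous hfc
  have hint : ∀ n x, Integrable (fun t => (ρ n).normed volume t * f (x - t)) volume := by
    intro n x
    refine ((hρi n).mul_const B).mono' ?_ (ae_of_all _ fun t => ?_)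
    · exact ((ρ n).continuous_normed.mul (hfc.comp (by fun_prop))).aestronglyMeasurable
    · rw [norm_mul, Real.norm_of_nonneg (hρ0 n t)]
      exact mul_le_mul_of_nonneg_left (hB _) (hρ0 n t)
  have hFL : ∀ n, LipschitzWith C (F n) := by
    intro n
    refine LipschitzWith.of_dist_le_mul fun x y => ?_
    rw [dist_eq_norm, ← integral_sub (hint n x) (hint n y)]
    calc ‖∫ t, ((ρ n).normed volume t * f (x - t) - (ρ n).normed volume t * f (y - t))‖
        ≤ ∫ t, (ρ n).normed volume t * (C * dist x y) := by
          refine norm_integral_le_of_norm_le ((hρi n).mul_const _) (ae_of_all _ fun t => ?_)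
          rw [← mul_sub, norm_mul, Real.norm_of_nonneg (hρ0 n t)]
          refine mul_le_mul_of_nonneg_left ?_ (hρ0 n t)
          simpa [dist_eq_norm] using hC.dist_le_mul (x - t) (y - t)
      _ = C * dist x y := by rw [integral_mul_const, hρ1, one_mul]
  -- differentiation under the integral, which needs only the Lipschitz bound on `f`
  have hder : ∀ n x, fderiv ℝ (F n) x =
      convolution ((ρ n).normed volume) (fderiv ℝ f) (ContinuousLinearMap.lsmul ℝ ℝ) volume x := by
    intro n x
    have h := hasFDerivAt_integral_of_dominated_loc_of_lip (μ := (volume : Measure (Coord 2)))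
      (𝕜 := ℝ) (F := fun x t => (ρ n).normed volume t * f (x - t))
      (F' := fun t => (ρ n).normed volume t • fderiv ℝ f (x - t)) (x₀ := x) (s := univ)
      (bound := fun t => (ρ n).normed volume t * C) univ_mem
      (Eventually.of_forall fun z => (hint n z).aestronglyMeasurable) (hint n x) ?_ ?_ ?_ ?_
    · exact h.2.fderiv
    · refine AEStronglyMeasurable.smul (hρi n).aestronglyMeasurable ?_
      exact ((measurable_fderiv ℝ f).comp (by fun_prop)).aestronglyMeasurable
    · refine ae_of_all _ fun t => LipschitzOnWith.of_dist_le_mul fun a _ b _ => ?_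
      have h0 : 0 ≤ (ρ n).normed volume t * C := mul_nonneg (hρ0 n t) C.coe_nonneg
      rw [Real.coe_nnabs, abs_of_nonneg h0, dist_eq_norm, ← mul_sub, norm_mul,
        Real.norm_of_nonneg (hρ0 n t), mul_assoc]
      refine mul_le_mul_of_nonneg_left ?_ (hρ0 n t)
      simpa [dist_eq_norm] using hC.dist_le_mul (a - t) (b - t)
    · exact (hρi n).mul_const _
    · have h1 : ∀ᵐ t, DifferentiableAt ℝ f (x - t) :=
        (quasiMeasurePreserving_sub_left (volume : Measure (Coord 2)) x).ae hC.ae_differentiableAt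
      filter_upwards [h1] with t ht
      have h2 : HasFDerivAt (fun z => f (z - t)) (fderiv ℝ f (x - t)) x := by
        have h3 : HasFDerivAt (fun z : Coord 2 => z - t) (ContinuousLinearMap.id ℝ _) x :=
          (hasFDerivAt_id x).sub_const t
        have h4 := ht.hasFDerivAt.comp x h3
        rw [ContinuousLinearMap.comp_id] at h4
        exact h4
      exact h2.const_smul ((ρ n).normed volume t)
  refine ⟨F, Metric.cthickening δ (tsupport f), max B C, hc.isCompact.cthickening, hδΩ, ?_, ?_, ?_,
    ?_, ?_, ?_⟩
  · intro n
    rw [hFconv]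
    exact (ρ n).hasCompactSupport_normed.contDiff_convolution_left _ (ρ n).contDiff_normed hli
  · intro n
    refine closure_minimal (fun x hx => ?_) Metric.isClosed_cthickening
    by_contra hx'
    apply hx
    have : ∀ t, (ρ n).normed volume t * f (x - t) = 0 := by
      intro t
      by_cases ht : t ∈ Metric.ball (0 : Coord 2) (ρ n).rOut
      · have : x - t ∉ tsupport f := by
          intro h
          refine hx' (Metric.mem_cthickening_of_dist_le x (x - t) _ _ h ?_)
          have h1 : ‖t‖ < δ / (n + 1) := by simpa [ρ] using ht
          have h2 : δ / (n + 1) ≤ δ := div_le_self hδ.le (by linarith [n.cast_nonneg (α := ℝ)])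
          simpa [dist_eq_norm] using h1.le.trans h2
        rw [image_eq_zero_of_notMem_tsupport this, mul_zero]
      · rw [← (ρ n).support_normed_eq (μ := volume), Function.notMem_support] at ht
        rw [ht, zero_mul]
    simp [F, this]
  · intro n x
    refine le_trans ?_ (le_max_left _ _)
    calc |F n x| ≤ ∫ t, (ρ n).normed volume t * B := by
          rw [← Real.norm_eq_abs]
          refine norm_integral_le_of_norm_le ((hρi n).mul_const _) (ae_of_all _ fun t => ?_)
          rw [norm_mul, Real.norm_of_nonneg (hρ0 n t)]
          exact mul_le_mul_of_nonneg_left (hB _) (hρ0 n t)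
      _ = B := by rw [integral_mul_const, hρ1, one_mul]
  · exact fun n i x => (abs_pd_le_of_lipschitz (hFL n)).trans (le_max_right _ _)
  · intro x
    simp only [hFconv]
    exact ContDiffBump.convolution_tendsto_right_of_continuous hρ hfc x
  -- the mollified derivatives converge at the Lebesgue points of `fderiv ℝ f`
  · have hli' : LocallyIntegrable (fderiv ℝ f) volume :=
      (locallyIntegrable_const (C : ℝ)).mono (measurable_fderiv ℝ f).aestronglyMeasurable
        (ae_of_all _ fun x => by simpa using norm_fderiv_le_of_lipschitz ℝ hC)
    filter_upwards [ContDiffBump.ae_convolution_tendsto_right_of_locallyIntegrable (K := 2) hρ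
      (Eventually.of_forall fun n => by simp [ρ]; linarith) hli'] with x hx i
    unfold pd
    simp only [hder]
    exact (((ContinuousLinearMap.apply ℝ ℝ
      (EuclideanSpace.single i (1 : ℝ) : Coord 2)).continuous.tendsto _).comp hx)

end LipTest

/-! ### Testing against compactly supported Lipschitz functions -/

section Testing

variable {f g φ : Coord 2 → ℝ} {Ω : Set (Coord 2)} {i j k : Fin 2} {D : Fin 2 → Coord 2 → ℝ}

lemma IsLipTest.exists_abs_pd_le (hf : IsLipTest f Ω) : ∃ C : ℝ, ∀ i x, |pd i f x| ≤ C := by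
  obtain ⟨⟨C, hC⟩, -⟩ := hf
  exact ⟨C, fun i x => abs_pd_le_of_lipschitz hC⟩

lemma IsLipTest.exists_abs_le (hf : IsLipTest f Ω) : ∃ C : ℝ, ∀ x, |f x| ≤ C :=
  hf.2.1.exists_bound_of_continuous hf.continuous

lemma integrable_mul_of_bound {w h : Coord 2 → ℝ} {K : Set (Coord 2)} {μ : Measure (Coord 2)}
    {B : ℝ} (hw : IntegrableOn w K μ) (hm : AEStronglyMeasurable h μ)
    (hB : ∀ x, |h x| ≤ B) (h0 : ∀ x, x ∉ K → h x = 0) :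
    Integrable (fun x => w x * h x) μ := by
  have : IntegrableOn (fun x => w x * h x) K μ := by
    refine Integrable.mono' (hw.norm.mul_const B) (hw.aestronglyMeasurable.mul hm.restrict)
      (ae_of_all _ fun x => ?_)
    rw [norm_mul]
    exact mul_le_mul_of_nonneg_left (hB x) (norm_nonneg _)
  refine (integrableOn_iff_integrable_of_support_subset fun x hx => ?_).1 this
  by_contra h'
  exact hx (by simp [h0 x h'])

/-- Dominated convergence for integrals against a function integrable on a compact set. -/
lemma tendsto_integral_mul_of_bound {w h : Coord 2 → ℝ} {H : ℕ → Coord 2 → ℝ}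
    {K : Set (Coord 2)} {μ : Measure (Coord 2)} {B : ℝ} (hK : IsCompact K)
    (hw : IntegrableOn w K μ) (hm : ∀ n, Measurable (H n)) (hB : ∀ n x, |H n x| ≤ B)
    (h0 : ∀ n x, x ∉ K → H n x = 0)
    (hlim : ∀ᵐ x ∂μ, Tendsto (fun n => H n x) atTop (𝓝 (h x))) :
    Tendsto (fun n => ∫ x, w x * H n x ∂μ) atTop (𝓝 (∫ x, w x * h x ∂μ)) := by
  have hB0 : 0 ≤ B := (abs_nonneg _).trans (hB 0 0)
  refine tendsto_integral_of_dominated_convergence (K.indicator fun x => |w x| * B) ?_ ?_ ?_ ?_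
  · exact fun n => (integrable_mul_of_bound hw (hm n).aestronglyMeasurable (hB n)
      (h0 n)).aestronglyMeasurable
  · rw [integrable_indicator_iff hK.measurableSet]
    exact hw.norm.mul_const B
  · refine fun n => ae_of_all _ fun x => ?_
    by_cases hx : x ∈ K
    · rw [indicator_of_mem hx, norm_mul]
      exact mul_le_mul_of_nonneg_left (hB n x) (norm_nonneg _)
    · simp [h0 n x hx, indicator_of_notMem hx]
  · filter_upwards [hlim] with x hx using hx.const_mul _

/-- The Jacobian determinant of two Lipschitz functions integrates to zero if one of them has compact
support. For smooth `f` this is integration by parts and the symmetry of second derivatives; the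
general case follows by mollifying `f` alone. -/
lemma integral_pd_mul_pd_sub_eq_zero_of_lipschitz (hf : IsLipTest f univ)
    (hg : ∃ C, LipschitzWith C g) :
    ∫ x, (pd 0 f x * pd 1 g x - pd 1 f x * pd 0 g x) = 0 := by
  obtain ⟨C, hC⟩ := hg
  obtain ⟨F, K, B, hK, -, hFs, hFK, -, hFd, -, hFlim⟩ := exists_smooth_approx isOpen_univ hf
  have hloc : ∀ i, IntegrableOn (pd i g) K volume := fun i => by
    refine Integrable.mono' (g := fun _ => (C : ℝ)) ?_
      measurable_pd.aestronglyMeasurable (ae_of_all _ fun x => abs_pd_le_of_lipschitz hC)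
    exact (integrableOn_const hK.measure_lt_top.ne)
  have hz : ∀ n i x, x ∉ K → pd i (F n) x = 0 := fun n i x hx =>
    pd_eq_zero_of_notMem fun h => hx (hFK n h)
  have hlim : ∀ i j, Tendsto (fun n => ∫ x, pd i g x * pd j (F n) x) atTop
      (𝓝 (∫ x, pd i g x * pd j f x)) := fun i j =>
    tendsto_integral_mul_of_bound hK (hloc i) (fun n => measurable_pd) (fun n => hFd n j)
      (fun n => hz n j) (hFlim.mono fun x hx => hx j)
  have hfK : ∀ i x, x ∉ tsupport f → pd i f x = 0 := fun i x hx => pd_eq_zero_of_notMem hx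
  obtain ⟨B', hB'⟩ := hf.exists_abs_pd_le
  have hloc' : ∀ i, IntegrableOn (pd i g) (tsupport f) volume := fun i => by
    refine Integrable.mono' (g := fun _ => (C : ℝ)) ?_
      measurable_pd.aestronglyMeasurable (ae_of_all _ fun x => abs_pd_le_of_lipschitz hC)
    exact (integrableOn_const hf.2.1.isCompact.measure_lt_top.ne)
  have hint : ∀ i j, Integrable (fun x => pd i g x * pd j f x) := fun i j =>
    integrable_mul_of_bound (hloc' i) measurable_pd.aestronglyMeasurable (hB' j)
      (hfK j)
  have hcs : ∀ n, HasCompactSupport (F n) := fun n =>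
    hK.of_isClosed_subset (isClosed_tsupport _) (hFK n)
  have hip : ∀ n i j, ∫ x, pd i g x * pd j (F n) x = -∫ x, g x * pd i (pd j (F n)) x :=
    fun n i j => integral_pd_mul ⟨C, hC⟩ (isLipTest_of_contDiff (contDiff_pd (hFs n))
      (hasCompactSupport_pd (hcs n)) (subset_univ _)).1 (hasCompactSupport_pd (hcs n))
  have heq : ∫ x, pd 1 g x * pd 0 f x = ∫ x, pd 0 g x * pd 1 f x := by
    refine tendsto_nhds_unique (hlim 1 0) ((hlim 0 1).congr fun n => ?_)
    rw [hip, hip]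
    simp only [pd_comm (i := 0) (j := 1) (hFs n)]
  rw [show (fun x => pd 0 f x * pd 1 g x - pd 1 f x * pd 0 g x) =
    fun x => pd 1 g x * pd 0 f x - pd 0 g x * pd 1 f x by ext; ring,
    integral_sub (hint 1 0) (hint 0 1), heq, sub_self]

lemma setIntegral_eq_of_tsupport {h : Coord 2 → ℝ} (hs : ∀ x, x ∉ Ω → h x = 0) :
    ∫ x in Ω, h x = ∫ x, h x :=
  setIntegral_eq_integral_of_forall_compl_eq_zero hs

/-- The Jacobian determinant is a null Lagrangian: it integrates to zero if one of the two functions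
has compact support. -/
lemma integral_jacobian_eq_zero (hΩ : IsOpen Ω) (hf : IsLipTest f Ω) (hg : LocallyLipschitzOn Ω g) :
    ∫ x, (pd 0 f x * pd 1 g x - pd 1 f x * pd 0 g x) = 0 := by
  obtain ⟨χ, hχ, hχc, hχΩ, hχ1, -⟩ := exists_cutoff hf.2.1.isCompact hΩ hf.2.2
  have hlip := (isLipTest_of_contDiff hχ hχc hχΩ).mul hΩ hg
  rw [← integral_pd_mul_pd_sub_eq_zero_of_lipschitz (hf.mono (subset_univ _)) hlip.1]
  congr 1
  ext x
  by_cases hx : x ∈ tsupport f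
  · have hev : ∀ i, pd i (fun x => χ x * g x) x = pd i g x := fun i => by
      refine pd_congr ?_
      filter_upwards [hχ1.filter_mono (nhds_le_nhdsSet hx)] with z hz
      rw [hz, one_mul]
    rw [hev, hev]
  · simp [pd_eq_zero_of_notMem hx]

/-- Integration by parts for locally Lipschitz functions. -/
lemma integral_mul_pd_of_locallyLipschitzOn (hΩ : IsOpen Ω) (hf : IsLipTest f Ω)
    (hg : LocallyLipschitzOn Ω g) : ∫ x, g x * pd k f x = -∫ x, pd k g x * f x := by
  obtain ⟨χ, hχ, hχc, hχΩ, hχ1, -⟩ := exists_cutoff hf.2.1.isCompact hΩ hf.2.2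
  have hlip := (isLipTest_of_contDiff hχ hχc hχΩ).mul hΩ hg
  have h := integral_pd_mul (i := k) hlip.1 hf.1 hf.2.1
  have h1 : ∀ x, pd k (fun x => χ x * g x) x * f x = pd k g x * f x := fun x => by
    by_cases hx : x ∈ tsupport f
    · congr 1
      refine pd_congr ?_
      filter_upwards [hχ1.filter_mono (nhds_le_nhdsSet hx)] with z hz
      rw [hz, one_mul]
    · simp [image_eq_zero_of_notMem_tsupport hx]
  have h2 : ∀ x, χ x * g x * pd k f x = g x * pd k f x := fun x => by
    by_cases hx : x ∈ tsupport f
    · rw [(hχ1.filter_mono (nhds_le_nhdsSet hx)).self_of_nhds, one_mul]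
    · simp [pd_eq_zero_of_notMem hx]
  simp only [h1, h2] at h
  rw [h, neg_neg]

lemma LocallyIntegrableOn.integrable_mul_test {w h : Coord 2 → ℝ} {K : Set (Coord 2)} {B : ℝ}
    (hw : LocallyIntegrableOn w Ω) (hK : IsCompact K) (hKΩ : K ⊆ Ω) (hm : Measurable h)
    (hB : ∀ x, |h x| ≤ B) (h0 : ∀ x, x ∉ K → h x = 0) :
    Integrable (fun x => w x * h x) :=
  integrable_mul_of_bound (hw.integrableOn_compact_subset hKΩ hK) hm.aestronglyMeasurable hB h0

/-- The weak gradient may be tested against Lipschitz functions. -/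
lemma IsWeakGradientOn.integral_mul_pd (hΩ : IsOpen Ω) (hD : IsWeakGradientOn φ D Ω)
    (hf : IsLipTest f Ω) : ∫ x, φ x * pd k f x = -∫ x, D k x * f x := by
  obtain ⟨F, K, B, hK, hKΩ, hFs, hFK, hFb, hFd, hFl, hFlim⟩ := exists_smooth_approx hΩ hf
  have h1 := tendsto_integral_mul_of_bound (μ := volume) hK
    (hD.1.integrableOn_compact_subset hKΩ hK)
    (fun n => measurable_pd (f := F n) (i := k)) (fun n => hFd n k)
    (fun n x hx => pd_eq_zero_of_notMem fun h => hx (hFK n h)) (hFlim.mono fun x hx => hx k)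
  have h2 := tendsto_integral_mul_of_bound (μ := volume) hK
    ((hD.2.1 k).integrableOn_compact_subset hKΩ hK)
    (fun n => (hFs n).continuous.measurable) hFb
    (fun n x hx => image_eq_zero_of_notMem_tsupport fun h => hx (hFK n h)) (ae_of_all _ hFl)
  refine tendsto_nhds_unique h1 (h2.neg.congr fun n => ?_)
  have h3 := hD.2.2 k (F n) (hFs n) (hK.of_isClosed_subset (isClosed_tsupport _) (hFK n))
    ((hFK n).trans hKΩ)
  rw [setIntegral_eq_of_tsupport, setIntegral_eq_of_tsupport] at h3
  · exact h3.symm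
  · exact fun x hx => by
      rw [image_eq_zero_of_notMem_tsupport fun h => hx (hKΩ (hFK n h)), mul_zero]
  · exact fun x hx => by rw [pd_eq_zero_of_notMem fun h => hx (hKΩ (hFK n h)), mul_zero]

/-- If `μ - ν` is minus the distributional Laplacian of `φ`, and `φ` has a weak gradient, then the
identity may be tested against Lipschitz functions, after one integration by parts. -/
lemma integral_sub_integral_eq_of_laplacian (hΩ : IsOpen Ω) (hD : IsWeakGradientOn φ D Ω)
    {μ ν : Measure (Coord 2)} (hμ : ∀ K, IsCompact K → K ⊆ Ω → μ K < ⊤)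
    (hν : ∀ K, IsCompact K → K ⊆ Ω → ν K < ⊤)
    (h : ∀ f : Coord 2 → ℝ, ContDiff ℝ ∞ f → HasCompactSupport f → tsupport f ⊆ Ω →
      ∫ x, f x ∂μ - ∫ x, f x ∂ν = -∫ y in Ω, (pd 0 (pd 0 f) y + pd 1 (pd 1 f) y) * φ y)
    (hf : IsLipTest f Ω) :
    ∫ x, f x ∂μ - ∫ x, f x ∂ν = ∫ x, (D 0 x * pd 0 f x + D 1 x * pd 1 f x) := by
  obtain ⟨F, K, B, hK, hKΩ, hFs, hFK, hFb, hFd, hFl, hFlim⟩ := exists_smooth_approx hΩ hf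
  have hm : ∀ μ : Measure (Coord 2), μ K < ⊤ → Tendsto (fun n => ∫ x, F n x ∂μ) atTop
      (𝓝 (∫ x, f x ∂μ)) := fun μ hμ => by
    have := tendsto_integral_mul_of_bound (μ := μ) (w := fun _ => 1) hK
      (integrableOn_const hμ.ne) (fun n => (hFs n).continuous.measurable) hFb
      (fun n x hx => image_eq_zero_of_notMem_tsupport fun h => hx (hFK n h)) (ae_of_all _ hFl)
    simpa using this
  have hd : ∀ k, Tendsto (fun n => ∫ x, D k x * pd k (F n) x) atTop
      (𝓝 (∫ x, D k x * pd k f x)) := fun k =>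
    tendsto_integral_mul_of_bound (μ := volume) hK
      ((hD.2.1 k).integrableOn_compact_subset hKΩ hK)
      (fun n => measurable_pd) (fun n => hFd n k)
      (fun n x hx => pd_eq_zero_of_notMem fun h => hx (hFK n h)) (hFlim.mono fun x hx => hx k)
  have hfint : ∀ k, Integrable (fun x => D k x * pd k f x) := fun k => by
    obtain ⟨C, hC⟩ := hf.exists_abs_pd_le
    exact LocallyIntegrableOn.integrable_mul_test (hD.2.1 k) hf.2.1.isCompact hf.2.2 measurable_pd
      (hC k) (fun x hx => pd_eq_zero_of_notMem hx)
  rw [integral_add (hfint 0) (hfint 1)]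
  refine tendsto_nhds_unique ((hm μ (hμ K hK hKΩ)).sub (hm ν (hν K hK hKΩ)))
    (((hd 0).add (hd 1)).congr fun n => ?_)
  have hcs : HasCompactSupport (F n) := hK.of_isClosed_subset (isClosed_tsupport _) (hFK n)
  have htest : ∀ k, IsLipTest (pd k (F n)) Ω := fun k =>
    isLipTest_of_contDiff (contDiff_pd (hFs n)) (hasCompactSupport_pd hcs)
      (tsupport_pd_subset.trans ((hFK n).trans hKΩ))
  have hint : ∀ k, Integrable (fun x => φ x * pd k (pd k (F n)) x) := fun k => by
    obtain ⟨C, hC⟩ := (htest k).exists_abs_pd_le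
    exact LocallyIntegrableOn.integrable_mul_test hD.1 (htest k).2.1.isCompact (htest k).2.2
      measurable_pd (hC k) (fun x hx => pd_eq_zero_of_notMem hx)
  rw [h (F n) (hFs n) hcs ((hFK n).trans hKΩ), setIntegral_eq_of_tsupport]
  · rw [← neg_neg (∫ x, D 0 x * _), ← neg_neg (∫ x, D 1 x * _),
      ← hD.integral_mul_pd hΩ (htest 0), ← hD.integral_mul_pd hΩ (htest 1), ← neg_add,
      ← integral_add (hint 0) (hint 1)]
    congr 2
    ext x; ring
  · intro x hx
    have h0 : ∀ k, pd k (pd k (F n)) x = 0 := fun k =>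
      pd_eq_zero_of_notMem fun h => hx ((htest k).2.2 h)
    simp [h0]

/-- A property of smooth test functions that is additive and holds locally holds globally. -/
lemma test_induction {P : (Coord 2 → ℝ) → Prop} (h0 : P fun _ => 0)
    (hadd : ∀ f g : Coord 2 → ℝ, ContDiff ℝ ∞ f → HasCompactSupport f → tsupport f ⊆ Ω →
      ContDiff ℝ ∞ g → HasCompactSupport g → tsupport g ⊆ Ω → P f → P g → P fun x => f x + g x)
    (hloc : ∀ x ∈ Ω, ∃ U, IsOpen U ∧ x ∈ U ∧ ∀ f : Coord 2 → ℝ, ContDiff ℝ ∞ f →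
      HasCompactSupport f → tsupport f ⊆ U → P f)
    (hf : ContDiff ℝ ∞ f) (hc : HasCompactSupport f) (hs : tsupport f ⊆ Ω) : P f := by
  classical
  -- `f` is decomposed by finitely many cutoff functions `χ a`, split off one at a time
  choose! U hU hxU hPU using hloc
  have hcut : ∀ x ∈ Ω, ∃ χ : Coord 2 → ℝ, ContDiff ℝ ∞ χ ∧ HasCompactSupport χ ∧
      tsupport χ ⊆ U x ∧ ∃ W, IsOpen W ∧ x ∈ W ∧ ∀ z ∈ W, χ z = 1 := by
    intro x hx
    obtain ⟨χ, h1, h2, h3, h4, -⟩ := exists_cutoff (isCompact_singleton (x := x)) (hU x hx)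
      (singleton_subset_iff.2 (hxU x hx))
    rw [nhdsSet_singleton] at h4
    obtain ⟨W, hW, hWo, hxW⟩ := eventually_nhds_iff.1 h4
    exact ⟨χ, h1, h2, h3, W, hWo, hxW, hW⟩
  choose! χ hχ hχc hχU W hW hxW hχ1 using hcut
  obtain ⟨t, htΩ, ht⟩ := hc.isCompact.elim_nhds_subcover W
    (fun x hx => (hW x (hs hx)).mem_nhds (hxW x (hs hx)))
  have hts : ∀ x ∈ t, x ∈ Ω := fun x hx => hs (htΩ x hx)
  clear htΩ
  induction t using Finset.induction_on generalizing f with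
  | empty =>
    have : f = fun _ => 0 := by
      ext x
      exact image_eq_zero_of_notMem_tsupport fun h => by simpa using ht h
    rw [this]; exact h0
  | insert a t ha ih =>
    have haΩ := hts a (by simp)
    have e : f = fun x => χ a x * f x + (1 - χ a x) * f x := by ext x; ring
    have s1 : tsupport (fun x => χ a x * f x) ⊆ tsupport f := tsupport_mul_subset_right
    have s1' : tsupport (fun x => χ a x * f x) ⊆ tsupport (χ a) := tsupport_mul_subset_left
    have s2 : tsupport (fun x => (1 - χ a x) * f x) ⊆ tsupport f := tsupport_mul_subset_right
    have c1 : ContDiff ℝ ∞ fun x => χ a x * f x := (hχ a haΩ).mul hf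
    have c2 : ContDiff ℝ ∞ fun x => (1 - χ a x) * f x := (contDiff_const.sub (hχ a haΩ)).mul hf
    have k1 := hc.of_isClosed_subset (isClosed_tsupport _) s1
    have k2 := hc.of_isClosed_subset (isClosed_tsupport _) s2
    rw [e]
    refine hadd _ _ c1 k1 (s1.trans hs) c2 k2 (s2.trans hs)
      (hPU a haΩ _ c1 k1 (s1'.trans (hχU a haΩ))) (ih c2 k2 (s2.trans hs) ?_ ?_)
    · intro x hx
      have hx1 := ht (s2 hx)
      simp only [Finset.mem_insert, iUnion_iUnion_eq_or_left, mem_union] at hx1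
      refine hx1.resolve_left fun hxa => ?_
      refine (closure_minimal (t := (W a)ᶜ) ?_ (hW a haΩ).isClosed_compl) hx hxa
      intro z hz hzW
      exact hz (by simp [hχ1 a haΩ z hzW])
    · exact fun x hx => hts x (by simp [hx])

end Testing

/-! ### Subharmonic functions: approximation and local integrability -/

section Subharmonic

variable {u : Coord 2 → EReal} {Ω K : Set (Coord 2)}

/-- The real number `max (u z) (-n)`, for `u z < ⊤`. -/
noncomputable def truncBelow (u : Coord 2 → EReal) (n : ℕ) (z : Coord 2) : ℝ :=
  (max (u z) ((-(n : ℝ) : ℝ) : EReal)).toReal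

lemma coe_truncBelow {n : ℕ} {z : Coord 2} (h : u z < ⊤) :
    ((truncBelow u n z : ℝ) : EReal) = max (u z) ((-(n : ℝ) : ℝ) : EReal) := by
  refine EReal.coe_toReal ?_ ?_
  · exact (max_lt h (EReal.coe_lt_top _)).ne
  · exact (lt_of_lt_of_le (EReal.bot_lt_coe _) (le_max_right _ _)).ne'

lemma truncBelow_le {n : ℕ} {z : Coord 2} (h : u z < ⊤) {a : ℝ} (ha : u z ≤ a)
    (hn : -(n : ℝ) ≤ a) : truncBelow u n z ≤ a := by
  rw [← EReal.coe_le_coe_iff, coe_truncBelow h]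
  exact max_le ha (EReal.coe_le_coe_iff.2 hn)

/-- An upper semicontinuous function on a compact set is the pointwise limit of a decreasing
sequence of continuous functions, namely its Lipschitz sup-convolutions. -/
lemma exists_antitone_continuous_approx (hK : IsCompact K) (hu : UpperSemicontinuousOn u K)
    (htop : ∀ y ∈ K, u y < ⊤) :
    ∃ c : ℕ → Coord 2 → ℝ, (∀ n, Continuous (c n)) ∧ (∀ y ∈ K, Antitone fun n => c n y) ∧
      (∀ n, ∀ y ∈ K, u y ≤ c n y) ∧
      ∀ y ∈ K, ∀ a : ℝ, u y < a → ∀ᶠ n in atTop, c n y ≤ a := by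
  rcases K.eq_empty_or_nonempty with rfl | hne
  · exact ⟨fun _ _ => 0, fun _ => continuous_const, by simp, by simp, by simp⟩
  obtain ⟨x₀, hx₀, hmax⟩ := hu.exists_isMaxOn hne hK
  obtain ⟨M, hM0, hM⟩ : ∃ M : ℝ, 0 ≤ M ∧ ∀ z ∈ K, u z ≤ M := by
    refine ⟨max (u x₀).toReal 0, le_max_right _ _, fun z hz => (hmax hz).trans ?_⟩
    refine (EReal.le_coe_toReal (htop _ hx₀).ne).trans ?_
    exact EReal.coe_le_coe_iff.2 (le_max_left _ _)
  have : Nonempty K := hne.to_subtype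
  let F : ℕ → Coord 2 → K → ℝ := fun n y z => truncBelow u n z - n * dist y z
  have hFM : ∀ n y z, F n y z ≤ M := fun n y z => by
    have h1 := truncBelow_le (n := n) (htop z z.2) (hM z z.2)
      (by have := n.cast_nonneg (α := ℝ); linarith)
    have h2 : 0 ≤ (n : ℝ) * dist y z := by positivity
    simp only [F]; linarith
  have hbdd : ∀ n y, BddAbove (range (F n y)) := fun n y =>
    ⟨M, by rintro _ ⟨z, rfl⟩; exact hFM n y z⟩
  refine ⟨fun n y => ⨆ z, F n y z, fun n => ?_, fun y hy => ?_, fun n y hy => ?_,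
    fun y hy a ha => ?_⟩
  · refine (LipschitzWith.of_le_add_mul (K := (n : NNReal)) fun y y' => ?_).continuous
    refine ciSup_le fun z => ?_
    have h1 := le_ciSup (hbdd n y') z
    have h2 := dist_triangle y' y z
    have h3 : (n : ℝ) * dist y' z ≤ n * (dist y' y + dist y z) := by gcongr
    rw [dist_comm y' y] at h3
    simp only [F, NNReal.coe_natCast] at h1 ⊢
    linarith
  · intro m n hmn
    refine ciSup_le fun z => ?_
    refine le_trans ?_ (le_ciSup (hbdd m y) z)
    have h1 : truncBelow u n z ≤ truncBelow u m z := by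
      rw [← EReal.coe_le_coe_iff, coe_truncBelow (htop z z.2), coe_truncBelow (htop z z.2)]
      refine max_le_max_left _ (EReal.coe_le_coe_iff.2 ?_)
      simpa using (Nat.cast_le (α := ℝ)).2 hmn
    have h2 : (m : ℝ) * dist y z ≤ n * dist y z := by gcongr
    simp only [F]; linarith
  · have h1 := le_ciSup (hbdd n y) ⟨y, hy⟩
    simp only [F, dist_self, mul_zero, sub_zero] at h1
    refine le_trans ?_ (EReal.coe_le_coe_iff.2 h1)
    rw [coe_truncBelow (htop y hy)]
    exact le_max_left _ _
  · obtain ⟨ε, hε, hball⟩ := Metric.mem_nhdsWithin_iff.1 (hu y hy a ha)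
    obtain ⟨N, hN⟩ := exists_nat_ge (max (-a) ((M - a) / ε))
    filter_upwards [eventually_ge_atTop N] with n hn
    have hNn : (N : ℝ) ≤ n := Nat.cast_le.2 hn
    have h1 : -(n : ℝ) ≤ a := by linarith [(le_max_left (-a) ((M - a) / ε)).trans hN]
    have h2 : M - a ≤ n * ε := by
      rw [← div_le_iff₀ hε]
      exact ((le_max_right _ _).trans hN).trans hNn
    refine ciSup_le fun z => ?_
    by_cases hz : dist (z : Coord 2) y < ε
    · have h3 : u z < a := hball ⟨hz, z.2⟩
      have h4 := truncBelow_le (htop z z.2) h3.le h1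
      have h5 : 0 ≤ (n : ℝ) * dist y z := by positivity
      simp only [F]; linarith
    · push Not at hz
      rw [dist_comm] at hz
      have h4 := truncBelow_le (n := n) (htop z z.2) (hM z z.2)
        (by have := n.cast_nonneg (α := ℝ); linarith)
      have h5 : (n : ℝ) * ε ≤ n * dist y z := by gcongr
      simp only [F]; linarith

lemma tendsto_toReal_of_approx {c : ℕ → Coord 2 → ℝ} {y : Coord 2} (hy : u y < ⊤)
    (h1 : ∀ n, u y ≤ c n y) (h2 : ∀ a : ℝ, u y < a → ∀ᶠ n in atTop, c n y ≤ a)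
    (hbot : u y ≠ ⊥) : Tendsto (fun n => c n y) atTop (𝓝 (u y).toReal) := by
  have hco : (((u y).toReal : ℝ) : EReal) = u y := EReal.coe_toReal hy.ne hbot
  refine tendsto_order.2 ⟨fun a ha => Eventually.of_forall fun n => ?_, fun a ha => ?_⟩
  · refine lt_of_lt_of_le ha ?_
    rw [← EReal.coe_le_coe_iff, hco]; exact h1 n
  · obtain ⟨b, hb1, hb2⟩ := exists_between ha
    filter_upwards [h2 b (by rw [← hco]; exact EReal.coe_lt_coe_iff.2 hb1)] with n hn
    exact lt_of_le_of_lt hn hb2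

/-- The unit vector at angle `θ`. -/
noncomputable def circ (θ : ℝ) : Coord 2 := !₂[Real.cos θ, Real.sin θ]

lemma continuous_circ : Continuous circ := by
  unfold circ
  refine (PiLp.continuous_toLp 2 _).comp (continuous_pi fun i => ?_)
  fin_cases i
  · exact Real.continuous_cos
  · exact Real.continuous_sin

lemma norm_circ (θ : ℝ) : ‖circ θ‖ = 1 := by
  simp [circ, EuclideanSpace.norm_eq]

lemma circ_periodic : Function.Periodic circ (2 * Real.pi) := fun θ => by
  simp [circ]

/-- Integration over a disc in polar coordinates. -/
lemma integral_ball_eq_polar {c : Coord 2 → ℝ} (hc : Continuous c) (x : Coord 2) (R : ℝ) :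
    ∫ y in Metric.ball x R, c y =
      ∫ r in Ioo 0 R, r * ∫ θ in (0 : ℝ)..2 * Real.pi, c (x + r • circ θ) := by
  let G : Coord 2 → ℝ := (Metric.ball (0 : Coord 2) R).indicator fun z => c (x + z)
  have e1 : ∫ y in Metric.ball x R, c y = ∫ z, G z := by
    rw [← integral_indicator measurableSet_ball,
      ← integral_add_left_eq_self (μ := (volume : Measure (Coord 2))) _ x]
    congr 1; ext z
    simp only [G, indicator, Metric.mem_ball, dist_eq_norm, add_sub_cancel_left, sub_zero]
  have e2 : ∫ z, G z = ∫ p : ℝ × ℝ, G !₂[p.1, p.2] := by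
    rw [← (PiLp.volume_preserving_toLp (Fin 2)).integral_comp
        (MeasurableEquiv.toLp 2 (Fin 2 → ℝ)).measurableEmbedding,
      ← ((volume_preserving_finTwoArrow ℝ).symm MeasurableEquiv.finTwoArrow).integral_comp'
        (g := fun a => G (WithLp.toLp 2 a))]
    rfl
  have e3 : ∀ r θ : ℝ, (!₂[r * Real.cos θ, r * Real.sin θ] : Coord 2) = r • circ θ := by
    intro r θ; ext i; fin_cases i <;> simp [circ]
  have hcc : Continuous fun p : ℝ × ℝ => p.1 * c (x + p.1 • circ p.2) := by
    have := continuous_circ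
    fun_prop
  rw [e1, e2, ← integral_comp_polarCoord_symm]
  have e4 : ∫ p in polarCoord.target, p.1 • G !₂[(polarCoord.symm p).1, (polarCoord.symm p).2] =
      ∫ p in Ioo 0 R ×ˢ Ioo (-Real.pi) Real.pi, p.1 * c (x + p.1 • circ p.2) := by
    have hsub : Ioo 0 R ×ˢ Ioo (-Real.pi) Real.pi ⊆ polarCoord.target :=
      prod_mono (fun r hr => hr.1) subset_rfl
    refine (setIntegral_eq_of_subset_of_forall_sdiff_eq_zero
      polarCoord.open_target.measurableSet hsub ?_).trans ?_
    rotate_left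
    · refine setIntegral_congr_fun (measurableSet_Ioo.prod measurableSet_Ioo) ?_
      rintro ⟨r, θ⟩ ⟨hr, hθ⟩
      simp only [polarCoord_symm_apply, e3, smul_eq_mul, G]
      rw [indicator_of_mem]
      simpa [norm_smul, norm_circ, abs_of_pos hr.1] using hr.2
    · rintro ⟨r, θ⟩ ⟨⟨hr, hθ⟩, h2⟩
      simp only [polarCoord_symm_apply, e3, smul_eq_mul, G]
      rw [indicator_of_notMem, mul_zero]
      intro h
      refine h2 ⟨⟨hr, ?_⟩, hθ⟩
      simpa [norm_smul, norm_circ, abs_of_pos (show (0 : ℝ) < r from hr)] using h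
  rw [e4, Measure.volume_eq_prod, setIntegral_prod]
  · refine setIntegral_congr_fun measurableSet_Ioo fun r hr => ?_
    simp only [integral_const_mul]
    congr 1
    rw [← integral_Ioc_eq_integral_Ioo, ← intervalIntegral.integral_of_le (by
      linarith [Real.pi_pos])]
    have hp : Function.Periodic (fun θ => c (x + r • circ θ)) (2 * Real.pi) := fun θ => by
      simp only [circ_periodic θ]
    have := hp.intervalIntegral_add_eq (-Real.pi) 0
    rw [zero_add] at this
    rw [← this]
    congr 1; ring
  · refine (hcc.continuousOn.integrableOn_compact
      (isCompact_Icc.prod (isCompact_Icc (a := -Real.pi) (b := Real.pi)))).mono_set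
      (prod_mono (Ioo_subset_Icc_self (b := R)) Ioo_subset_Icc_self)

variable (hu : IsSubharmonicOn u Ω)
include hu

/-- A subharmonic function is integrable on a disc about a point where it is finite. -/
lemma IsSubharmonicOn.integrableOn_closedBall {x : Coord 2} {R : ℝ} (hR : 0 < R)
    (hx : u x ≠ ⊥) (hsub : Metric.closedBall x R ⊆ Ω) :
    IntegrableOn (fun y => (u y).toReal) (Metric.ball x R) ∧
      ∀ᵐ y ∂(volume.restrict (Metric.ball x R)), u y ≠ ⊥ := by
  have hxΩ : x ∈ Ω := hsub (Metric.mem_closedBall_self hR.le)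
  obtain ⟨c, hc, hanti, hle, hlim⟩ := exists_antitone_continuous_approx
    (isCompact_closedBall x R) (hu.upperSemicontinuous.mono hsub)
    (fun y hy => hu.lt_top y (hsub hy))
  set B := Metric.ball x R with hB
  have hBK : B ⊆ Metric.closedBall x R := Metric.ball_subset_closedBall
  have hBm : MeasurableSet B := measurableSet_ball
  set a := (u x).toReal with ha
  have hco : ((a : ℝ) : EReal) = u x := EReal.coe_toReal (hu.lt_top x hxΩ).ne hx
  have hci : ∀ n, IntegrableOn (c n) B := fun n =>
    ((hc n).continuousOn.integrableOn_compact (isCompact_closedBall x R)).mono_set hBK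
  have hmean : ∀ n, ∀ r ∈ Ioo 0 R,
      2 * Real.pi * a ≤ ∫ θ in (0 : ℝ)..2 * Real.pi, c n (x + r • circ θ) := by
    intro n r hr
    have hrs : Metric.closedBall x r ⊆ Metric.closedBall x R :=
      Metric.closedBall_subset_closedBall hr.2.le
    have h := hu.subMean x r hr.1 (hrs.trans hsub) (c n) (hc n).continuousOn
      (fun y hy => hle n y (hrs (Metric.sphere_subset_closedBall hy)))
    rw [← hco, EReal.coe_le_coe_iff] at h
    have hp : 0 < 2 * Real.pi := by positivity
    rwa [inv_mul_eq_div, le_div_iff₀ hp, mul_comm] at h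
  have hlow : ∀ n, Real.pi * R ^ 2 * a ≤ ∫ y in B, c n y := by
    intro n
    rw [hB, integral_ball_eq_polar (hc n) x R]
    have hcont : Continuous fun r : ℝ =>
        r * ∫ θ in (0 : ℝ)..2 * Real.pi, c n (x + r • circ θ) := by
      refine continuous_id.mul ?_
      refine intervalIntegral.continuous_parametric_intervalIntegral_of_continuous' ?_ _ _
      have := continuous_circ
      have := hc n
      unfold Function.uncurry
      fun_prop
    have h1 : ∫ r in Ioo 0 R, r * (2 * Real.pi * a) = Real.pi * R ^ 2 * a := by
      rw [← integral_Ioc_eq_integral_Ioo, ← intervalIntegral.integral_of_le hR.le,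
        intervalIntegral.integral_mul_const, integral_id]
      ring
    rw [← h1]
    refine setIntegral_mono_on ?_ ?_ measurableSet_Ioo fun r hr => ?_
    · exact ((continuous_id.mul continuous_const).continuousOn.integrableOn_compact
        isCompact_Icc).mono_set Ioo_subset_Icc_self
    · exact (hcont.continuousOn.integrableOn_compact isCompact_Icc).mono_set Ioo_subset_Icc_self
    · exact mul_le_mul_of_nonneg_left (hmean n r hr) hr.1.le
  -- monotone convergence for `c 0 - c n`
  let G : Coord 2 → ENNReal := fun y => ⨆ n, ENNReal.ofReal (c 0 y - c n y)
  have hGm : Measurable G := Measurable.iSup fun n =>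
    (((hc 0).sub (hc n)).measurable).ennreal_ofReal
  have hGint : ∫⁻ y in B, G y ≤ ENNReal.ofReal ((∫ y in B, c 0 y) - Real.pi * R ^ 2 * a) := by
    rw [lintegral_iSup_ae]
    · refine iSup_le fun n => ?_
      rw [← ofReal_integral_eq_lintegral_ofReal (f := fun y => c 0 y - c n y)
        ((hci 0).sub (hci n))]
      · rw [integral_sub (hci 0) (hci n)]
        exact ENNReal.ofReal_le_ofReal (by linarith [hlow n])
      · rw [EventuallyLE, ae_restrict_iff' hBm]
        exact ae_of_all _ fun y hy => sub_nonneg.2 (hanti y (hBK hy) (Nat.zero_le n))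
    · exact fun n => (((hc 0).sub (hc n)).measurable).ennreal_ofReal
    · intro n
      rw [ae_restrict_iff' hBm]
      refine ae_of_all _ fun y hy => ENNReal.ofReal_le_ofReal ?_
      linarith [hanti y (hBK hy) (Nat.le_succ n)]
  have hGfin : ∫⁻ y in B, G y ≠ ⊤ := (hGint.trans_lt ENNReal.ofReal_lt_top).ne
  have hGae : ∀ᵐ y ∂(volume.restrict B), G y < ⊤ := ae_lt_top hGm hGfin
  have hbot : ∀ᵐ y ∂(volume.restrict B), u y ≠ ⊥ := by
    filter_upwards [hGae, ae_restrict_mem hBm] with y hy hyB hbot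
    obtain ⟨n, hn⟩ := (hlim y (hBK hyB) (c 0 y - (G y).toReal - 1)
      (by rw [hbot]; exact EReal.bot_lt_coe _)).exists
    have h1 : ENNReal.ofReal (c 0 y - c n y) ≤ G y := le_iSup (fun n => ENNReal.ofReal _) n
    have h2 : c 0 y - c n y ≤ (G y).toReal := by
      rw [← ENNReal.ofReal_le_iff_le_toReal hy.ne]; exact h1
    linarith
  refine ⟨?_, hbot⟩
  have hGi : IntegrableOn (fun y => (G y).toReal) B :=
    integrable_toReal_of_lintegral_ne_top hGm.aemeasurable hGfin
  refine ((hci 0).sub hGi).congr ?_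
  filter_upwards [hGae, ae_restrict_mem hBm, hbot] with y hy hyB hb
  have ht := tendsto_toReal_of_approx (hu.lt_top y (hsub (hBK hyB)))
    (fun n => hle n y (hBK hyB)) (hlim y (hBK hyB)) hb
  have hmono : Monotone fun n => ENNReal.ofReal (c 0 y - c n y) := fun m n hmn =>
    ENNReal.ofReal_le_ofReal (by linarith [hanti y (hBK hyB) hmn])
  have ht2 : Tendsto (fun n => ENNReal.ofReal (c 0 y - c n y)) atTop
      (𝓝 (ENNReal.ofReal (c 0 y - (u y).toReal))) :=
    ENNReal.tendsto_ofReal (ht.const_sub _)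
  have hGeq : G y = ENNReal.ofReal (c 0 y - (u y).toReal) :=
    tendsto_nhds_unique (tendsto_atTop_iSup hmono) ht2
  have hnn : 0 ≤ c 0 y - (u y).toReal :=
    ge_of_tendsto (ht.const_sub (c 0 y)) (Eventually.of_forall fun n =>
      sub_nonneg.2 (hanti y (hBK hyB) (Nat.zero_le n)))
  simp only [Pi.sub_apply, hGeq, ENNReal.toReal_ofReal hnn]
  ring

lemma IsSubharmonicOn.exists_nhds_integrableOn (hΩ : IsOpen Ω) {x : Coord 2} (hx : x ∈ Ω) :
    ∃ U, IsOpen U ∧ x ∈ U ∧ U ⊆ Ω ∧ IntegrableOn (fun y => (u y).toReal) U ∧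
      ∀ᵐ y ∂(volume.restrict U), u y ≠ ⊥ := by
  obtain ⟨R, hR, hball⟩ := Metric.isOpen_iff.1 hΩ x hx
  obtain ⟨y, hy, hyb⟩ := hu.not_bot (Metric.ball x (R / 4)) Metric.isOpen_ball
    (Metric.nonempty_ball.2 (by linarith)) ((Metric.ball_subset_ball (by linarith)).trans hball)
  rw [Metric.mem_ball] at hy
  have h1 : Metric.closedBall y (R / 2) ⊆ Ω := by
    refine (fun z hz => hball ?_)
    rw [Metric.mem_closedBall] at hz
    rw [Metric.mem_ball]
    linarith [dist_triangle z y x]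
  obtain ⟨h2, h3⟩ := hu.integrableOn_closedBall (half_pos hR) hyb h1
  refine ⟨Metric.ball y (R / 2), Metric.isOpen_ball, ?_,
    Metric.ball_subset_closedBall.trans h1, h2, h3⟩
  rw [Metric.mem_ball, dist_comm]; linarith

lemma IsSubharmonicOn.locallyIntegrableOn (hΩ : IsOpen Ω) :
    LocallyIntegrableOn (fun y => (u y).toReal) Ω := by
  intro x hx
  obtain ⟨U, hU, hxU, -, h, -⟩ := hu.exists_nhds_integrableOn hΩ hx
  exact ⟨U, mem_nhdsWithin_of_mem_nhds (hU.mem_nhds hxU), h⟩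

lemma IsSubharmonicOn.ae_ne_bot (hΩ : IsOpen Ω) : ∀ᵐ y ∂(volume.restrict Ω), u y ≠ ⊥ := by
  rw [ae_restrict_iff' hΩ.measurableSet, ae_iff]
  refine measure_null_of_locally_null _ fun x hx => ?_
  have hx' : x ∈ Ω := by
    by_contra h; exact hx fun h' => absurd h' h
  obtain ⟨U, hU, hxU, -, -, h0⟩ := hu.exists_nhds_integrableOn hΩ hx'
  refine ⟨U ∩ {a | ¬(a ∈ Ω → u a ≠ ⊥)}, inter_mem (mem_nhdsWithin_of_mem_nhds (hU.mem_nhds hxU))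
    self_mem_nhdsWithin, ?_⟩
  rw [ae_restrict_iff' hU.measurableSet, ae_iff] at h0
  refine measure_mono_null (fun z hz => ?_) h0
  exact fun h => hz.2 fun _ => h hz.1

end Subharmonic

/-! ### The distributional Laplacian of a subharmonic function -/

section Laplacian

lemma pd_pd_eq {f : Coord 2 → ℝ} (hf : ContDiff ℝ ∞ f) (i j : Fin 2) (y : Coord 2) :
    pd i (pd j f) y =
      fderiv ℝ (fderiv ℝ f) y (EuclideanSpace.single i 1) (EuclideanSpace.single j 1) := by
  have h2 : DifferentiableAt ℝ (fderiv ℝ f) y :=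
    ((hf.fderiv_right (m := ∞) (by simp)).differentiable (by simp)) y
  have : HasFDerivAt (pd j f) ((ContinuousLinearMap.apply ℝ ℝ
      (EuclideanSpace.single j (1 : ℝ) : Coord 2)).comp (fderiv ℝ (fderiv ℝ f) y)) y :=
    (ContinuousLinearMap.apply ℝ ℝ
      (EuclideanSpace.single j (1 : ℝ) : Coord 2)).hasFDerivAt.comp y h2.hasFDerivAt
  unfold pd at this ⊢
  rw [this.fderiv]; rfl

/-- Taylor's formula of second order, with a cubic error for a Lipschitz second derivative: the mean
value inequality, applied to the first derivative and then to the function. -/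
lemma taylor_bound {E : Type*} [NormedAddCommGroup E] [NormedSpace ℝ E] {f : E → ℝ}
    {f1 : E → E →L[ℝ] ℝ} {f2 : E → E →L[ℝ] E →L[ℝ] ℝ} {L : NNReal}
    (hd0 : ∀ y, HasFDerivAt f (f1 y) y) (hd1 : ∀ y, HasFDerivAt f1 (f2 y) y)
    (hL : LipschitzWith L f2) (y w : E) :
    |f (y + w) - f y - f1 y w - 1 / 2 * f2 y w w| ≤ L * ‖w‖ ^ 3 := by
  have hsymm : ∀ y v w, f2 y v w = f2 y w v :=
    fun y v w => second_derivative_symmetric hd0 (hd1 y) v w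
  have hadd : ∀ y v : E, HasFDerivAt (fun v : E => y + v)
      (ContinuousLinearMap.id ℝ E) v := fun y v => (hasFDerivAt_id v).const_add y
  have claim : ∀ y w, ‖f1 (y + w) - f1 y - f2 y w‖ ≤ L * ‖w‖ ^ 2 := by
    intro y w
    have h := (convex_closedBall (0 : E) ‖w‖).norm_image_sub_le_of_norm_hasFDerivWithin_le
      (f := fun v => f1 (y + v) - f2 y v) (f' := fun v => f2 (y + v) - f2 y)
      (C := L * ‖w‖) (x := 0) (y := w) ?_ ?_ (by simp) (by simp)
    · rw [show (f1 (y + w) - f1 y - f2 y w) =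
        (f1 (y + w) - f2 y w) - (f1 (y + 0) - f2 y 0) by simp; abel]
      refine h.trans (le_of_eq ?_)
      rw [sub_zero]; ring
    · intro v _
      have h1 := (hd1 (y + v)).comp v (hadd y v)
      rw [ContinuousLinearMap.comp_id] at h1
      exact (h1.sub (f2 y).hasFDerivAt).hasFDerivWithinAt
    · intro v hv
      have h1 := hL.dist_le_mul (y + v) y
      rw [dist_eq_norm, dist_eq_norm, add_sub_cancel_left] at h1
      refine h1.trans ?_
      gcongr
      simpa using hv
  have h := (convex_closedBall (0 : E) ‖w‖).norm_image_sub_le_of_norm_hasFDerivWithin_le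
      (f := fun v => f (y + v) - f1 y v - 1 / 2 * f2 y v v)
      (f' := fun v => f1 (y + v) - f1 y - f2 y v)
      (C := L * ‖w‖ ^ 2) (x := 0) (y := w) ?_ ?_ (by simp) (by simp)
  · rw [← Real.norm_eq_abs, show f (y + w) - f y - f1 y w - 1 / 2 * f2 y w w =
      (f (y + w) - f1 y w - 1 / 2 * f2 y w w) -
      (f (y + 0) - f1 y 0 - 1 / 2 * f2 y 0 0) by simp; ring]
    refine h.trans (le_of_eq ?_)
    rw [sub_zero]; ring
  · intro v _
    have h1 := (hd0 (y + v)).comp v (hadd y v)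
    rw [ContinuousLinearMap.comp_id] at h1
    have h2 := ((f2 y).hasFDerivAt (x := v)).clm_apply (hasFDerivAt_id v)
    have h3 := ((h1.sub (f1 y).hasFDerivAt).sub (h2.const_mul (1 / 2))).hasFDerivWithinAt
      (s := Metric.closedBall 0 ‖w‖)
    refine h3.congr_fderiv ?_
    ext z
    have := hsymm y z v
    simp
    linarith
  · intro v hv
    refine (claim y v).trans ?_
    gcongr
    simpa using hv

lemma exists_lipschitzWith_fderiv_fderiv {f : Coord 2 → ℝ} (hf : ContDiff ℝ ∞ f)
    (hc : HasCompactSupport f) : ∃ L, LipschitzWith L (fderiv ℝ (fderiv ℝ f)) := by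
  have hf1 : ContDiff ℝ ∞ (fderiv ℝ f) := hf.fderiv_right (m := ∞) (by simp)
  have hf2 : ContDiff ℝ ∞ (fderiv ℝ (fderiv ℝ f)) := hf1.fderiv_right (m := ∞) (by simp)
  exact hf2.lipschitzWith_of_hasCompactSupport ((hc.fderiv ℝ).fderiv ℝ) (by simp)

lemma hasFDerivAt_fderiv {f : Coord 2 → ℝ} (hf : ContDiff ℝ ∞ f) (y : Coord 2) :
    HasFDerivAt (fderiv ℝ f) (fderiv ℝ (fderiv ℝ f) y) y :=
  ((hf.fderiv_right (m := ∞) (by simp)).differentiable (by simp) y).hasFDerivAt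

lemma exists_taylor_bound {f : Coord 2 → ℝ} (hf : ContDiff ℝ ∞ f) (hc : HasCompactSupport f) :
    ∃ L : ℝ, 0 ≤ L ∧ ∀ y w : Coord 2, |f (y + w) - f y - fderiv ℝ f y w -
      1 / 2 * fderiv ℝ (fderiv ℝ f) y w w| ≤ L * ‖w‖ ^ 3 := by
  obtain ⟨L, hL⟩ := exists_lipschitzWith_fderiv_fderiv hf hc
  have h1 : ∀ y, HasFDerivAt f (fderiv ℝ f y) y := fun y =>
    (hf.differentiable (by simp) y).hasFDerivAt
  exact ⟨L, L.coe_nonneg, fun y w => taylor_bound h1 (hasFDerivAt_fderiv hf) hL y w⟩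

lemma circ_eq (θ : ℝ) : circ θ = Real.cos θ • EuclideanSpace.single 0 (1 : ℝ) +
    Real.sin θ • EuclideanSpace.single 1 (1 : ℝ) := by
  ext i; fin_cases i <;> simp [circ]

/-- The mean of a smooth function over a small circle, to second order. -/
lemma exists_circle_mean_bound {f : Coord 2 → ℝ} (hf : ContDiff ℝ ∞ f)
    (hc : HasCompactSupport f) : ∃ L : ℝ, 0 ≤ L ∧ ∀ y, ∀ r : ℝ, 0 ≤ r →
      |(2 * Real.pi)⁻¹ * (∫ θ in (0 : ℝ)..2 * Real.pi, f (y - r • circ θ)) - f y -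
        r ^ 2 / 4 * (pd 0 (pd 0 f) y + pd 1 (pd 1 f) y)| ≤ L * r ^ 3 := by
  obtain ⟨L, hL0, hL⟩ := exists_taylor_bound hf hc
  refine ⟨L, hL0, fun y r hr => ?_⟩
  have hpi := Real.pi_pos
  have hcirc := continuous_circ
  have hfc := hf.continuous
  set A := pd 0 f y
  set B := pd 1 f y
  set a := pd 0 (pd 0 f) y with ha
  set b := pd 1 (pd 0 f) y with hb
  set c := pd 1 (pd 1 f) y with hcc
  -- the Taylor polynomial on the circle; its terms of odd order in `circ θ` have mean zero
  let T : ℝ → ℝ := fun θ => f y - r * (Real.cos θ * A + Real.sin θ * B) +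
    r ^ 2 / 2 * (Real.cos θ ^ 2 * a + 2 * (Real.sin θ * Real.cos θ) * b + Real.sin θ ^ 2 * c)
  have hTc : Continuous T := by fun_prop
  have hTint : ∫ θ in (0 : ℝ)..2 * Real.pi, T θ = 2 * Real.pi * (f y + r ^ 2 / 4 * (a + c)) := by
    have i1 : IntervalIntegrable (fun θ => r * (Real.cos θ * A + Real.sin θ * B)) volume
      0 (2 * Real.pi) := Continuous.intervalIntegrable (by fun_prop) _ _
    have hcs : ∫ θ in (0 : ℝ)..2 * Real.pi, Real.cos θ ^ 2 = Real.pi := by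
      rw [integral_cos_sq]; simp
    have hss : ∫ θ in (0 : ℝ)..2 * Real.pi, Real.sin θ ^ 2 = Real.pi := by
      rw [integral_sin_sq]; simp
    have hsc : ∫ θ in (0 : ℝ)..2 * Real.pi, Real.sin θ * Real.cos θ = 0 := by
      rw [integral_sin_mul_cos₁]; simp
    simp only [T]
    rw [intervalIntegral.integral_add (Continuous.intervalIntegrable (by fun_prop) _ _)
      (Continuous.intervalIntegrable (by fun_prop) _ _),
      intervalIntegral.integral_sub (Continuous.intervalIntegrable (by fun_prop) _ _) i1,
      intervalIntegral.integral_const_mul, intervalIntegral.integral_const_mul,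
      intervalIntegral.integral_add (Continuous.intervalIntegrable (by fun_prop) _ _)
      (Continuous.intervalIntegrable (by fun_prop) _ _),
      intervalIntegral.integral_add (Continuous.intervalIntegrable (by fun_prop) _ _)
      (Continuous.intervalIntegrable (by fun_prop) _ _),
      intervalIntegral.integral_add (Continuous.intervalIntegrable (by fun_prop) _ _)
      (Continuous.intervalIntegrable (by fun_prop) _ _)]
    simp only [intervalIntegral.integral_mul_const, intervalIntegral.integral_const_mul, hcs, hss,
      hsc, integral_cos, integral_sin, intervalIntegral.integral_const]
    simp
    ring
  have hbound : ∀ θ, |f (y - r • circ θ) - T θ| ≤ L * r ^ 3 := by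
    intro θ
    have h := hL y (-(r • circ θ))
    rw [norm_neg, norm_smul, norm_circ, mul_one, Real.norm_of_nonneg hr, ← sub_eq_add_neg] at h
    convert h using 2
    have e1 : fderiv ℝ f y (-(r • circ θ)) = -(r * (Real.cos θ * A + Real.sin θ * B)) := by
      rw [circ_eq]; simp [A, B, pd]; ring
    have e2 : fderiv ℝ (fderiv ℝ f) y (-(r • circ θ)) (-(r • circ θ)) = r ^ 2 *
        (Real.cos θ ^ 2 * a + 2 * (Real.sin θ * Real.cos θ) * b + Real.sin θ ^ 2 * c) := by
      have hba : pd 0 (pd 1 f) y = b := pd_comm hf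
      rw [pd_pd_eq hf] at hba ha hb hcc
      rw [circ_eq]
      simp only [map_neg, map_smul, map_add, add_apply,
        smul_apply, neg_apply, smul_eq_mul, hba, ← ha,
        ← hb, ← hcc]
      ring
    rw [e1, e2]
    simp only [T]; ring
  have hint : ‖∫ θ in (0 : ℝ)..2 * Real.pi, (f (y - r • circ θ) - T θ)‖ ≤
      L * r ^ 3 * |2 * Real.pi - 0| :=
    intervalIntegral.norm_integral_le_of_norm_le_const fun θ _ => hbound θ
  rw [intervalIntegral.integral_sub (Continuous.intervalIntegrable (by fun_prop) _ _)
    (hTc.intervalIntegrable _ _), hTint, sub_zero, abs_of_pos (by positivity),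
    Real.norm_eq_abs] at hint
  rw [show (2 * Real.pi)⁻¹ * (∫ θ in (0 : ℝ)..2 * Real.pi, f (y - r • circ θ)) - f y -
      r ^ 2 / 4 * (a + c) = (2 * Real.pi)⁻¹ * ((∫ θ in (0 : ℝ)..2 * Real.pi, f (y - r • circ θ)) -
      2 * Real.pi * (f y + r ^ 2 / 4 * (a + c))) by field_simp; ring, abs_mul,
    abs_of_pos (by positivity), inv_mul_le_iff₀ (by positivity)]
  linarith

lemma integrable_prod_Ioc_of_continuous {H : Coord 2 × ℝ → ℝ} (hH : Continuous H)
    {K : Set (Coord 2)} (hK : IsCompact K) (h0 : ∀ p : Coord 2 × ℝ, p.1 ∉ K → H p = 0) (T : ℝ) :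
    Integrable H ((volume : Measure (Coord 2)).prod (volume.restrict (Ioc 0 T))) := by
  have e : (volume : Measure (Coord 2)).prod ((volume : Measure ℝ).restrict (Ioc 0 T)) =
      ((volume : Measure (Coord 2)).prod (volume : Measure ℝ)).restrict (univ ×ˢ Ioc 0 T) := by
    rw [← Measure.prod_restrict, Measure.restrict_univ]
  rw [e]
  have h1 : IntegrableOn H (K ×ˢ Icc 0 T) ((volume : Measure (Coord 2)).prod volume) :=
    hH.continuousOn.integrableOn_compact (hK.prod isCompact_Icc)
  refine (h1.mono_set (prod_mono_right Ioc_subset_Icc_self)).of_forall_sdiff_eq_zero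
    (MeasurableSet.univ.prod measurableSet_Ioc) fun p hp => h0 p fun hpK => ?_
  exact hp.2 ⟨hpK, hp.1.2⟩

/-- Averaging over circles is a symmetric operation. -/
lemma integral_mul_circle_mean {f c : Coord 2 → ℝ} (hf : Continuous f) (hfc : HasCompactSupport f)
    (hc : Continuous c) (r : ℝ) :
    ∫ x, f x * ∫ θ in (0 : ℝ)..2 * Real.pi, c (x + r • circ θ) =
      ∫ x, c x * ∫ θ in (0 : ℝ)..2 * Real.pi, f (x - r • circ θ) := by
  have hpi : (0 : ℝ) ≤ 2 * Real.pi := by positivity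
  have hcirc := continuous_circ
  simp only [intervalIntegral.integral_of_le hpi, ← integral_const_mul]
  have i1 : Integrable (Function.uncurry fun (x : Coord 2) (θ : ℝ) => f x * c (x + r • circ θ))
      ((volume : Measure (Coord 2)).prod (volume.restrict (Ioc 0 (2 * Real.pi)))) := by
    refine integrable_prod_Ioc_of_continuous (by unfold Function.uncurry; fun_prop)
      hfc.isCompact (fun p hp => ?_) _
    simp [Function.uncurry, image_eq_zero_of_notMem_tsupport hp]
  have i2 : Integrable (Function.uncurry fun (x : Coord 2) (θ : ℝ) => c x * f (x - r • circ θ))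
      ((volume : Measure (Coord 2)).prod (volume.restrict (Ioc 0 (2 * Real.pi)))) := by
    refine integrable_prod_Ioc_of_continuous (by unfold Function.uncurry; fun_prop)
      (hfc.isCompact.cthickening (r := |r|)) (fun p hp => ?_) _
    have : p.1 - r • circ p.2 ∉ tsupport f := fun h => hp <|
      Metric.mem_cthickening_of_dist_le p.1 _ _ _ h (by simp [norm_smul, norm_circ])
    simp [Function.uncurry, image_eq_zero_of_notMem_tsupport this]
  rw [integral_integral_swap i1, integral_integral_swap i2]
  refine integral_congr_ae (ae_of_all _ fun θ => ?_)
  simp only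
  rw [← integral_sub_right_eq_self (μ := (volume : Measure (Coord 2))) _ (r • circ θ)]
  simp [mul_comm]

variable {u : Coord 2 → EReal} {Ω : Set (Coord 2)}

/-- The distributional Laplacian of a subharmonic function is nonnegative. -/
lemma IsSubharmonicOn.integral_laplacian_nonneg (hu : IsSubharmonicOn u Ω) (hΩ : IsOpen Ω)
    {f : Coord 2 → ℝ} (hf : ContDiff ℝ ∞ f) (hc : HasCompactSupport f) (hs : tsupport f ⊆ Ω)
    (hpos : ∀ x, 0 ≤ f x) :
    0 ≤ ∫ x, (u x).toReal * (pd 0 (pd 0 f) x + pd 1 (pd 1 f) x) := by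
  obtain ⟨δ, hδ, hδΩ⟩ := hc.isCompact.exists_cthickening_subset_open hΩ hs
  set K := Metric.cthickening δ (tsupport f) with hKdef
  have hK : IsCompact K := hc.isCompact.cthickening
  have hfK : tsupport f ⊆ K := Metric.self_subset_cthickening _
  have hfcont := hf.continuous
  have hcirc := continuous_circ
  set U : Coord 2 → ℝ := fun x => (u x).toReal with hU
  have hUK : IntegrableOn U K :=
    (hu.locallyIntegrableOn hΩ).integrableOn_compact_subset hδΩ hK
  obtain ⟨c, hcc, hanti, hle, hlim⟩ := exists_antitone_continuous_approx hK
    (hu.upperSemicontinuous.mono hδΩ) (fun y hy => hu.lt_top y (hδΩ hy))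
  have hbotΩ := hu.ae_ne_bot hΩ
  have hbot : ∀ᵐ y ∂(volume.restrict K), u y ≠ ⊥ := ae_restrict_of_ae_restrict_of_subset hδΩ hbotΩ
  obtain ⟨L, hL0, hL⟩ := exists_circle_mean_bound hf hc
  set lap : Coord 2 → ℝ := fun x => pd 0 (pd 0 f) x + pd 1 (pd 1 f) x with hlap
  -- the mean of `f` over the circle of radius `r`
  let M : ℝ → Coord 2 → ℝ := fun r x =>
    (2 * Real.pi)⁻¹ * ∫ θ in (0 : ℝ)..2 * Real.pi, f (x - r • circ θ)
  have hMcont : ∀ r, Continuous (M r) := fun r => by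
    refine continuous_const.mul
      (intervalIntegral.continuous_parametric_intervalIntegral_of_continuous' ?_ _ _)
    unfold Function.uncurry
    fun_prop
  obtain ⟨B, hB⟩ := hc.exists_bound_of_continuous hfcont
  have hpi := Real.pi_pos
  have hMB : ∀ r x, |M r x| ≤ B := fun r x => by
    have h1 : ‖∫ θ in (0 : ℝ)..2 * Real.pi, f (x - r • circ θ)‖ ≤ B * |2 * Real.pi - 0| :=
      intervalIntegral.norm_integral_le_of_norm_le_const fun θ _ => hB _
    rw [sub_zero, abs_of_pos (by positivity : (0 : ℝ) < 2 * Real.pi), Real.norm_eq_abs] at h1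
    simp only [M]
    rw [abs_mul, abs_of_pos (by positivity), inv_mul_le_iff₀ (by positivity)]
    linarith
  have hM0 : ∀ r, 0 ≤ r → r ≤ δ → ∀ x, x ∉ K → M r x = 0 := fun r hr hrδ x hx => by
    have : ∀ θ, f (x - r • circ θ) = 0 := fun θ => by
      refine image_eq_zero_of_notMem_tsupport fun h => hx ?_
      refine Metric.mem_cthickening_of_dist_le x _ _ _ h ?_
      simpa [dist_eq_norm, norm_smul, norm_circ, abs_of_nonneg hr] using hrδ
    simp [M, this]
  have hci : ∀ n, IntegrableOn (c n) K := fun n => (hcc n).continuousOn.integrableOn_compact hK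
  have hUM : ∀ r, 0 ≤ r → r ≤ δ → Integrable (fun x => U x * M r x) := fun r hr hrδ =>
    integrable_mul_of_bound hUK (hMcont r).aestronglyMeasurable (hMB r) (hM0 r hr hrδ)
  have hUf : Integrable (fun x => U x * f x) :=
    integrable_mul_of_bound hUK hfcont.aestronglyMeasurable hB
      (fun x hx => image_eq_zero_of_notMem_tsupport fun h => hx (hfK h))
  have hlapc : Continuous lap := ((contDiff_pd (contDiff_pd hf)).continuous).add
    ((contDiff_pd (contDiff_pd hf)).continuous)
  have hlap0 : ∀ x, x ∉ K → lap x = 0 := fun x hx => by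
    have h0 : ∀ i, pd i (pd i f) x = 0 := fun i =>
      pd_eq_zero_of_notMem fun h => hx (hfK (tsupport_pd_subset h))
    simp [lap, h0]
  have hlapcs : HasCompactSupport lap := HasCompactSupport.intro hK hlap0
  obtain ⟨B', hB'⟩ := hlapcs.exists_bound_of_continuous hlapc
  have hUlap : Integrable (fun x => U x * lap x) :=
    integrable_mul_of_bound hUK hlapc.aestronglyMeasurable hB' hlap0
  -- the sub-mean value inequality, integrated against `f`
  have step : ∀ r, 0 < r → r ≤ δ → ∫ x, U x * f x ≤ ∫ x, U x * M r x := by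
    intro r hr hrδ
    have h1 : ∀ n, ∫ x, U x * f x ≤ ∫ x, c n x * M r x := by
      intro n
      -- the averaging is moved from `f` to the continuous majorant `c n` of `u`
      have e : ∫ x, c n x * M r x = ∫ x, f x *
          ((2 * Real.pi)⁻¹ * ∫ θ in (0 : ℝ)..2 * Real.pi, c n (x + r • circ θ)) := by
        simp only [M]
        have := integral_mul_circle_mean hfcont hc (hcc n) r
        simp only [mul_left_comm _ (2 * Real.pi)⁻¹, integral_const_mul, this]
      rw [e]
      have hmc : Continuous fun x =>
          (2 * Real.pi)⁻¹ * ∫ θ in (0 : ℝ)..2 * Real.pi, c n (x + r • circ θ) := by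
        refine continuous_const.mul
          (intervalIntegral.continuous_parametric_intervalIntegral_of_continuous' ?_ _ _)
        have := hcc n
        unfold Function.uncurry
        fun_prop
      refine integral_mono_ae hUf ((hfcont.mul hmc).integrable_of_hasCompactSupport hc.mul_right) ?_
      rw [ae_restrict_iff' hΩ.measurableSet] at hbotΩ
      filter_upwards [hbotΩ] with x hxb
      by_cases hx : x ∈ tsupport f
      · rw [mul_comm]
        refine mul_le_mul_of_nonneg_left ?_ (hpos x)
        have hxΩ := hs hx
        have hball : Metric.closedBall x r ⊆ K := fun z hz =>
          Metric.mem_cthickening_of_dist_le z x _ _ hx ((Metric.mem_closedBall.1 hz).trans hrδ)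
        have h := hu.subMean x r hr (hball.trans hδΩ) (c n) (hcc n).continuousOn
          (fun y hy => hle n y (hball (Metric.sphere_subset_closedBall hy)))
        have hco : ((U x : ℝ) : EReal) = u x :=
          EReal.coe_toReal (hu.lt_top x hxΩ).ne (hxb hxΩ)
        rw [← hco, EReal.coe_le_coe_iff] at h
        exact h
      · simp [image_eq_zero_of_notMem_tsupport hx]
    -- dominated convergence, since `u ≤ c n ≤ c 0` on `K`
    have h2 : Tendsto (fun n => ∫ x, c n x * M r x) atTop (𝓝 (∫ x, U x * M r x)) := by
      have hset : ∀ w : Coord 2 → ℝ, ∫ x, w x * M r x = ∫ x in K, w x * M r x := fun w =>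
        (setIntegral_eq_integral_of_forall_compl_eq_zero fun x hx => by
          rw [hM0 r hr.le hrδ x hx, mul_zero]).symm
      simp only [hset]
      refine tendsto_integral_of_dominated_convergence (fun x => (|c 0 x| + |U x|) * B) ?_ ?_ ?_ ?_
      · exact fun n => ((hcc n).mul (hMcont r)).aestronglyMeasurable
      · exact ((hci 0).norm.add hUK.norm).mul_const B
      · intro n
        filter_upwards [hbot, ae_restrict_mem hK.measurableSet] with x hxb hxK
        rw [norm_mul]
        refine mul_le_mul ?_ (hMB r x) (norm_nonneg _) (by positivity)
        have hco : ((U x : ℝ) : EReal) = u x :=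
          EReal.coe_toReal (hu.lt_top x (hδΩ hxK)).ne hxb
        have h3 : U x ≤ c n x := by
          rw [← EReal.coe_le_coe_iff, hco]; exact hle n x hxK
        have h4 : c n x ≤ c 0 x := hanti x hxK (Nat.zero_le n)
        rw [Real.norm_eq_abs, abs_le]
        constructor
        · linarith [neg_abs_le (U x), abs_nonneg (c 0 x)]
        · linarith [le_abs_self (c 0 x), abs_nonneg (U x)]
      · filter_upwards [hbot, ae_restrict_mem hK.measurableSet] with x hxb hxK
        exact (tendsto_toReal_of_approx (hu.lt_top x (hδΩ hxK)) (fun n => hle n x hxK)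
          (hlim x hxK) hxb).mul_const _
    exact ge_of_tendsto' h2 h1
  set A := ∫ x in K, |U x| with hA
  -- `M r - f` is `r² / 4` times the Laplacian of `f`, up to an error of order `r³`
  have key : ∀ r, 0 < r → r ≤ δ → -(4 * L * A) * r ≤ ∫ x, U x * lap x := by
    intro r hr hrδ
    have h1 := step r hr hrδ
    have hdiff : ∫ x, U x * (M r x - f x - r ^ 2 / 4 * lap x) =
        (∫ x, U x * M r x) - (∫ x, U x * f x) - r ^ 2 / 4 * ∫ x, U x * lap x := by
      have i1 : Integrable (fun x => U x * M r x - U x * f x) := (hUM r hr.le hrδ).sub hUf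
      rw [← integral_sub (hUM r hr.le hrδ) hUf, ← integral_const_mul, ← integral_sub
        i1 (hUlap.const_mul _)]
      congr 1; ext x; ring
    have h2 : ‖∫ x in K, U x * (M r x - f x - r ^ 2 / 4 * lap x)‖ ≤ ∫ x in K, |U x| * (L * r ^ 3) := by
      refine norm_integral_le_of_norm_le (hUK.norm.mul_const _) (ae_of_all _ fun x => ?_)
      rw [norm_mul]
      exact mul_le_mul_of_nonneg_left (hL x r hr.le) (norm_nonneg _)
    rw [setIntegral_eq_integral_of_forall_compl_eq_zero, hdiff, integral_mul_const,
      Real.norm_eq_abs] at h2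
    · have h3 := (abs_le.1 h2).2
      rw [← hA] at h3
      have hr2 : 0 < r ^ 2 := by positivity
      by_contra hcon
      push Not at hcon
      have : r ^ 2 / 4 * ∫ x, U x * lap x < r ^ 2 / 4 * (-(4 * L * A) * r) := by gcongr
      have e : r ^ 2 / 4 * (-(4 * L * A) * r) = -(A * (L * r ^ 3)) := by ring
      rw [e] at this
      linarith [(abs_le.1 h2).1]
    · intro x hx
      rw [hM0 r hr.le hrδ x hx, hlap0 x hx,
        image_eq_zero_of_notMem_tsupport fun h => hx (hfK h)]
      ring
  have hlim0 : Tendsto (fun r : ℝ => -(4 * L * A) * r) (𝓝[>] 0) (𝓝 0) := by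
    have : Tendsto (fun r : ℝ => -(4 * L * A) * r) (𝓝 0) (𝓝 (-(4 * L * A) * 0)) :=
      (continuous_const.mul continuous_id).tendsto 0
    rw [mul_zero] at this
    exact this.mono_left nhdsWithin_le_nhds
  refine le_of_tendsto hlim0 ?_
  filter_upwards [Ioc_mem_nhdsGT hδ] with r hr using key r hr.1 hr.2

end Laplacian

/-! ### The Riesz measure of a subharmonic function -/

section Riesz

open CompactlySupportedContinuousMap

variable {Ω : Set (Coord 2)}

/-- Extension by zero of a compactly supported function on `Ω` to the plane. -/
noncomputable def extZero (g : CompactlySupportedContinuousMap Ω ℝ) : Coord 2 → ℝ :=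
  Function.extend Subtype.val g 0

lemma extZero_apply (g : CompactlySupportedContinuousMap Ω ℝ) (y : Ω) : extZero g y = g y :=
  Subtype.val_injective.extend_apply g 0 y

lemma extZero_of_notMem (g : CompactlySupportedContinuousMap Ω ℝ) {y : Coord 2} (h : y ∉ Ω) :
    extZero g y = 0 :=
  Function.extend_apply' _ _ _ (by rintro ⟨z, rfl⟩; exact h z.2)

lemma extZero_add (g h : CompactlySupportedContinuousMap Ω ℝ) :
    extZero (g + h) = fun y => extZero g y + extZero h y := by
  ext y
  by_cases hy : y ∈ Ω
  · lift y to Ω using hy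
    simp [extZero_apply]
  · simp [extZero_of_notMem _ hy]

lemma extZero_smul (c : ℝ) (g : CompactlySupportedContinuousMap Ω ℝ) :
    extZero (c • g) = fun y => c * extZero g y := by
  ext y
  by_cases hy : y ∈ Ω
  · lift y to Ω using hy
    simp [extZero_apply]
  · simp [extZero_of_notMem _ hy]

lemma tsupport_extZero_subset (g : CompactlySupportedContinuousMap Ω ℝ) :
    tsupport (extZero g) ⊆ Subtype.val '' tsupport g := by
  have hcomp : IsCompact (Subtype.val '' tsupport g) :=
    g.hasCompactSupport'.isCompact.image continuous_subtype_val
  refine closure_minimal (fun y hy => ?_) hcomp.isClosed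
  by_cases hyΩ : y ∈ Ω
  · lift y to Ω using hyΩ
    rw [Function.mem_support, extZero_apply] at hy
    exact ⟨y, subset_tsupport _ hy, rfl⟩
  · exact absurd (extZero_of_notMem g hyΩ) hy

lemma hasCompactSupport_extZero (g : CompactlySupportedContinuousMap Ω ℝ) :
    HasCompactSupport (extZero g) :=
  (g.hasCompactSupport'.isCompact.image continuous_subtype_val).of_isClosed_subset
    (isClosed_tsupport _) (tsupport_extZero_subset g)

lemma tsupport_extZero_subset_self (g : CompactlySupportedContinuousMap Ω ℝ) :
    tsupport (extZero g) ⊆ Ω :=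
  (tsupport_extZero_subset g).trans (by rintro _ ⟨z, -, rfl⟩; exact z.2)

/-- Restriction to `Ω` of a function on the plane with compact support in `Ω`. -/
noncomputable def restrictTest (f : Coord 2 → ℝ) (hf : Continuous f) (hc : HasCompactSupport f)
    (hs : tsupport f ⊆ Ω) : CompactlySupportedContinuousMap Ω ℝ where
  toFun y := f y
  continuous_toFun := hf.comp continuous_subtype_val
  hasCompactSupport' := by
    have h : IsCompact (Subtype.val ⁻¹' tsupport f : Set Ω) := by
      rw [Subtype.isCompact_iff, Subtype.image_preimage_coe, inter_eq_self_of_subset_right hs]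
      exact hc.isCompact
    refine HasCompactSupport.intro h fun y hy => ?_
    exact image_eq_zero_of_notMem_tsupport hy

lemma extZero_restrictTest {f : Coord 2 → ℝ} (hf : Continuous f) (hc : HasCompactSupport f)
    (hs : tsupport f ⊆ Ω) : extZero (restrictTest f hf hc hs) = f := by
  ext y
  by_cases hy : y ∈ Ω
  · lift y to Ω using hy
    rw [extZero_apply]; rfl
  · rw [extZero_of_notMem _ hy, image_eq_zero_of_notMem_tsupport fun h => hy (hs h)]

/-- A positive linear functional on smooth test functions is represented by a measure. It extends
to continuous functions by the theorem of M. Riesz on positive extensions. -/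
lemma exists_measure_of_positive (hΩ : IsOpen Ω) {Λ : (Coord 2 → ℝ) → ℝ}
    (hadd : ∀ f g : Coord 2 → ℝ, ContDiff ℝ ∞ f → HasCompactSupport f → tsupport f ⊆ Ω →
      ContDiff ℝ ∞ g → HasCompactSupport g → tsupport g ⊆ Ω →
      Λ (fun x => f x + g x) = Λ f + Λ g)
    (hsmul : ∀ (c : ℝ) (f : Coord 2 → ℝ), ContDiff ℝ ∞ f → HasCompactSupport f → tsupport f ⊆ Ω →
      Λ (fun x => c * f x) = c * Λ f)
    (hpos : ∀ f : Coord 2 → ℝ, ContDiff ℝ ∞ f → HasCompactSupport f → tsupport f ⊆ Ω →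
      (∀ x, 0 ≤ f x) → 0 ≤ Λ f) :
    ∃ μ : Measure (Coord 2), (∀ K, IsCompact K → K ⊆ Ω → μ K < ⊤) ∧
      ∀ f : Coord 2 → ℝ, ContDiff ℝ ∞ f → HasCompactSupport f → tsupport f ⊆ Ω →
        ∫ x, f x ∂μ = Λ f := by
  have : LocallyCompactSpace Ω := hΩ.locallyCompactSpace
  let S : Submodule ℝ (CompactlySupportedContinuousMap Ω ℝ) :=
    { carrier := {g | ContDiff ℝ ∞ (extZero g)}
      add_mem' := fun {g h} hg hh => by
        simp only [mem_ofPred_eq] at hg hh ⊢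
        rw [extZero_add]; exact hg.add hh
      zero_mem' := by
        have : extZero (0 : CompactlySupportedContinuousMap Ω ℝ) = fun _ => 0 := by
          ext y
          by_cases hy : y ∈ Ω
          · lift y to Ω using hy
            simp [extZero_apply]
          · simp [extZero_of_notMem _ hy]
        simp only [mem_ofPred_eq, this]
        exact contDiff_const
      smul_mem' := fun c g hg => by
        simp only [mem_ofPred_eq] at hg ⊢
        rw [extZero_smul]; exact contDiff_const.mul hg }
  let F : CompactlySupportedContinuousMap Ω ℝ →ₗ.[ℝ] ℝ :=
    { domain := S
      toFun :=
        { toFun := fun g => Λ (extZero g.1)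
          map_add' := fun g h => by
            simp only [Submodule.coe_add, extZero_add]
            exact hadd _ _ g.2 (hasCompactSupport_extZero _) (tsupport_extZero_subset_self _)
              h.2 (hasCompactSupport_extZero _) (tsupport_extZero_subset_self _)
          map_smul' := fun c g => by
            simp only [Submodule.coe_smul, extZero_smul]
            exact hsmul c _ g.2 (hasCompactSupport_extZero _) (tsupport_extZero_subset_self _) } }
  let C : PointedCone ℝ (CompactlySupportedContinuousMap Ω ℝ) :=
    { carrier := {g | ∀ y, 0 ≤ g y}
      add_mem' := fun {g h} hg hh y => add_nonneg (hg y) (hh y)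
      zero_mem' := fun y => le_rfl
      smul_mem' := fun c g hg y => mul_nonneg c.2 (hg y) }
  have hext : ∃ G : CompactlySupportedContinuousMap Ω ℝ →ₗ[ℝ] ℝ,
      (∀ x : F.domain, G x = F x) ∧ ∀ x ∈ C, 0 ≤ G x := by
    refine riesz_extension C F ?_ ?_
    · rintro ⟨g, hg⟩ hgC
      refine hpos _ hg (hasCompactSupport_extZero _) (tsupport_extZero_subset_self _) fun y => ?_
      by_cases hy : y ∈ Ω
      · lift y to Ω using hy
        rw [extZero_apply]; exact hgC y
      · rw [extZero_of_notMem _ hy]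
    · intro g
      have hK : IsCompact (Subtype.val '' tsupport g) :=
        g.hasCompactSupport'.isCompact.image continuous_subtype_val
      obtain ⟨χ, hχ, hχc, hχΩ, hχ1, hχ01⟩ := exists_cutoff hK hΩ
        (by rintro _ ⟨z, -, rfl⟩; exact z.2)
      obtain ⟨B, hB⟩ := g.hasCompactSupport'.exists_bound_of_continuous g.continuous_toFun
      have hB0 : 0 ≤ B ∨ IsEmpty Ω := by
        by_cases h : Nonempty Ω
        · exact Or.inl ((norm_nonneg _).trans (hB h.some))
        · exact Or.inr (not_nonempty_iff.1 h)
      have hmem : B • restrictTest χ hχ.continuous hχc hχΩ ∈ S := by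
        refine S.smul_mem B ?_
        change ContDiff ℝ ∞ (extZero _)
        rw [extZero_restrictTest]; exact hχ
      -- the smooth function `B χ` dominates `-g`, as the extension theorem demands
      refine ⟨⟨_, hmem⟩, fun y => ?_⟩
      change 0 ≤ B * χ y + g y
      rcases hB0 with hB0 | he
      swap
      · exact he.elim y
      by_cases hy : y ∈ tsupport g
      · have h1 : χ y = 1 := (hχ1.filter_mono (nhds_le_nhdsSet (mem_image_of_mem _ hy))).self_of_nhds
        rw [h1, mul_one]
        have := neg_le_of_abs_le (hB y)
        change -B ≤ g y at this
        linarith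
      · rw [image_eq_zero_of_notMem_tsupport hy, add_zero]
        exact mul_nonneg hB0 (hχ01 _).1
  obtain ⟨G, hGF, hGpos⟩ := hext
  let Λ' : CompactlySupportedContinuousMap Ω ℝ →ₚ[ℝ] ℝ :=
    PositiveLinearMap.mk₀ G fun g hg => hGpos g fun y => hg y
  refine ⟨(RealRMK.rieszMeasure Λ').map Subtype.val, fun K hK hKΩ => ?_, fun f hf hc hs => ?_⟩
  · rw [Measure.map_apply measurable_subtype_coe hK.measurableSet]
    have h : IsCompact (Subtype.val ⁻¹' K : Set Ω) := by
      rw [Subtype.isCompact_iff, Subtype.image_preimage_coe, inter_eq_self_of_subset_right hKΩ]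
      exact hK
    exact h.measure_lt_top
  · have h1 := RealRMK.integral_rieszMeasure Λ' (restrictTest f hf.continuous hc hs)
    have hmem : restrictTest f hf.continuous hc hs ∈ S := by
      change ContDiff ℝ ∞ (extZero _)
      rw [extZero_restrictTest]; exact hf
    have h2 : Λ' (restrictTest f hf.continuous hc hs) = Λ f := by
      refine (hGF ⟨_, hmem⟩).trans ?_
      change Λ (extZero _) = _
      rw [extZero_restrictTest]
    rw [integral_map measurable_subtype_coe.aemeasurable hf.continuous.aestronglyMeasurable,
      ← h2, ← h1]
    rfl

/-- The Riesz measure of a subharmonic function: its distributional Laplacian. -/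
lemma IsSubharmonicOn.exists_rieszMeasure {u : Coord 2 → EReal} (hu : IsSubharmonicOn u Ω)
    (hΩ : IsOpen Ω) :
    ∃ μ : Measure (Coord 2), (∀ K, IsCompact K → K ⊆ Ω → μ K < ⊤) ∧
      ∀ f : Coord 2 → ℝ, ContDiff ℝ ∞ f → HasCompactSupport f → tsupport f ⊆ Ω →
        ∫ x, f x ∂μ = ∫ x, (u x).toReal * (pd 0 (pd 0 f) x + pd 1 (pd 1 f) x) := by
  have hli := hu.locallyIntegrableOn hΩ
  have hint : ∀ (f : Coord 2 → ℝ), ContDiff ℝ ∞ f → HasCompactSupport f → tsupport f ⊆ Ω →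
      Integrable fun x => (u x).toReal * (pd 0 (pd 0 f) x + pd 1 (pd 1 f) x) := by
    intro f hf hc hs
    have hcont : Continuous fun x => pd 0 (pd 0 f) x + pd 1 (pd 1 f) x :=
      ((contDiff_pd (contDiff_pd hf)).continuous).add ((contDiff_pd (contDiff_pd hf)).continuous)
    have h0 : ∀ x, x ∉ tsupport f → pd 0 (pd 0 f) x + pd 1 (pd 1 f) x = 0 := fun x hx => by
      have h0 : ∀ i, pd i (pd i f) x = 0 := fun i =>
        pd_eq_zero_of_notMem fun h => hx (tsupport_pd_subset h)
      simp [h0]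
    obtain ⟨B, hB⟩ := (HasCompactSupport.intro hc.isCompact h0).exists_bound_of_continuous hcont
    exact LocallyIntegrableOn.integrable_mul_test hli hc.isCompact hs hcont.measurable hB h0
  have hd : ∀ {f : Coord 2 → ℝ}, ContDiff ℝ ∞ f → ∀ x, DifferentiableAt ℝ f x := fun hf x =>
    hf.differentiable (by simp) x
  refine exists_measure_of_positive hΩ
    (Λ := fun f => ∫ x, (u x).toReal * (pd 0 (pd 0 f) x + pd 1 (pd 1 f) x)) ?_ ?_ ?_
  · intro f g hf hfc hfs hg hgc hgs
    rw [← integral_add (hint f hf hfc hfs) (hint g hg hgc hgs)]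
    congr 1; ext x
    have h1 : ∀ i, pd i (fun x => f x + g x) = fun x => pd i f x + pd i g x := fun i =>
      funext fun z => pd_add (hd hf z) (hd hg z)
    simp only [h1]
    rw [pd_add (hd (contDiff_pd hf) x) (hd (contDiff_pd hg) x),
      pd_add (hd (contDiff_pd hf) x) (hd (contDiff_pd hg) x)]
    ring
  · intro c f hf hfc hfs
    rw [← integral_const_mul]
    congr 1; ext x
    have h1 : ∀ i, pd i (fun x => c * f x) = fun x => c * pd i f x := fun i =>
      funext fun z => pd_const_mul c (hd hf z)
    simp only [h1]
    rw [pd_const_mul c (hd (contDiff_pd hf) x), pd_const_mul c (hd (contDiff_pd hf) x)]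
    ring
  · exact fun f hf hc hs hpos => hu.integral_laplacian_nonneg hΩ hf hc hs hpos

end Riesz

/-! ### Regularised logarithmic kernels -/

section Kernel

/-- The squared Euclidean norm, as a polynomial in the coordinates. -/
def sqNorm (z : Coord 2) : ℝ := z 0 ^ 2 + z 1 ^ 2

lemma sqNorm_eq (z : Coord 2) : sqNorm z = ‖z‖ ^ 2 := by
  rw [EuclideanSpace.norm_sq_eq, Fin.sum_univ_two]
  simp [sqNorm]

lemma sqNorm_nonneg (z : Coord 2) : 0 ≤ sqNorm z := by unfold sqNorm; positivity

lemma sqNorm_pos {z : Coord 2} (hz : z ≠ 0) : 0 < sqNorm z := by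
  rw [sqNorm_eq]; have := norm_pos_iff.2 hz; positivity

lemma contDiff_coord (i : Fin 2) : ContDiff ℝ ∞ fun z : Coord 2 => z i :=
  (EuclideanSpace.proj i : Coord 2 →L[ℝ] ℝ).contDiff

lemma contDiff_sqNorm : ContDiff ℝ ∞ sqNorm := by
  unfold sqNorm
  exact ((contDiff_coord 0).pow 2).add ((contDiff_coord 1).pow 2)

lemma pd_coord (i j : Fin 2) (z : Coord 2) :
    pd i (fun w : Coord 2 => w j) z = if i = j then 1 else 0 := by
  have h : HasFDerivAt (fun w : Coord 2 => w j) (EuclideanSpace.proj j : Coord 2 →L[ℝ] ℝ) z :=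
    (EuclideanSpace.proj j : Coord 2 →L[ℝ] ℝ).hasFDerivAt
  unfold pd
  rw [h.fderiv]
  simp [eq_comm]

/-- The regularised logarithm `½ log (|z|² + e²)`. -/
noncomputable def logReg (e : ℝ) (z : Coord 2) : ℝ := 1 / 2 * Real.log (sqNorm z + e ^ 2)

lemma sqNorm_add_pos {e : ℝ} (he : e ≠ 0) (z : Coord 2) : 0 < sqNorm z + e ^ 2 := by
  have := sqNorm_nonneg z
  positivity

lemma contDiff_logReg {e : ℝ} (he : e ≠ 0) : ContDiff ℝ ∞ (logReg e) := by
  unfold logReg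
  exact contDiff_const.mul ((contDiff_sqNorm.add contDiff_const).log
    fun z => (sqNorm_add_pos he z).ne')

lemma hasFDerivAt_coord (j : Fin 2) (z : Coord 2) :
    HasFDerivAt (fun w : Coord 2 => w j) (EuclideanSpace.proj j : Coord 2 →L[ℝ] ℝ) z :=
  (EuclideanSpace.proj j : Coord 2 →L[ℝ] ℝ).hasFDerivAt

lemma hasFDerivAt_sqNorm (z : Coord 2) :
    HasFDerivAt sqNorm ((2 * z 0) • (EuclideanSpace.proj 0 : Coord 2 →L[ℝ] ℝ) +
      (2 * z 1) • (EuclideanSpace.proj 1 : Coord 2 →L[ℝ] ℝ)) z := by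
  have h := ((hasFDerivAt_coord 0 z).pow 2).add ((hasFDerivAt_coord 1 z).pow 2)
  simpa [sqNorm] using! h

lemma pd_logReg {e : ℝ} (he : e ≠ 0) (i : Fin 2) (z : Coord 2) :
    pd i (logReg e) z = z i / (sqNorm z + e ^ 2) := by
  have h0 := (sqNorm_add_pos he z).ne'
  have h := (((hasFDerivAt_sqNorm z).add_const (e ^ 2)).log h0).const_mul (1 / 2)
  unfold pd
  have h' : HasFDerivAt (logReg e) _ z := h
  rw [h'.fderiv]
  fin_cases i <;> simp <;> field_simp

lemma pd_pd_logReg {e : ℝ} (he : e ≠ 0) (i : Fin 2) (z : Coord 2) :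
    pd i (pd i (logReg e)) z =
      1 / (sqNorm z + e ^ 2) - 2 * z i ^ 2 / (sqNorm z + e ^ 2) ^ 2 := by
  have h0 := (sqNorm_add_pos he z).ne'
  have e1 : pd i (logReg e) = fun z => z i * (sqNorm z + e ^ 2)⁻¹ := by
    ext w; rw [pd_logReg he, div_eq_mul_inv]
  have h2 := (hasDerivAt_inv h0).comp_hasFDerivAt z ((hasFDerivAt_sqNorm z).add_const (e ^ 2))
  have h := (hasFDerivAt_coord i z).mul h2
  rw [e1]
  unfold pd
  have h' : HasFDerivAt (fun z : Coord 2 => z i * (sqNorm z + e ^ 2)⁻¹) _ z := h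
  rw [h'.fderiv]
  fin_cases i <;> simp <;> field_simp <;> ring

/-- The Laplacian of `logReg e`, an approximate identity up to a constant. -/
noncomputable def poissonReg (e : ℝ) (z : Coord 2) : ℝ := 2 * e ^ 2 / (sqNorm z + e ^ 2) ^ 2

lemma laplacian_logReg {e : ℝ} (he : e ≠ 0) (z : Coord 2) :
    pd 0 (pd 0 (logReg e)) z + pd 1 (pd 1 (logReg e)) z = poissonReg e z := by
  have h0 := (sqNorm_add_pos he z).ne'
  rw [pd_pd_logReg he, pd_pd_logReg he]
  unfold poissonReg
  field_simp
  unfold sqNorm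
  ring

variable (η : Coord 2 → ℝ)

/-- For `e ≠ 0` this is `∂ₖ (η · logReg e)`; for `e = 0` it is the singular limit kernel. -/
noncomputable def gradKernel (e : ℝ) (k : Fin 2) (z : Coord 2) : ℝ :=
  η z * (z k / (sqNorm z + e ^ 2)) + pd k η z * logReg e z

/-- For `e ≠ 0` this is `Δ (η · logReg e) - η · poissonReg e`. -/
noncomputable def remKernel (e : ℝ) (z : Coord 2) : ℝ :=
  2 * (pd 0 η z * (z 0 / (sqNorm z + e ^ 2)) + pd 1 η z * (z 1 / (sqNorm z + e ^ 2))) +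
    (pd 0 (pd 0 η) z + pd 1 (pd 1 η) z) * logReg e z

variable {η} (hη : ContDiff ℝ ∞ η)
include hη

lemma pd_mul_logReg {e : ℝ} (he : e ≠ 0) (k : Fin 2) (z : Coord 2) :
    pd k (fun z => η z * logReg e z) z = gradKernel η e k z := by
  rw [pd_mul (hη.differentiable (by simp) z) ((contDiff_logReg he).differentiable (by simp) z),
    pd_logReg he]
  rfl

/-- The Laplacian of the regularised kernel consists of an approximate identity and of a remainder that
vanishes near the origin, where `η` is constant. -/
lemma laplacian_mul_logReg {e : ℝ} (he : e ≠ 0) (z : Coord 2) :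
    pd 0 (pd 0 fun z => η z * logReg e z) z + pd 1 (pd 1 fun z => η z * logReg e z) z =
      η z * poissonReg e z + remKernel η e z := by
  have hd : ∀ {f : Coord 2 → ℝ}, ContDiff ℝ ∞ f → ∀ x, DifferentiableAt ℝ f x := fun hf x =>
    hf.differentiable (by simp) x
  have hN := contDiff_logReg he
  have e1 : ∀ k, pd k (fun z => η z * logReg e z) =
      fun z => η z * pd k (logReg e) z + pd k η z * logReg e z := fun k =>
    funext fun z => pd_mul (hd hη z) (hd hN z)
  have e2 : ∀ k, pd k (pd k fun z => η z * logReg e z) z = η z * pd k (pd k (logReg e)) z +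
      2 * (pd k η z * pd k (logReg e) z) + pd k (pd k η) z * logReg e z := fun k => by
    rw [e1, pd_add (hd (hη.mul (contDiff_pd hN)) z) (hd ((contDiff_pd hη).mul hN) z),
      pd_mul (hd hη z) (hd (contDiff_pd hN) z), pd_mul (hd (contDiff_pd hη) z) (hd hN z)]
    ring
  rw [e2, e2, ← laplacian_logReg he]
  simp only [pd_logReg he]
  unfold remKernel
  ring

omit hη in
lemma continuousAt_logReg {e : ℝ} {z : Coord 2} (hz : z ≠ 0) :
    ContinuousAt (fun p : ℝ × Coord 2 => logReg p.1 p.2) (e, z) := by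
  have hq : Continuous sqNorm := contDiff_sqNorm.continuous
  have h : sqNorm z + e ^ 2 ≠ 0 := by have := sqNorm_pos hz; positivity
  unfold logReg
  refine continuousAt_const.mul (ContinuousAt.log ?_ h)
  fun_prop

omit hη in
lemma continuousAt_div {e : ℝ} {z : Coord 2} (hz : z ≠ 0) (i : Fin 2) :
    ContinuousAt (fun p : ℝ × Coord 2 => p.2 i / (sqNorm p.2 + p.1 ^ 2)) (e, z) := by
  have hq : Continuous sqNorm := contDiff_sqNorm.continuous
  have h : sqNorm z + e ^ 2 ≠ 0 := by have := sqNorm_pos hz; positivity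
  have hc : Continuous fun p : ℝ × Coord 2 => p.2 i :=
    (contDiff_coord i).continuous.comp continuous_snd
  exact ContinuousAt.div hc.continuousAt (by fun_prop) h

variable {δ : ℝ} (hδ : 0 < δ) (h1 : ∀ z ∈ Metric.ball (0 : Coord 2) (δ / 2), η z = 1)
  (h0 : ∀ z, z ∉ Metric.closedBall (0 : Coord 2) δ → η z = 0)
include hδ h1 h0

omit hη hδ h0 in
lemma pd_eq_zero_of_mem_ball (k : Fin 2) {z : Coord 2} (hz : z ∈ Metric.ball (0 : Coord 2) (δ / 2)) :
    pd k η z = 0 := by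
  rw [pd_congr (g := fun _ => 1) (by
    filter_upwards [Metric.isOpen_ball.mem_nhds hz] with w hw using h1 w hw), pd_const]

omit hη hδ h0 in
lemma pd_pd_eq_zero_of_mem_ball (k : Fin 2) {z : Coord 2}
    (hz : z ∈ Metric.ball (0 : Coord 2) (δ / 2)) : pd k (pd k η) z = 0 := by
  rw [pd_congr (g := fun _ => 0) (by
    filter_upwards [Metric.isOpen_ball.mem_nhds hz] with w hw
      using pd_eq_zero_of_mem_ball h1 k hw), pd_const]

omit hη hδ h1 in
lemma tsupport_subset_closedBall : tsupport η ⊆ Metric.closedBall (0 : Coord 2) δ :=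
  closure_minimal (fun z hz => by by_contra h; exact hz (h0 z h)) Metric.isClosed_closedBall

omit hη hδ in
lemma remKernel_eq_zero {e : ℝ} {z : Coord 2}
    (hz : z ∈ Metric.ball (0 : Coord 2) (δ / 2) ∨ z ∉ Metric.closedBall (0 : Coord 2) δ) :
    remKernel η e z = 0 := by
  unfold remKernel
  rcases hz with hz | hz
  · simp [pd_eq_zero_of_mem_ball h1 _ hz, pd_pd_eq_zero_of_mem_ball h1 _ hz]
  · have h2 : z ∉ tsupport η := fun h => hz (tsupport_subset_closedBall h0 h)
    have h3 : ∀ k, pd k η z = 0 := fun k => pd_eq_zero_of_notMem h2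
    have h4 : ∀ k, pd k (pd k η) z = 0 := fun k =>
      pd_eq_zero_of_notMem fun h => h2 (tsupport_pd_subset h)
    simp [h3, h4]

omit hη h1 h0 in
/-- A function that is continuous away from the origin of the plane and vanishes outside the annulus
`δ / 2 ≤ |z| ≤ δ` is bounded, uniformly in `e ∈ [0, 1]`. -/
lemma exists_bound_annulus {H : ℝ × Coord 2 → ℝ}
    (hH : ∀ e z, z ≠ 0 → ContinuousAt H (e, z))
    (hH0 : ∀ e z, z ∈ Metric.ball (0 : Coord 2) (δ / 2) ∨ z ∉ Metric.closedBall (0 : Coord 2) δ →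
      H (e, z) = 0) : ∃ C, ∀ e ∈ Icc (0 : ℝ) 1, ∀ z, |H (e, z)| ≤ C := by
  have hK : IsCompact (Icc (0 : ℝ) 1 ×ˢ
      (Metric.closedBall (0 : Coord 2) δ \ Metric.ball (0 : Coord 2) (δ / 2))) :=
    isCompact_Icc.prod ((isCompact_closedBall 0 δ).diff Metric.isOpen_ball)
  obtain ⟨C, hC⟩ := hK.exists_bound_of_continuousOn (f := H) (by
    rintro ⟨e, z⟩ ⟨-, hz⟩
    refine (hH e z ?_).continuousWithinAt
    rintro rfl
    exact hz.2 (Metric.mem_ball_self (half_pos hδ)))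
  refine ⟨max C 0, fun e he z => ?_⟩
  by_cases hz : z ∈ Metric.ball (0 : Coord 2) (δ / 2) ∨ z ∉ Metric.closedBall (0 : Coord 2) δ
  · rw [hH0 e z hz]; simp
  · push Not at hz
    exact (hC (e, z) ⟨he, hz.2, hz.1⟩).trans (le_max_left _ _)

lemma exists_remKernel_bound : ∃ C, ∀ e ∈ Icc (0 : ℝ) 1, ∀ z, |remKernel η e z| ≤ C := by
  refine exists_bound_annulus (H := fun p => remKernel η p.1 p.2) hδ (fun e z hz => ?_)
    (fun e z hz => remKernel_eq_zero h1 h0 hz)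
  have hc1 : ∀ k, ContinuousAt (fun p : ℝ × Coord 2 => pd k η p.2) (e, z) := fun k =>
    ((contDiff_pd hη).continuous.comp continuous_snd).continuousAt
  have hc2 : ∀ k, ContinuousAt (fun p : ℝ × Coord 2 => pd k (pd k η) p.2) (e, z) := fun k =>
    ((contDiff_pd (contDiff_pd hη)).continuous.comp continuous_snd).continuousAt
  unfold remKernel
  exact (continuousAt_const.mul (((hc1 0).mul (continuousAt_div hz 0)).add
    ((hc1 1).mul (continuousAt_div hz 1)))).add
    (((hc2 0).add (hc2 1)).mul (continuousAt_logReg hz))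

/-- The limit remainder is smooth, as it vanishes near the singularity of the logarithm. -/
lemma contDiff_remKernel_zero : ContDiff ℝ ∞ (remKernel η 0) := by
  rw [contDiff_iff_contDiffAt]
  intro z
  by_cases hz : z ∈ Metric.ball (0 : Coord 2) (δ / 2)
  · refine contDiffAt_const (c := (0 : ℝ)) |>.congr_of_eventuallyEq ?_
    filter_upwards [Metric.isOpen_ball.mem_nhds hz] with w hw
      using remKernel_eq_zero h1 h0 (Or.inl hw)
  · have hz0 : z ≠ 0 := by rintro rfl; exact hz (Metric.mem_ball_self (half_pos hδ))
    have hq : sqNorm z + 0 ^ 2 ≠ 0 := by have := sqNorm_pos hz0; positivity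
    have hq' : ContDiffAt ℝ ∞ (fun z : Coord 2 => sqNorm z + 0 ^ 2) z :=
      (contDiff_sqNorm.add contDiff_const).contDiffAt
    have hdiv : ∀ i, ContDiffAt ℝ ∞ (fun z : Coord 2 => z i / (sqNorm z + 0 ^ 2)) z := fun i =>
      (contDiff_coord i).contDiffAt.div hq' hq
    have hlog : ContDiffAt ℝ ∞ (logReg 0) z := by
      unfold logReg
      exact contDiffAt_const.mul (hq'.log hq)
    have c1 : ∀ k, ContDiffAt ℝ ∞ (pd k η) z := fun k => (contDiff_pd hη).contDiffAt
    have c2 : ∀ k, ContDiffAt ℝ ∞ (pd k (pd k η)) z := fun k =>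
      (contDiff_pd (contDiff_pd hη)).contDiffAt
    exact (contDiffAt_const.mul (((c1 0).mul (hdiv 0)).add ((c1 1).mul (hdiv 1)))).add
      (((c2 0).add (c2 1)).mul hlog)

omit hη h1 h0 hδ in
lemma tendsto_div {z : Coord 2} (i : Fin 2) {e : ℕ → ℝ} (he : Tendsto e atTop (𝓝 0)) :
    Tendsto (fun n => z i / (sqNorm z + e n ^ 2)) atTop (𝓝 (z i / (sqNorm z + 0 ^ 2))) := by
  by_cases hz : z = 0
  · simp [hz]
  · exact (continuousAt_div hz i).tendsto.comp (he.prodMk_nhds tendsto_const_nhds)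

omit hη hδ h1 h0 in
lemma tendsto_mul_logReg {z : Coord 2} {a : ℝ} {e : ℕ → ℝ} (he : Tendsto e atTop (𝓝 0))
    (ha : z = 0 → a = 0) :
    Tendsto (fun n => a * logReg (e n) z) atTop (𝓝 (a * logReg 0 z)) := by
  by_cases hz : z = 0
  · simp [ha hz]
  · exact ((continuousAt_logReg hz).tendsto.comp (he.prodMk_nhds tendsto_const_nhds)).const_mul _

omit hη h0 in
lemma tendsto_remKernel {e : ℕ → ℝ} (he : Tendsto e atTop (𝓝 0)) (z : Coord 2) :
    Tendsto (fun n => remKernel η (e n) z) atTop (𝓝 (remKernel η 0 z)) := by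
  refine ((((tendsto_div 0 he).const_mul _).add ((tendsto_div 1 he).const_mul _)).const_mul _).add
    (tendsto_mul_logReg he fun h => ?_)
  have hz : z ∈ Metric.ball (0 : Coord 2) (δ / 2) := by
    rw [h]; exact Metric.mem_ball_self (half_pos hδ)
  simp [pd_pd_eq_zero_of_mem_ball h1 _ hz]

omit hη h0 in
lemma tendsto_gradKernel {e : ℕ → ℝ} (he : Tendsto e atTop (𝓝 0)) (k : Fin 2) (z : Coord 2) :
    Tendsto (fun n => gradKernel η (e n) k z) atTop (𝓝 (gradKernel η 0 k z)) := by
  refine ((tendsto_div k he).const_mul _).add (tendsto_mul_logReg he fun h => ?_)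
  have hz : z ∈ Metric.ball (0 : Coord 2) (δ / 2) := by
    rw [h]; exact Metric.mem_ball_self (half_pos hδ)
  exact pd_eq_zero_of_mem_ball h1 _ hz

omit hη hδ h1 in
lemma gradKernel_eq_zero {e : ℝ} {k : Fin 2} {z : Coord 2}
    (hz : z ∉ Metric.closedBall (0 : Coord 2) δ) : gradKernel η e k z = 0 := by
  have h2 : z ∉ tsupport η := fun h => hz (tsupport_subset_closedBall h0 h)
  simp [gradKernel, h0 z hz, pd_eq_zero_of_notMem h2]

omit hη h1 h0 hδ in
lemma integrableOn_inv_norm (r : ℝ) :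
    IntegrableOn (fun z : Coord 2 => ‖z‖⁻¹) (Metric.closedBall 0 r) := by
  have h : IntegrableOn (fun z : Coord 2 => ‖z‖⁻¹) (Metric.ball 0 (r + 1)) := by
    rw [← integrable_indicator_iff measurableSet_ball]
    have e : (Metric.ball (0 : Coord 2) (r + 1)).indicator (fun z => ‖z‖⁻¹) =
        fun z => (fun t : ℝ => (Iio (r + 1)).indicator (fun t => t⁻¹) t) ‖z‖ := by
      ext z; simp [indicator]
    rw [e, integrable_fun_norm_addHaar]
    have : IntegrableOn (fun _ : ℝ => (1 : ℝ)) (Ioo 0 (r + 1)) :=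
      integrableOn_const (by simp)
    refine (this.integrable_indicator measurableSet_Ioo).integrableOn.congr_fun ?_ measurableSet_Ioi
    intro t ht
    have ht' : (0 : ℝ) < t := ht
    by_cases h : t < r + 1
    · simp [indicator, h, ht', finrank_euclideanSpace, ht'.ne']
    · simp [indicator, h]
  exact h.mono_set (Metric.closedBall_subset_ball (by linarith))

/-- The kernels `gradKernel η e k` have a common integrable majorant, a multiple of `1 / |z|` plus a
constant on a disc. -/
lemma exists_gradKernel_bound : ∃ G : Coord 2 → ℝ, Integrable G ∧
    (∀ e ∈ Icc (0 : ℝ) 1, ∀ k z, |gradKernel η e k z| ≤ G z) := by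
  have hb : ∀ k, ∃ C, ∀ e ∈ Icc (0 : ℝ) 1, ∀ z, |pd k η z * logReg e z| ≤ C := fun k => by
    refine exists_bound_annulus (H := fun p => pd k η p.2 * logReg p.1 p.2) hδ
      (fun e z hz => ?_) (fun e z hz => ?_)
    · exact ((contDiff_pd hη).continuous.comp continuous_snd).continuousAt.mul
        (continuousAt_logReg hz)
    · rcases hz with hz | hz
      · simp [pd_eq_zero_of_mem_ball h1 _ hz]
      · simp [pd_eq_zero_of_notMem fun h => hz (tsupport_subset_closedBall h0 h)]
  choose C hC using hb
  have hηc : HasCompactSupport η := (isCompact_closedBall (0 : Coord 2) δ).of_isClosed_subset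
    (isClosed_tsupport _) (tsupport_subset_closedBall h0)
  obtain ⟨B, hB⟩ := hηc.exists_bound_of_continuous hη.continuous
  refine ⟨(Metric.closedBall (0 : Coord 2) δ).indicator
    fun z => B * ‖z‖⁻¹ + (|C 0| + |C 1|), ?_, fun e he k z => ?_⟩
  · rw [integrable_indicator_iff measurableSet_closedBall]
    exact ((integrableOn_inv_norm δ).const_mul B).add
      (integrableOn_const (isCompact_closedBall _ _).measure_lt_top.ne)
  · by_cases hz : z ∈ Metric.closedBall (0 : Coord 2) δ
    swap
    · rw [gradKernel_eq_zero h0 hz, indicator_of_notMem hz, abs_zero]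
    rw [indicator_of_mem hz]
    unfold gradKernel
    refine (abs_add_le _ _).trans (add_le_add ?_ ?_)
    · rw [abs_mul]
      refine mul_le_mul (hB z) ?_ (abs_nonneg _) ((norm_nonneg _).trans (hB 0))
      by_cases hz0 : z = 0
      · simp [hz0]
      have hn : 0 < ‖z‖ := norm_pos_iff.2 hz0
      rw [abs_div, sqNorm_eq, abs_of_pos (by positivity : (0 : ℝ) < ‖z‖ ^ 2 + e ^ 2), inv_eq_one_div,
        div_le_div_iff₀ (by positivity) hn]
      have hzk : |z k| ≤ ‖z‖ := by
        simpa using PiLp.norm_apply_le z k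
      nlinarith [sq_nonneg e, abs_nonneg (z k)]
    · refine (hC k e he z).trans ?_
      fin_cases k
      · exact (le_abs_self _).trans (le_add_of_nonneg_right (abs_nonneg _))
      · exact (le_abs_self _).trans (le_add_of_nonneg_left (abs_nonneg _))

end Kernel

/-! ### Convolution with a kernel -/

section Convolution

open scoped Convolution

/-- The convolution `κ * g` of two real functions on the plane. -/
noncomputable def cv (κ g : Coord 2 → ℝ) (x : Coord 2) : ℝ := ∫ z, κ z * g (x - z)

variable {κ g f G : Coord 2 → ℝ} {x₀ : Coord 2} {δ B : ℝ}

lemma cv_eq_convolution : cv κ g = κ ⋆[ContinuousLinearMap.mul ℝ ℝ, volume] g := by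
  ext x; simp [cv, convolution_def]

lemma cv_comm : cv κ g = cv g κ := by
  ext x
  unfold cv
  rw [← integral_sub_left_eq_self _ volume x]
  exact integral_congr_ae (ae_of_all _ fun z => by simp [mul_comm])

lemma cv_eq_integral_sub (x : Coord 2) : cv κ g x = ∫ y, κ (x - y) * g y := by
  unfold cv
  rw [← integral_sub_left_eq_self _ volume x]
  exact integral_congr_ae (ae_of_all _ fun z => by simp)

lemma contDiff_cv (hκ : LocallyIntegrable κ) (hg : ContDiff ℝ ∞ g) (hc : HasCompactSupport g) :
    ContDiff ℝ ∞ (cv κ g) := by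
  rw [cv_eq_convolution]
  exact hc.contDiff_convolution_right _ hκ hg

lemma pd_cv (hκ : LocallyIntegrable κ) (hg : ContDiff ℝ ∞ g) (hc : HasCompactSupport g)
    (i : Fin 2) : pd i (cv κ g) = cv κ (pd i g) := by
  ext x
  have h := hc.hasFDerivAt_convolution_right (ContinuousLinearMap.mul ℝ ℝ) (μ := volume) hκ
    (hg.of_le (by simp)) x
  rw [← cv_eq_convolution] at h
  unfold pd
  rw [h.fderiv, convolution_precompR_apply _ hκ (hc.fderiv ℝ)
    (hg.continuous_fderiv (by simp))]
  simp [cv, convolution_def]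

lemma pd_cv_left (hκ : ContDiff ℝ ∞ κ) (hκc : HasCompactSupport κ) (hg : ContDiff ℝ ∞ g)
    (i : Fin 2) : pd i (cv κ g) = cv (pd i κ) g := by
  rw [cv_comm, pd_cv hg.continuous.locallyIntegrable hκ hκc, cv_comm]

lemma cv_pd (hκ : ContDiff ℝ ∞ κ) (hκc : HasCompactSupport κ) (hg : ContDiff ℝ ∞ g)
    (hc : HasCompactSupport g) (i : Fin 2) : cv κ (pd i g) = cv (pd i κ) g := by
  rw [← pd_cv_left hκ hκc hg, pd_cv hκ.continuous.locallyIntegrable hg hc]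

lemma cv_eq_zero (hκ : ∀ z ∉ Metric.closedBall (0 : Coord 2) δ, κ z = 0)
    (hg : ∀ z ∉ Metric.ball x₀ δ, g z = 0) {x : Coord 2}
    (hx : x ∉ Metric.closedBall x₀ (2 * δ)) : cv κ g x = 0 := by
  unfold cv
  rw [integral_eq_zero_of_ae]
  refine ae_of_all _ fun z => ?_
  by_cases hz : z ∈ Metric.closedBall (0 : Coord 2) δ
  · have : x - z ∉ Metric.ball x₀ δ := fun h => hx (by
      rw [mem_closedBall_zero_iff] at hz
      rw [mem_ball_iff_norm] at h
      rw [mem_closedBall_iff_norm]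
      calc ‖x - x₀‖ = ‖(x - z - x₀) + z‖ := by congr 1; abel
        _ ≤ ‖x - z - x₀‖ + ‖z‖ := norm_add_le _ _
        _ ≤ 2 * δ := by linarith)
    simp [hg _ this]
  · simp [hκ z hz]

lemma abs_cv_le (hG : Integrable G) (hκ : ∀ z, |κ z| ≤ G z) (hg : ∀ z, |g z| ≤ B) (x : Coord 2) :
    |cv κ g x| ≤ (∫ z, G z) * B := by
  unfold cv
  rw [← integral_mul_const, ← Real.norm_eq_abs]
  refine norm_integral_le_of_norm_le (hG.mul_const B) (ae_of_all _ fun z => ?_)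
  rw [Real.norm_eq_abs, abs_mul]
  exact mul_le_mul (hκ z) (hg _) (abs_nonneg _) ((abs_nonneg _).trans (hκ z))

lemma tendsto_cv {κs : ℕ → Coord 2 → ℝ} (hG : Integrable G) (hκ : ∀ n z, |κs n z| ≤ G z)
    (hm : ∀ n, Measurable (κs n)) (hgm : Measurable g) (hg : ∀ z, |g z| ≤ B)
    (hlim : ∀ z, Tendsto (fun n => κs n z) atTop (𝓝 (κ z))) (x : Coord 2) :
    Tendsto (fun n => cv (κs n) g x) atTop (𝓝 (cv κ g x)) := by
  refine tendsto_integral_of_dominated_convergence (fun z => G z * B) ?_ (hG.mul_const B) ?_ ?_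
  · exact fun n => ((hm n).mul (hgm.comp (measurable_const.sub measurable_id))).aestronglyMeasurable
  · refine fun n => ae_of_all _ fun z => ?_
    rw [norm_mul]
    exact mul_le_mul (hκ n z) (hg _) (norm_nonneg _) ((abs_nonneg _).trans (hκ n z))
  · exact ae_of_all _ fun z => (hlim z).mul_const _

/-- Fubini's theorem for a convolution tested against the measure `w ν`. -/
lemma integral_mul_cv_eq {ν : Measure (Coord 2)} [SFinite ν] {w E : Coord 2 → ℝ}
    (hw : Integrable w ν) (hE : Integrable E) (hgm : Measurable g) (hg : ∀ z, |g z| ≤ B) :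
    Integrable (fun y => ∫ x, w x * E (x - y) ∂ν) ∧
    ∫ x, w x * cv E g x ∂ν = ∫ y, (∫ x, w x * E (x - y) ∂ν) * g y := by
  have hE' : Integrable (fun z : Coord 2 => E (-z)) := hE.comp_neg
  have h1 := hw.convolution_integrand (ContinuousLinearMap.mul ℝ ℝ) hE'
  have h2 : Integrable (fun p : Coord 2 × Coord 2 => w p.2 * E (p.2 - p.1)) (volume.prod ν) := by
    simpa using! h1
  refine ⟨h2.integral_prod_left, ?_⟩
  have h3 : Integrable (fun p : Coord 2 × Coord 2 => w p.2 * E (p.2 - p.1) * g p.1)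
      (volume.prod ν) :=
    h2.mul_bdd (c := B) (hgm.comp measurable_fst).aestronglyMeasurable (ae_of_all _ fun p => hg _)
  have h4 := integral_integral_swap (f := fun y x => w x * E (x - y) * g y) h3
  simp only [integral_mul_const] at h4
  rw [h4]
  refine integral_congr_ae (ae_of_all _ fun x => ?_)
  simp only
  rw [cv_eq_integral_sub, ← integral_const_mul]
  simp only [mul_assoc]

end Convolution

/-! ### The weak gradient of a function whose Laplacian is a measure -/

section WeakGradient

lemma integrable_poissonReg_one : Integrable (poissonReg 1) := by
  have h := integrable_rpow_neg_one_add_norm_sq (E := Coord 2) (μ := volume) (r := 4)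
    (by rw [finrank_euclideanSpace]; norm_num)
  refine (h.const_mul 2).congr (ae_of_all _ fun z => ?_)
  have hp : 0 < 1 + ‖z‖ ^ 2 := by positivity
  simp only [poissonReg, sqNorm_eq]
  rw [show (-4 / 2 : ℝ) = -(2 : ℕ) by norm_num, Real.rpow_neg hp.le, Real.rpow_natCast]
  field_simp
  ring

lemma integral_poissonReg_one_pos : 0 < ∫ z, poissonReg 1 z := by
  have h : ∀ z : Coord 2, 0 < poissonReg 1 z := fun z => by
    have := sqNorm_nonneg z
    unfold poissonReg; positivity
  rw [integral_pos_iff_support_of_nonneg (fun z => (h z).le) integrable_poissonReg_one]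
  rw [show Function.support (poissonReg 1) = univ from eq_univ_of_forall fun z => (h z).ne']
  simp

/-- The substitution `z = e w` turns `poissonReg e` into the fixed kernel `poissonReg 1`. -/
lemma cv_mul_poissonReg {η g : Coord 2 → ℝ} {e : ℝ} (he : 0 < e) (x : Coord 2) :
    cv (fun z => η z * poissonReg e z) g x =
      ∫ w, poissonReg 1 w * (η (e • w) * g (x - e • w)) := by
  unfold cv
  have h := Measure.integral_comp_smul (volume : Measure (Coord 2))
    (fun z => η z * poissonReg e z * g (x - z)) e
  rw [finrank_euclideanSpace, Fintype.card_fin, abs_of_pos (by positivity), smul_eq_mul,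
    inv_mul_eq_div, eq_div_iff (by positivity)] at h
  rw [← h, ← integral_mul_const]
  refine integral_congr_ae (ae_of_all _ fun w => ?_)
  have hq : sqNorm (e • w) = e ^ 2 * sqNorm w := by simp [sqNorm]; ring
  have := sqNorm_nonneg w
  simp only [poissonReg, hq]
  field_simp

/-- The functions `η · poissonReg e` are an approximate identity as `e → 0`, up to the factor
`η 0 · ∫ poissonReg 1`, and the convolutions with them are uniformly bounded. -/
lemma tendsto_cv_mul_poissonReg {η g : Coord 2 → ℝ} (hη : Continuous η) (hg : Continuous g)
    {B C : ℝ} (hηB : ∀ z, |η z| ≤ B) (hgC : ∀ z, |g z| ≤ C) {e : ℕ → ℝ} (he : ∀ n, 0 < e n)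
    (hlim : Tendsto e atTop (𝓝 0)) (x : Coord 2) :
    (∀ n, |cv (fun z => η z * poissonReg (e n) z) g x| ≤ (∫ w, poissonReg 1 w) * (B * C)) ∧
    Tendsto (fun n => cv (fun z => η z * poissonReg (e n) z) g x) atTop
      (𝓝 ((∫ w, poissonReg 1 w) * (η 0 * g x))) := by
  simp only [cv_mul_poissonReg (he _), ← integral_mul_const]
  have hP : ∀ z : Coord 2, 0 ≤ poissonReg 1 z := fun z => by
    have := sqNorm_nonneg z
    unfold poissonReg; positivity
  have hb : ∀ n w, ‖poissonReg 1 w * (η (e n • w) * g (x - e n • w))‖ ≤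
      poissonReg 1 w * (B * C) := fun n w => by
    rw [norm_mul, norm_mul, Real.norm_of_nonneg (hP w)]
    exact mul_le_mul_of_nonneg_left (mul_le_mul (hηB _) (hgC _) (norm_nonneg _)
      ((abs_nonneg _).trans (hηB 0))) (hP w)
  refine ⟨fun n => norm_integral_le_of_norm_le (integrable_poissonReg_one.mul_const _)
    (ae_of_all _ (hb n)), ?_⟩
  refine tendsto_integral_of_dominated_convergence (fun w => poissonReg 1 w * (B * C)) ?_
    (integrable_poissonReg_one.mul_const _) (fun n => ae_of_all _ (hb n)) (ae_of_all _ fun w => ?_)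
  · intro n
    exact integrable_poissonReg_one.aestronglyMeasurable.mul
      (by fun_prop : Continuous fun w => η (e n • w) * g (x - e n • w)).aestronglyMeasurable
  · have h0 : Tendsto (fun n => e n • w) atTop (𝓝 0) := by
      simpa using hlim.smul_const w
    have h1 : Tendsto (fun n => x - e n • w) atTop (𝓝 x) := by
      simpa using tendsto_const_nhds.sub h0
    exact (((hη.tendsto 0).comp h0).mul ((hg.tendsto x).comp h1)).const_mul _

end WeakGradient

section LocalWeakGradient

variable {Ω : Set (Coord 2)} {η f g : Coord 2 → ℝ} {x₀ : Coord 2} {δ : ℝ}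

lemma measurable_gradKernel (hη : ContDiff ℝ ∞ η) (e : ℝ) (k : Fin 2) :
    Measurable (gradKernel η e k) := by
  have h1 : Measurable (pd k η) := measurable_pd
  have h2 : Measurable η := hη.continuous.measurable
  have h3 : Measurable fun z => sqNorm z + e ^ 2 := (contDiff_sqNorm.continuous.measurable).add_const _
  have h4 : Measurable fun z : Coord 2 => z k := (contDiff_coord k).continuous.measurable
  exact (h2.mul (h4.div h3)).add (h1.mul ((Real.measurable_log.comp h3).const_mul _))

lemma measurable_remKernel (e : ℝ) : Measurable (remKernel η e) := by
  have h1 : ∀ k, Measurable (pd k η) := fun k => measurable_pd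
  have h2 : ∀ k, Measurable (pd k (pd k η)) := fun k => measurable_pd
  have h3 : Measurable fun z => sqNorm z + e ^ 2 := (contDiff_sqNorm.continuous.measurable).add_const _
  have h4 : ∀ k, Measurable fun z : Coord 2 => z k := fun k =>
    (contDiff_coord k).continuous.measurable
  exact ((((h1 0).mul ((h4 0).div h3)).add ((h1 1).mul ((h4 1).div h3))).const_mul 2).add
    (((h2 0).add (h2 1)).mul ((Real.measurable_log.comp h3).const_mul _))

/-- The convolution of a test function with `∂ₖ (η · logReg e)` is again a test function, and its
Laplacian involves the approximate identity `poissonReg e`. -/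
lemma laplacian_cv_gradKernel (hη : ContDiff ℝ ∞ η) (hηc : HasCompactSupport η)
    (hf : ContDiff ℝ ∞ f) (hc : HasCompactSupport f) {e : ℝ} (he : e ≠ 0) (k : Fin 2)
    (hr : Integrable (remKernel η e)) (x : Coord 2) :
    pd 0 (pd 0 (cv (gradKernel η e k) f)) x + pd 1 (pd 1 (cv (gradKernel η e k) f)) x =
      cv (fun z => η z * poissonReg e z) (pd k f) x + cv (remKernel η e) (pd k f) x := by
  set κ : Coord 2 → ℝ := fun z => η z * logReg e z with hκ
  have hκs : ContDiff ℝ ∞ κ := hη.mul (contDiff_logReg he)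
  have hκc : HasCompactSupport κ := hηc.mul_right
  have h1 : cv (gradKernel η e k) f = cv κ (pd k f) := by
    rw [cv_pd hκs hκc hf hc]
    congr 1; ext z; exact (pd_mul_logReg hη he k z).symm
  have hg := contDiff_pd (i := k) hf
  have hgc := hasCompactSupport_pd (i := k) hc
  have h2 : ∀ j, pd j (pd j (cv κ (pd k f))) = cv (pd j (pd j κ)) (pd k f) := fun j => by
    rw [pd_cv_left hκs hκc hg, pd_cv_left (contDiff_pd hκs) (hasCompactSupport_pd hκc) hg]
  have hint : ∀ {a : Coord 2 → ℝ}, Integrable a → Integrable fun z => a z * pd k f (x - z) :=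
    fun {a} ha => by
      obtain ⟨B, hB⟩ := hgc.exists_bound_of_continuous hg.continuous
      exact ha.mul_bdd (c := B)
        (hg.continuous.comp (continuous_const.sub continuous_id)).aestronglyMeasurable
        (ae_of_all _ fun z => hB _)
  have hi : ∀ j, Integrable (pd j (pd j κ)) := fun j =>
    (contDiff_pd (contDiff_pd hκs)).continuous.integrable_of_hasCompactSupport
      (hasCompactSupport_pd (hasCompactSupport_pd hκc))
  have hlap : ∀ z, pd 0 (pd 0 κ) z + pd 1 (pd 1 κ) z = η z * poissonReg e z + remKernel η e z :=
    laplacian_mul_logReg hη he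
  have hp : Integrable fun z => η z * poissonReg e z := by
    refine (((hi 0).add (hi 1)).sub hr).congr (ae_of_all _ fun z => ?_)
    simp only [Pi.sub_apply, Pi.add_apply, hlap]; ring
  rw [h1, h2, h2]
  unfold cv
  rw [← integral_add (hint (hi 0)) (hint (hi 1)), ← integral_add (hint hp) (hint hr)]
  refine integral_congr_ae (ae_of_all _ fun z => ?_)
  simp only [← add_mul, hlap]

lemma notMem_ball_of_tsupport (hs : tsupport f ⊆ Metric.ball x₀ δ) {z : Coord 2}
    (hz : z ∉ Metric.ball x₀ δ) : f z = 0 :=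
  image_eq_zero_of_notMem_tsupport fun h => hz (hs h)

/-- The representation of `∫ U ∂ₖf` obtained from `ΔU = μ` by testing with the convolution of `f`
with `∂ₖ (η · logReg e)` and letting `e → 0`. -/
lemma integral_cv_gradKernel_eq {U : Coord 2 → ℝ} {μ : Measure (Coord 2)}
    (hη : ContDiff ℝ ∞ η) (hδ : 0 < δ)
    (h1 : ∀ z ∈ Metric.ball (0 : Coord 2) (δ / 2), η z = 1)
    (h0 : ∀ z ∉ Metric.closedBall (0 : Coord 2) δ, η z = 0)
    (hK : IntegrableOn U (Metric.closedBall x₀ (2 * δ)))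
    (hμ : μ (Metric.closedBall x₀ (2 * δ)) < ⊤)
    (h : ∀ f : Coord 2 → ℝ, ContDiff ℝ ∞ f → HasCompactSupport f →
      tsupport f ⊆ Metric.closedBall x₀ (2 * δ) →
      ∫ x, f x ∂μ = ∫ x, U x * (pd 0 (pd 0 f) x + pd 1 (pd 1 f) x))
    (hf : ContDiff ℝ ∞ f) (hs : tsupport f ⊆ Metric.ball x₀ δ) (k : Fin 2) :
    ∫ x, cv (gradKernel η 0 k) f x ∂μ =
      (∫ w, poissonReg 1 w) * (∫ x, U x * pd k f x) +
        ∫ x, U x * cv (remKernel η 0) (pd k f) x := by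
  have hc : HasCompactSupport f := (isCompact_closedBall x₀ δ).of_isClosed_subset
    (isClosed_tsupport _) (hs.trans Metric.ball_subset_closedBall)
  have hηc : HasCompactSupport η := (isCompact_closedBall (0 : Coord 2) δ).of_isClosed_subset
    (isClosed_tsupport _) (tsupport_subset_closedBall h0)
  set K := Metric.closedBall x₀ (2 * δ)
  have hKc : IsCompact K := isCompact_closedBall _ _
  set e : ℕ → ℝ := fun n => 1 / ((n : ℝ) + 1) with hedef
  have hepos : ∀ n, 0 < e n := fun n => by positivity
  have he1 : ∀ n, e n ∈ Icc (0 : ℝ) 1 := fun n => by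
    refine ⟨(hepos n).le, ?_⟩
    rw [hedef]
    simp only
    rw [div_le_one (by positivity)]
    linarith [(Nat.cast_nonneg n : (0 : ℝ) ≤ n)]
  have helim : Tendsto e atTop (𝓝 0) := tendsto_one_div_add_atTop_nhds_zero_nat
  obtain ⟨G, hG, hGb⟩ := exists_gradKernel_bound hη hδ h1 h0
  obtain ⟨C, hC⟩ := exists_remKernel_bound hη hδ h1 h0
  set R : Coord 2 → ℝ := (Metric.closedBall (0 : Coord 2) δ).indicator fun _ => C
  have hR : Integrable R := (integrable_indicator_iff measurableSet_closedBall).2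
    (integrableOn_const (isCompact_closedBall _ _).measure_lt_top.ne)
  have hRb : ∀ t ∈ Icc (0 : ℝ) 1, ∀ z, |remKernel η t z| ≤ R z := fun t ht z => by
    by_cases hz : z ∈ Metric.closedBall (0 : Coord 2) δ
    · simpa [R, indicator_of_mem hz] using hC t ht z
    · simp [R, indicator_of_notMem hz, remKernel_eq_zero h1 h0 (Or.inr hz)]
  have hRi : ∀ t ∈ Icc (0 : ℝ) 1, Integrable (remKernel η t) := fun t ht =>
    hR.mono' (measurable_remKernel t).aestronglyMeasurable (ae_of_all _ (hRb t ht))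
  have hGi : ∀ t ∈ Icc (0 : ℝ) 1, Integrable (gradKernel η t k) := fun t ht =>
    hG.mono' (measurable_gradKernel hη t k).aestronglyMeasurable (ae_of_all _ (hGb t ht k))
  obtain ⟨B, hB⟩ := hc.exists_bound_of_continuous hf.continuous
  have hg := contDiff_pd (i := k) hf
  obtain ⟨B', hB'⟩ := (hasCompactSupport_pd (i := k) hc).exists_bound_of_continuous hg.continuous
  obtain ⟨Bη, hBη⟩ := hηc.exists_bound_of_continuous hη.continuous
  have hgs : tsupport (pd k f) ⊆ Metric.ball x₀ δ := tsupport_pd_subset.trans hs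
  have hz1 : ∀ t x, x ∉ K → cv (gradKernel η t k) f x = 0 := fun t x hx =>
    cv_eq_zero (fun z hz => gradKernel_eq_zero h0 hz) (fun z hz => notMem_ball_of_tsupport hs hz) hx
  have hz2 : ∀ t x, x ∉ K → cv (remKernel η t) (pd k f) x = 0 := fun t x hx =>
    cv_eq_zero (fun z hz => remKernel_eq_zero h1 h0 (Or.inr hz))
      (fun z hz => notMem_ball_of_tsupport hgs hz) hx
  have hz3 : ∀ t x, x ∉ K → cv (fun z => η z * poissonReg t z) (pd k f) x = 0 := fun t x hx =>
    cv_eq_zero (fun z hz => by simp [h0 z hz]) (fun z hz => notMem_ball_of_tsupport hgs hz) hx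
  -- the identity for `e > 0`
  have hid : ∀ n, ∫ x, cv (gradKernel η (e n) k) f x ∂μ =
      (∫ x, U x * cv (fun z => η z * poissonReg (e n) z) (pd k f) x) +
        ∫ x, U x * cv (remKernel η (e n)) (pd k f) x := fun n => by
    have hs1 := contDiff_cv (hGi _ (he1 n)).locallyIntegrable hf hc
    have hsupp : tsupport (cv (gradKernel η (e n) k) f) ⊆ K :=
      closure_minimal (fun x hx => by by_contra h'; exact hx (hz1 _ x h')) hKc.isClosed
    rw [h _ hs1 (hKc.of_isClosed_subset (isClosed_tsupport _) hsupp) hsupp, ← integral_add]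
    · refine integral_congr_ae (ae_of_all _ fun x => ?_)
      simp only
      rw [laplacian_cv_gradKernel hη hηc hf hc (hepos n).ne' k (hRi _ (he1 n)), mul_add]
    · have hi := contDiff_cv (κ := fun z => η z * poissonReg (e n) z) (g := pd k f) ?_ hg
        (hasCompactSupport_pd hc)
      · exact integrable_mul_of_bound hK hi.continuous.aestronglyMeasurable
          ((tendsto_cv_mul_poissonReg hη.continuous hg.continuous hBη hB' hepos helim · |>.1 n))
          (hz3 _)
      · have hq : Continuous fun z => η z * poissonReg (e n) z := by
          refine hη.continuous.mul (continuous_const.div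
            ((contDiff_sqNorm.continuous.add continuous_const).pow 2) fun z => ?_)
          exact pow_ne_zero _ (sqNorm_add_pos (hepos n).ne' z).ne'
        exact hq.locallyIntegrable
    · have hi := contDiff_cv (hRi _ (he1 n)).locallyIntegrable hg (hasCompactSupport_pd hc)
      exact integrable_mul_of_bound hK hi.continuous.aestronglyMeasurable
        (abs_cv_le hR (hRb _ (he1 n)) hB') (hz2 _)
  -- the three limits as `e → 0`
  have hl1 : Tendsto (fun n => ∫ x, cv (gradKernel η (e n) k) f x ∂μ) atTop
      (𝓝 (∫ x, cv (gradKernel η 0 k) f x ∂μ)) := by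
    have := tendsto_integral_mul_of_bound (w := fun _ => 1) (μ := μ) hKc
      (integrableOn_const hμ.ne)
      (fun n => (contDiff_cv (hGi _ (he1 n)).locallyIntegrable hf hc).continuous.measurable)
      (fun n => abs_cv_le hG (hGb _ (he1 n) k) hB) (fun n => hz1 _)
      (ae_of_all _ fun x => tendsto_cv hG (fun n => hGb _ (he1 n) k)
        (fun n => measurable_gradKernel hη _ k) hf.continuous.measurable hB
        (tendsto_gradKernel hδ h1 helim k) x)
    simpa using this
  have hl2 : Tendsto (fun n => ∫ x, U x * cv (remKernel η (e n)) (pd k f) x) atTop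
      (𝓝 (∫ x, U x * cv (remKernel η 0) (pd k f) x)) :=
    tendsto_integral_mul_of_bound hKc hK
      (fun n => (contDiff_cv (hRi _ (he1 n)).locallyIntegrable hg
        (hasCompactSupport_pd hc)).continuous.measurable)
      (fun n => abs_cv_le hR (hRb _ (he1 n)) hB') (fun n => hz2 _)
      (ae_of_all _ fun x => tendsto_cv hR (fun n => hRb _ (he1 n))
        (fun n => measurable_remKernel _) hg.continuous.measurable hB'
        (tendsto_remKernel hδ h1 helim) x)
  have hP := fun x => tendsto_cv_mul_poissonReg hη.continuous hg.continuous hBη hB' hepos helim x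
  have hl3 := tendsto_integral_mul_of_bound (H := fun n =>
      cv (fun z => η z * poissonReg (e n) z) (pd k f)) hKc hK (fun n => by
        refine (contDiff_cv ?_ hg (hasCompactSupport_pd hc)).continuous.measurable
        have hq : Continuous fun z => η z * poissonReg (e n) z := by
          refine hη.continuous.mul (continuous_const.div
            ((contDiff_sqNorm.continuous.add continuous_const).pow 2) fun z => ?_)
          exact pow_ne_zero _ (sqNorm_add_pos (hepos n).ne' z).ne'
        exact hq.locallyIntegrable)
      (fun n x => (hP x).1 n) (fun n => hz3 _) (ae_of_all _ fun x => (hP x).2)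
  have hfin := tendsto_nhds_unique (hl1.congr hid) (hl3.add hl2)
  rw [hfin, ← integral_const_mul]
  congr 1
  refine integral_congr_ae (ae_of_all _ fun x => ?_)
  simp only
  rw [h1 0 (Metric.mem_ball_self (half_pos hδ))]
  ring

/-- A function whose distributional Laplacian is a measure has a weak gradient near each point. -/
lemma exists_local_weakGradient (hΩ : IsOpen Ω) {U : Coord 2 → ℝ} (hU : LocallyIntegrableOn U Ω)
    {μ : Measure (Coord 2)} (hμ : ∀ K, IsCompact K → K ⊆ Ω → μ K < ⊤)
    (h : ∀ f : Coord 2 → ℝ, ContDiff ℝ ∞ f → HasCompactSupport f → tsupport f ⊆ Ω →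
      ∫ x, f x ∂μ = ∫ x, U x * (pd 0 (pd 0 f) x + pd 1 (pd 1 f) x)) (hx₀ : x₀ ∈ Ω) :
    ∃ V, IsOpen V ∧ x₀ ∈ V ∧ V ⊆ Ω ∧ ∃ D, IsWeakGradientOn U D V := by
  obtain ⟨r, hr, hrΩ⟩ := Metric.nhds_basis_closedBall.mem_iff.1 (hΩ.mem_nhds hx₀)
  set δ := r / 2 with hδdef
  have hδ : 0 < δ := half_pos hr
  have h2δ : 2 * δ = r := by rw [hδdef]; ring
  set K := Metric.closedBall x₀ (2 * δ) with hKdef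
  have hKΩ : K ⊆ Ω := by rw [hKdef, h2δ]; exact hrΩ
  have hKc : IsCompact K := isCompact_closedBall _ _
  let b : ContDiffBump (0 : Coord 2) := ⟨δ / 2, δ, half_pos hδ, half_lt_self hδ⟩
  set η : Coord 2 → ℝ := fun z => b z with hηdef
  have hη : ContDiff ℝ ∞ η := b.contDiff
  have h1 : ∀ z ∈ Metric.ball (0 : Coord 2) (δ / 2), η z = 1 := fun z hz =>
    b.one_of_mem_closedBall (Metric.ball_subset_closedBall hz)
  have h0 : ∀ z ∉ Metric.closedBall (0 : Coord 2) δ, η z = 0 := fun z hz =>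
    b.zero_of_le_dist (by rw [Metric.mem_closedBall, not_le] at hz; exact hz.le)
  obtain ⟨G, hG, hGb⟩ := exists_gradKernel_bound hη hδ h1 h0
  have hEi : ∀ k, Integrable (gradKernel η 0 k) := fun k =>
    hG.mono' (measurable_gradKernel hη 0 k).aestronglyMeasurable
      (ae_of_all _ (hGb 0 ⟨le_rfl, zero_le_one⟩ k))
  have hrs : ContDiff ℝ ∞ (remKernel η 0) := contDiff_remKernel_zero hη hδ h1 h0
  have hrc : HasCompactSupport (remKernel η 0) :=
    HasCompactSupport.intro (isCompact_closedBall 0 δ) fun z hz =>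
      remKernel_eq_zero h1 h0 (Or.inr hz)
  have hri : ∀ k, Integrable (pd k (remKernel η 0)) := fun k =>
    (contDiff_pd hrs).continuous.integrable_of_hasCompactSupport (hasCompactSupport_pd hrc)
  have hUK : IntegrableOn U K := hU.integrableOn_compact_subset hKΩ hKc
  have hμK : μ K < ⊤ := hμ K hKc hKΩ
  have : IsFiniteMeasure (μ.restrict K) := ⟨by simpa using hμK⟩
  set c := ∫ w, poissonReg 1 w
  have hcpos : 0 < c := integral_poissonReg_one_pos
  -- solving `integral_cv_gradKernel_eq` for the integral of `U ∂ₖf`, after an application of Fubini's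
  -- theorem to move the kernels from `f` to `μ` and `U`
  set D : Fin 2 → Coord 2 → ℝ := fun k y => -(c⁻¹ *
    ((∫ x in K, 1 * gradKernel η 0 k (x - y) ∂μ) - ∫ x in K, U x * pd k (remKernel η 0) (x - y)))
  have hone : Integrable (fun _ : Coord 2 => (1 : ℝ)) (μ.restrict K) := integrable_const 1
  have hcv1 : ∀ k, Integrable fun y => ∫ x in K, 1 * gradKernel η 0 k (x - y) ∂μ := fun k =>
    (integral_mul_cv_eq (g := fun _ => 0) (B := 0) hone (hEi k) measurable_const (by simp)).1
  have hcv2 : ∀ k, Integrable fun y => ∫ x in K, U x * pd k (remKernel η 0) (x - y) := fun k =>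
    (integral_mul_cv_eq (g := fun _ => 0) (B := 0) hUK (hri k) measurable_const (by simp)).1
  have hDi : ∀ k, Integrable (D k) := fun k => (((hcv1 k).sub (hcv2 k)).const_mul _).neg
  refine ⟨Metric.ball x₀ δ, Metric.isOpen_ball, Metric.mem_ball_self hδ, ?_, D, ?_, ?_, ?_⟩
  · exact (Metric.ball_subset_closedBall.trans
      (Metric.closedBall_subset_closedBall (by linarith))).trans hKΩ
  · exact hU.mono_set ((Metric.ball_subset_closedBall.trans
      (Metric.closedBall_subset_closedBall (by linarith))).trans hKΩ)
  · exact fun k => (hDi k).locallyIntegrable.locallyIntegrableOn _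
  intro k f hf hc hs
  have hf0 : ∀ x, x ∉ Metric.ball x₀ δ → f x = 0 := fun x hx => notMem_ball_of_tsupport hs hx
  have hg0 : ∀ x, x ∉ Metric.ball x₀ δ → pd k f x = 0 := fun x hx =>
    pd_eq_zero_of_notMem fun h => hx (hs h)
  rw [setIntegral_eq_of_tsupport (fun x hx => by rw [hg0 x hx, mul_zero]),
    setIntegral_eq_of_tsupport (fun x hx => by rw [hf0 x hx, mul_zero])]
  have hmain := integral_cv_gradKernel_eq (f := f) hη hδ h1 h0 hUK hμK
    (fun f hf hc hs => h f hf hc (hs.trans hKΩ)) hf hs k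
  obtain ⟨B, hB⟩ := hc.exists_bound_of_continuous hf.continuous
  have e1 : ∫ x, cv (gradKernel η 0 k) f x ∂μ =
      ∫ y, (∫ x in K, 1 * gradKernel η 0 k (x - y) ∂μ) * f y := by
    rw [← (integral_mul_cv_eq hone (hEi k) hf.continuous.measurable hB).2]
    simp only [one_mul]
    exact (setIntegral_eq_integral_of_forall_compl_eq_zero fun x hx => cv_eq_zero
      (fun z hz => gradKernel_eq_zero h0 hz) hf0 hx).symm
  have e2 : ∫ x, U x * cv (remKernel η 0) (pd k f) x =
      ∫ y, (∫ x in K, U x * pd k (remKernel η 0) (x - y)) * f y := by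
    rw [← (integral_mul_cv_eq hUK (hri k) hf.continuous.measurable hB).2, cv_pd hrs hrc hf hc]
    refine (setIntegral_eq_of_tsupport fun x hx => ?_).symm
    rw [cv_eq_zero (fun z hz => ?_) hf0 hx, mul_zero]
    refine pd_eq_zero_of_notMem fun h' => hz ?_
    exact closure_minimal (fun w hw => by
      by_contra h''; exact hw (remKernel_eq_zero h1 h0 (Or.inr h''))) Metric.isClosed_closedBall h'
  rw [e1, e2] at hmain
  have hbd : ∀ {a : Coord 2 → ℝ}, Integrable a → Integrable fun y => a y * f y := fun {a} ha =>
    ha.mul_bdd (c := B) hf.continuous.aestronglyMeasurable (ae_of_all _ hB)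
  have e3 : ∫ x, D k x * f x = -(c⁻¹ * ((∫ y, (∫ x in K, 1 * gradKernel η 0 k (x - y) ∂μ) * f y) -
      ∫ y, (∫ x in K, U x * pd k (remKernel η 0) (x - y)) * f y)) := by
    rw [← integral_sub (hbd (hcv1 k)) (hbd (hcv2 k)), ← integral_const_mul, ← integral_neg]
    refine integral_congr_ae (ae_of_all _ fun y => ?_)
    simp only [D]; ring
  rw [e3, hmain]
  field_simp
  ring

end LocalWeakGradient

section GlobalWeakGradient

variable {Ω V : Set (Coord 2)} {φ φ' : Coord 2 → ℝ} {D D' : Fin 2 → Coord 2 → ℝ}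

lemma isWeakGradientOn_iff :
    IsWeakGradientOn φ D Ω ↔ LocallyIntegrableOn φ Ω ∧ (∀ k, LocallyIntegrableOn (D k) Ω) ∧
      ∀ (k : Fin 2) (f : Coord 2 → ℝ), ContDiff ℝ ∞ f → HasCompactSupport f → tsupport f ⊆ Ω →
        ∫ y, φ y * pd k f y = -∫ y, D k y * f y := by
  unfold IsWeakGradientOn
  refine and_congr_right fun _ => and_congr_right fun _ => ?_
  refine forall_congr' fun k => forall_congr' fun f => forall_congr' fun _ => forall_congr' fun _ =>
    forall_congr' fun hs => ?_
  rw [setIntegral_eq_of_tsupport (fun x hx => ?_), setIntegral_eq_of_tsupport (fun x hx => ?_)]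
  · rw [image_eq_zero_of_notMem_tsupport fun h => hx (hs h), mul_zero]
  · rw [pd_eq_zero_of_notMem fun h => hx (hs h), mul_zero]

lemma IsWeakGradientOn.mono (h : IsWeakGradientOn φ D Ω) (hV : V ⊆ Ω) :
    IsWeakGradientOn φ D V := by
  rw [isWeakGradientOn_iff] at h ⊢
  exact ⟨h.1.mono_set hV, fun k => (h.2.1 k).mono_set hV,
    fun k f hf hc hs => h.2.2 k f hf hc (hs.trans hV)⟩

lemma LocallyIntegrableOn.integrable_mul_smooth {w f : Coord 2 → ℝ} (hw : LocallyIntegrableOn w Ω)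
    (hf : ContDiff ℝ ∞ f) (hc : HasCompactSupport f) (hs : tsupport f ⊆ Ω) :
    Integrable fun x => w x * f x := by
  obtain ⟨B, hB⟩ := hc.exists_bound_of_continuous hf.continuous
  exact LocallyIntegrableOn.integrable_mul_test hw hc.isCompact hs hf.continuous.measurable hB
    fun x hx => image_eq_zero_of_notMem_tsupport hx

lemma IsWeakGradientOn.congr_ae (hΩ : IsOpen Ω) (h : IsWeakGradientOn φ D Ω)
    (h1 : ∀ᵐ y ∂(volume.restrict Ω), φ y = φ' y)
    (h2 : ∀ k, ∀ᵐ y ∂(volume.restrict Ω), D k y = D' k y) : IsWeakGradientOn φ' D' Ω := by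
  have hli : ∀ {a b : Coord 2 → ℝ}, LocallyIntegrableOn a Ω →
      (∀ᵐ y ∂(volume.restrict Ω), a y = b y) → LocallyIntegrableOn b Ω := fun {a b} ha hab => by
    rw [locallyIntegrableOn_iff hΩ.isLocallyClosed] at ha ⊢
    exact fun K hK hKc => (ha K hK hKc).congr_fun_ae (ae_mono (Measure.restrict_mono hK le_rfl) hab)
  refine ⟨hli h.1 h1, fun k => hli (h.2.1 k) (h2 k), fun k f hf hc hs => ?_⟩
  have e1 : ∫ y in Ω, φ' y * pd k f y = ∫ y in Ω, φ y * pd k f y :=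
    integral_congr_ae (h1.mono fun y hy => by simp only [hy])
  have e2 : ∫ y in Ω, D' k y * f y = ∫ y in Ω, D k y * f y :=
    integral_congr_ae ((h2 k).mono fun y hy => by simp only [hy])
  rw [e1, e2]
  exact h.2.2 k f hf hc hs

/-- Weak gradients are unique almost everywhere. -/
lemma IsWeakGradientOn.ae_eq (hΩ : IsOpen Ω) (h : IsWeakGradientOn φ D Ω)
    (h' : IsWeakGradientOn φ D' Ω) (k : Fin 2) : ∀ᵐ y ∂(volume.restrict Ω), D k y = D' k y := by
  rw [ae_restrict_iff' hΩ.measurableSet]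
  have hsub : LocallyIntegrableOn (fun y => D k y - D' k y) Ω := (h.2.1 k).sub (h'.2.1 k)
  rw [isWeakGradientOn_iff] at h h'
  have := hΩ.ae_eq_zero_of_integral_contDiff_smul_eq_zero hsub fun f hf hc hs => by
    have e : ∫ x, f x • (D k x - D' k x) = ∫ x, (D k x * f x - D' k x * f x) :=
      integral_congr_ae (ae_of_all _ fun x => by simp only [smul_eq_mul]; ring)
    rw [e, integral_sub (LocallyIntegrableOn.integrable_mul_smooth (h.2.1 k) hf hc hs)
      (LocallyIntegrableOn.integrable_mul_smooth (h'.2.1 k) hf hc hs)]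
    have a := h.2.2 k f hf hc hs
    have b := h'.2.2 k f hf hc hs
    linarith
  exact this.mono fun y hy hyΩ => sub_eq_zero.1 (hy hyΩ)

lemma IsWeakGradientOn.sub (h : IsWeakGradientOn φ D Ω) (h' : IsWeakGradientOn φ' D' Ω) :
    IsWeakGradientOn (fun y => φ y - φ' y) (fun k y => D k y - D' k y) Ω := by
  rw [isWeakGradientOn_iff] at h h' ⊢
  refine ⟨h.1.sub h'.1, fun k => (h.2.1 k).sub (h'.2.1 k), fun k f hf hc hs => ?_⟩
  have hi : ∀ {w : Coord 2 → ℝ}, LocallyIntegrableOn w Ω → Integrable fun x => w x * pd k f x :=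
    fun {w} hw => LocallyIntegrableOn.integrable_mul_smooth hw (contDiff_pd hf)
      (hasCompactSupport_pd hc) (tsupport_pd_subset.trans hs)
  simp only [sub_mul]
  rw [integral_sub (hi h.1) (hi h'.1),
    integral_sub (LocallyIntegrableOn.integrable_mul_smooth (h.2.1 k) hf hc hs)
      (LocallyIntegrableOn.integrable_mul_smooth (h'.2.1 k) hf hc hs),
    h.2.2 k f hf hc hs, h'.2.2 k f hf hc hs]
  ring

lemma locallyIntegrableOn_of_local {w : Coord 2 → ℝ}
    (h : ∀ x ∈ Ω, ∃ V, IsOpen V ∧ x ∈ V ∧ LocallyIntegrableOn w V) : LocallyIntegrableOn w Ω := by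
  intro x hx
  obtain ⟨V, hV, hxV, hw⟩ := h x hx
  have := hw x hxV
  rw [hV.nhdsWithin_eq hxV] at this
  exact this.filter_mono nhdsWithin_le_nhds

/-- Being a weak gradient is a local property, by a partition of unity applied to the test functions. -/
lemma isWeakGradientOn_of_local
    (h : ∀ x ∈ Ω, ∃ V, IsOpen V ∧ x ∈ V ∧ IsWeakGradientOn φ D V) : IsWeakGradientOn φ D Ω := by
  have h1 : LocallyIntegrableOn φ Ω := locallyIntegrableOn_of_local fun x hx => by
    obtain ⟨V, hV, hxV, hw⟩ := h x hx
    exact ⟨V, hV, hxV, hw.1⟩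
  have h2 : ∀ k, LocallyIntegrableOn (D k) Ω := fun k => locallyIntegrableOn_of_local fun x hx => by
    obtain ⟨V, hV, hxV, hw⟩ := h x hx
    exact ⟨V, hV, hxV, hw.2.1 k⟩
  rw [isWeakGradientOn_iff]
  refine ⟨h1, h2, fun k f hf hc hs => ?_⟩
  refine test_induction (Ω := Ω) (P := fun f => ∫ y, φ y * pd k f y = -∫ y, D k y * f y)
    ?_ ?_ ?_ hf hc hs
  · simp [pd_const]
  · intro f g hf hfc hfs hg hgc hgs ef eg
    have hd : ∀ {f : Coord 2 → ℝ}, ContDiff ℝ ∞ f → ∀ x, DifferentiableAt ℝ f x := fun hf x =>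
      hf.differentiable (by simp) x
    have hi : ∀ {f : Coord 2 → ℝ}, ContDiff ℝ ∞ f → HasCompactSupport f → tsupport f ⊆ Ω →
        Integrable fun x => φ x * pd k f x := fun {f} hf hc hs =>
      LocallyIntegrableOn.integrable_mul_smooth h1 (contDiff_pd hf)
        (hasCompactSupport_pd hc) (tsupport_pd_subset.trans hs)
    simp only [pd_add (hd hf _) (hd hg _), mul_add]
    rw [integral_add (hi hf hfc hfs) (hi hg hgc hgs),
      integral_add (LocallyIntegrableOn.integrable_mul_smooth (h2 k) hf hfc hfs)
        (LocallyIntegrableOn.integrable_mul_smooth (h2 k) hg hgc hgs), ef, eg]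
    ring
  · intro x hx
    obtain ⟨V, hV, hxV, hw⟩ := h x hx
    rw [isWeakGradientOn_iff] at hw
    exact ⟨V, hV, hxV, fun f hf hc hs => hw.2.2 k f hf hc hs⟩

/-- Local weak gradients of a function fit together, as they are unique almost everywhere. -/
lemma exists_weakGradient_of_local
    (h : ∀ x ∈ Ω, ∃ V, IsOpen V ∧ x ∈ V ∧ V ⊆ Ω ∧ ∃ D, IsWeakGradientOn φ D V) :
    ∃ D, IsWeakGradientOn φ D Ω := by
  classical
  choose! V hV hxV hVΩ D hD using h
  rcases Ω.eq_empty_or_nonempty with rfl | ⟨x₁, hx₁⟩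
  · exact ⟨fun _ _ => 0, isWeakGradientOn_of_local fun x hx => hx.elim⟩
  obtain ⟨t, htΩ, htc, hcov⟩ := TopologicalSpace.countable_cover_nhdsWithin
    (f := V) (s := Ω) fun x hx => mem_nhdsWithin_of_mem_nhds ((hV x hx).mem_nhds (hxV x hx))
  have htne : t.Nonempty := by
    obtain ⟨x, hx, -⟩ := mem_iUnion₂.1 (hcov hx₁)
    exact ⟨x, hx⟩
  obtain ⟨a, rfl⟩ := htc.exists_eq_range htne
  have haΩ : ∀ n, a n ∈ Ω := fun n => htΩ (mem_range_self n)
  -- the local gradient on the first set of a countable cover that contains the point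
  let E : Fin 2 → Coord 2 → ℝ := fun k y =>
    if hy : ∃ n, y ∈ V (a n) then D (a (Nat.find hy)) k y else 0
  refine ⟨E, isWeakGradientOn_of_local fun x hx => ?_⟩
  obtain ⟨m, hm⟩ : ∃ m, x ∈ V (a m) := by
    obtain ⟨_, ⟨m, rfl⟩, hm⟩ := mem_iUnion₂.1 (hcov hx)
    exact ⟨m, hm⟩
  have hVm := hV _ (haΩ m)
  refine ⟨V (a m), hVm, hm, (hD _ (haΩ m)).congr_ae hVm (ae_of_all _ fun _ => rfl) fun k => ?_⟩
  have key : ∀ n, ∀ᵐ y ∂(volume : Measure (Coord 2)), y ∈ V (a n) ∩ V (a m) →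
      D (a n) k y = D (a m) k y := fun n => by
    have ho := (hV _ (haΩ n)).inter hVm
    exact (ae_restrict_iff' ho.measurableSet).1 (((hD _ (haΩ n)).mono inter_subset_left).ae_eq ho
      ((hD _ (haΩ m)).mono inter_subset_right) k)
  rw [ae_restrict_iff' hVm.measurableSet]
  filter_upwards [ae_all_iff.2 key] with y hy hym
  have hex : ∃ n, y ∈ V (a n) := ⟨m, hym⟩
  simp only [E, dif_pos hex]
  exact (hy _ ⟨Nat.find_spec hex, hym⟩).symm

/-- A difference of subharmonic functions has a weak gradient, and its Laplacian is a difference of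
two measures. -/
lemma IsDeltaSubharmonicOn.exists_weakGradient (hφ : IsDeltaSubharmonicOn φ Ω) (hΩ : IsOpen Ω) :
    (∃ D, IsWeakGradientOn φ D Ω) ∧ ∃ μ ν : Measure (Coord 2),
      (∀ K, IsCompact K → K ⊆ Ω → μ K < ⊤) ∧ (∀ K, IsCompact K → K ⊆ Ω → ν K < ⊤) ∧
      ∀ f : Coord 2 → ℝ, ContDiff ℝ ∞ f → HasCompactSupport f → tsupport f ⊆ Ω →
        ∫ x, f x ∂μ - ∫ x, f x ∂ν = -∫ y in Ω, (pd 0 (pd 0 f) y + pd 1 (pd 1 f) y) * φ y := by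
  obtain ⟨u, v, hu, hv, huv⟩ := hφ
  obtain ⟨μ, hμ, hμf⟩ := hu.exists_rieszMeasure hΩ
  obtain ⟨ν, hν, hνf⟩ := hv.exists_rieszMeasure hΩ
  have hui := hu.locallyIntegrableOn hΩ
  have hvi := hv.locallyIntegrableOn hΩ
  obtain ⟨Du, hDu⟩ := exists_weakGradient_of_local fun x hx =>
    exists_local_weakGradient hΩ hui hμ hμf hx
  obtain ⟨Dv, hDv⟩ := exists_weakGradient_of_local fun x hx =>
    exists_local_weakGradient hΩ hvi hν hνf hx
  refine ⟨⟨_, (hDu.sub hDv).congr_ae hΩ (huv.mono fun y hy => hy.2.2.symm)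
    fun k => ae_of_all _ fun _ => rfl⟩, ν, μ, hν, hμ, fun f hf hc hs => ?_⟩
  have hg : ContDiff ℝ ∞ fun y => pd 0 (pd 0 f) y + pd 1 (pd 1 f) y :=
    (contDiff_pd (contDiff_pd hf)).add (contDiff_pd (contDiff_pd hf))
  have hg0 : ∀ y, y ∉ tsupport f → pd 0 (pd 0 f) y + pd 1 (pd 1 f) y = 0 := fun y hy => by
    rw [pd_eq_zero_of_notMem fun h => hy (tsupport_pd_subset h),
      pd_eq_zero_of_notMem fun h => hy (tsupport_pd_subset h), add_zero]
  have hgs : tsupport (fun y => pd 0 (pd 0 f) y + pd 1 (pd 1 f) y) ⊆ tsupport f :=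
    closure_minimal (fun y hy => by by_contra h; exact hy (hg0 y h)) (isClosed_tsupport f)
  have hgc := hc.of_isClosed_subset (isClosed_tsupport _) hgs
  rw [hνf f hf hc hs, hμf f hf hc hs, ← integral_sub
    (LocallyIntegrableOn.integrable_mul_smooth hvi hg hgc (hgs.trans hs))
    (LocallyIntegrableOn.integrable_mul_smooth hui hg hgc (hgs.trans hs)), ← integral_neg,
    ← setIntegral_eq_of_tsupport (Ω := Ω) (fun x hx => by rw [hg0 x fun h => hx (hs h)]; simp)]
  refine integral_congr_ae (huv.mono fun y hy => ?_)
  simp only [hy.2.2]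
  ring

end GlobalWeakGradient

/-! ### Diffeomorphisms of class `C^{1,1}` of plane domains -/

section Diffeo

/-- The Jacobian matrix of a map of the plane. -/
noncomputable def jacMat (T : Coord 2 → Coord 2) (y : Coord 2) : Matrix (Fin 2) (Fin 2) ℝ :=
  fun a b => pd b (fun z => T z a) y

/-- A homeomorphism between open subsets of the plane which is `C¹` with locally Lipschitz derivative,
together with its inverse. -/
structure IsC11Diffeo (T : OpenPartialHomeomorph (Coord 2) (Coord 2)) : Prop where
  contDiffOn : ContDiffOn ℝ 1 T T.source
  lipschitz : LocallyLipschitzOn T.source (fderiv ℝ T)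
  contDiffOn_symm : ContDiffOn ℝ 1 T.symm T.target
  lipschitz_symm : LocallyLipschitzOn T.target (fderiv ℝ T.symm)

variable {T : OpenPartialHomeomorph (Coord 2) (Coord 2)} {y : Coord 2}

lemma IsC11Diffeo.symm (H : IsC11Diffeo T) : IsC11Diffeo T.symm where
  contDiffOn := H.contDiffOn_symm
  lipschitz := H.lipschitz_symm
  contDiffOn_symm := by simpa using! H.contDiffOn
  lipschitz_symm := by simpa using! H.lipschitz

lemma IsC11Diffeo.differentiableAt (H : IsC11Diffeo T) (hy : y ∈ T.source) :
    DifferentiableAt ℝ T y :=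
  (H.contDiffOn.contDiffAt (T.open_source.mem_nhds hy)).differentiableAt (by simp)

lemma differentiableAt_coord {S : Coord 2 → Coord 2} (h : DifferentiableAt ℝ S y) (a : Fin 2) :
    DifferentiableAt ℝ (fun z => S z a) y :=
  (EuclideanSpace.proj a : Coord 2 →L[ℝ] ℝ).differentiableAt.comp y h

lemma jacMat_eq {S : Coord 2 → Coord 2} (h : DifferentiableAt ℝ S y) (a b : Fin 2) :
    jacMat S y a b = fderiv ℝ S y (EuclideanSpace.single b 1) a := by
  have := (hasFDerivAt_coord a (S y)).comp y h.hasFDerivAt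
  have e : fderiv ℝ (fun z => S z a) y = _ := this.fderiv
  unfold jacMat pd
  rw [e]
  rfl

lemma fderiv_apply_eq_sum {h : Coord 2 → ℝ} (w : Coord 2) :
    fderiv ℝ h y w = ∑ a, pd a h y * w a := by
  have hw : w = ∑ a, w a • (EuclideanSpace.single a (1 : ℝ) : Coord 2) := by
    ext i
    simp [Fin.sum_univ_two]
    fin_cases i <;> simp
  conv_lhs => rw [hw, map_sum]
  simp [pd, mul_comm]

/-- The chain rule. -/
lemma pd_comp {h : Coord 2 → ℝ} {S : Coord 2 → Coord 2} (hh : DifferentiableAt ℝ h (S y))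
    (hS : DifferentiableAt ℝ S y) (k : Fin 2) :
    pd k (fun z => h (S z)) y = ∑ a, pd a h (S y) * jacMat S y a k := by
  have e : fderiv ℝ (fun z => h (S z)) y = (fderiv ℝ h (S y)).comp (fderiv ℝ S y) :=
    (hh.hasFDerivAt.comp y hS.hasFDerivAt).fderiv
  conv_lhs => unfold pd
  rw [e, ContinuousLinearMap.comp_apply, fderiv_apply_eq_sum]
  simp only [jacMat_eq hS]

lemma jacMat_comp {R S : Coord 2 → Coord 2} (hR : DifferentiableAt ℝ R (S y))
    (hS : DifferentiableAt ℝ S y) :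
    jacMat (fun z => R (S z)) y = jacMat R (S y) * jacMat S y := by
  ext a b
  rw [Matrix.mul_apply]
  exact pd_comp (differentiableAt_coord hR a) hS b

lemma det_fderiv {S : Coord 2 → Coord 2} (h : DifferentiableAt ℝ S y) :
    (fderiv ℝ S y).det = (jacMat S y).det := by
  rw [ContinuousLinearMap.det,
    ← LinearMap.det_toMatrix (EuclideanSpace.basisFun (Fin 2) ℝ).toBasis]
  congr 1
  ext a b
  rw [LinearMap.toMatrix_apply, jacMat_eq h]
  simp

lemma IsC11Diffeo.jacMat_symm_mul (H : IsC11Diffeo T) (hy : y ∈ T.source) :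
    jacMat T.symm (T y) * jacMat T y = 1 := by
  rw [← jacMat_comp (H.symm.differentiableAt (T.map_source hy)) (H.differentiableAt hy)]
  ext a b
  have h : (fun z => T.symm (T z) a) =ᶠ[𝓝 y] fun z => z a := by
    filter_upwards [T.open_source.mem_nhds hy] with z hz
    rw [T.left_inv hz]
  unfold jacMat
  rw [pd_congr h, pd_coord, Matrix.one_apply]
  exact if_congr eq_comm rfl rfl

lemma IsC11Diffeo.jacMat_mul_symm (H : IsC11Diffeo T) (hy : y ∈ T.source) :
    jacMat T y * jacMat T.symm (T y) = 1 :=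
  mul_eq_one_comm.1 (H.jacMat_symm_mul hy)

lemma IsC11Diffeo.det_symm_mul (H : IsC11Diffeo T) (hy : y ∈ T.source) :
    (jacMat T.symm (T y)).det * (jacMat T y).det = 1 := by
  rw [← Matrix.det_mul, H.jacMat_symm_mul hy, Matrix.det_one]

lemma IsC11Diffeo.det_ne_zero (H : IsC11Diffeo T) (hy : y ∈ T.source) : (jacMat T y).det ≠ 0 :=
  right_ne_zero_of_mul_eq_one (H.det_symm_mul hy)

lemma IsC11Diffeo.locallyLipschitzOn_jacMat (H : IsC11Diffeo T) (a b : Fin 2) :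
    LocallyLipschitzOn T.source fun y => jacMat T y a b := by
  have hL : LocallyLipschitzOn univ fun A : Coord 2 →L[ℝ] Coord 2 =>
      A (EuclideanSpace.single b 1) a := by
    refine locallyLipschitzOn_of_contDiffOn isOpen_univ (ContDiff.contDiffOn ?_)
    exact (EuclideanSpace.proj a : Coord 2 →L[ℝ] ℝ).contDiff.comp
      (ContinuousLinearMap.apply ℝ (Coord 2) (EuclideanSpace.single b (1 : ℝ))).contDiff
  exact locallyLipschitzOn_congr (locallyLipschitzOn_comp hL H.lipschitz (mapsTo_univ _ _))
    fun y hy => jacMat_eq (H.differentiableAt hy) a b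

lemma IsC11Diffeo.locallyLipschitzOn (H : IsC11Diffeo T) : LocallyLipschitzOn T.source T :=
  locallyLipschitzOn_of_contDiffOn T.open_source H.contDiffOn

lemma IsC11Diffeo.locallyLipschitzOn_det (H : IsC11Diffeo T) :
    LocallyLipschitzOn T.source fun y => (jacMat T y).det := by
  simp only [Matrix.det_fin_two]
  exact locallyLipschitzOn_sub
    (locallyLipschitzOn_mul (H.locallyLipschitzOn_jacMat 0 0) (H.locallyLipschitzOn_jacMat 1 1))
    (locallyLipschitzOn_mul (H.locallyLipschitzOn_jacMat 0 1) (H.locallyLipschitzOn_jacMat 1 0))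

/-- Null sets are transported by a `C¹` diffeomorphism. -/
lemma IsC11Diffeo.ae_comp (H : IsC11Diffeo T) {P : Coord 2 → Prop} {s : Set (Coord 2)}
    (hs : MeasurableSet s) (hsT : s ⊆ T.target)
    (h : ∀ᵐ x ∂(volume.restrict s), P x) :
    ∀ᵐ y ∂(volume : Measure (Coord 2)), y ∈ T.source → T y ∈ s → P (T y) := by
  rw [ae_restrict_iff' hs, ae_iff] at h
  rw [ae_iff]
  have hd : DifferentiableOn ℝ T.symm {x | ¬(x ∈ s → P x)} := fun x hx => by
    have hxs : x ∈ s := by by_contra h'; exact hx fun h => absurd h h'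
    exact (H.symm.differentiableAt (hsT hxs)).differentiableWithinAt
  refine measure_mono_null (fun y hy => ?_)
    (addHaar_image_eq_zero_of_differentiableOn_of_addHaar_eq_zero volume hd h)
  simp only [mem_ofPred_eq, Classical.not_imp] at hy
  exact ⟨T y, by simpa using! ⟨hy.2.1, hy.2.2⟩, T.left_inv hy.1⟩

lemma IsC11Diffeo.ae_comp_target (H : IsC11Diffeo T) {P : Coord 2 → Prop}
    (h : ∀ᵐ x ∂(volume.restrict T.target), P x) :
    ∀ᵐ y ∂(volume.restrict T.source), P (T y) := by
  rw [ae_restrict_iff' T.open_source.measurableSet]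
  exact (H.ae_comp T.open_target.measurableSet subset_rfl h).mono fun y hy hys =>
    hy hys (T.map_source hys)

lemma IsC11Diffeo.aemeasurable_comp (H : IsC11Diffeo T) {w : Coord 2 → ℝ}
    (hw : AEMeasurable w (volume.restrict T.target)) :
    AEMeasurable (fun y => w (T y)) (volume.restrict T.source) := by
  have hT : AEMeasurable T (volume.restrict T.source) :=
    T.continuousOn.aemeasurable T.open_source.measurableSet
  exact (hw.measurable_mk.comp_aemeasurable hT).congr
    ((H.ae_comp_target hw.ae_eq_mk).mono fun _ hy => hy.symm)

section ChangeOfVariables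

variable (H : IsC11Diffeo T)
include H

lemma IsC11Diffeo.hasFDerivWithinAt {s : Set (Coord 2)} (hs : s ⊆ T.source) :
    ∀ y ∈ s, HasFDerivWithinAt T (fderiv ℝ T y) s y := fun _ hy =>
  (H.differentiableAt (hs hy)).hasFDerivAt.hasFDerivWithinAt

lemma IsC11Diffeo.integral_comp {h : Coord 2 → ℝ} :
    ∫ x in T.target, h x = ∫ y in T.source, |(jacMat T y).det| * h (T y) := by
  rw [← T.image_source_eq_target, integral_image_eq_integral_abs_det_fderiv_smul volume
    T.open_source.measurableSet (H.hasFDerivWithinAt subset_rfl) T.injOn]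
  refine setIntegral_congr_fun T.open_source.measurableSet fun y hy => ?_
  simp only [det_fderiv (H.differentiableAt hy), smul_eq_mul]

lemma IsC11Diffeo.integrableOn_comp {h : Coord 2 → ℝ} {s : Set (Coord 2)} (hs : MeasurableSet s)
    (hsT : s ⊆ T.source) : IntegrableOn h (T '' s) ↔
      IntegrableOn (fun y => |(jacMat T y).det| * h (T y)) s := by
  rw [integrableOn_image_iff_integrableOn_abs_det_fderiv_smul volume hs
    (H.hasFDerivWithinAt hsT) (T.injOn.mono hsT)]
  refine integrableOn_congr_fun (fun y hy => ?_) hs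
  simp only [det_fderiv (H.differentiableAt (hsT hy)), smul_eq_mul]

lemma IsC11Diffeo.lintegral_comp {h : Coord 2 → ENNReal} {s : Set (Coord 2)} (hs : MeasurableSet s)
    (hsT : s ⊆ T.source) :
    ∫⁻ x in T '' s, h x = ∫⁻ y in s, ENNReal.ofReal |(jacMat T y).det| * h (T y) := by
  rw [lintegral_image_eq_lintegral_abs_det_fderiv_mul volume hs
    (H.hasFDerivWithinAt hsT) (T.injOn.mono hsT)]
  refine setLIntegral_congr_fun hs fun y hy => ?_
  simp only [det_fderiv (H.differentiableAt (hsT hy))]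

lemma IsC11Diffeo.locallyIntegrableOn_comp {h : Coord 2 → ℝ} (hh : LocallyIntegrableOn h T.target) :
    LocallyIntegrableOn (fun y => h (T y)) T.source := by
  rw [locallyIntegrableOn_iff T.open_source.isLocallyClosed]
  intro K hK hKc
  have h1 : IntegrableOn h (T '' K) := hh.integrableOn_compact_subset
    (by rintro _ ⟨y, hy, rfl⟩; exact T.map_source (hK hy))
    (hKc.image_of_continuousOn (T.continuousOn.mono hK))
  rw [H.integrableOn_comp hKc.measurableSet hK] at h1
  have hcont : ContinuousOn (fun y => |(jacMat T y).det|⁻¹) K :=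
    ((H.locallyLipschitzOn_det.continuousOn.mono hK).abs).inv₀ fun y hy =>
      abs_ne_zero.2 (H.det_ne_zero (hK hy))
  refine (h1.continuousOn_mul hcont hKc).congr_fun (fun y hy => ?_) hKc.measurableSet
  have := abs_ne_zero.2 (H.det_ne_zero (hK hy))
  simp only
  field_simp

end ChangeOfVariables

/-- Almost everywhere the entries of the Jacobian matrix are differentiable, and the second
derivatives are symmetric. -/
lemma IsC11Diffeo.ae_differentiableAt_jacMat (H : IsC11Diffeo T) :
    ∀ᵐ y ∂(volume.restrict T.source), (∀ a b, DifferentiableAt ℝ (fun z => jacMat T z a b) y) ∧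
      ∀ a j k, pd j (fun z => jacMat T z a k) y = pd k (fun z => jacMat T z a j) y := by
  filter_upwards [ae_differentiableAt_of_locallyLipschitzOn T.open_source H.lipschitz,
    ae_restrict_mem T.open_source.measurableSet] with y hd hy
  have hloc : ∀ᶠ z in 𝓝 y, z ∈ T.source := T.open_source.mem_nhds hy
  have hev : ∀ a b, (fun z => jacMat T z a b) =ᶠ[𝓝 y]
      fun z => fderiv ℝ T z (EuclideanSpace.single b 1) a := fun a b =>
    hloc.mono fun z hz => jacMat_eq (H.differentiableAt hz) a b
  have hder : ∀ a b, HasFDerivAt (fun z => fderiv ℝ T z (EuclideanSpace.single b 1) a)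
      ((EuclideanSpace.proj a : Coord 2 →L[ℝ] ℝ).comp
        ((ContinuousLinearMap.apply ℝ (Coord 2) (EuclideanSpace.single b (1 : ℝ))).comp
          (fderiv ℝ (fderiv ℝ T) y))) y := fun a b =>
    (hasFDerivAt_coord a _).comp y
      ((ContinuousLinearMap.apply ℝ (Coord 2) (EuclideanSpace.single b (1 : ℝ))).hasFDerivAt.comp y
        hd.hasFDerivAt)
  have hpd : ∀ a j k, pd j (fun z => jacMat T z a k) y =
      fderiv ℝ (fderiv ℝ T) y (EuclideanSpace.single j 1) (EuclideanSpace.single k 1) a :=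
    fun a j k => by
      rw [pd_congr (hev a k)]
      unfold pd
      rw [(hder a k).fderiv]
      rfl
  refine ⟨fun a b => (hder a b).differentiableAt.congr_of_eventuallyEq (hev a b), fun a j k => ?_⟩
  rw [hpd, hpd, second_derivative_symmetric_of_eventually
    (hloc.mono fun z hz => (H.differentiableAt hz).hasFDerivAt) hd.hasFDerivAt]

end Diffeo

/-! ### The chain rule for weak gradients -/

section ChainRule

variable {Ω : Set (Coord 2)} {w f g : Coord 2 → ℝ} {T : OpenPartialHomeomorph (Coord 2) (Coord 2)}

lemma IsLipTest.integrable_mul (hf : IsLipTest f Ω) (hw : LocallyIntegrableOn w Ω) :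
    Integrable fun x => w x * f x := by
  obtain ⟨B, hB⟩ := hf.exists_abs_le
  exact LocallyIntegrableOn.integrable_mul_test hw hf.2.1.isCompact hf.2.2 hf.continuous.measurable
    hB fun x hx => image_eq_zero_of_notMem_tsupport hx

lemma IsLipTest.integrable_mul_pd (hf : IsLipTest f Ω) (hw : LocallyIntegrableOn w Ω) (k : Fin 2) :
    Integrable fun x => w x * pd k f x := by
  obtain ⟨B, hB⟩ := hf.exists_abs_pd_le
  exact LocallyIntegrableOn.integrable_mul_test hw hf.2.1.isCompact hf.2.2 measurable_pd
    (hB k) fun x hx => pd_eq_zero_of_notMem hx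

lemma locallyIntegrableOn_pd (hΩ : IsOpen Ω) (hg : LocallyLipschitzOn Ω g) (k : Fin 2) :
    LocallyIntegrableOn (pd k g) Ω := by
  refine locallyIntegrableOn_of_local fun x hx => ?_
  obtain ⟨C, t, ht, hC⟩ := hg hx
  rw [hΩ.nhdsWithin_eq hx] at ht
  obtain ⟨r, hr, hrt⟩ := Metric.mem_nhds_iff.1 ht
  refine ⟨Metric.ball x r, Metric.isOpen_ball, Metric.mem_ball_self hr, ?_⟩
  refine IntegrableOn.locallyIntegrableOn ?_
  refine Integrable.mono' (g := fun _ => (C : ℝ)) (integrableOn_const measure_ball_lt_top.ne)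
    measurable_pd.aestronglyMeasurable ?_
  filter_upwards [ae_restrict_mem measurableSet_ball] with y hy
  have h1 := norm_fderiv_le_of_lipschitzOn ℝ (Metric.isOpen_ball.mem_nhds hy) (hC.mono hrt)
  calc ‖pd k g y‖ ≤ ‖fderiv ℝ g y‖ * ‖(EuclideanSpace.single k (1 : ℝ) : Coord 2)‖ :=
        (fderiv ℝ g y).le_opNorm _
    _ ≤ C := by simpa using h1

lemma isWeakGradientOn_of_locallyLipschitzOn (hΩ : IsOpen Ω) (hg : LocallyLipschitzOn Ω g) :
    IsWeakGradientOn g (fun k => pd k g) Ω := by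
  rw [isWeakGradientOn_iff]
  exact ⟨hg.continuousOn.locallyIntegrableOn hΩ.measurableSet,
    fun k => locallyIntegrableOn_pd hΩ hg k, fun k f hf hc hs =>
    integral_mul_pd_of_locallyLipschitzOn hΩ (isLipTest_of_contDiff hf hc hs) hg⟩

/-- A compactly supported Lipschitz function on the source of `T`, transported to the target. -/
lemma IsC11Diffeo.isLipTest_comp_symm (H : IsC11Diffeo T) (hf : IsLipTest f T.source) :
    IsLipTest (T.target.indicator fun x => f (T.symm x)) T.target := by
  have hKc : IsCompact (T '' tsupport f) :=
    hf.2.1.isCompact.image_of_continuousOn (T.continuousOn.mono hf.2.2)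
  have hsub : tsupport (T.target.indicator fun x => f (T.symm x)) ⊆ T '' tsupport f := by
    refine closure_minimal (fun x hx => ?_) hKc.isClosed
    have hxT : x ∈ T.target := by
      by_contra h; exact hx (indicator_of_notMem h _)
    rw [Function.mem_support, indicator_of_mem hxT] at hx
    exact ⟨T.symm x, subset_tsupport _ hx, T.right_inv hxT⟩
  refine isLipTest_of_locallyLipschitzOn T.open_target ?_
    (hKc.of_isClosed_subset (isClosed_tsupport _) hsub) (hsub.trans ?_)
  · exact locallyLipschitzOn_congr (locallyLipschitzOn_comp (hf.locallyLipschitzOn univ)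
      H.symm.locallyLipschitzOn (mapsTo_univ _ _))
      fun x hx => indicator_of_mem hx _
  · rintro _ ⟨y, hy, rfl⟩
    exact T.map_source (hf.2.2 hy)

lemma jac_mul_det_eq_adjugate {A B : Matrix (Fin 2) (Fin 2) ℝ} (h : B * A = 1) (a k : Fin 2) :
    B a k * A.det = A.adjugate a k := by
  have e : A.adjugate = A.det • B := by
    calc A.adjugate = (B * A) * A.adjugate := by rw [h, one_mul]
      _ = A.det • B := by rw [mul_assoc, Matrix.mul_adjugate, Matrix.mul_smul, mul_one]
  rw [e, Matrix.smul_apply, smul_eq_mul, mul_comm]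

/-- The sign of a continuous non-vanishing function is locally constant. -/
lemma exists_sign_eventually {d : Coord 2 → ℝ} {x : Coord 2} (hd : ContinuousAt d x)
    (h0 : d x ≠ 0) : ∃ s : ℝ, ∀ᶠ z in 𝓝 x, |d z| = s * d z := by
  rcases h0.lt_or_gt with h | h
  · exact ⟨-1, (hd.eventually_lt_const h).mono fun z hz => by rw [abs_of_neg hz]; ring⟩
  · exact ⟨1, (hd.eventually_const_lt h).mono fun z hz => by rw [abs_of_pos hz]; ring⟩

/-- The Piola identity: the columns of the cofactor matrix are divergence free. -/
lemma IsC11Diffeo.sum_pd_cofactor (H : IsC11Diffeo T) (hf : ContDiff ℝ ∞ f) {x : Coord 2}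
    (hx : x ∈ T.target)
    (hd : ∀ a b, DifferentiableAt ℝ (fun z => jacMat T.symm z a b) x)
    (hs : ∀ a j k, pd j (fun z => jacMat T.symm z a k) x = pd k (fun z => jacMat T.symm z a j) x)
    (k : Fin 2) :
    ∑ a, pd a (fun z => T.target.indicator (fun x => f (T.symm x)) z *
      (jacMat T (T.symm z) a k * |(jacMat T.symm z).det|)) x =
      |(jacMat T.symm x).det| * pd k f (T.symm x) := by
  have hdet : ContinuousAt (fun z => (jacMat T.symm z).det) x :=
    (H.symm.locallyLipschitzOn_det.continuousOn).continuousAt (T.open_target.mem_nhds hx)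
  obtain ⟨s, hsg⟩ := exists_sign_eventually hdet (H.symm.det_ne_zero hx)
  have hinv : ∀ z ∈ T.target, jacMat T (T.symm z) * jacMat T.symm z = 1 := fun z hz => by
    simpa using! H.symm.jacMat_symm_mul hz
  have hev : ∀ a, (fun z => T.target.indicator (fun x => f (T.symm x)) z *
      (jacMat T (T.symm z) a k * |(jacMat T.symm z).det|)) =ᶠ[𝓝 x]
      fun z => f (T.symm z) * (s * (jacMat T.symm z).adjugate a k) := fun a => by
    filter_upwards [hsg, T.open_target.mem_nhds hx] with z hz hzT
    rw [indicator_of_mem hzT, hz, ← jac_mul_det_eq_adjugate (hinv z hzT)]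
    ring
  have hS : DifferentiableAt ℝ T.symm x := H.symm.differentiableAt hx
  have hfd : DifferentiableAt ℝ f (T.symm x) := hf.differentiable (by simp) _
  have hcomp : DifferentiableAt ℝ (fun z => f (T.symm z)) x := hfd.comp x hS
  simp only [pd_congr (hev _)]
  rw [hsg.self_of_nhds]
  have hd' : ∀ a, DifferentiableAt ℝ (fun z => (jacMat T.symm z).adjugate a k) x := fun a => by
    simp only [Matrix.adjugate_fin_two]
    fin_cases a <;> fin_cases k <;> simp [hd]
  have hpd : ∀ a, pd a (fun z => f (T.symm z) * (s * (jacMat T.symm z).adjugate a k)) x =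
      f (T.symm x) * (s * pd a (fun z => (jacMat T.symm z).adjugate a k) x) +
        (∑ b, pd b f (T.symm x) * jacMat T.symm x b a) * (s * (jacMat T.symm x).adjugate a k) :=
    fun a => by
      rw [pd_mul hcomp ((hd' a).const_mul s), pd_const_mul s (hd' a), pd_comp hfd hS]
  simp only [hpd, Fin.sum_univ_two]
  simp only [Matrix.adjugate_fin_two, Matrix.det_fin_two]
  have s0 := hs 1 0 1
  have s1 := hs 0 0 1
  fin_cases k
  · simp [pd_neg, s0]
    ring
  · simp [pd_neg, s1]
    ring

/-- The chain rule for the weak gradient under a `C^{1,1}` change of variables. -/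
lemma IsWeakGradientOn.comp {φ : Coord 2 → ℝ} {D : Fin 2 → Coord 2 → ℝ} (H : IsC11Diffeo T)
    (hD : IsWeakGradientOn φ D T.target) :
    IsWeakGradientOn (fun y => φ (T y)) (fun k y => ∑ a, jacMat T y a k * D a (T y)) T.source := by
  rw [isWeakGradientOn_iff]
  refine ⟨H.locallyIntegrableOn_comp hD.1, fun k => ?_, fun k f hf hc hs => ?_⟩
  · have h : ∀ a, LocallyIntegrableOn (fun y => jacMat T y a k * D a (T y)) T.source := fun a =>
      (H.locallyIntegrableOn_comp (hD.2.1 a)).continuousOn_mul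
        (H.locallyLipschitzOn_jacMat a k).continuousOn T.open_source.isLocallyClosed
    simp only [Fin.sum_univ_two]
    exact (h 0).add (h 1)
  -- test functions on the target, given by the cofactors of the inverse map; their divergence is
  -- the density-weighted derivative of `f`, by the Piola identity
  set G : Fin 2 → Coord 2 → ℝ := fun a z => T.target.indicator (fun x => f (T.symm x)) z *
      (jacMat T (T.symm z) a k * |(jacMat T.symm z).det|) with hGdef
  have hft := isLipTest_of_contDiff hf hc hs
  have hG : ∀ a, IsLipTest (G a) T.target := fun a =>
    (H.isLipTest_comp_symm hft).mul T.open_target (locallyLipschitzOn_mul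
      (locallyLipschitzOn_comp (H.locallyLipschitzOn_jacMat a k) H.symm.locallyLipschitzOn
        T.symm.mapsTo) (locallyLipschitzOn_abs H.symm.locallyLipschitzOn_det))
  have hf0 : ∀ y, y ∉ T.source → f y = 0 := fun y hy =>
    image_eq_zero_of_notMem_tsupport fun h => hy (hs h)
  have hfk0 : ∀ y, y ∉ T.source → pd k f y = 0 := fun y hy => pd_eq_zero_of_notMem fun h => hy (hs h)
  have hGk0 : ∀ a x, x ∉ T.target → pd a (G a) x = 0 := fun a x hx =>
    pd_eq_zero_of_notMem fun h => hx ((hG a).2.2 h)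
  have e1 : ∫ y, φ (T y) * pd k f y = ∑ a, ∫ x, φ x * pd a (G a) x := by
    rw [← integral_finsetSum _ fun a _ => (hG a).integrable_mul_pd hD.1 a,
      ← setIntegral_eq_of_tsupport (Ω := T.source) fun y hy => by rw [hfk0 y hy, mul_zero],
      ← setIntegral_eq_of_tsupport (Ω := T.target) fun x hx => by simp [hGk0 _ x hx]]
    have := H.symm.integral_comp (h := fun y => φ (T y) * pd k f y)
    rw [show T.symm.target = T.source from rfl] at this
    rw [this]
    refine integral_congr_ae ?_
    filter_upwards [H.symm.ae_differentiableAt_jacMat,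
      ae_restrict_mem T.open_target.measurableSet] with x hx hxT
    rw [← Finset.mul_sum, H.sum_pd_cofactor hf hxT hx.1 hx.2 k, T.right_inv hxT]
    ring
  have e2 : ∫ y, (∑ a, jacMat T y a k * D a (T y)) * f y = ∑ a, ∫ x, D a x * G a x := by
    rw [← integral_finsetSum _ fun a _ => (hG a).integrable_mul (hD.2.1 a),
      ← setIntegral_eq_of_tsupport (Ω := T.source) fun y hy => by rw [hf0 y hy, mul_zero],
      ← setIntegral_eq_of_tsupport (Ω := T.target) fun x hx => by
        simp [hGdef, indicator_of_notMem hx]]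
    have := H.symm.integral_comp (h := fun y => (∑ a, jacMat T y a k * D a (T y)) * f y)
    rw [show T.symm.target = T.source from rfl] at this
    rw [this]
    refine setIntegral_congr_fun T.open_target.measurableSet fun x hxT => ?_
    have hi : T.target.indicator (fun x => f (T.symm x)) x = f (T.symm x) := indicator_of_mem hxT _
    simp only [hGdef, hi, Fin.sum_univ_two, T.right_inv hxT]
    ring
  rw [e1, e2, ← Finset.sum_neg_distrib]
  exact Finset.sum_congr rfl fun a _ => hD.integral_mul_pd T.open_target (hG a)

end ChainRule

/-! ### Conformal changes of coordinates -/

section Conformal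

variable {T : OpenPartialHomeomorph (Coord 2) (Coord 2)} {y : Coord 2} {f : Coord 2 → ℝ}

/-- The Jacobian matrix of `T` is conformal at every point: `Jᵀ J = |det J| · 1`. -/
def IsConformal (T : OpenPartialHomeomorph (Coord 2) (Coord 2)) : Prop :=
  ∀ y ∈ T.source, (jacMat T y).transpose * jacMat T y =
    |(jacMat T y).det| • (1 : Matrix (Fin 2) (Fin 2) ℝ)

/-- The logarithm of the conformal factor. -/
noncomputable def logFactor (T : Coord 2 → Coord 2) (y : Coord 2) : ℝ :=
  1 / 2 * Real.log |(jacMat T y).det|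

lemma IsC11Diffeo.locallyLipschitzOn_logFactor (H : IsC11Diffeo T) :
    LocallyLipschitzOn T.source (logFactor T) :=
  locallyLipschitzOn_mul (locallyLipschitzOn_const _) (locallyLipschitzOn_log
    (locallyLipschitzOn_abs H.locallyLipschitzOn_det) fun _ hy => abs_ne_zero.2 (H.det_ne_zero hy))

/-- A matrix with `Aᵀ A = |det A| · 1` is a similarity, either direct or indirect. -/
lemma conformal_entries {A : Matrix (Fin 2) (Fin 2) ℝ} (h : A.transpose * A = |A.det| • 1) {s : ℝ}
    (hs : s * s = 1) (hd : |A.det| = s * A.det) :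
    A 0 1 = -s * A 1 0 ∧ A 1 1 = s * A 0 0 ∧ |A.det| = A 0 0 ^ 2 + A 1 0 ^ 2 := by
  have h00 := congr_fun (congr_fun h 0) 0
  have h11 := congr_fun (congr_fun h 1) 1
  simp only [Matrix.mul_apply, Matrix.transpose_apply, Fin.sum_univ_two, Matrix.smul_apply,
    Matrix.one_apply_eq, smul_eq_mul, mul_one] at h00 h11
  have hdet := Matrix.det_fin_two A
  have key : (A 1 1 - s * A 0 0) ^ 2 + (A 0 1 + s * A 1 0) ^ 2 = 0 := by
    rw [hd, hdet] at h00 h11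
    linear_combination h00 + h11 + (A 0 0 ^ 2 + A 1 0 ^ 2) * hs
  have k1 : A 1 1 - s * A 0 0 = 0 := by
    nlinarith [sq_nonneg (A 1 1 - s * A 0 0), sq_nonneg (A 0 1 + s * A 1 0)]
  have k2 : A 0 1 + s * A 1 0 = 0 := by
    nlinarith [sq_nonneg (A 1 1 - s * A 0 0), sq_nonneg (A 0 1 + s * A 1 0)]
  exact ⟨by linarith, by linarith, by linarith⟩

/-- First-order facts about a conformal map `T` at a point where its Jacobian matrix `J` is
differentiable: with `p = J 0 0`, `q = J 1 0` and `s = ±1` the sign of `det J`, the other two entries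
are `-s q` and `s p`, and `(p, q)` obeys the Cauchy–Riemann equations. -/
structure ConformalAt (T : Coord 2 → Coord 2) (y : Coord 2) (s : ℝ) : Prop where
  sign : s * s = 1
  entry01 : jacMat T y 0 1 = -s * jacMat T y 1 0
  entry11 : jacMat T y 1 1 = s * jacMat T y 0 0
  pos : 0 < jacMat T y 0 0 ^ 2 + jacMat T y 1 0 ^ 2
  diff : ∀ a b, DifferentiableAt ℝ (fun z => jacMat T z a b) y
  pd01 : ∀ k, pd k (fun z => jacMat T z 0 1) y = -s * pd k (fun z => jacMat T z 1 0) y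
  pd11 : ∀ k, pd k (fun z => jacMat T z 1 1) y = s * pd k (fun z => jacMat T z 0 0) y
  cr0 : pd 1 (fun z => jacMat T z 0 0) y = -s * pd 0 (fun z => jacMat T z 1 0) y
  cr1 : pd 1 (fun z => jacMat T z 1 0) y = s * pd 0 (fun z => jacMat T z 0 0) y
  pd_logFactor : ∀ k, pd k (logFactor T) y =
    (jacMat T y 0 0 * pd k (fun z => jacMat T z 0 0) y +
      jacMat T y 1 0 * pd k (fun z => jacMat T z 1 0) y) /
      (jacMat T y 0 0 ^ 2 + jacMat T y 1 0 ^ 2)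

/-- A conformal `C^{1,1}` change of variables satisfies the first-order relations of `ConformalAt` almost
everywhere: the Cauchy–Riemann equations for the first column of the Jacobian matrix follow from the
symmetry of the second derivatives. -/
lemma IsConformal.ae_conformalAt (hc : IsConformal T) (H : IsC11Diffeo T) :
    ∀ᵐ y ∂(volume.restrict T.source), ∃ s, ConformalAt T y s := by
  filter_upwards [H.ae_differentiableAt_jacMat, ae_restrict_mem T.open_source.measurableSet]
    with y ⟨hd, hsym⟩ hy
  have hdet : ContinuousAt (fun z => (jacMat T z).det) y :=
    (H.locallyLipschitzOn_det.continuousOn).continuousAt (T.open_source.mem_nhds hy)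
  have hd0 := H.det_ne_zero hy
  obtain ⟨s, hs⟩ := exists_sign_eventually hdet hd0
  have hss : s * s = 1 := by
    have h1 := hs.self_of_nhds
    have h2 : (s * s - 1) * ((jacMat T y).det * (jacMat T y).det) = 0 := by
      have := abs_mul_abs_self (jacMat T y).det
      rw [h1] at this
      linear_combination this
    rcases mul_eq_zero.1 h2 with h | h
    · linarith
    · exact absurd (mul_self_eq_zero.1 h) hd0
  have hloc : ∀ᶠ z in 𝓝 y, jacMat T z 0 1 = -s * jacMat T z 1 0 ∧
      jacMat T z 1 1 = s * jacMat T z 0 0 ∧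
      |(jacMat T z).det| = jacMat T z 0 0 ^ 2 + jacMat T z 1 0 ^ 2 := by
    filter_upwards [hs, T.open_source.mem_nhds hy] with z hz hzT
    exact conformal_entries (hc z hzT) hss hz
  obtain ⟨h01, h11, habs⟩ := hloc.self_of_nhds
  have hpos : 0 < jacMat T y 0 0 ^ 2 + jacMat T y 1 0 ^ 2 := by
    rw [← habs]; exact abs_pos.2 hd0
  have p01 : ∀ k, pd k (fun z => jacMat T z 0 1) y = -s * pd k (fun z => jacMat T z 1 0) y :=
    fun k => by
      rw [pd_congr (hloc.mono fun z hz => hz.1), pd_const_mul _ (hd 1 0)]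
  have p11 : ∀ k, pd k (fun z => jacMat T z 1 1) y = s * pd k (fun z => jacMat T z 0 0) y :=
    fun k => by
      rw [pd_congr (hloc.mono fun z hz => hz.2.1), pd_const_mul _ (hd 0 0)]
  refine ⟨s, hss, h01, h11, hpos, hd, p01, p11, ?_, ?_, fun k => ?_⟩
  · rw [hsym 0 1 0, p01]
  · rw [hsym 1 1 0, p11]
  · have e : logFactor T =ᶠ[𝓝 y] fun z => 1 / 2 * Real.log
        (jacMat T z 0 0 * jacMat T z 0 0 + jacMat T z 1 0 * jacMat T z 1 0) :=
      hloc.mono fun z hz => by simp only [logFactor, hz.2.2, sq]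
    have hpos' : 0 < jacMat T y 0 0 * jacMat T y 0 0 + jacMat T y 1 0 * jacMat T y 1 0 := by
      simpa [sq] using hpos
    have hq : DifferentiableAt ℝ (fun z => jacMat T z 0 0 * jacMat T z 0 0 +
        jacMat T z 1 0 * jacMat T z 1 0) y :=
      ((hd 0 0).mul (hd 0 0)).add ((hd 1 0).mul (hd 1 0))
    have hlog : pd k (fun z => Real.log
        (jacMat T z 0 0 * jacMat T z 0 0 + jacMat T z 1 0 * jacMat T z 1 0)) y =
        (jacMat T y 0 0 * jacMat T y 0 0 + jacMat T y 1 0 * jacMat T y 1 0)⁻¹ *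
        pd k (fun z => jacMat T z 0 0 * jacMat T z 0 0 + jacMat T z 1 0 * jacMat T z 1 0) y := by
      unfold pd
      rw [(hq.hasFDerivAt.log hpos'.ne').fderiv]
      rfl
    rw [pd_congr e, pd_const_mul _ (hq.log hpos'.ne'), hlog,
      pd_add ((hd 0 0).fun_mul (hd 0 0)) ((hd 1 0).fun_mul (hd 1 0)), pd_mul (hd 0 0) (hd 0 0),
      pd_mul (hd 1 0) (hd 1 0), eq_div_iff hpos.ne', sq, sq]
    field_simp
    ring

/-- The second derivatives of a conformal map: the transformation law of the Christoffel symbols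
of conformal metrics. -/
lemma ConformalAt.pd_jacMat {T : Coord 2 → Coord 2} {s : ℝ} (h : ConformalAt T y s)
    (a j k : Fin 2) :
    pd j (fun z => jacMat T z a k) y =
      ∑ i, jacMat T y a i * ((if i = j then pd k (logFactor T) y else 0) +
        (if i = k then pd j (logFactor T) y else 0) -
        if j = k then pd i (logFactor T) y else 0) := by
  have hp := h.pos.ne'
  have hs := h.sign
  simp only [Fin.sum_univ_two, h.pd_logFactor]
  fin_cases a <;> fin_cases j <;> fin_cases k <;>
    simp [h.pd01, h.pd11, h.cr0, h.cr1, h.entry01, h.entry11] <;> field_simp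
  all_goals
    have hs2 : s ^ 2 = 1 := by rw [sq, hs]
    try rw [hs2]
    ring

/-- The derivative of `f` in the direction of the gradient of the conformal factor is a sum of two
Jacobian determinants. -/
lemma ConformalAt.sum_pd_logFactor {T : Coord 2 → Coord 2} {s : ℝ} (h : ConformalAt T y s)
    (hf : DifferentiableAt ℝ f y) :
    ∑ k, pd k f y * pd k (logFactor T) y =
      (pd 0 (fun z => f z * (jacMat T z 0 0 * ((jacMat T z).det)⁻¹)) y *
          pd 1 (fun z => jacMat T z 1 0) y -
        pd 1 (fun z => f z * (jacMat T z 0 0 * ((jacMat T z).det)⁻¹)) y *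
          pd 0 (fun z => jacMat T z 1 0) y) -
      (pd 0 (fun z => f z * (jacMat T z 1 0 * ((jacMat T z).det)⁻¹)) y *
          pd 1 (fun z => jacMat T z 0 0) y -
        pd 1 (fun z => f z * (jacMat T z 1 0 * ((jacMat T z).det)⁻¹)) y *
          pd 0 (fun z => jacMat T z 0 0) y) := by
  have hp := h.pos.ne'
  have hs := h.sign
  have hs0 : s ≠ 0 := by rintro rfl; simp at hs
  have hdet : (jacMat T y).det = s * (jacMat T y 0 0 ^ 2 + jacMat T y 1 0 ^ 2) := by
    rw [Matrix.det_fin_two, h.entry01, h.entry11]; ring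
  have hd0 : (jacMat T y).det ≠ 0 := by rw [hdet]; exact mul_ne_zero hs0 hp
  have hdd : DifferentiableAt ℝ (fun z => (jacMat T z).det) y := by
    simp only [Matrix.det_fin_two]
    exact ((h.diff 0 0).mul (h.diff 1 1)).sub ((h.diff 0 1).mul (h.diff 1 0))
  have hpdet : ∀ k, pd k (fun z => (jacMat T z).det) y =
      s * (2 * (jacMat T y 0 0 * pd k (fun z => jacMat T z 0 0) y +
        jacMat T y 1 0 * pd k (fun z => jacMat T z 1 0) y)) := fun k => by
    simp only [Matrix.det_fin_two]
    rw [pd_sub ((h.diff 0 0).fun_mul (h.diff 1 1)) ((h.diff 0 1).fun_mul (h.diff 1 0)),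
      pd_mul (h.diff 0 0) (h.diff 1 1), pd_mul (h.diff 0 1) (h.diff 1 0), h.pd01, h.pd11,
      h.entry01, h.entry11]
    ring
  have hpinv : ∀ k, pd k (fun z => ((jacMat T z).det)⁻¹) y =
      -(((jacMat T y).det ^ 2)⁻¹) * pd k (fun z => (jacMat T z).det) y := fun k => by
    unfold pd
    have := ((hasDerivAt_inv hd0).comp_hasFDerivAt y hdd.hasFDerivAt).fderiv
    have e : fderiv ℝ (fun z => ((jacMat T z).det)⁻¹) y = _ := this
    rw [e]
    rfl
  have hI : DifferentiableAt ℝ (fun z => ((jacMat T z).det)⁻¹) y := hdd.inv hd0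
  have hG : ∀ k a, pd k (fun z => f z * (jacMat T z a 0 * ((jacMat T z).det)⁻¹)) y =
      f y * (jacMat T y a 0 * (-(((jacMat T y).det ^ 2)⁻¹) * pd k (fun z => (jacMat T z).det) y) +
        pd k (fun z => jacMat T z a 0) y * ((jacMat T y).det)⁻¹) +
      pd k f y * (jacMat T y a 0 * ((jacMat T y).det)⁻¹) := fun k a => by
    rw [pd_mul hf ((h.diff a 0).fun_mul hI), pd_mul (h.diff a 0) hI, hpinv]
  simp only [hG, hpdet, Fin.sum_univ_two, h.pd_logFactor, h.cr0, h.cr1, hdet]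
  generalize pd 0 (fun z => jacMat T z 0 0) y = p0
  generalize pd 0 (fun z => jacMat T z 1 0) y = q0
  generalize jacMat T y 0 0 = p at *
  generalize jacMat T y 1 0 = q at *
  field_simp
  linear_combination (p ^ 2 + q ^ 2) * pd 1 f y * (-(p * q0) + p0 * q) * hs

/-- The logarithm of the conformal factor is weakly harmonic. The change of variables is only `C^{1,1}`,
so the factor is merely Lipschitz and its Laplacian is not available pointwise; instead, the pairing
of its gradient with that of `f` is a difference of Jacobian determinants. -/
lemma IsConformal.integral_sum_pd_logFactor (hc : IsConformal T) (H : IsC11Diffeo T)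
    (hf : IsLipTest f T.source) : ∫ y, ∑ k, pd k f y * pd k (logFactor T) y = 0 := by
  have hG : ∀ a, IsLipTest (fun z => f z * (jacMat T z a 0 * ((jacMat T z).det)⁻¹)) T.source :=
    fun a => hf.mul T.open_source (locallyLipschitzOn_mul (H.locallyLipschitzOn_jacMat a 0)
      (locallyLipschitzOn_inv H.locallyLipschitzOn_det fun y hy => H.det_ne_zero hy))
  have hint : ∀ a b, Integrable fun y =>
      (pd 0 (fun z => f z * (jacMat T z a 0 * ((jacMat T z).det)⁻¹)) y *
          pd 1 (fun z => jacMat T z b 0) y -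
        pd 1 (fun z => f z * (jacMat T z a 0 * ((jacMat T z).det)⁻¹)) y *
          pd 0 (fun z => jacMat T z b 0) y) := fun a b => by
    have h1 := fun j k => (hG a).integrable_mul_pd
      (locallyIntegrableOn_pd T.open_source (H.locallyLipschitzOn_jacMat b 0) j) k
    refine ((h1 1 0).sub (h1 0 1)).congr (ae_of_all _ fun y => ?_)
    simp only [Pi.sub_apply]
    ring
  have hz := fun a b => integral_jacobian_eq_zero T.open_source (hG a)
    (H.locallyLipschitzOn_jacMat b 0)
  rw [← setIntegral_eq_of_tsupport (Ω := T.source) fun y hy => by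
      simp [pd_eq_zero_of_notMem fun h => hy (hf.2.2 h)]]
  calc _ = ∫ y in T.source, ((pd 0 (fun z => f z * (jacMat T z 0 0 * ((jacMat T z).det)⁻¹)) y *
          pd 1 (fun z => jacMat T z 1 0) y -
        pd 1 (fun z => f z * (jacMat T z 0 0 * ((jacMat T z).det)⁻¹)) y *
          pd 0 (fun z => jacMat T z 1 0) y) -
      (pd 0 (fun z => f z * (jacMat T z 1 0 * ((jacMat T z).det)⁻¹)) y *
          pd 1 (fun z => jacMat T z 0 0) y -
        pd 1 (fun z => f z * (jacMat T z 1 0 * ((jacMat T z).det)⁻¹)) y *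
          pd 0 (fun z => jacMat T z 0 0) y)) := by
        refine integral_congr_ae ?_
        filter_upwards [hc.ae_conformalAt H, ae_differentiableAt_of_locallyLipschitzOn T.open_source
          (hf.locallyLipschitzOn _)] with y ⟨s, hs⟩ hfy
        exact hs.sum_pd_logFactor hfy
    _ = 0 := by
        rw [setIntegral_eq_of_tsupport fun y hy => by
          simp [pd_eq_zero_of_notMem fun h => hy ((hG _).2.2 h)],
          integral_sub (hint 0 1) (hint 1 0), hz, hz, sub_zero]

section Exponents

variable {φ φ' : Coord 2 → ℝ} {D D' : Fin 2 → Coord 2 → ℝ}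

/-- The transformation law of the gradient of the conformal exponent. -/
lemma IsC11Diffeo.ae_gradient_eq (H : IsC11Diffeo T) (hD : IsWeakGradientOn φ D T.source)
    (hD' : IsWeakGradientOn φ' D' T.target)
    (hφ : ∀ᵐ y ∂(volume.restrict T.source), φ y = φ' (T y) + logFactor T y) (k : Fin 2) :
    ∀ᵐ y ∂(volume.restrict T.source),
      D k y = (∑ a, jacMat T y a k * D' a (T y)) + pd k (logFactor T) y := by
  have h1 := (hD'.comp H).sub (isWeakGradientOn_of_locallyLipschitzOn T.open_source
    (locallyLipschitzOn_mul (locallyLipschitzOn_const (-1)) H.locallyLipschitzOn_logFactor))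
  have h2 := h1.congr_ae (φ' := φ) T.open_source (hφ.mono fun y hy => by rw [hy]; ring)
    (D' := fun k y => (∑ a, jacMat T y a k * D' a (T y)) + pd k (logFactor T) y) fun k => by
      filter_upwards [ae_differentiableAt_of_locallyLipschitzOn T.open_source
        H.locallyLipschitzOn_logFactor] with y hy
      rw [pd_const_mul _ hy]
      ring
  exact hD.ae_eq T.open_source h2 k

/-- The pairing of the gradient of the conformal exponent with the gradient of a test function does
not depend on the isothermal chart. -/
lemma IsConformal.integral_gradient_eq (hc : IsConformal T) (H : IsC11Diffeo T)
    (hD : IsWeakGradientOn φ D T.source) (hD' : IsWeakGradientOn φ' D' T.target)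
    (hφ : ∀ᵐ y ∂(volume.restrict T.source), φ y = φ' (T y) + logFactor T y)
    (hf : IsLipTest f T.source) :
    ∫ y, (D 0 y * pd 0 f y + D 1 y * pd 1 f y) =
      ∫ x, (D' 0 x * pd 0 (T.target.indicator fun x => f (T.symm x)) x +
        D' 1 x * pd 1 (T.target.indicator fun x => f (T.symm x)) x) := by
  set g := T.target.indicator fun x => f (T.symm x) with hg
  have hgt : IsLipTest g T.target := H.isLipTest_comp_symm hf
  have hpd0 : ∀ k y, y ∉ T.source → pd k f y = 0 := fun k y hy =>
    pd_eq_zero_of_notMem fun h => hy (hf.2.2 h)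
  have hpg0 : ∀ k x, x ∉ T.target → pd k g x = 0 := fun k x hx =>
    pd_eq_zero_of_notMem fun h => hx (hgt.2.2 h)
  have hL := hc.integral_sum_pd_logFactor H hf
  have hLi : Integrable fun y => ∑ k, pd k f y * pd k (logFactor T) y := by
    have h1 := fun k => hf.integrable_mul_pd
      (locallyIntegrableOn_pd T.open_source H.locallyLipschitzOn_logFactor k) k
    refine ((h1 0).add (h1 1)).congr (ae_of_all _ fun y => ?_)
    simp only [Pi.add_apply, Fin.sum_univ_two]
    ring
  have hDi : Integrable fun y => D 0 y * pd 0 f y + D 1 y * pd 1 f y :=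
    (hf.integrable_mul_pd (hD.2.1 0) 0).add (hf.integrable_mul_pd (hD.2.1 1) 1)
  -- the term of the conformal factor contributes nothing, as this factor is weakly harmonic
  have e1 : ∫ y, (D 0 y * pd 0 f y + D 1 y * pd 1 f y) =
      ∫ y, ((D 0 y * pd 0 f y + D 1 y * pd 1 f y) - ∑ k, pd k f y * pd k (logFactor T) y) := by
    rw [integral_sub hDi hLi, hL, sub_zero]
  rw [e1, ← setIntegral_eq_of_tsupport (Ω := T.source) fun y hy => by simp [hpd0 _ y hy],
    ← setIntegral_eq_of_tsupport (Ω := T.target) fun x hx => by simp [hpg0 _ x hx],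
    H.integral_comp]
  refine integral_congr_ae ?_
  filter_upwards [H.ae_gradient_eq hD hD' hφ 0, H.ae_gradient_eq hD hD' hφ 1,
    ae_differentiableAt_of_locallyLipschitzOn T.open_source (hf.locallyLipschitzOn _),
    ae_restrict_mem T.open_source.measurableSet] with y h0 h1 hfy hy
  have hgd : DifferentiableAt ℝ g (T y) := by
    have h2 : DifferentiableAt ℝ (fun x => f (T.symm x)) (T y) :=
      DifferentiableAt.comp (T y) (by rwa [T.left_inv hy])
        (H.symm.differentiableAt (T.map_source hy))
    refine h2.congr_of_eventuallyEq ?_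
    filter_upwards [T.open_target.mem_nhds (T.map_source hy)] with x hx
    exact indicator_of_mem hx _
  have hfg : ∀ k, pd k f y = ∑ a, pd a g (T y) * jacMat T y a k := fun k => by
    rw [← pd_comp hgd (H.differentiableAt hy)]
    refine pd_congr ?_
    filter_upwards [T.open_source.mem_nhds hy] with z hz
    rw [hg, indicator_of_mem (T.map_source hz), T.left_inv hz]
  -- the rows of the Jacobian matrix are orthogonal as well as its columns
  have hJ : jacMat T y * (jacMat T y).transpose = |(jacMat T y).det| • 1 := by
    have h3 := hc y hy
    have hne := abs_ne_zero.2 (H.det_ne_zero hy)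
    have h4 : (|(jacMat T y).det|⁻¹ • (jacMat T y).transpose) * jacMat T y = 1 := by
      rw [Matrix.smul_mul, h3, smul_smul, inv_mul_cancel₀ hne, one_smul]
    have h5 := mul_eq_one_comm.1 h4
    rw [Matrix.mul_smul] at h5
    rw [← h5, smul_smul, mul_inv_cancel₀ hne, one_smul]
  have j00 := congr_fun (congr_fun hJ 0) 0
  have j01 := congr_fun (congr_fun hJ 0) 1
  have j11 := congr_fun (congr_fun hJ 1) 1
  simp only [Matrix.mul_apply, Matrix.transpose_apply, Fin.sum_univ_two, Matrix.smul_apply,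
    Matrix.one_apply_eq, smul_eq_mul, mul_one] at j00 j11
  simp only [Matrix.mul_apply, Matrix.transpose_apply, Fin.sum_univ_two, Matrix.smul_apply,
    Matrix.one_apply, smul_eq_mul, Fin.zero_eq_one_iff, OfNat.ofNat_ne_one, if_false,
    mul_zero] at j01
  simp only [h0, h1, hfg, Fin.sum_univ_two]
  linear_combination (D' 0 (T y) * pd 0 g (T y)) * j00 + (D' 1 (T y) * pd 1 g (T y)) * j11 +
    (D' 0 (T y) * pd 1 g (T y) + D' 1 (T y) * pd 0 g (T y)) * j01

end Exponents

end Conformal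

/-! ### Transformation of connections and half-densities -/

section Transform

variable {M : Type*} [TopologicalSpace M] [ChartedSpace (Coord 2) M]

lemma IsC11Manifold.isC11Diffeo (hM : IsC11Manifold 2 M) (e e' : atlas (Coord 2) M) :
    IsC11Diffeo (chartTrans e e') where
  contDiffOn := (hM e e').1
  lipschitz := (hM e e').2
  contDiffOn_symm := (hM e' e).1
  lipschitz_symm := (hM e' e).2

lemma mem_chartTrans_source {e e' : atlas (Coord 2) M} {y : Coord 2} :
    y ∈ (chartTrans e e').source ↔ y ∈ e.1.target ∧ e.1.symm y ∈ e'.1.source := by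
  simp [chartTrans]

lemma chartTrans_source_subset (e e' : atlas (Coord 2) M) :
    (chartTrans e e').source ⊆ e.1.target := fun _ hy => (mem_chartTrans_source.1 hy).1

lemma chartTrans_target_subset (e e' : atlas (Coord 2) M) :
    (chartTrans e e').target ⊆ e'.1.target :=
  chartTrans_source_subset e' e

/-- Jacobi's formula for the derivative of the logarithm of the determinant. -/
lemma two_mul_pd_logFactor {T : Coord 2 → Coord 2} {y : Coord 2} {K : Matrix (Fin 2) (Fin 2) ℝ}
    (hd : ∀ a b, DifferentiableAt ℝ (fun z => jacMat T z a b) y)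
    (hK : K * jacMat T y = 1) (k : Fin 2) :
    DifferentiableAt ℝ (logFactor T) y ∧
    2 * pd k (logFactor T) y = ∑ i, ∑ a, K i a * pd k (fun z => jacMat T z a i) y := by
  have hdet : (jacMat T y).det ≠ 0 := by
    intro h
    have := congr_arg Matrix.det hK
    rw [Matrix.det_mul, h, mul_zero, Matrix.det_one] at this
    exact zero_ne_one this
  have hdd : DifferentiableAt ℝ (fun z => (jacMat T z).det) y := by
    simp only [Matrix.det_fin_two]
    exact ((hd 0 0).mul (hd 1 1)).sub ((hd 0 1).mul (hd 1 0))
  have e : logFactor T = fun z => 1 / 2 * Real.log ((jacMat T z).det) := by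
    ext z; simp [logFactor, Real.log_abs]
  have hl := hdd.hasFDerivAt.log hdet
  have hlog : pd k (fun z => Real.log ((jacMat T z).det)) y =
      ((jacMat T y).det)⁻¹ * pd k (fun z => (jacMat T z).det) y := by
    unfold pd
    rw [hl.fderiv]
    rfl
  have hpdet : pd k (fun z => (jacMat T z).det) y =
      jacMat T y 0 0 * pd k (fun z => jacMat T z 1 1) y +
        pd k (fun z => jacMat T z 0 0) y * jacMat T y 1 1 -
      (jacMat T y 0 1 * pd k (fun z => jacMat T z 1 0) y +
        pd k (fun z => jacMat T z 0 1) y * jacMat T y 1 0) := by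
    simp only [Matrix.det_fin_two]
    rw [pd_sub ((hd 0 0).fun_mul (hd 1 1)) ((hd 0 1).fun_mul (hd 1 0)),
      pd_mul (hd 0 0) (hd 1 1), pd_mul (hd 0 1) (hd 1 0)]
  refine ⟨by rw [e]; exact hl.differentiableAt.const_mul _, ?_⟩
  rw [e, pd_const_mul _ hl.differentiableAt, hlog, hpdet]
  have hadj := fun i a => jac_mul_det_eq_adjugate hK i a
  rw [Matrix.adjugate_fin_two] at hadj
  have a00 := hadj 0 0
  have a01 := hadj 0 1
  have a10 := hadj 1 0
  have a11 := hadj 1 1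
  simp at a00 a01 a10 a11
  simp only [Fin.sum_univ_two]
  rw [← mul_right_inj' hdet]
  field_simp
  linear_combination -pd k (fun z => jacMat T z 0 0) y * a00 -
    pd k (fun z => jacMat T z 1 0) y * a01 - pd k (fun z => jacMat T z 0 1) y * a10 -
    pd k (fun z => jacMat T z 1 1) y * a11

lemma sqrt_abs_det_eq_exp {T : Coord 2 → Coord 2} {y : Coord 2} (h : (jacMat T y).det ≠ 0) :
    Real.sqrt |(jacMat T y).det| = Real.exp (logFactor T y) := by
  have hp := abs_pos.2 h
  rw [Real.sqrt_eq_rpow, Real.rpow_def_of_pos hp, logFactor, mul_comm]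

lemma sum_mul_sum_of_mul_eq_one {A B : Matrix (Fin 2) (Fin 2) ℝ} (h : A * B = 1) (Z : Fin 2 → ℝ)
    (a : Fin 2) : ∑ i, A a i * ∑ b, B i b * Z b = Z a := by
  have := congr_fun (Matrix.mulVec_mulVec Z A B) a
  rw [h, Matrix.one_mulVec] at this
  exact this

variable (conn : MeasurableConnection 2 M) (V W : LipHalfDensity 2 M)

lemma LipHalfDensity.locallyLipschitzOn_coord (e : atlas (Coord 2) M) (i : Fin 2) :
    LocallyLipschitzOn e.1.target fun y => V.coord e y i := by
  have h : LocallyLipschitzOn univ fun v : Fin 2 → ℝ => v i :=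
    (LipschitzWith.eval i).locallyLipschitz.locallyLipschitzOn
  exact locallyLipschitzOn_comp h (V.locallyLipschitz e) (mapsTo_univ _ _)

lemma LipHalfDensity.ae_differentiableAt (e : atlas (Coord 2) M) :
    ∀ᵐ y ∂(volume.restrict e.1.target), ∀ i, DifferentiableAt ℝ (fun z => V.coord e z i) y :=
  ae_all_iff.2 fun i => ae_differentiableAt_of_locallyLipschitzOn e.1.open_target
    (V.locallyLipschitzOn_coord e i)

/-- The covariant derivative of a vector-valued half-density transforms as a tensor-valued
half-density. -/
lemma covDeriv_transform {e e' : atlas (Coord 2) M} (H : IsC11Diffeo (chartTrans e e')) {y : Coord 2}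
    (hy : y ∈ (chartTrans e e').source)
    (hd : ∀ a b, DifferentiableAt ℝ (fun z => jacMat (chartTrans e e') z a b) y)
    (hs : ∀ a j k, pd j (fun z => jacMat (chartTrans e e') z a k) y =
      pd k (fun z => jacMat (chartTrans e e') z a j) y)
    (hΓ : ∀ i j k, conn.Γ e y i j k =
      (∑ a, ∑ b, ∑ c, jac e' e (chartTrans e e' y) i a * jac e e' y b j * jac e e' y c k *
        conn.Γ e' (chartTrans e e' y) a b c) +
      ∑ a, jac e' e (chartTrans e e' y) i a * hess e e' y a j k)
    (hv : ∀ i, DifferentiableAt ℝ (fun z => V.coord e z i) y)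
    (hv' : ∀ i, DifferentiableAt ℝ (fun z => V.coord e' z i) (chartTrans e e' y)) (a k : Fin 2) :
    ∑ i, jacMat (chartTrans e e') y a i * covDeriv conn V e y k i =
      Real.sqrt |(jacMat (chartTrans e e') y).det| *
        ∑ c, jacMat (chartTrans e e') y c k * covDeriv conn V e' (chartTrans e e' y) c a := by
  set T := chartTrans e e' with hT
  set J := jacMat T y with hJ
  set K := jacMat T.symm (T y) with hK
  have hKJ : K * J = 1 := H.jacMat_symm_mul hy
  have hJK : J * K = 1 := H.jacMat_mul_symm hy
  obtain ⟨hLd, -⟩ := two_mul_pd_logFactor hd hKJ k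
  have hL := (two_mul_pd_logFactor hd hKJ k).2
  set L := pd k (logFactor T) y
  have hTd := H.differentiableAt hy
  -- the components of `V` in the two charts
  have hev : ∀ z ∈ T.source, ∀ a, ∑ i, jacMat T z a i * V.coord e z i =
      Real.exp (logFactor T z) * V.coord e' (T z) a := fun z hz a => by
    have h1 := V.transform e e' z hz
    have h2 := sum_mul_sum_of_mul_eq_one (H.jacMat_mul_symm hz) (V.coord e' (T z)) a
    rw [← sqrt_abs_det_eq_exp (H.det_ne_zero hz), ← h2, Finset.mul_sum]
    refine Finset.sum_congr rfl fun i _ => ?_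
    rw [h1 i]
    change _ * (Real.sqrt |(jacMat T z).det| * ∑ a, jacMat T.symm (T z) i a * _) = _
    ring
  have hw : ∀ b, ∑ i, J b i * V.coord e y i =
      Real.exp (logFactor T y) * V.coord e' (T y) b := hev y hy
  have hρ : pd k (fun z => Real.exp (logFactor T z)) y = Real.exp (logFactor T y) * L := by
    unfold pd
    rw [hLd.hasFDerivAt.exp.fderiv]
    rfl
  have hE1 : ∑ i, (J a i * pd k (fun z => V.coord e z i) y +
        pd k (fun z => jacMat T z a i) y * V.coord e y i) =
      Real.exp (logFactor T y) * (∑ b, pd b (fun z => V.coord e' z a) (T y) * J b k) +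
        Real.exp (logFactor T y) * L * V.coord e' (T y) a := by
    have h1 : pd k (fun z => ∑ i, jacMat T z a i * V.coord e z i) y =
        pd k (fun z => Real.exp (logFactor T z) * V.coord e' (T z) a) y :=
      pd_congr (by filter_upwards [T.open_source.mem_nhds hy] with z hz using hev z hz a)
    have h2 : DifferentiableAt ℝ (fun z => V.coord e' (T z) a) y :=
      DifferentiableAt.comp y (hv' a) hTd
    rw [pd_sum _ _ fun i _ => (hd a i).fun_mul (hv i), pd_mul hLd.exp h2, hρ,
      pd_comp (h := fun z => V.coord e' z a) (hv' a) hTd] at h1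
    rw [← h1]
    exact Finset.sum_congr rfl fun i _ => (pd_mul (hd a i) (hv i)).symm
  -- the Christoffel symbols in the two charts
  set Z : Fin 2 → Fin 2 → Fin 2 → ℝ := fun a j k =>
    (∑ b, ∑ c, J b j * J c k * conn.Γ e' (T y) a b c) + pd k (fun z => jacMat T z a j) y with hZ
  have hΓ' : ∀ i j k, conn.Γ e y i j k = ∑ a, K i a * Z a j k := fun i j k => by
    rw [hΓ, hZ]
    change (∑ a, ∑ b, ∑ c, K i a * J b j * J c k * conn.Γ e' (T y) a b c) +
      ∑ a, K i a * pd j (fun z => jacMat T z a k) y = _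
    simp only [Fin.sum_univ_two, hs _ j k]
    ring
  have hE2 : ∀ l, ∑ i, J a i * conn.Γ e y i l k = Z a l k := fun l => by
    simp only [hΓ']
    exact sum_mul_sum_of_mul_eq_one hJK (fun b => Z b l k) a
  -- the trace of the symbols picks up the derivative of `log |det J|`, which the weight `1 / 2` of
  -- the half-density compensates
  have hE3 : ∑ l, conn.Γ e y l l k = (∑ c, J c k * ∑ b, conn.Γ e' (T y) b b c) + 2 * L := by
    have j00 := congr_fun (congr_fun hJK 0) 0
    have j01 := congr_fun (congr_fun hJK 0) 1
    have j10 := congr_fun (congr_fun hJK 1) 0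
    have j11 := congr_fun (congr_fun hJK 1) 1
    simp only [Matrix.mul_apply, Fin.sum_univ_two, Matrix.one_apply, Fin.zero_eq_one_iff,
      OfNat.ofNat_ne_one, Fin.one_eq_zero_iff, if_true, if_false] at j00 j01 j10 j11
    rw [hL]
    simp only [hΓ', hZ, Fin.sum_univ_two]
    linear_combination
      (J 0 k * conn.Γ e' (T y) 0 0 0 + J 1 k * conn.Γ e' (T y) 0 0 1) * j00 +
      (J 0 k * conn.Γ e' (T y) 1 1 0 + J 1 k * conn.Γ e' (T y) 1 1 1) * j11 +
      (J 0 k * conn.Γ e' (T y) 1 0 0 + J 1 k * conn.Γ e' (T y) 1 0 1) * j01 +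
      (J 0 k * conn.Γ e' (T y) 0 1 0 + J 1 k * conn.Γ e' (T y) 0 1 1) * j10
  rw [sqrt_abs_det_eq_exp (H.det_ne_zero hy)]
  have e0 := hE2 0
  have e1 := hE2 1
  have w0 := hw 0
  have w1 := hw 1
  have wa := hw a
  simp only [hZ] at e0 e1
  unfold covDeriv
  simp only [Fin.sum_univ_two] at *
  linear_combination hE1 + V.coord e y 0 * e0 + V.coord e y 1 * e1 -
    1 / 2 * (J a 0 * V.coord e y 0 + J a 1 * V.coord e y 1) * hE3 +
    (J 0 k * conn.Γ e' (T y) a 0 0 + J 1 k * conn.Γ e' (T y) a 0 1) * w0 +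
    (J 0 k * conn.Γ e' (T y) a 1 0 + J 1 k * conn.Γ e' (T y) a 1 1) * w1 -
    (1 / 2 * (J 0 k * (conn.Γ e' (T y) 0 0 0 + conn.Γ e' (T y) 1 1 0) +
      J 1 k * (conn.Γ e' (T y) 0 0 1 + conn.Γ e' (T y) 1 1 1)) + L) * wa

/-- The quadratic form `tr N tr P - tr (N P)` of two endomorphisms is invariant under a change of
basis; the factor `ρ` comes from the half-densities. -/
lemma trace_identity {N N' P P' J K : Matrix (Fin 2) (Fin 2) ℝ} {ρ : ℝ} (hKJ : K * J = 1)
    (hN : ∀ a k, ∑ i, J a i * N k i = ρ * ∑ c, J c k * N' c a)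
    (hP : ∀ a k, ∑ i, J a i * P k i = ρ * ∑ c, J c k * P' c a) :
    ∑ i, ∑ j, (N i i * P j j - N i j * P j i) =
      ρ ^ 2 * ∑ i, ∑ j, (N' i i * P' j j - N' i j * P' j i) := by
  have hJK : J * K = 1 := mul_eq_one_comm.1 hKJ
  have key : ∀ {N N' : Matrix (Fin 2) (Fin 2) ℝ},
      (∀ a k, ∑ i, J a i * N k i = ρ * ∑ c, J c k * N' c a) →
      N = ρ • (J.transpose * N' * K.transpose) := fun {N N'} h => by
    have h1 : N * J.transpose = ρ • (J.transpose * N') := by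
      ext k a
      simpa [Matrix.mul_apply, mul_comm] using h a k
    calc N = N * (K * J).transpose := by rw [hKJ]; simp
      _ = N * J.transpose * K.transpose := by rw [Matrix.transpose_mul, Matrix.mul_assoc]
      _ = _ := by rw [h1, Matrix.smul_mul]
  have hKt : K.transpose * J.transpose = 1 := by
    rw [← Matrix.transpose_mul, hJK, Matrix.transpose_one]
  have tr : ∀ A : Matrix (Fin 2) (Fin 2) ℝ,
      (J.transpose * A * K.transpose).trace = A.trace := fun A => by
    rw [Matrix.trace_mul_comm, ← Matrix.mul_assoc, hKt, Matrix.one_mul]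
  have t1 : N.trace = ρ * N'.trace := by rw [key hN, Matrix.trace_smul, tr, smul_eq_mul]
  have t2 : P.trace = ρ * P'.trace := by rw [key hP, Matrix.trace_smul, tr, smul_eq_mul]
  have t3 : (N * P).trace = ρ ^ 2 * (N' * P').trace := by
    rw [key hN, key hP, Matrix.smul_mul, Matrix.mul_smul, smul_smul, Matrix.trace_smul]
    have : J.transpose * N' * K.transpose * (J.transpose * P' * K.transpose) =
        J.transpose * (N' * P') * K.transpose := by
      simp only [Matrix.mul_assoc]
      rw [← Matrix.mul_assoc K.transpose, hKt, Matrix.one_mul]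
    rw [this, tr, smul_eq_mul, sq]
  simp only [Matrix.trace, Matrix.diag, Matrix.mul_apply, Fin.sum_univ_two] at t1 t2 t3
  simp only [Fin.sum_univ_two]
  linear_combination t1 * (P 0 0 + P 1 1) + ρ * (N' 0 0 + N' 1 1) * t2 - t3

/-- The integrand of `Q` is a density. -/
lemma ae_integrand_eq (hM : IsC11Manifold 2 M) (e e' : atlas (Coord 2) M) :
    ∀ᵐ y ∂(volume.restrict (chartTrans e e').source), integrand conn V W e y =
      |(jacMat (chartTrans e e') y).det| * integrand conn V W e' (chartTrans e e' y) := by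
  have H := hM.isC11Diffeo e e'
  have hsub : ∀ {P : Coord 2 → Prop}, (∀ᵐ y ∂(volume.restrict e.1.target), P y) →
      ∀ᵐ y ∂(volume.restrict (chartTrans e e').source), P y := fun h =>
    ae_mono (Measure.restrict_mono (chartTrans_source_subset e e') le_rfl) h
  have hsub' : ∀ {P : Coord 2 → Prop}, (∀ᵐ y ∂(volume.restrict e'.1.target), P y) →
      ∀ᵐ y ∂(volume.restrict (chartTrans e e').source), P (chartTrans e e' y) := fun h =>
    H.ae_comp_target (ae_mono (Measure.restrict_mono (chartTrans_target_subset e e') le_rfl) h)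
  filter_upwards [H.ae_differentiableAt_jacMat, conn.transform e e',
    hsub (V.ae_differentiableAt e), hsub (W.ae_differentiableAt e),
    hsub' (V.ae_differentiableAt e'), hsub' (W.ae_differentiableAt e'),
    ae_restrict_mem (chartTrans e e').open_source.measurableSet]
    with y ⟨hd, hs⟩ hΓ hv hw hv' hw' hy
  have := trace_identity (H.jacMat_symm_mul hy)
    (covDeriv_transform conn V H hy hd hs hΓ hv hv')
    (covDeriv_transform conn W H hy hd hs hΓ hw hw')
  rw [Real.sq_sqrt (abs_nonneg _)] at this
  exact this

end Transform

/-! ### Integration of densities -/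

section Density

variable {M : Type*} [TopologicalSpace M] [ChartedSpace (Coord 2) M]

/-- A function `dens` defines a measurable density: the coefficients in two charts differ by the
absolute value of the Jacobian determinant. -/
structure IsDensity (dens : atlas (Coord 2) M → Coord 2 → ℝ) : Prop where
  aemeasurable : ∀ e, AEMeasurable (dens e) (volume.restrict e.1.target)
  transform : ∀ e e', ∀ᵐ y ∂(volume.restrict (chartTrans e e').source),
    dens e y = |(jacMat (chartTrans e e') y).det| * dens e' (chartTrans e e' y)

variable {dens dens' : atlas (Coord 2) M → Coord 2 → ℝ}

lemma IsDensity.neg (h : IsDensity dens) : IsDensity fun e y => -dens e y where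
  aemeasurable e := (h.aemeasurable e).neg
  transform e e' := (h.transform e e').mono fun y hy => by rw [hy]; ring

lemma IsDensity.abs (h : IsDensity dens) : IsDensity fun e y => |dens e y| where
  aemeasurable e := continuous_abs.measurable.comp_aemeasurable (h.aemeasurable e)
  transform e e' := (h.transform e e').mono fun y hy => by rw [hy, abs_mul, abs_abs]

lemma IsDensity.add (h : IsDensity dens) (h' : IsDensity dens') :
    IsDensity fun e y => dens e y + dens' e y where
  aemeasurable e := (h.aemeasurable e).add (h'.aemeasurable e)
  transform e e' := by
    filter_upwards [h.transform e e', h'.transform e e'] with y hy hy'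
    rw [hy, hy']; ring

lemma measurableSet_inter_preimage {X Y : Type*} [TopologicalSpace X] [MeasurableSpace X]
    [BorelSpace X] [TopologicalSpace Y] [MeasurableSpace Y] [BorelSpace Y] {f : X → Y} {s : Set X}
    {A : Set Y} (hf : ContinuousOn f s) (hs : MeasurableSet s) (hA : MeasurableSet A) :
    MeasurableSet (s ∩ f ⁻¹' A) := by
  have h : MeasurableSet (Subtype.val '' (s.domRestrict f ⁻¹' A)) :=
    hs.subtype_image (hf.domRestrict.measurable hA)
  convert h using 1
  ext x
  simp [Set.domRestrict, and_comm]

variable (M) in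
/-- A partition of the surface into countably many Borel sets, each contained in a chart. -/
structure ChartPartition [MeasurableSpace M] where
  chart : ℕ → atlas (Coord 2) M
  part : ℕ → Set M
  measurableSet : ∀ n, MeasurableSet (part n)
  disjoint : Pairwise fun m n => Disjoint (part m) (part n)
  iUnion_eq : ⋃ n, part n = univ
  subset : ∀ n, part n ⊆ (chart n).1.source

/-- The image in a chart of a part of a set. -/
def chartImage (e : atlas (Coord 2) M) (A : Set M) : Set (Coord 2) := e.1.target ∩ e.1.symm ⁻¹' A

lemma image_chartImage (e e' : atlas (Coord 2) M) {A : Set M} (hA : A ⊆ e.1.source)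
    (hA' : A ⊆ e'.1.source) : chartTrans e e' '' chartImage e A = chartImage e' A := by
  ext x
  constructor
  · rintro ⟨y, ⟨hy, hyA⟩, rfl⟩
    refine ⟨(chartTrans e e').map_source (mem_chartTrans_source.2 ⟨hy, hA' hyA⟩) |>.1, ?_⟩
    change e'.1.symm (e'.1 (e.1.symm y)) ∈ A
    rwa [e'.1.left_inv (hA' hyA)]
  · rintro ⟨hx, hxA⟩
    have hxA' : e'.1.symm x ∈ A := hxA
    refine ⟨e.1 (e'.1.symm x), ⟨e.1.map_source (hA hxA), ?_⟩, ?_⟩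
    · change e.1.symm (e.1 (e'.1.symm x)) ∈ A
      rwa [e.1.left_inv (hA hxA)]
    · change e'.1 (e.1.symm (e.1 (e'.1.symm x))) = x
      rw [e.1.left_inv (hA hxA), e'.1.right_inv hx]

lemma chartImage_subset_source (e e' : atlas (Coord 2) M) {A : Set M}
    (hA' : A ⊆ e'.1.source) : chartImage e A ⊆ (chartTrans e e').source := fun _ hy =>
  mem_chartTrans_source.2 ⟨hy.1, hA' hy.2⟩

lemma aemeasurable_ofReal_chartImage (h : IsDensity dens) (e : atlas (Coord 2) M) (A : Set M) :
    AEMeasurable (fun y => ENNReal.ofReal (dens e y)) (volume.restrict (chartImage e A)) :=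
  ((h.aemeasurable e).mono_measure (Measure.restrict_mono inter_subset_left le_rfl)).ennreal_ofReal

variable [MeasurableSpace M]

lemma ChartPartition.measure_eq_tsum (P : ChartPartition M) (μ : Measure M) {A : Set M}
    (hA : MeasurableSet A) : μ A = ∑' n, μ (A ∩ P.part n) := by
  rw [← measure_iUnion (fun m n hmn => (P.disjoint hmn).mono inter_subset_right inter_subset_right)
    fun n => hA.inter (P.measurableSet n), ← inter_iUnion, P.iUnion_eq, inter_univ]

lemma DensityIntegrable.neg (hi : DensityIntegrable dens) :
    DensityIntegrable fun e y => -dens e y := by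
  refine ⟨fun e => (hi.1 e).neg, ?_⟩
  simpa only [abs_neg] using hi.2

variable [BorelSpace M]

lemma measurableSet_chartImage (e : atlas (Coord 2) M) {A : Set M} (hA : MeasurableSet A) :
    MeasurableSet (chartImage e A) :=
  measurableSet_inter_preimage e.1.continuousOn_symm e.1.open_target.measurableSet hA

/-- The measure on the surface given by the positive part of a density in a chart. -/
noncomputable def chartMeasure (dens : atlas (Coord 2) M → Coord 2 → ℝ) (e : atlas (Coord 2) M) :
    Measure M :=
  Measure.map e.1.symm ((volume.restrict e.1.target).withDensity fun y => ENNReal.ofReal (dens e y))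

lemma chartMeasure_apply (dens : atlas (Coord 2) M → Coord 2 → ℝ) (e : atlas (Coord 2) M)
    {A : Set M} (hA : MeasurableSet A) :
    chartMeasure dens e A = ∫⁻ y in chartImage e A, ENNReal.ofReal (dens e y) := by
  have hm : AEMeasurable e.1.symm
      ((volume.restrict e.1.target).withDensity fun y => ENNReal.ofReal (dens e y)) :=
    (e.1.continuousOn_symm.aemeasurable e.1.open_target.measurableSet).mono_ac
      (withDensity_absolutelyContinuous _ _)
  rw [chartMeasure, Measure.map_apply_of_aemeasurable hm hA, withDensity_apply',
    Measure.restrict_restrict' e.1.open_target.measurableSet, inter_comm]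
  rfl

lemma chartMeasure_eq (hM : IsC11Manifold 2 M) (h : IsDensity dens) (e e' : atlas (Coord 2) M)
    {A : Set M} (hA : MeasurableSet A) (hAe : A ⊆ e.1.source) (hAe' : A ⊆ e'.1.source) :
    chartMeasure dens e A = chartMeasure dens e' A := by
  rw [chartMeasure_apply _ _ hA, chartMeasure_apply _ _ hA, ← image_chartImage e e' hAe hAe',
    (hM.isC11Diffeo e e').lintegral_comp (measurableSet_chartImage e hA)
      (chartImage_subset_source e e' hAe')]
  refine lintegral_congr_ae (ae_mono (Measure.restrict_mono
    (chartImage_subset_source e e' hAe') le_rfl) ((h.transform e e').mono fun y hy => ?_))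
  simp only [hy]
  rw [ENNReal.ofReal_mul (abs_nonneg _)]

lemma chartMeasure_compl_source (dens : atlas (Coord 2) M → Coord 2 → ℝ) (e : atlas (Coord 2) M) :
    chartMeasure dens e (e.1.source)ᶜ = 0 := by
  rw [chartMeasure_apply _ _ e.1.open_source.measurableSet.compl]
  have : chartImage e (e.1.source)ᶜ = ∅ := by
    ext y
    simp only [chartImage, mem_inter_iff, mem_preimage, mem_compl_iff, mem_empty_iff_false,
      iff_false, not_and, not_not]
    exact fun hy => e.1.map_target hy
  rw [this]
  simp

lemma chartMeasure_inter_source (dens : atlas (Coord 2) M → Coord 2 → ℝ) (e : atlas (Coord 2) M)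
    (A : Set M) : chartMeasure dens e (A ∩ e.1.source) = chartMeasure dens e A :=
  measure_inter_conull (chartMeasure_compl_source dens e)

/-- The measure of a density is the sum of its parts in the charts of a partition. -/
lemma densityMeasure_eq_sum (hM : IsC11Manifold 2 M) (h : IsDensity dens) (P : ChartPartition M) :
    densityMeasure dens = Measure.sum fun n => (chartMeasure dens (P.chart n)).restrict (P.part n) := by
  refine le_antisymm (iSup_le fun e => Measure.le_iff.2 fun A hA => ?_)
    (Measure.le_iff.2 fun A hA => ?_)
  · change chartMeasure dens e A ≤ _
    rw [Measure.sum_apply _ hA, P.measure_eq_tsum _ hA]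
    refine ENNReal.tsum_le_tsum fun n => ?_
    rw [Measure.restrict_apply hA, ← chartMeasure_inter_source,
      chartMeasure_eq hM h e (P.chart n)
        ((hA.inter (P.measurableSet n)).inter e.1.open_source.measurableSet) inter_subset_right
        (inter_subset_left.trans (inter_subset_right.trans (P.subset n)))]
    exact measure_mono inter_subset_left
  · rw [Measure.sum_apply _ hA, P.measure_eq_tsum _ hA]
    refine ENNReal.tsum_le_tsum fun n => ?_
    rw [Measure.restrict_apply hA]
    exact le_iSup (fun e => chartMeasure dens e) (P.chart n) _

lemma densityMeasure_univ (hM : IsC11Manifold 2 M) (h : IsDensity dens) (P : ChartPartition M) :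
    densityMeasure dens univ =
      ∑' n, ∫⁻ y in chartImage (P.chart n) (P.part n), ENNReal.ofReal (dens (P.chart n) y) := by
  rw [densityMeasure_eq_sum hM h P, Measure.sum_apply _ MeasurableSet.univ]
  refine tsum_congr fun n => ?_
  rw [Measure.restrict_apply MeasurableSet.univ, univ_inter,
    chartMeasure_apply _ _ (P.measurableSet n)]

lemma densityMeasure_apply_of_subset (hM : IsC11Manifold 2 M) (h : IsDensity dens)
    (P : ChartPartition M) (e : atlas (Coord 2) M) {A : Set M} (hA : MeasurableSet A)
    (hAe : A ⊆ e.1.source) : densityMeasure dens A = chartMeasure dens e A := by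
  rw [densityMeasure_eq_sum hM h P, Measure.sum_apply _ hA, P.measure_eq_tsum _ hA]
  refine tsum_congr fun n => ?_
  rw [Measure.restrict_apply hA]
  exact chartMeasure_eq hM h _ _ (hA.inter (P.measurableSet n))
    (inter_subset_right.trans (P.subset n)) (inter_subset_left.trans hAe)

/-- A density that vanishes outside the domain of a chart is integrated in this chart. -/
lemma densityMeasure_univ_of_chart (hM : IsC11Manifold 2 M) (h : IsDensity dens)
    (P : ChartPartition M) (e : atlas (Coord 2) M)
    (h0 : ∀ e', ∀ᵐ y ∂(volume.restrict e'.1.target), e'.1.symm y ∉ e.1.source → dens e' y = 0) :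
    densityMeasure dens univ = ∫⁻ y in e.1.target, ENNReal.ofReal (dens e y) := by
  have hs := e.1.open_source.measurableSet
  have hz : densityMeasure dens (e.1.source)ᶜ = 0 := by
    rw [densityMeasure_eq_sum hM h P, Measure.sum_apply _ hs.compl]
    refine ENNReal.tsum_eq_zero.2 fun n => ?_
    rw [Measure.restrict_apply hs.compl, chartMeasure_apply _ _ (hs.compl.inter (P.measurableSet n)),
      lintegral_eq_zero_iff' (aemeasurable_ofReal_chartImage h _ _)]
    have hmeas := measurableSet_chartImage (P.chart n) (hs.compl.inter (P.measurableSet n))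
    filter_upwards [ae_mono (Measure.restrict_mono (inter_subset_left) le_rfl) (h0 (P.chart n)),
      ae_restrict_mem hmeas] with y hy hyA
    rw [hy hyA.2.1]
    simp
  rw [← measure_add_measure_compl hs, hz, add_zero, densityMeasure_apply_of_subset hM h P e hs
    subset_rfl, chartMeasure_apply _ _ hs]
  congr 2
  ext y
  simp only [chartImage, mem_inter_iff, mem_preimage, and_iff_left_iff_imp]
  exact fun hy => e.1.map_target hy

lemma densityIntegrable_iff (hM : IsC11Manifold 2 M) (h : IsDensity dens) (P : ChartPartition M) :
    DensityIntegrable dens ↔ (∑' n, ∫⁻ y in chartImage (P.chart n) (P.part n),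
      ENNReal.ofReal |dens (P.chart n) y|) < ⊤ := by
  rw [DensityIntegrable, densityMeasure_univ hM h.abs P]
  exact ⟨fun h' => h'.2, fun h' => ⟨h.aemeasurable, h'⟩⟩

lemma densityMeasure_univ_lt_top (hM : IsC11Manifold 2 M) (h : IsDensity dens) (P : ChartPartition M)
    (hi : DensityIntegrable dens) : densityMeasure dens univ < ⊤ := by
  rw [densityIntegrable_iff hM h P] at hi
  rw [densityMeasure_univ hM h P]
  exact (ENNReal.tsum_le_tsum fun n => lintegral_mono fun y =>
    ENNReal.ofReal_le_ofReal (le_abs_self _)).trans_lt hi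

lemma DensityIntegrable.add (hM : IsC11Manifold 2 M) (P : ChartPartition M) (h : IsDensity dens)
    (h' : IsDensity dens') (hi : DensityIntegrable dens) (hi' : DensityIntegrable dens') :
    DensityIntegrable fun e y => dens e y + dens' e y := by
  rw [densityIntegrable_iff hM h P] at hi
  rw [densityIntegrable_iff hM h' P] at hi'
  rw [densityIntegrable_iff hM (h.add h') P]
  refine lt_of_le_of_lt ?_ (ENNReal.add_lt_top.2 ⟨hi, hi'⟩)
  rw [← ENNReal.tsum_add]
  refine ENNReal.tsum_le_tsum fun n => ?_
  rw [← lintegral_add_left' (aemeasurable_ofReal_chartImage h.abs _ _)]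
  refine lintegral_mono fun y => ?_
  simp only
  rw [← ENNReal.ofReal_add (abs_nonneg _) (abs_nonneg _)]
  exact ENNReal.ofReal_le_ofReal (abs_add_le _ _)

/-- Additivity of `a = a⁺ - a⁻`, written without subtraction. -/
lemma ofReal_add_identity (a b : ℝ) :
    ENNReal.ofReal (a + b) + (ENNReal.ofReal (-a) + ENNReal.ofReal (-b)) =
      ENNReal.ofReal (-(a + b)) + (ENNReal.ofReal a + ENNReal.ofReal b) := by
  have h : ∀ x : ℝ, ENNReal.ofReal x = ENNReal.ofReal (max x 0) := fun x => by
    rcases le_total 0 x with hx | hx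
    · rw [max_eq_left hx]
    · rw [max_eq_right hx, ENNReal.ofReal_of_nonpos hx, ENNReal.ofReal_zero]
  have h0 : ∀ x : ℝ, 0 ≤ max x 0 := fun x => le_max_right _ _
  have h1 : ∀ x : ℝ, max x 0 = x + max (-x) 0 := fun x => by
    rcases le_total 0 x with hx | hx
    · rw [max_eq_left hx, max_eq_right (by linarith)]; ring
    · rw [max_eq_right hx, max_eq_left (by linarith)]; ring
  rw [h (a + b), h (-a), h (-b), h (-(a + b)), h a, h b, ← ENNReal.ofReal_add (h0 _) (h0 _),
    ← ENNReal.ofReal_add (h0 _) (h0 _), ← ENNReal.ofReal_add (h0 _) (by positivity),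
    ← ENNReal.ofReal_add (h0 _) (by positivity)]
  congr 1
  rw [h1 (a + b), h1 a, h1 b]
  ring

/-- The integral of densities is additive. The measure of a density only sees its positive part, which is
not additive, so positive and negative parts are treated together. -/
lemma densityIntegral_add (hM : IsC11Manifold 2 M) (P : ChartPartition M) (h : IsDensity dens)
    (h' : IsDensity dens') (hi : DensityIntegrable dens) (hi' : DensityIntegrable dens') :
    densityIntegral (fun e y => dens e y + dens' e y) =
      densityIntegral dens + densityIntegral dens' := by
  have hs := h.add h'
  have his := hi.add hM P h h' hi'
  have key : densityMeasure (fun e y => dens e y + dens' e y) univ +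
      (densityMeasure (fun e y => -dens e y) univ + densityMeasure (fun e y => -dens' e y) univ) =
      densityMeasure (fun e y => -(dens e y + dens' e y)) univ +
      (densityMeasure dens univ + densityMeasure dens' univ) := by
    rw [densityMeasure_univ hM h P, densityMeasure_univ hM h' P, densityMeasure_univ hM hs P,
      densityMeasure_univ hM h.neg P, densityMeasure_univ hM h'.neg P,
      densityMeasure_univ hM hs.neg P]
    simp only [← ENNReal.tsum_add]
    refine tsum_congr fun n => ?_
    rw [← lintegral_add_left' (aemeasurable_ofReal_chartImage h _ _),
      ← lintegral_add_left' (aemeasurable_ofReal_chartImage h.neg _ _),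
      ← lintegral_add_left' (aemeasurable_ofReal_chartImage hs _ _),
      ← lintegral_add_left' (aemeasurable_ofReal_chartImage hs.neg _ _)]
    exact lintegral_congr fun y => ofReal_add_identity _ _
  have f1 := (densityMeasure_univ_lt_top hM h P hi).ne
  have f2 := (densityMeasure_univ_lt_top hM h' P hi').ne
  have f3 := (densityMeasure_univ_lt_top hM hs P his).ne
  have f4 := (densityMeasure_univ_lt_top hM h.neg P hi.neg).ne
  have f5 := (densityMeasure_univ_lt_top hM h'.neg P hi'.neg).ne
  have f6 := (densityMeasure_univ_lt_top hM hs.neg P his.neg).ne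
  have := congr_arg ENNReal.toReal key
  rw [ENNReal.toReal_add f3 (ENNReal.add_ne_top.2 ⟨f4, f5⟩), ENNReal.toReal_add f4 f5,
    ENNReal.toReal_add f6 (ENNReal.add_ne_top.2 ⟨f1, f2⟩), ENNReal.toReal_add f1 f2] at this
  unfold densityIntegral
  linarith

/-- A density supported in the domain of a chart is integrable if its coefficient is, and its
integral is computed in the chart. -/
lemma densityIntegral_of_chart (hM : IsC11Manifold 2 M) (h : IsDensity dens)
    (P : ChartPartition M) (e : atlas (Coord 2) M)
    (h0 : ∀ e', ∀ᵐ y ∂(volume.restrict e'.1.target), e'.1.symm y ∉ e.1.source → dens e' y = 0)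
    (hi : IntegrableOn (dens e) e.1.target) :
    DensityIntegrable dens ∧ densityIntegral dens = ∫ y in e.1.target, dens e y := by
  refine ⟨⟨h.aemeasurable, ?_⟩, ?_⟩
  · rw [densityMeasure_univ_of_chart hM h.abs P e fun e' => (h0 e').mono fun y hy hy' => by
      rw [hy hy', abs_zero]]
    exact hi.abs.lintegral_lt_top
  · rw [densityIntegral, densityMeasure_univ_of_chart hM h P e h0,
      densityMeasure_univ_of_chart hM h.neg P e fun e' => (h0 e').mono fun y hy hy' => by
        rw [hy hy', neg_zero], ← integral_eq_lintegral_pos_part_sub_lintegral_neg_part hi]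

end Density

/-! ### Isothermal charts -/

section Isothermal

variable {M : Type*} [TopologicalSpace M] [ChartedSpace (Coord 2) M] {g : SingularMetric 2 M}

/-- Pulling back a multiple of the Euclidean metric to another one. -/
lemma abs_det_of_conformal {J : Matrix (Fin 2) (Fin 2) ℝ} {s t : ℝ}
    (h : Real.exp (2 * s) • (1 : Matrix (Fin 2) (Fin 2) ℝ) =
      J.transpose * (Real.exp (2 * t) • (1 : Matrix (Fin 2) (Fin 2) ℝ)) * J) :
    J.transpose * J = |J.det| • (1 : Matrix (Fin 2) (Fin 2) ℝ) ∧
      s = t + 1 / 2 * Real.log |J.det| := by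
  rw [Matrix.mul_smul, Matrix.mul_one, Matrix.smul_mul] at h
  have h1 : J.transpose * J = Real.exp (2 * s - 2 * t) • (1 : Matrix (Fin 2) (Fin 2) ℝ) := by
    have h2 := congr_arg (fun A => (Real.exp (2 * t))⁻¹ • A) h
    simp only [smul_smul, inv_mul_cancel₀ (Real.exp_pos _).ne', one_smul] at h2
    rw [← h2, Real.exp_sub, div_eq_inv_mul]
  have h2 : |J.det| = Real.exp (2 * s - 2 * t) := by
    have h3 := congr_arg Matrix.det h1
    rw [Matrix.det_mul, Matrix.det_transpose, Matrix.det_smul, Matrix.det_one, mul_one,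
      Fintype.card_fin, ← sq] at h3
    rw [← Real.sqrt_sq_eq_abs, h3, Real.sqrt_sq (Real.exp_pos _).le]
  refine ⟨by rw [h2, h1], ?_⟩
  rw [h2, Real.log_exp]
  ring

lemma isothermal_pair_ae (hM : IsC11Manifold 2 M) {e e' : atlas (Coord 2) M}
    {φ φ' : Coord 2 → ℝ} (h : IsIsothermal g e φ) (h' : IsIsothermal g e' φ') :
    ∀ᵐ y ∂(volume.restrict (chartTrans e e').source),
      (jacMat (chartTrans e e') y).transpose * jacMat (chartTrans e e') y =
        |(jacMat (chartTrans e e') y).det| • (1 : Matrix (Fin 2) (Fin 2) ℝ) ∧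
      φ y = φ' (chartTrans e e' y) + logFactor (chartTrans e e') y := by
  have H := hM.isC11Diffeo e e'
  filter_upwards [g.transform e e',
    ae_mono (Measure.restrict_mono (chartTrans_source_subset e e') le_rfl) h.2,
    H.ae_comp_target (ae_mono (Measure.restrict_mono (chartTrans_target_subset e e') le_rfl) h'.2)]
    with y h1 h2 h3
  rw [h2, h3] at h1
  exact abs_det_of_conformal h1

/-- The change of coordinates between isothermal charts is conformal at every point. -/
lemma isConformal_of_isothermal (hM : IsC11Manifold 2 M) {e e' : atlas (Coord 2) M}
    {φ φ' : Coord 2 → ℝ} (h : IsIsothermal g e φ) (h' : IsIsothermal g e' φ') :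
    IsConformal (chartTrans e e') := by
  have H := hM.isC11Diffeo e e'
  have hJ : ∀ a b, ContinuousOn (fun y => jacMat (chartTrans e e') y a b)
      (chartTrans e e').source := fun a b => (H.locallyLipschitzOn_jacMat a b).continuousOn
  have hdet := H.locallyLipschitzOn_det.continuousOn.abs
  intro y hy
  ext i j
  have hae : (fun y => ((jacMat (chartTrans e e') y).transpose * jacMat (chartTrans e e') y) i j)
      =ᵐ[volume.restrict (chartTrans e e').source] fun y =>
      (|(jacMat (chartTrans e e') y).det| • (1 : Matrix (Fin 2) (Fin 2) ℝ)) i j :=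
    (isothermal_pair_ae hM h h').mono fun y hy => by simp only [hy.1]
  refine Measure.eqOn_open_of_ae_eq hae (chartTrans e e').open_source ?_ ?_ hy
  · simp only [Matrix.mul_apply, Matrix.transpose_apply]
    exact continuousOn_finsetSum _ fun k _ => (hJ k i).mul (hJ k j)
  · simp only [Matrix.smul_apply, smul_eq_mul]
    exact hdet.mul continuousOn_const

/-! ### Lipschitz functions on the surface -/

/-- A real function on the surface is locally Lipschitz if it is so in each chart. -/
def IsLipFun (F : M → ℝ) : Prop :=
  ∀ e : atlas (Coord 2) M, LocallyLipschitzOn e.1.target fun y => F (e.1.symm y)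

lemma isLipFun_const (c : ℝ) : IsLipFun fun _ : M => c := fun _ => locallyLipschitzOn_const c

lemma IsLipFun.mul {F G : M → ℝ} (hF : IsLipFun F) (hG : IsLipFun G) :
    IsLipFun fun p => F p * G p := fun e => locallyLipschitzOn_mul (hF e) (hG e)

lemma IsLipFun.sub {F G : M → ℝ} (hF : IsLipFun F) (hG : IsLipFun G) :
    IsLipFun fun p => F p - G p := fun e => locallyLipschitzOn_sub (hF e) (hG e)

lemma IsLipFun.continuous {F : M → ℝ} (hF : IsLipFun F) : Continuous F := by
  rw [continuous_iff_continuousAt]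
  intro p
  let e : atlas (Coord 2) M := ⟨chartAt (Coord 2) p, chart_mem_atlas (Coord 2) p⟩
  have hp : p ∈ e.1.source := mem_chart_source (Coord 2) p
  have h1 : ContinuousAt (fun y => F (e.1.symm y)) (e.1 p) :=
    (hF e).continuousOn.continuousAt (e.1.open_target.mem_nhds (e.1.map_source hp))
  have h2 : ContinuousAt (fun q => F (e.1.symm (e.1 q))) p :=
    ContinuousAt.comp (f := e.1) (g := fun y => F (e.1.symm y)) h1 (e.1.continuousAt hp)
  refine h2.congr ?_
  filter_upwards [e.1.open_source.mem_nhds hp] with q hq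
  rw [e.1.left_inv hq]

/-- A function in a chart, extended by zero to the surface. -/
noncomputable def extendChart (e : atlas (Coord 2) M) (f : Coord 2 → ℝ) : M → ℝ :=
  e.1.source.indicator fun p => f (e.1 p)

lemma extendChart_apply {e : atlas (Coord 2) M} {f : Coord 2 → ℝ} {p : M} (hp : p ∈ e.1.source) :
    extendChart e f p = f (e.1 p) := indicator_of_mem hp _

/-- The support in the chart is compact, hence closed in the Hausdorff surface, and the extension by zero
is locally Lipschitz across its boundary. -/
lemma isLipFun_extendChart [T2Space M] (hM : IsC11Manifold 2 M) {e : atlas (Coord 2) M}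
    {f : Coord 2 → ℝ} (hf : IsLipTest f e.1.target) : IsLipFun (extendChart e f) := by
  intro e'
  have hC : IsCompact (e.1.symm '' tsupport f) :=
    hf.2.1.isCompact.image_of_continuousOn (e.1.continuousOn_symm.mono hf.2.2)
  refine locallyLipschitzOn_of_forall_isOpen fun x hx => ?_
  by_cases hxe : e'.1.symm x ∈ e.1.source
  · refine ⟨(chartTrans e' e).source, (chartTrans e' e).open_source,
      mem_chartTrans_source.2 ⟨hx, hxe⟩, ?_⟩
    have h1 : LocallyLipschitzOn (chartTrans e' e).source fun y => f (chartTrans e' e y) :=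
      locallyLipschitzOn_comp (hf.locallyLipschitzOn univ)
        (hM.isC11Diffeo e' e).locallyLipschitzOn (mapsTo_univ _ _)
    exact (locallyLipschitzOn_congr h1 fun y hy =>
      extendChart_apply (mem_chartTrans_source.1 hy).2).mono inter_subset_right
  · have ho : IsOpen (e'.1.target ∩ e'.1.symm ⁻¹' (e.1.symm '' tsupport f)ᶜ) :=
      e'.1.continuousOn_symm.isOpen_inter_preimage e'.1.open_target hC.isClosed.isOpen_compl
    refine ⟨_, ho, ⟨hx, ?_⟩, ?_⟩
    · rintro ⟨z, hz, hzx⟩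
      exact hxe (hzx ▸ e.1.map_target (hf.2.2 hz))
    · refine locallyLipschitzOn_congr (locallyLipschitzOn_const (0 : ℝ)) fun y hy => ?_
      by_cases hye : e'.1.symm y ∈ e.1.source
      · rw [extendChart_apply hye]
        refine image_eq_zero_of_notMem_tsupport fun h => hy.2.2 ⟨_, h, e.1.left_inv hye⟩
      · exact indicator_of_notMem hye _

/-! ### Countable covers by isothermal charts -/

variable (g) in
/-- A countable cover of the surface by open sets `dom n` on which the cutoff function `cut n`,
supported in the isothermal chart `chart n`, is equal to one. -/
structure IsothermalCover where
  chart : ℕ → atlas (Coord 2) M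
  exponent : ℕ → Coord 2 → ℝ
  isothermal : ∀ n, IsIsothermal g (chart n) (exponent n)
  cut : ℕ → Coord 2 → ℝ
  contDiff : ∀ n, ContDiff ℝ ∞ (cut n)
  compact : ∀ n, HasCompactSupport (cut n)
  tsupport_subset : ∀ n, tsupport (cut n) ⊆ (chart n).1.target
  mem_Icc : ∀ n y, cut n y ∈ Icc (0 : ℝ) 1
  dom : ℕ → Set M
  isOpen : ∀ n, IsOpen (dom n)
  iUnion_eq : ⋃ n, dom n = univ
  subset : ∀ n, dom n ⊆ (chart n).1.source
  cut_eq : ∀ n, ∀ p ∈ dom n, cut n ((chart n).1 p) = 1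

/-- Isothermal charts cover the surface by assumption, and countably many of them suffice by second
countability. -/
lemma exists_isothermalCover [SecondCountableTopology M] [Nonempty M]
    (hg : HasBoundedIntegralCurvature g) : Nonempty (IsothermalCover g) := by
  choose e he φ hφ using hg
  have hcut : ∀ p : M, ∃ χ : Coord 2 → ℝ, ContDiff ℝ ∞ χ ∧ HasCompactSupport χ ∧
      tsupport χ ⊆ (e p).1.target ∧ (∀ᶠ x in 𝓝ˢ {(e p).1 p}, χ x = 1) ∧
      ∀ x, χ x ∈ Icc (0 : ℝ) 1 := fun p =>
    exists_cutoff isCompact_singleton (e p).1.open_target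
      (singleton_subset_iff.2 ((e p).1.map_source (he p)))
  choose χ hχ hχc hχs hχ1 hχI using hcut
  have hU : ∀ p : M, ∃ U : Set M, IsOpen U ∧ p ∈ U ∧ U ⊆ (e p).1.source ∧
      ∀ q ∈ U, χ p ((e p).1 q) = 1 := fun p => by
    have h1 := hχ1 p
    rw [nhdsSet_singleton] at h1
    have h2 := ((e p).1.continuousAt (he p)).eventually h1
    obtain ⟨U, hU, hUo, hpU⟩ := mem_nhds_iff.1 (inter_mem h2 ((e p).1.open_source.mem_nhds (he p)))
    exact ⟨U, hUo, hpU, fun q hq => (hU hq).2, fun q hq => (hU hq).1⟩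
  choose U hUo hpU hUs hU1 using hU
  obtain ⟨t, htc, ht⟩ := TopologicalSpace.countable_cover_nhds
    (f := U) fun p => (hUo p).mem_nhds (hpU p)
  have htne : t.Nonempty := by
    obtain ⟨p⟩ := ‹Nonempty M›
    have : p ∈ ⋃ x ∈ t, U x := ht ▸ mem_univ p
    obtain ⟨x, hx, -⟩ := mem_iUnion₂.1 this
    exact ⟨x, hx⟩
  obtain ⟨a, rfl⟩ := htc.exists_eq_range htne
  exact ⟨{ chart := fun n => e (a n)
           exponent := fun n => φ (a n)
           isothermal := fun n => hφ (a n)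
           cut := fun n => χ (a n)
           contDiff := fun n => hχ (a n)
           compact := fun n => hχc (a n)
           tsupport_subset := fun n => hχs (a n)
           mem_Icc := fun n => hχI (a n)
           dom := fun n => U (a n)
           isOpen := fun n => hUo (a n)
           iUnion_eq := by simpa using! ht
           subset := fun n => hUs (a n)
           cut_eq := fun n => hU1 (a n) }⟩

/-- The partition of the surface obtained by making the sets of a cover disjoint. -/
def IsothermalCover.partition [MeasurableSpace M] [BorelSpace M] (c : IsothermalCover g) :
    ChartPartition M where
  chart := c.chart
  part := disjointed c.dom
  measurableSet n := MeasurableSet.disjointed (fun i => (c.isOpen i).measurableSet) n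
  disjoint := disjoint_disjointed _
  iUnion_eq := by rw [iUnion_disjointed, c.iUnion_eq]
  subset n := (disjointed_subset _ n).trans (c.subset n)

/-- The cutoff function of a cover, as a function on the surface. -/
noncomputable def IsothermalCover.hat (c : IsothermalCover g) (n : ℕ) : M → ℝ :=
  extendChart (c.chart n) (c.cut n)

lemma IsothermalCover.isLipFun_hat [T2Space M] (hM : IsC11Manifold 2 M) (c : IsothermalCover g)
    (n : ℕ) : IsLipFun (c.hat n) :=
  isLipFun_extendChart hM (isLipTest_of_contDiff (c.contDiff n) (c.compact n) (c.tsupport_subset n))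

lemma IsothermalCover.hat_eq_one (c : IsothermalCover g) {n : ℕ} {p : M} (hp : p ∈ c.dom n) :
    c.hat n p = 1 := by
  rw [IsothermalCover.hat, extendChart_apply (c.subset n hp), c.cut_eq n p hp]

lemma IsothermalCover.hat_mem_Icc (c : IsothermalCover g) (n : ℕ) (p : M) :
    c.hat n p ∈ Icc (0 : ℝ) 1 := by
  by_cases hp : p ∈ (c.chart n).1.source
  · rw [IsothermalCover.hat, extendChart_apply hp]; exact c.mem_Icc n _
  · rw [IsothermalCover.hat, extendChart, indicator_of_notMem hp]; simp

end Isothermal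

/-! ### Existence of the Levi-Civita connection -/

section LeviCivita

variable {M : Type*} [TopologicalSpace M] [ChartedSpace (Coord 2) M] {g : SingularMetric 2 M}

/-- The Christoffel symbols of the metric `e^{2φ} ((dx¹)² + (dx²)²)`, where `D` is the gradient
of `φ`. -/
def conformalSymbol (D : Fin 2 → ℝ) (i j k : Fin 2) : ℝ :=
  (if i = j then D k else 0) + (if i = k then D j else 0) - if j = k then D i else 0

/-- Christoffel symbols `G` in the chart `e₀`, transformed to the chart `e`. -/
noncomputable def transSymbol (e e₀ : atlas (Coord 2) M)
    (G : Coord 2 → Fin 2 → Fin 2 → Fin 2 → ℝ) (y : Coord 2) (i j k : Fin 2) : ℝ :=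
  (∑ a, ∑ b, ∑ c, jac e₀ e (chartTrans e e₀ y) i a * jac e e₀ y b j * jac e e₀ y c k *
    G (chartTrans e e₀ y) a b c) + ∑ a, jac e₀ e (chartTrans e e₀ y) i a * hess e e₀ y a j k

lemma chartTrans_chartTrans {e e' : atlas (Coord 2) M} (e₀ : atlas (Coord 2) M) {y : Coord 2}
    (hy : y ∈ (chartTrans e e').source) :
    chartTrans e' e₀ (chartTrans e e' y) = chartTrans e e₀ y := by
  change e₀.1 (e'.1.symm (e'.1 (e.1.symm y))) = e₀.1 (e.1.symm y)
  rw [e'.1.left_inv (mem_chartTrans_source.1 hy).2]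

lemma mem_source_of_mem {e e' e₀ : atlas (Coord 2) M} {y : Coord 2}
    (hy : y ∈ (chartTrans e e').source) (hy₀ : y ∈ (chartTrans e e₀).source) :
    chartTrans e e' y ∈ (chartTrans e' e₀).source := by
  refine mem_chartTrans_source.2 ⟨((chartTrans e e').map_source hy).1, ?_⟩
  change e'.1.symm (e'.1 (e.1.symm y)) ∈ _
  rw [e'.1.left_inv (mem_chartTrans_source.1 hy).2]
  exact (mem_chartTrans_source.1 hy₀).2

lemma jac_comp (hM : IsC11Manifold 2 M) {e e' e₀ : atlas (Coord 2) M} {y : Coord 2}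
    (hy : y ∈ (chartTrans e e').source) (hy₀ : y ∈ (chartTrans e e₀).source) :
    jac e e₀ y = jac e' e₀ (chartTrans e e' y) * jac e e' y := by
  have h := jacMat_comp (R := chartTrans e' e₀)
    ((hM.isC11Diffeo e' e₀).differentiableAt (mem_source_of_mem hy hy₀))
    ((hM.isC11Diffeo e e').differentiableAt hy)
  refine Eq.trans ?_ h
  ext a b
  refine pd_congr ?_
  filter_upwards [(chartTrans e e').open_source.mem_nhds hy] with z hz
  rw [chartTrans_chartTrans e₀ hz]

/-- The chain rule for second derivatives, for changes of coordinates that are differentiable twice at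
the point in question. -/
lemma hess_comp (hM : IsC11Manifold 2 M) {e e' e₀ : atlas (Coord 2) M} {y : Coord 2}
    (hy : y ∈ (chartTrans e e').source) (hy₀ : y ∈ (chartTrans e e₀).source)
    (hd : ∀ a b, DifferentiableAt ℝ (fun z => jacMat (chartTrans e e') z a b) y)
    (hd' : ∀ a b, DifferentiableAt ℝ (fun z => jacMat (chartTrans e' e₀) z a b)
      (chartTrans e e' y)) (a j k : Fin 2) :
    hess e e₀ y a j k =
      (∑ b, ∑ c, hess e' e₀ (chartTrans e e' y) a c b * jac e e' y c j * jac e e' y b k) +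
        ∑ b, jac e' e₀ (chartTrans e e' y) a b * hess e e' y b j k := by
  have hT := (hM.isC11Diffeo e e').differentiableAt hy
  have h1 : (fun z => jac e e₀ z a k) =ᶠ[𝓝 y]
      fun z => ∑ b, jacMat (chartTrans e' e₀) (chartTrans e e' z) a b *
        jacMat (chartTrans e e') z b k := by
    filter_upwards [(chartTrans e e').open_source.mem_nhds hy,
      (chartTrans e e₀).open_source.mem_nhds hy₀] with z hz hz₀
    rw [jac_comp hM hz hz₀, Matrix.mul_apply]
    rfl
  have hc : ∀ b, DifferentiableAt ℝ
      (fun z => jacMat (chartTrans e' e₀) (chartTrans e e' z) a b) y := fun b =>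
    DifferentiableAt.comp (g := fun w => jacMat (chartTrans e' e₀) w a b) y (hd' a b) hT
  have h2 : hess e e₀ y a j k = pd j (fun z => jac e e₀ z a k) y := rfl
  rw [h2, pd_congr h1, pd_sum _ _ fun b _ => (hc b).fun_mul (hd b k)]
  have h3 : ∀ b, pd j (fun z => jacMat (chartTrans e' e₀) (chartTrans e e' z) a b *
      jacMat (chartTrans e e') z b k) y =
      jac e' e₀ (chartTrans e e' y) a b * hess e e' y b j k +
      (∑ c, hess e' e₀ (chartTrans e e' y) a c b * jac e e' y c j) * jac e e' y b k := fun b => by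
    rw [pd_mul (hc b) (hd b k), pd_comp (h := fun w => jacMat (chartTrans e' e₀) w a b) (hd' a b) hT]
    rfl
  simp only [h3, Fin.sum_univ_two]
  ring

lemma transSymbol_algebra {A B K L : Matrix (Fin 2) (Fin 2) ℝ} (hLB : L * B = 1)
    (G H' HT : Fin 2 → Fin 2 → Fin 2 → ℝ) (i j k : Fin 2) :
    (∑ a, ∑ b, ∑ c, (K * L) i a * (B * A) b j * (B * A) c k * G a b c) +
      ∑ a, (K * L) i a * ((∑ b, ∑ c, H' a c b * A c j * A b k) + ∑ b, B a b * HT b j k) =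
    (∑ a, ∑ b, ∑ c, K i a * A b j * A c k *
      ((∑ d, ∑ e, ∑ f, L a d * B e b * B f c * G d e f) + ∑ d, L a d * H' d b c)) +
      ∑ a, K i a * HT a j k := by
  have h := sum_mul_sum_of_mul_eq_one hLB fun b => HT b j k
  have h0 := h 0
  have h1 := h 1
  simp only [Fin.sum_univ_two] at h0 h1
  simp only [Matrix.mul_apply, Fin.sum_univ_two]
  linear_combination K i 0 * h0 + K i 1 * h1

/-- Transforming from `e₀` to `e` agrees with transforming from `e₀` to `e'` and then to `e`. -/
lemma transSymbol_cocycle (hM : IsC11Manifold 2 M) {e e' e₀ : atlas (Coord 2) M} {y : Coord 2}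
    (G : Coord 2 → Fin 2 → Fin 2 → Fin 2 → ℝ)
    (hy : y ∈ (chartTrans e e').source) (hy₀ : y ∈ (chartTrans e e₀).source)
    (hd : ∀ a b, DifferentiableAt ℝ (fun z => jacMat (chartTrans e e') z a b) y)
    (hd' : ∀ a b, DifferentiableAt ℝ (fun z => jacMat (chartTrans e' e₀) z a b)
      (chartTrans e e' y)) (i j k : Fin 2) :
    transSymbol e e₀ G y i j k =
      (∑ a, ∑ b, ∑ c, jac e' e (chartTrans e e' y) i a * jac e e' y b j * jac e e' y c k *
        transSymbol e' e₀ G (chartTrans e e' y) a b c) +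
      ∑ a, jac e' e (chartTrans e e' y) i a * hess e e' y a j k := by
  have hs := mem_source_of_mem hy hy₀
  have hS : chartTrans e' e₀ (chartTrans e e' y) = chartTrans e e₀ y := chartTrans_chartTrans e₀ hy
  have hz : chartTrans e e₀ y ∈ (chartTrans e₀ e').source := by
    rw [← hS]; exact (chartTrans e' e₀).map_source hs
  have hz' : chartTrans e e₀ y ∈ (chartTrans e₀ e).source := (chartTrans e e₀).map_source hy₀
  have hT : chartTrans e₀ e' (chartTrans e e₀ y) = chartTrans e e' y :=
    chartTrans_chartTrans e' hy₀
  have hK : jac e₀ e (chartTrans e e₀ y) =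
      jac e' e (chartTrans e e' y) * jac e₀ e' (chartTrans e e₀ y) := by
    rw [jac_comp hM hz hz', hT]
  have hLB : jac e₀ e' (chartTrans e e₀ y) * jac e' e₀ (chartTrans e e' y) = 1 := by
    rw [← hS]
    exact (hM.isC11Diffeo e' e₀).jacMat_symm_mul hs
  unfold transSymbol
  rw [hS, hK, jac_comp hM hy hy₀]
  simp only [hess_comp hM hy hy₀ hd hd']
  exact transSymbol_algebra hLB _ _ _ i j k

lemma aemeasurable_transSymbol (hM : IsC11Manifold 2 M) (e e₀ : atlas (Coord 2) M)
    {G : Coord 2 → Fin 2 → Fin 2 → Fin 2 → ℝ}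
    (hG : ∀ a b c, AEMeasurable (fun x => G x a b c) (volume.restrict e₀.1.target))
    (i j k : Fin 2) :
    AEMeasurable (fun y => transSymbol e e₀ G y i j k)
      (volume.restrict (chartTrans e e₀).source) := by
  have H := hM.isC11Diffeo e e₀
  have hc : ∀ {w : Coord 2 → ℝ}, AEMeasurable w (volume.restrict e₀.1.target) →
      AEMeasurable (fun y => w (chartTrans e e₀ y)) (volume.restrict (chartTrans e e₀).source) :=
    fun hw => H.aemeasurable_comp
      (hw.mono_measure (Measure.restrict_mono (chartTrans_target_subset e e₀) le_rfl))
  have hK : ∀ i a, AEMeasurable (fun y => jac e₀ e (chartTrans e e₀ y) i a)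
      (volume.restrict (chartTrans e e₀).source) := fun i a =>
    hc (w := fun x => jac e₀ e x i a) measurable_pd.aemeasurable
  have hJ : ∀ a b, AEMeasurable (fun y => jac e e₀ y a b)
      (volume.restrict (chartTrans e e₀).source) := fun a b => measurable_pd.aemeasurable
  have hH : ∀ a b c, AEMeasurable (fun y => hess e e₀ y a b c)
      (volume.restrict (chartTrans e e₀).source) := fun a b c => measurable_pd.aemeasurable
  simp only [transSymbol, Fin.sum_univ_two]
  have ht : ∀ a b c, AEMeasurable (fun y => jac e₀ e (chartTrans e e₀ y) i a * jac e e₀ y b j *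
      jac e e₀ y c k * G (chartTrans e e₀ y) a b c) (volume.restrict (chartTrans e e₀).source) :=
    fun a b c => (((hK i a).mul (hJ b j)).mul (hJ c k)).mul (hc (hG a b c))
  have hu := fun a => (hK i a).mul (hH a j k)
  exact ((((ht 0 0 0).add (ht 0 0 1)).add ((ht 0 1 0).add (ht 0 1 1))).add
    (((ht 1 0 0).add (ht 1 0 1)).add ((ht 1 1 0).add (ht 1 1 1)))).add ((hu 0).add (hu 1))

section Partition

variable [MeasurableSpace M] (P : ChartPartition M)

lemma ChartPartition.exists_mem (p : M) : ∃ n, p ∈ P.part n := by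
  have : p ∈ ⋃ n, P.part n := P.iUnion_eq ▸ mem_univ p
  exact mem_iUnion.1 this

open Classical in
/-- The index of the part that contains a point. -/
noncomputable def ChartPartition.index (p : M) : ℕ := Nat.find (P.exists_mem p)

lemma ChartPartition.index_eq {n : ℕ} {p : M} (hp : p ∈ P.part n) : P.index p = n := by
  classical
  by_contra h
  exact disjoint_left.1 (P.disjoint h) (Nat.find_spec (P.exists_mem p)) hp

/-- A property holds almost everywhere in a chart if it does so on each part of the partition. -/
lemma ChartPartition.ae_of_forall (e : atlas (Coord 2) M) {Q : Coord 2 → Prop}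
    (h : ∀ n, ∀ᵐ y ∂(volume.restrict (chartTrans e (P.chart n)).source),
      e.1.symm y ∈ P.part n → Q y) : ∀ᵐ y ∂(volume.restrict e.1.target), Q y := by
  rw [ae_restrict_iff' e.1.open_target.measurableSet]
  have h' : ∀ᵐ y ∂(volume : Measure (Coord 2)), ∀ n, y ∈ (chartTrans e (P.chart n)).source →
      e.1.symm y ∈ P.part n → Q y := ae_all_iff.2 fun n =>
    (ae_restrict_iff' (chartTrans e (P.chart n)).open_source.measurableSet).1 (h n)
  filter_upwards [h'] with y hy hye
  obtain ⟨n, hn⟩ := P.exists_mem (e.1.symm y)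
  exact hy n (mem_chartTrans_source.2 ⟨hye, P.subset n hn⟩) hn

variable [BorelSpace M]

/-- The connection with prescribed Christoffel symbols `G n` on the `n`-th part of a partition. -/
noncomputable def glueConnection (hM : IsC11Manifold 2 M)
    (G : ℕ → Coord 2 → Fin 2 → Fin 2 → Fin 2 → ℝ)
    (hG : ∀ n a b c, AEMeasurable (fun x => G n x a b c) (volume.restrict (P.chart n).1.target))
    (hs : ∀ n x a b c, G n x a b c = G n x a c b) : MeasurableConnection 2 M where
  Γ e y := transSymbol e (P.chart (P.index (e.1.symm y))) (G (P.index (e.1.symm y))) y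
  aemeasurable e i j k := by
    have hcov : e.1.target = ⋃ n, chartImage e (P.part n) := by
      ext y
      simp only [chartImage, mem_iUnion, mem_inter_iff, mem_preimage]
      exact ⟨fun hy => (P.exists_mem (e.1.symm y)).imp fun n hn => ⟨hy, hn⟩, fun ⟨n, hn⟩ => hn.1⟩
    rw [hcov, aemeasurable_iUnion_iff]
    intro n
    refine ((aemeasurable_transSymbol hM e (P.chart n) (hG n) i j k).mono_measure
      (Measure.restrict_mono (chartImage_subset_source e _ (P.subset n)) le_rfl)).congr ?_
    filter_upwards [ae_restrict_mem (measurableSet_chartImage e (P.measurableSet n))] with y hy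
    rw [P.index_eq hy.2]
  torsionFree e := P.ae_of_forall e fun n => by
    filter_upwards [(hM.isC11Diffeo e (P.chart n)).ae_differentiableAt_jacMat] with y ⟨_, hsym⟩ hyn
    intro i j k
    rw [P.index_eq hyn]
    have hh : ∀ a, hess e (P.chart n) y a j k = hess e (P.chart n) y a k j := fun a => hsym a j k
    unfold transSymbol
    congr 1
    · refine Finset.sum_congr rfl fun a _ => ?_
      rw [Finset.sum_comm]
      refine Finset.sum_congr rfl fun c _ => Finset.sum_congr rfl fun b _ => ?_
      rw [hs]; ring
    · simp only [hh]
  transform e e' := by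
    have h : ∀ᵐ y ∂(volume.restrict e.1.target), y ∈ (chartTrans e e').source → ∀ i j k,
        transSymbol e (P.chart (P.index (e.1.symm y))) (G (P.index (e.1.symm y))) y i j k =
        (∑ a, ∑ b, ∑ c, jac e' e (chartTrans e e' y) i a * jac e e' y b j * jac e e' y c k *
          transSymbol e' (P.chart (P.index (e'.1.symm (chartTrans e e' y))))
            (G (P.index (e'.1.symm (chartTrans e e' y)))) (chartTrans e e' y) a b c) +
        ∑ a, jac e' e (chartTrans e e' y) i a * hess e e' y a j k := by
      refine P.ae_of_forall e fun n => ?_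
      rw [ae_restrict_iff' (chartTrans e (P.chart n)).open_source.measurableSet]
      filter_upwards [(ae_restrict_iff' (chartTrans e e').open_source.measurableSet).1
          (hM.isC11Diffeo e e').ae_differentiableAt_jacMat,
        (hM.isC11Diffeo e e').ae_comp (s := (chartTrans e e').target ∩
          (chartTrans e' (P.chart n)).source)
          ((chartTrans e e').open_target.inter
            (chartTrans e' (P.chart n)).open_source).measurableSet inter_subset_left
          (ae_mono (Measure.restrict_mono inter_subset_right le_rfl)
            (hM.isC11Diffeo e' (P.chart n)).ae_differentiableAt_jacMat)] with y h1 h2 hyn hyp hy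
      have hsym : e'.1.symm (chartTrans e e' y) = e.1.symm y :=
        e'.1.left_inv (mem_chartTrans_source.1 hy).2
      rw [hsym, P.index_eq hyp]
      exact transSymbol_cocycle hM (G n) hy hyn (h1 hy).1
        (h2 hy ⟨(chartTrans e e').map_source hy, mem_source_of_mem hy hyn⟩).1
    rw [ae_restrict_iff' (chartTrans e e').open_source.measurableSet]
    rw [ae_restrict_iff' e.1.open_target.measurableSet] at h
    exact h.mono fun y hy hys => hy (chartTrans_source_subset e e' hys) hys

end Partition

/-- The symbols of a conformal metric, transformed by a conformal change of coordinates, have the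
same form. -/
lemma transSymbol_conformal {e e₀ : atlas (Coord 2) M} {y : Coord 2} {s : ℝ}
    {D₀ : Coord 2 → Fin 2 → ℝ} (H : IsC11Diffeo (chartTrans e e₀)) (hc : IsConformal (chartTrans e e₀))
    (hy : y ∈ (chartTrans e e₀).source) (h : ConformalAt (chartTrans e e₀) y s)
    (i j k : Fin 2) :
    transSymbol e e₀ (fun x => conformalSymbol (D₀ x)) y i j k =
      conformalSymbol (fun k => (∑ a, jacMat (chartTrans e e₀) y a k * D₀ (chartTrans e e₀ y) a) +
        pd k (logFactor (chartTrans e e₀)) y) i j k := by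
  have hKJ := H.jacMat_symm_mul hy
  have hJJ := hc y hy
  set J := jacMat (chartTrans e e₀) y with hJ
  set K := jacMat (chartTrans e e₀).symm (chartTrans e e₀ y) with hK
  have hJK : J * K = 1 := H.jacMat_mul_symm hy
  set d := D₀ (chartTrans e e₀ y)
  set ψ : Fin 2 → ℝ := fun k => pd k (logFactor (chartTrans e e₀)) y
  have hh : ∀ a, hess e e₀ y a j k = ∑ l, J a l * conformalSymbol ψ l j k := fun a =>
    h.pd_jacMat a j k
  have hH : ∑ a, K i a * hess e e₀ y a j k = conformalSymbol ψ i j k := by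
    simp only [hh]
    exact sum_mul_sum_of_mul_eq_one hKJ (fun l => conformalSymbol ψ l j k) i
  -- `(Jᵀ J) K = Jᵀ`
  have hJt : J.transpose = |J.det| • K := by
    calc J.transpose = J.transpose * J * K := by rw [mul_assoc, hJK, mul_one]
      _ = |J.det| • K := by rw [hJJ, Matrix.smul_mul, one_mul]
  have hG : ∑ a, ∑ b, ∑ c, K i a * J b j * J c k * conformalSymbol d a b c =
      conformalSymbol (fun k => ∑ a, J a k * d a) i j k := by
    have k1 := fun l => congr_fun (congr_fun hKJ i) l
    have k2 := congr_fun (congr_fun hJJ j) k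
    have k3 := fun a => congr_fun (congr_fun hJt i) a
    have k1j := k1 j
    have k1k := k1 k
    have k30 := k3 0
    have k31 := k3 1
    simp only [Matrix.mul_apply, Matrix.transpose_apply, Fin.sum_univ_two, Matrix.smul_apply,
      Matrix.one_apply, smul_eq_mul] at k1j k1k k2 k30 k31
    have hij : (if i = j then ∑ a, J a k * d a else 0) =
        (if i = j then (1 : ℝ) else 0) * ∑ a, J a k * d a := by split_ifs <;> simp
    have hik : (if i = k then ∑ a, J a j * d a else 0) =
        (if i = k then (1 : ℝ) else 0) * ∑ a, J a j * d a := by split_ifs <;> simp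
    have hjk : (if j = k then ∑ a, J a i * d a else 0) =
        (if j = k then (1 : ℝ) else 0) * ∑ a, J a i * d a := by split_ifs <;> simp
    have hR : conformalSymbol (fun k => ∑ a, J a k * d a) i j k =
        (if i = j then (1 : ℝ) else 0) * (∑ a, J a k * d a) +
        (if i = k then (1 : ℝ) else 0) * (∑ a, J a j * d a) -
        (if j = k then (1 : ℝ) else 0) * ∑ a, J a i * d a := by
      unfold conformalSymbol
      simp only [hij, hik, hjk]
    rw [hR]
    simp only [← k1j, ← k1k, Fin.sum_univ_two, k30, k31]
    by_cases h' : j = k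
    · simp [conformalSymbol, h'] at k2 ⊢
      linear_combination (-(K i 0 * d 0 + K i 1 * d 1)) * k2
    · simp [conformalSymbol, h'] at k2 ⊢
      linear_combination (-(K i 0 * d 0 + K i 1 * d 1)) * k2
  have : transSymbol e e₀ (fun x => conformalSymbol (D₀ x)) y i j k =
      (∑ a, ∑ b, ∑ c, K i a * J b j * J c k * conformalSymbol d a b c) +
        ∑ a, K i a * hess e e₀ y a j k := rfl
  rw [this, hG, hH]
  unfold conformalSymbol
  split_ifs <;> ring

/-- The connection is glued from the conformal Christoffel symbols in the charts of a cover; since these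
symbols keep their form under changes of isothermal charts, it is the Levi-Civita connection in all of
them. -/
lemma exists_leviCivita [MeasurableSpace M] [BorelSpace M] (hM : IsC11Manifold 2 M)
    (c : IsothermalCover g) : ∃ conn : MeasurableConnection 2 M, IsLeviCivita g conn := by
  have hD : ∀ n, ∃ D, IsWeakGradientOn (c.exponent n) D (c.chart n).1.target := fun n =>
    ((c.isothermal n).1.exists_weakGradient (c.chart n).1.open_target).1
  choose D hD using hD
  have hDm : ∀ n k, AEMeasurable (D n k) (volume.restrict (c.chart n).1.target) := fun n k =>
    ((hD n).2.1 k).aestronglyMeasurable.aemeasurable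
  let G : ℕ → Coord 2 → Fin 2 → Fin 2 → Fin 2 → ℝ := fun n x => conformalSymbol fun k => D n k x
  have hG : ∀ n a b c', AEMeasurable (fun x => G n x a b c')
      (volume.restrict (c.partition.chart n).1.target) := fun n a b c' => by
    have hif : ∀ (p : Prop) [Decidable p] (k : Fin 2), AEMeasurable
        (fun x => if p then D n k x else 0) (volume.restrict (c.chart n).1.target) := by
      intro p _ k
      by_cases hp : p
      · simpa [hp] using hDm n k
      · simp [hp]
    exact ((hif _ c').add (hif _ b)).sub (hif _ a)
  have hs : ∀ n x a b c', G n x a b c' = G n x a c' b := fun n x a b c' => by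
    simp only [G, conformalSymbol, eq_comm (a := b) (b := c')]
    ring
  refine ⟨glueConnection c.partition hM G hG hs, fun e φ hφ => ?_⟩
  obtain ⟨D', hD'⟩ := (hφ.1.exists_weakGradient e.1.open_target).1
  refine ⟨D', hD', ?_⟩
  have key : ∀ᵐ y ∂(volume.restrict e.1.target), ∀ i j k,
      (glueConnection c.partition hM G hG hs).Γ e y i j k =
        conformalSymbol (fun k => D' k y) i j k := by
    refine c.partition.ae_of_forall e fun n => ?_
    have H := hM.isC11Diffeo e (c.chart n)
    have hc := isConformal_of_isothermal hM hφ (c.isothermal n)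
    have hgr := fun k => H.ae_gradient_eq (hD'.mono (chartTrans_source_subset e (c.chart n)))
      ((hD n).mono (chartTrans_target_subset e (c.chart n)))
      ((isothermal_pair_ae hM hφ (c.isothermal n)).mono fun y hy => hy.2) k
    change ∀ᵐ y ∂(volume.restrict (chartTrans e (c.chart n)).source), _
    filter_upwards [hc.ae_conformalAt H, ae_all_iff.2 hgr,
      ae_restrict_mem (chartTrans e (c.chart n)).open_source.measurableSet]
      with y ⟨s, hs⟩ hgr hy hyn
    intro i j k
    have h1 := transSymbol_conformal (D₀ := fun x k => D n k x) H hc hy hs i j k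
    have h2 : c.partition.index (e.1.symm y) = n := c.partition.index_eq hyn
    change transSymbol e (c.chart (c.partition.index (e.1.symm y)))
      (G (c.partition.index (e.1.symm y))) y i j k = _
    rw [h2]
    refine h1.trans ?_
    simp only [← hgr]
  filter_upwards [key, hφ.2] with y hy hgy
  intro i j k
  rw [hgy]
  simp only [hy, Matrix.smul_apply, Matrix.one_apply, smul_eq_mul, mul_ite, mul_one, mul_zero,
    ite_mul, zero_mul, Finset.sum_add_distrib, Finset.sum_ite_eq, Finset.sum_ite_eq',
    Finset.mem_univ, if_true, conformalSymbol]
  fin_cases i <;> fin_cases j <;> fin_cases k <;> simp <;> ring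

end LeviCivita

/-! ### Pairing of the conformal exponent with functions on the surface -/

section Pairing

variable {M : Type*} [TopologicalSpace M] [ChartedSpace (Coord 2) M] {g : SingularMetric 2 M}

/-- A function on the surface, in a chart; extended by zero to the plane. -/
noncomputable def inChart (e : atlas (Coord 2) M) (H : M → ℝ) : Coord 2 → ℝ :=
  e.1.target.indicator fun y => H (e.1.symm y)

lemma inChart_apply {e : atlas (Coord 2) M} {H : M → ℝ} {y : Coord 2} (hy : y ∈ e.1.target) :
    inChart e H y = H (e.1.symm y) := indicator_of_mem hy _

lemma tsupport_inChart_subset {e : atlas (Coord 2) M} {H : M → ℝ} {C : Set M} (hC : IsCompact C)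
    (hCe : C ⊆ e.1.source) (h0 : ∀ p ∉ C, H p = 0) : tsupport (inChart e H) ⊆ e.1 '' C := by
  refine closure_minimal (fun y hy => ?_)
    (hC.image_of_continuousOn (e.1.continuousOn.mono hCe)).isClosed
  by_cases hye : y ∈ e.1.target
  · by_contra hn
    refine hy ?_
    rw [inChart_apply hye]
    exact h0 _ fun h => hn ⟨_, h, e.1.right_inv hye⟩
  · exact (hy (indicator_of_notMem hye _)).elim

lemma isLipTest_inChart {e : atlas (Coord 2) M} {H : M → ℝ} (hH : IsLipFun H) {C : Set M}
    (hC : IsCompact C) (hCe : C ⊆ e.1.source) (h0 : ∀ p ∉ C, H p = 0) :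
    IsLipTest (inChart e H) e.1.target := by
  have hs := tsupport_inChart_subset hC hCe h0
  refine isLipTest_of_locallyLipschitzOn e.1.open_target
    (locallyLipschitzOn_congr (hH e) fun y hy => inChart_apply hy)
    ((hC.image_of_continuousOn (e.1.continuousOn.mono hCe)).of_isClosed_subset
      (isClosed_tsupport _) hs) (hs.trans ?_)
  rintro _ ⟨p, hp, rfl⟩
  exact e.1.map_source (hCe hp)

/-- The integral of `D · ∇f`. -/
noncomputable def gradPairing (D : Fin 2 → Coord 2 → ℝ) (f : Coord 2 → ℝ) : ℝ :=
  ∫ y, (D 0 y * pd 0 f y + D 1 y * pd 1 f y)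

lemma IsLipTest.ae_pd_add {Ω : Set (Coord 2)} {f h : Coord 2 → ℝ} (hf : IsLipTest f Ω)
    (hh : IsLipTest h Ω) :
    ∀ᵐ y, ∀ k, pd k (fun z => f z + h z) y = pd k f y + pd k h y := by
  have h1 := ae_differentiableAt_of_locallyLipschitzOn isOpen_univ (hf.locallyLipschitzOn univ)
  have h2 := ae_differentiableAt_of_locallyLipschitzOn isOpen_univ (hh.locallyLipschitzOn univ)
  rw [Measure.restrict_univ] at h1 h2
  filter_upwards [h1, h2] with y hy hy' k
  exact pd_add hy hy'

lemma gradPairing_add {Ω : Set (Coord 2)} {φ : Coord 2 → ℝ} {D : Fin 2 → Coord 2 → ℝ}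
    (hD : IsWeakGradientOn φ D Ω) {f h : Coord 2 → ℝ} (hf : IsLipTest f Ω) (hh : IsLipTest h Ω) :
    gradPairing D (fun y => f y + h y) = gradPairing D f + gradPairing D h := by
  have hi : ∀ {f : Coord 2 → ℝ}, IsLipTest f Ω →
      Integrable fun y => D 0 y * pd 0 f y + D 1 y * pd 1 f y := fun hf =>
    (hf.integrable_mul_pd (hD.2.1 0) 0).add (hf.integrable_mul_pd (hD.2.1 1) 1)
  unfold gradPairing
  rw [← integral_add (hi hf) (hi hh)]
  refine integral_congr_ae ?_
  filter_upwards [hf.ae_pd_add hh] with y hy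
  rw [hy, hy]
  ring

/-- For smooth functions the pairing is minus the integral of the exponent against the Laplacian, that is,
the curvature of the chart. -/
lemma gradPairing_eq_neg_integral_laplacian {Ω : Set (Coord 2)} {φ : Coord 2 → ℝ}
    {D : Fin 2 → Coord 2 → ℝ} (hD : IsWeakGradientOn φ D Ω) {f : Coord 2 → ℝ}
    (hf : ContDiff ℝ ∞ f) (hc : HasCompactSupport f) (hs : tsupport f ⊆ Ω) :
    gradPairing D f = -∫ y in Ω, (pd 0 (pd 0 f) y + pd 1 (pd 1 f) y) * φ y := by
  have ht : ∀ k, IsLipTest (pd k f) Ω := fun k => isLipTest_of_contDiff (contDiff_pd hf)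
    (hasCompactSupport_pd hc) (tsupport_pd_subset.trans hs)
  have hft := isLipTest_of_contDiff hf hc hs
  have h : ∀ k, ∫ y in Ω, φ y * pd k (pd k f) y = -∫ y, D k y * pd k f y := fun k => by
    rw [hD.2.2 k _ (contDiff_pd hf) (hasCompactSupport_pd hc) (tsupport_pd_subset.trans hs),
      setIntegral_eq_of_tsupport fun x hx => by
        rw [pd_eq_zero_of_notMem fun h => hx (hs h), mul_zero]]
  have hi : ∀ k, IntegrableOn (fun y => φ y * pd k (pd k f) y) Ω := fun k =>
    ((ht k).integrable_mul_pd hD.1 k).integrableOn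
  have h2 : ∫ y in Ω, (pd 0 (pd 0 f) y + pd 1 (pd 1 f) y) * φ y =
      ∫ y in Ω, (φ y * pd 0 (pd 0 f) y + φ y * pd 1 (pd 1 f) y) := by
    congr 1; ext y; ring
  rw [h2, integral_add (hi 0) (hi 1), h 0, h 1, gradPairing,
    integral_add (hft.integrable_mul_pd (hD.2.1 0) 0) (hft.integrable_mul_pd (hD.2.1 1) 1)]
  ring

/-- The pairing of the gradient of the conformal exponent with that of a function on the surface
does not depend on the isothermal chart. -/
lemma gradPairing_inChart_eq (hM : IsC11Manifold 2 M) {e e' : atlas (Coord 2) M}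
    {φ φ' : Coord 2 → ℝ} (h : IsIsothermal g e φ) (h' : IsIsothermal g e' φ')
    {D D' : Fin 2 → Coord 2 → ℝ} (hD : IsWeakGradientOn φ D e.1.target)
    (hD' : IsWeakGradientOn φ' D' e'.1.target) {H : M → ℝ} (hH : IsLipFun H) {C : Set M}
    (hC : IsCompact C) (hCe : C ⊆ e.1.source) (hCe' : C ⊆ e'.1.source)
    (h0 : ∀ p ∉ C, H p = 0) :
    gradPairing D (inChart e H) = gradPairing D' (inChart e' H) := by
  have hl := isLipTest_inChart hH hC hCe h0
  have hs : tsupport (inChart e H) ⊆ (chartTrans e e').source := by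
    refine (tsupport_inChart_subset hC hCe h0).trans ?_
    rintro _ ⟨p, hp, rfl⟩
    exact mem_chartTrans_source.2
      ⟨e.1.map_source (hCe hp), by rw [e.1.left_inv (hCe hp)]; exact hCe' hp⟩
  have key := (isConformal_of_isothermal hM h h').integral_gradient_eq (hM.isC11Diffeo e e')
    (hD.mono (chartTrans_source_subset e e')) (hD'.mono (chartTrans_target_subset e e'))
    ((isothermal_pair_ae hM h h').mono fun y hy => hy.2) ⟨hl.1, hl.2.1, hs⟩
  have heq : ((chartTrans e e').target.indicator fun x =>
      inChart e H ((chartTrans e e').symm x)) = inChart e' H := by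
    ext x
    by_cases hx : x ∈ (chartTrans e e').target
    · have hx' : x ∈ (chartTrans e' e).source := hx
      rw [indicator_of_mem hx, inChart_apply (mem_chartTrans_source.1 hx').1]
      change inChart e H (e.1 (e'.1.symm x)) = _
      rw [inChart_apply (e.1.map_source (mem_chartTrans_source.1 hx').2)]
      rw [e.1.left_inv (mem_chartTrans_source.1 hx').2]
    · rw [indicator_of_notMem hx]
      by_cases hx' : x ∈ e'.1.target
      · rw [inChart_apply hx']
        refine (h0 _ fun hp => hx ?_).symm
        exact mem_chartTrans_source (e := e') (e' := e) |>.2 ⟨hx', hCe hp⟩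
      · exact (indicator_of_notMem hx' _).symm
  rw [heq] at key
  exact key

/-! ### A partition of unity -/

/-- A partition of unity subordinate to an isothermal cover. -/
noncomputable def IsothermalCover.weight (c : IsothermalCover g) (n : ℕ) (p : M) : ℝ :=
  c.hat n p * ∏ m ∈ Finset.range n, (1 - c.hat m p)

/-- The compact set in the `n`-th chart that contains the support of the `n`-th cutoff function. -/
def IsothermalCover.core (c : IsothermalCover g) (n : ℕ) : Set M :=
  (c.chart n).1.symm '' tsupport (c.cut n)

lemma IsothermalCover.isCompact_core (c : IsothermalCover g) (n : ℕ) : IsCompact (c.core n) :=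
  (c.compact n).isCompact.image_of_continuousOn
    ((c.chart n).1.continuousOn_symm.mono (c.tsupport_subset n))

lemma IsothermalCover.core_subset (c : IsothermalCover g) (n : ℕ) :
    c.core n ⊆ (c.chart n).1.source := by
  rintro _ ⟨y, hy, rfl⟩
  exact (c.chart n).1.map_target (c.tsupport_subset n hy)

lemma IsothermalCover.hat_eq_zero (c : IsothermalCover g) {n : ℕ} {p : M} (hp : p ∉ c.core n) :
    c.hat n p = 0 := by
  by_cases h : p ∈ (c.chart n).1.source
  · rw [IsothermalCover.hat, extendChart_apply h]
    exact image_eq_zero_of_notMem_tsupport fun h' => hp ⟨_, h', (c.chart n).1.left_inv h⟩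
  · rw [IsothermalCover.hat, extendChart, indicator_of_notMem h]

lemma IsothermalCover.weight_eq_zero (c : IsothermalCover g) {n : ℕ} {p : M} (hp : p ∉ c.core n) :
    c.weight n p = 0 := by rw [IsothermalCover.weight, c.hat_eq_zero hp, zero_mul]

lemma IsothermalCover.weight_eq_zero_of_lt (c : IsothermalCover g) {i n : ℕ} (h : i < n) {p : M}
    (hp : p ∈ c.dom i) : c.weight n p = 0 := by
  rw [IsothermalCover.weight, Finset.prod_eq_zero (Finset.mem_range.2 h)
    (by rw [c.hat_eq_one hp, sub_self]), mul_zero]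

lemma IsothermalCover.weight_mem_Icc (c : IsothermalCover g) (n : ℕ) (p : M) :
    c.weight n p ∈ Icc (0 : ℝ) 1 := by
  have h := c.hat_mem_Icc
  have h1 : 0 ≤ ∏ m ∈ Finset.range n, (1 - c.hat m p) :=
    Finset.prod_nonneg fun m _ => sub_nonneg.2 (h m p).2
  have h2 : ∏ m ∈ Finset.range n, (1 - c.hat m p) ≤ 1 :=
    Finset.prod_le_one (fun m _ => sub_nonneg.2 (h m p).2) fun m _ => by linarith [(h m p).1]
  exact ⟨mul_nonneg (h n p).1 h1, mul_le_one₀ (h n p).2 h1 h2⟩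

lemma IsothermalCover.sum_weight (c : IsothermalCover g) (N : ℕ) (p : M) :
    ∑ n ∈ Finset.range N, c.weight n p = 1 - ∏ m ∈ Finset.range N, (1 - c.hat m p) := by
  induction N with
  | zero => simp
  | succ N ih =>
    rw [Finset.sum_range_succ, ih, Finset.prod_range_succ, IsothermalCover.weight]
    ring

lemma IsothermalCover.sum_weight_eq_one (c : IsothermalCover g) {i N : ℕ} (h : i < N) {p : M}
    (hp : p ∈ c.dom i) : ∑ n ∈ Finset.range N, c.weight n p = 1 := by
  rw [c.sum_weight, Finset.prod_eq_zero (Finset.mem_range.2 h)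
    (by rw [c.hat_eq_one hp, sub_self]), sub_zero]

lemma IsothermalCover.isLipFun_weight [T2Space M] (hM : IsC11Manifold 2 M) (c : IsothermalCover g)
    (n : ℕ) : IsLipFun (c.weight n) := by
  have h : IsLipFun fun p => ∏ m ∈ Finset.range n, (1 - c.hat m p) := by
    induction n with
    | zero => simpa using isLipFun_const (M := M) 1
    | succ n ih =>
      simp only [Finset.prod_range_succ]
      exact ih.mul ((isLipFun_const 1).sub (c.isLipFun_hat hM n))
  exact (c.isLipFun_hat hM n).mul h

lemma IsothermalCover.exists_subset_iUnion_lt (c : IsothermalCover g) {C : Set M}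
    (hC : IsCompact C) : ∃ N, ∀ p ∈ C, ∃ i < N, p ∈ c.dom i := by
  obtain ⟨t, ht⟩ := hC.elim_finite_subcover c.dom c.isOpen (by rw [c.iUnion_eq]; exact subset_univ _)
  refine ⟨t.sup id + 1, fun p hp => ?_⟩
  obtain ⟨i, hi, hpi⟩ := mem_iUnion₂.1 (ht hp)
  exact ⟨i, Nat.lt_succ_of_le (Finset.le_sup (f := id) hi), hpi⟩

/-! ### Gluing measures -/

variable [MeasurableSpace M] [BorelSpace M]

lemma integral_map_symm (e : atlas (Coord 2) M) (μ : Measure (Coord 2)) {H : M → ℝ}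
    (hH : Continuous H) :
    ∫ p, H p ∂(Measure.map e.1.symm (μ.restrict e.1.target)) = ∫ y, inChart e H y ∂μ := by
  rw [integral_map (e.1.continuousOn_symm.aemeasurable e.1.open_target.measurableSet)
    hH.aestronglyMeasurable, ← integral_indicator e.1.open_target.measurableSet]
  rfl

/-- Measures in the charts of a cover, glued with the partition of unity. -/
noncomputable def IsothermalCover.glue (c : IsothermalCover g) (μ : ℕ → Measure (Coord 2)) :
    Measure M :=
  Measure.sum fun n => (Measure.map (c.chart n).1.symm
    ((μ n).restrict (c.chart n).1.target)).withDensity fun p => ENNReal.ofReal (c.weight n p)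

variable [T2Space M]

/-- On the open set `dom n` only the first `n + 1` weights are nonzero, and each of the measures is finite
on the support of its weight. -/
lemma IsothermalCover.isLocallyFiniteMeasure_glue (c : IsothermalCover g)
    {μ : ℕ → Measure (Coord 2)} (hμ : ∀ n, μ n (tsupport (c.cut n)) < ⊤) :
    IsLocallyFiniteMeasure (c.glue μ) := by
  refine ⟨fun p => ?_⟩
  obtain ⟨n, hn⟩ := mem_iUnion.1 (c.iUnion_eq ▸ mem_univ p : p ∈ ⋃ n, c.dom n)
  refine ⟨c.dom n, (c.isOpen n).mem_nhds hn, ?_⟩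
  have hm := (c.isOpen n).measurableSet
  rw [IsothermalCover.glue, Measure.sum_apply _ hm, tsum_eq_sum (s := Finset.range (n + 1))]
  · refine ENNReal.sum_lt_top.2 fun i _ => ?_
    rw [withDensity_apply _ hm]
    set κ := Measure.map (c.chart i).1.symm ((μ i).restrict (c.chart i).1.target)
    have hκ : κ (c.core i) < ⊤ := by
      have hcm := (c.isCompact_core i).isClosed.measurableSet
      rw [Measure.map_apply_of_aemeasurable ((c.chart i).1.continuousOn_symm.aemeasurable
        (c.chart i).1.open_target.measurableSet) hcm,
        Measure.restrict_apply' (c.chart i).1.open_target.measurableSet]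
      refine (measure_mono ?_).trans_lt (hμ i)
      rintro y ⟨⟨z, hz, hzy⟩, hy⟩
      rw [← (c.chart i).1.symm.injOn (c.tsupport_subset i hz) hy hzy]
      exact hz
    calc ∫⁻ p in c.dom n, ENNReal.ofReal (c.weight i p) ∂κ
        ≤ ∫⁻ p, ENNReal.ofReal (c.weight i p) ∂κ := setLIntegral_le_lintegral _ _
      _ ≤ ∫⁻ p, (c.core i).indicator 1 p ∂κ := by
          refine lintegral_mono fun p => ?_
          by_cases hp : p ∈ c.core i
          · rw [indicator_of_mem hp]
            exact ENNReal.ofReal_le_one.2 (c.weight_mem_Icc i p).2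
          · rw [c.weight_eq_zero hp, ENNReal.ofReal_zero]; exact zero_le
      _ = κ (c.core i) := lintegral_indicator_one (c.isCompact_core i).isClosed.measurableSet
      _ < ⊤ := hκ
  · intro i hi
    rw [withDensity_apply _ hm]
    refine (setLIntegral_congr_fun hm fun p hp => ?_).trans lintegral_zero
    rw [c.weight_eq_zero_of_lt (by simpa using hi) hp, ENNReal.ofReal_zero]

/-- On the support of `H` all but finitely many weights vanish. -/
lemma IsothermalCover.integral_glue (hM : IsC11Manifold 2 M) (c : IsothermalCover g)
    {μ : ℕ → Measure (Coord 2)} {H : M → ℝ} (hH : Continuous H) (hi : Integrable H (c.glue μ))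
    {N : ℕ} (hN : ∀ p, H p ≠ 0 → ∃ i < N, p ∈ c.dom i) :
    ∫ p, H p ∂(c.glue μ) =
      ∑ n ∈ Finset.range N, ∫ y, inChart (c.chart n) (fun p => c.weight n p * H p) y ∂(μ n) := by
  have ht : ∀ n, ∫ p, H p ∂((Measure.map (c.chart n).1.symm
      ((μ n).restrict (c.chart n).1.target)).withDensity fun p => ENNReal.ofReal (c.weight n p)) =
      ∫ y, inChart (c.chart n) (fun p => c.weight n p * H p) y ∂(μ n) := fun n => by
    have hw := (c.isLipFun_weight hM n).continuous
    rw [integral_withDensity_eq_integral_toReal_smul hw.measurable.ennreal_ofReal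
      (ae_of_all _ fun _ => ENNReal.ofReal_lt_top), ← integral_map_symm (H := fun p => c.weight n p * H p) _ _
      (hw.mul hH)]
    simp only [ENNReal.toReal_ofReal (c.weight_mem_Icc n _).1, smul_eq_mul]
  refine (hasSum_integral_measure hi).unique ?_
  simp only [ht]
  refine hasSum_sum_of_ne_finset_zero fun n hn => ?_
  have hz : (fun p => c.weight n p * H p) = fun _ => 0 := by
    ext p
    by_cases hp : H p = 0
    · rw [hp, mul_zero]
    · obtain ⟨i, hi, hpi⟩ := hN p hp
      rw [c.weight_eq_zero_of_lt (hi.trans_le (by simpa using hn)) hpi, zero_mul]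
  rw [hz]
  simp [inChart]

/-! ### Existence of the curvature measure -/

omit [ChartedSpace (Coord 2) M] in
lemma integrable_of_continuous_of_compact {κ : Measure M} [IsLocallyFiniteMeasure κ] {H : M → ℝ}
    (hH : Continuous H) {C : Set M} (hC : IsCompact C) (h0 : ∀ p ∉ C, H p = 0) :
    Integrable H κ :=
  hH.integrable_of_hasCompactSupport (HasCompactSupport.intro hC h0)

/-- The Riesz measures of the exponents in the charts of a cover, glued with a partition of unity. That
the result is the curvature measure in every isothermal chart rests on the independence of the pairing
`gradPairing` from the chart. -/
lemma exists_curvatureMeasure (hM : IsC11Manifold 2 M) (c : IsothermalCover g) :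
    ∃ K : SignedRadonMeasure M, IsCurvatureMeasure g K := by
  have h := fun n => (c.isothermal n).1.exists_weakGradient (c.chart n).1.open_target
  choose D hD using fun n => (h n).1
  choose μ ν hμ hν hK using fun n => (h n).2
  have hμl := c.isLocallyFiniteMeasure_glue fun n => hμ n _ (c.compact n) (c.tsupport_subset n)
  have hνl := c.isLocallyFiniteMeasure_glue fun n => hν n _ (c.compact n) (c.tsupport_subset n)
  refine ⟨⟨c.glue μ, c.glue ν, hμl, hνl⟩, fun e φ hφ f hf hfc hfs => ?_⟩
  obtain ⟨D', hD'⟩ := (hφ.1.exists_weakGradient e.1.open_target).1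
  have hft : IsLipTest f e.1.target := isLipTest_of_contDiff hf hfc hfs
  set H := extendChart e f with hH
  have hHl : IsLipFun H := isLipFun_extendChart hM hft
  set C := e.1.symm '' tsupport f with hCdef
  have hC : IsCompact C := hfc.isCompact.image_of_continuousOn (e.1.continuousOn_symm.mono hfs)
  have hCe : C ⊆ e.1.source := by
    rintro _ ⟨y, hy, rfl⟩
    exact e.1.map_target (hfs hy)
  have h0 : ∀ p ∉ C, H p = 0 := fun p hp => by
    by_cases hpe : p ∈ e.1.source
    · rw [hH, extendChart_apply hpe]
      exact image_eq_zero_of_notMem_tsupport fun h' => hp ⟨_, h', e.1.left_inv hpe⟩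
    · exact indicator_of_notMem hpe _
  have hHf : inChart e H = f := by
    ext y
    by_cases hy : y ∈ e.1.target
    · rw [inChart_apply hy, hH, extendChart_apply (e.1.map_target hy), e.1.right_inv hy]
    · rw [inChart, indicator_of_notMem hy]
      exact (image_eq_zero_of_notMem_tsupport fun h' => hy (hfs h')).symm
  obtain ⟨N, hN⟩ := c.exists_subset_iUnion_lt hC
  have hN' : ∀ p, H p ≠ 0 → ∃ i < N, p ∈ c.dom i := fun p hp => hN p (by
    by_contra h'; exact hp (h0 p h'))
  have hset : ∀ κ : Measure M, ∫ p in e.1.source, f (e.1 p) ∂κ = ∫ p, H p ∂κ := fun κ => by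
    rw [hH, extendChart, integral_indicator e.1.open_source.measurableSet]
  -- each term of the sum can be computed in the chart `e`
  have hterm : ∀ n, ∫ y, inChart (c.chart n) (fun p => c.weight n p * H p) y ∂(μ n) -
      ∫ y, inChart (c.chart n) (fun p => c.weight n p * H p) y ∂(ν n) =
      gradPairing D' (inChart e fun p => c.weight n p * H p) := fun n => by
    have hl := (c.isLipFun_weight hM n).mul hHl
    have h1 : ∀ p ∉ c.core n ∩ C, c.weight n p * H p = 0 := fun p hp => by
      by_cases hp' : p ∈ c.core n
      · rw [h0 p fun h' => hp ⟨hp', h'⟩, mul_zero]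
      · rw [c.weight_eq_zero hp', zero_mul]
    have hcC : IsCompact (c.core n ∩ C) := (c.isCompact_core n).inter hC
    rw [integral_sub_integral_eq_of_laplacian (c.chart n).1.open_target (hD n) (hμ n) (hν n) (hK n)
      (isLipTest_inChart hl hcC (inter_subset_left.trans (c.core_subset n)) h1)]
    exact gradPairing_inChart_eq hM (c.isothermal n) hφ (hD n) hD' hl hcC
      (inter_subset_left.trans (c.core_subset n)) (inter_subset_right.trans hCe) h1
  have hlt : ∀ n, IsLipTest (inChart e fun p => c.weight n p * H p) e.1.target := fun n =>
    isLipTest_inChart ((c.isLipFun_weight hM n).mul hHl) hC hCe fun p hp => by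
      rw [h0 p hp, mul_zero]
  have hsum : ∀ n, IsLipTest
        (fun y => ∑ m ∈ Finset.range n, inChart e (fun p => c.weight m p * H p) y) e.1.target ∧
      ∑ m ∈ Finset.range n, gradPairing D' (inChart e fun p => c.weight m p * H p) =
        gradPairing D' fun y => ∑ m ∈ Finset.range n, inChart e (fun p => c.weight m p * H p) y := by
    intro n
    induction n with
    | zero =>
      refine ⟨?_, ?_⟩
      · simpa using isLipTest_of_contDiff (f := fun _ => (0 : ℝ)) contDiff_const
          HasCompactSupport.zero (by simp [tsupport])
      · simp [gradPairing, pd_const]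
    | succ n ih =>
      simp only [Finset.sum_range_succ]
      exact ⟨ih.1.add e.1.open_target (hlt n), by rw [ih.2, gradPairing_add hD' ih.1 (hlt n)]⟩
  have hone : (fun y => ∑ m ∈ Finset.range N, inChart e (fun p => c.weight m p * H p) y) = f := by
    rw [← hHf]
    ext y
    by_cases hy : y ∈ e.1.target
    · simp only [inChart_apply hy, ← Finset.sum_mul]
      by_cases hp : H (e.1.symm y) = 0
      · rw [hp, mul_zero]
      · obtain ⟨i, hi, hpi⟩ := hN' _ hp
        rw [c.sum_weight_eq_one hi hpi, one_mul]
    · simp [inChart, hy]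
  rw [hset, hset, c.integral_glue hM hHl.continuous
      (integrable_of_continuous_of_compact hHl.continuous hC h0) hN',
    c.integral_glue hM hHl.continuous
      (integrable_of_continuous_of_compact hHl.continuous hC h0) hN',
    ← Finset.sum_sub_distrib, Finset.sum_congr rfl fun n _ => hterm n, (hsum N).2, hone]
  exact gradPairing_eq_neg_integral_laplacian hD' hf hfc hfs

end Pairing

/-! ### The quotient of the metric by the volume -/

section Quotient

variable {M : Type*} [TopologicalSpace M] [ChartedSpace (Coord 2) M] {g : SingularMetric 2 M}

/-- The Euclidean inner product of the components of two half-densities in a chart. -/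
def coordInner (V W : LipHalfDensity 2 M) (e : atlas (Coord 2) M) (y : Coord 2) : ℝ :=
  V.coord e y 0 * W.coord e y 0 + V.coord e y 1 * W.coord e y 1

variable (V W : LipHalfDensity 2 M)

lemma locallyLipschitzOn_coordInner (e : atlas (Coord 2) M) :
    LocallyLipschitzOn e.1.target (coordInner V W e) :=
  locallyLipschitzOn_add
    (locallyLipschitzOn_mul (V.locallyLipschitzOn_coord e 0) (W.locallyLipschitzOn_coord e 0))
    (locallyLipschitzOn_mul (V.locallyLipschitzOn_coord e 1) (W.locallyLipschitzOn_coord e 1))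

/-- The transformation of `g(V, W) / dvol_g` from a chart in which `g` is a multiple `c` of the
Euclidean metric. -/
lemma quotient_algebra {J K : Matrix (Fin 2) (Fin 2) ℝ} (hJK : J * K = 1) {c : ℝ} (hc : 0 < c)
    (v w : Fin 2 → ℝ) :
    (∑ i, ∑ j, (J.transpose * (c • (1 : Matrix (Fin 2) (Fin 2) ℝ)) * J) i j *
      (Real.sqrt |J.det| * ∑ a, K i a * v a) * (Real.sqrt |J.det| * ∑ a, K j a * w a)) /
      Real.sqrt (J.transpose * (c • (1 : Matrix (Fin 2) (Fin 2) ℝ)) * J).det =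
    v 0 * w 0 + v 1 * w 1 := by
  have hdet : J.det ≠ 0 := fun h => by
    have := congr_arg Matrix.det hJK
    rw [Matrix.det_mul, h, zero_mul, Matrix.det_one] at this
    exact zero_ne_one this
  have hρ := abs_pos.2 hdet
  have h1 : Real.sqrt (J.transpose * (c • (1 : Matrix (Fin 2) (Fin 2) ℝ)) * J).det =
      c * |J.det| := by
    rw [Matrix.det_mul, Matrix.det_mul, Matrix.det_transpose, Matrix.det_smul, Matrix.det_one,
      Fintype.card_fin, mul_one,
      show J.det * c ^ 2 * J.det = (c * |J.det|) ^ 2 by rw [mul_pow, sq_abs]; ring,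
      Real.sqrt_sq (by positivity)]
  have hs : Real.sqrt |J.det| * Real.sqrt |J.det| = |J.det| := Real.mul_self_sqrt hρ.le
  have hv := sum_mul_sum_of_mul_eq_one hJK v
  have hw := sum_mul_sum_of_mul_eq_one hJK w
  rw [h1, div_eq_iff (by positivity), Matrix.mul_smul, Matrix.mul_one, Matrix.smul_mul,
    ← hv 0, ← hv 1, ← hw 0, ← hw 1]
  generalize Real.sqrt |J.det| = s at hs ⊢
  rw [← hs]
  simp only [Fin.sum_univ_two, Matrix.smul_apply, Matrix.mul_apply, Matrix.transpose_apply,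
    smul_eq_mul]
  ring

/-- Half-densities are scaled under a conformal change of coordinates by orthogonal matrices, so that the
Euclidean inner product of their components does not change. -/
lemma IsConformal.coordInner_eq (hM : IsC11Manifold 2 M) {e e' : atlas (Coord 2) M}
    (hc : IsConformal (chartTrans e e')) {y : Coord 2} (hy : y ∈ (chartTrans e e').source) :
    coordInner V W e y = coordInner V W e' (chartTrans e e' y) := by
  have H := hM.isC11Diffeo e e'
  have hJK : jac e e' y * jac e' e (chartTrans e e' y) = 1 := H.jacMat_mul_symm hy
  have hJJ : (jac e e' y).transpose * jac e e' y =
      |(jac e e' y).det| • (1 : Matrix (Fin 2) (Fin 2) ℝ) := hc y hy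
  have hρ : 0 < |(jac e e' y).det| := abs_pos.2 (H.det_ne_zero hy)
  have key := quotient_algebra hJK one_pos (V.coord e' (chartTrans e e' y))
    (W.coord e' (chartTrans e e' y))
  rw [one_smul, Matrix.mul_one, hJJ, Matrix.det_smul, Matrix.det_one, Fintype.card_fin, mul_one,
    Real.sqrt_sq hρ.le] at key
  unfold coordInner
  rw [← key, eq_div_iff hρ.ne']
  simp only [V.transform e e' y hy, W.transform e e' y hy, Fin.sum_univ_two, Matrix.smul_apply,
    Matrix.one_apply, smul_eq_mul]
  simp
  ring

/-- The function `g(V, W) / dvol_g` at a point, computed in an arbitrary isothermal chart. -/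
noncomputable def metricQuotient (hg : HasBoundedIntegralCurvature g) (V W : LipHalfDensity 2 M)
    (p : M) : ℝ :=
  coordInner V W (hg p).choose ((hg p).choose.1 p)

variable (hg : HasBoundedIntegralCurvature g)

lemma metricQuotient_eq (hM : IsC11Manifold 2 M) {e : atlas (Coord 2) M} {φ : Coord 2 → ℝ}
    (h : IsIsothermal g e φ) {y : Coord 2} (hy : y ∈ e.1.target) :
    metricQuotient hg V W (e.1.symm y) = coordInner V W e y := by
  obtain ⟨hp, φ', h'⟩ := (hg (e.1.symm y)).choose_spec
  exact ((isConformal_of_isothermal hM h h').coordInner_eq V W hM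
    (mem_chartTrans_source.2 ⟨hy, hp⟩)).symm

lemma isLipFun_metricQuotient (hM : IsC11Manifold 2 M) : IsLipFun (metricQuotient hg V W) := by
  intro e
  refine locallyLipschitzOn_of_forall_isOpen fun x hx => ?_
  obtain ⟨e', hp, φ', h'⟩ := hg (e.1.symm x)
  refine ⟨(chartTrans e e').source, (chartTrans e e').open_source,
    mem_chartTrans_source.2 ⟨hx, hp⟩, ?_⟩
  have h1 : LocallyLipschitzOn (chartTrans e e').source
      fun y => coordInner V W e' (chartTrans e e' y) :=
    locallyLipschitzOn_comp (locallyLipschitzOn_coordInner V W e')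
      (hM.isC11Diffeo e e').locallyLipschitzOn
      fun y hy => chartTrans_target_subset e e' ((chartTrans e e').map_source hy)
  refine (locallyLipschitzOn_congr h1 fun y hy => ?_).mono inter_subset_right
  rw [← metricQuotient_eq V W hg hM h'
    (chartTrans_target_subset e e' ((chartTrans e e').map_source hy))]
  congr 1
  exact (e'.1.left_inv (mem_chartTrans_source.1 hy).2).symm

/-- In an arbitrary chart the metric is almost everywhere the pullback of a multiple of the Euclidean
metric, and the multiple cancels in the quotient. -/
lemma isLipQuotient_metricQuotient [MeasurableSpace M] [BorelSpace M] (hM : IsC11Manifold 2 M)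
    (c : IsothermalCover g) : IsLipQuotient g V W (metricQuotient hg V W) := by
  refine fun e => ⟨isLipFun_metricQuotient V W hg hM e, c.partition.ae_of_forall e fun n => ?_⟩
  have hc := c.isothermal n
  change ∀ᵐ y ∂(volume.restrict (chartTrans e (c.chart n)).source), _
  filter_upwards [ae_restrict_mem (chartTrans e (c.chart n)).open_source.measurableSet,
    g.transform e (c.chart n), (hM.isC11Diffeo e (c.chart n)).ae_comp_target
      (ae_mono (Measure.restrict_mono (chartTrans_target_subset e (c.chart n)) le_rfl) hc.2)]
    with y hy h1 h2 _
  have hT := chartTrans_target_subset e (c.chart n) ((chartTrans e (c.chart n)).map_source hy)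
  have hp : e.1.symm y = (c.chart n).1.symm (chartTrans e (c.chart n) y) :=
    ((c.chart n).1.left_inv (mem_chartTrans_source.1 hy).2).symm
  have hJK : jac e (c.chart n) y * jac (c.chart n) e (chartTrans e (c.chart n) y) = 1 :=
    (hM.isC11Diffeo e (c.chart n)).jacMat_mul_symm hy
  rw [hp, metricQuotient_eq V W hg hM hc hT, h1, h2]
  simp only [V.transform e (c.chart n) y hy, W.transform e (c.chart n) y hy]
  exact (quotient_algebra hJK (Real.exp_pos _) _ _).symm

/-! ### Multiplication of half-densities by functions -/

/-- The product of a vector-valued half-density with a locally Lipschitz function. -/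
def LipHalfDensity.smul (χ : M → ℝ) (hχ : IsLipFun χ) (V : LipHalfDensity 2 M) :
    LipHalfDensity 2 M where
  coord e y i := χ (e.1.symm y) * V.coord e y i
  locallyLipschitz e := by
    have h1 : LocallyLipschitzOn univ fun p : ℝ × (Fin 2 → ℝ) => fun i => p.1 * p.2 i :=
      locallyLipschitzOn_of_contDiffOn isOpen_univ (by fun_prop)
    exact locallyLipschitzOn_comp h1 (locallyLipschitzOn_prodMk (hχ e) (V.locallyLipschitz e))
      (mapsTo_univ _ _)
  transform e e' y hy i := by
    have hp : e'.1.symm (chartTrans e e' y) = e.1.symm y :=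
      e'.1.left_inv (mem_chartTrans_source.1 hy).2
    rw [V.transform e e' y hy i, hp]
    simp only [Fin.sum_univ_two]
    ring
  compactSupport := by
    obtain ⟨C, hC, h0⟩ := V.compactSupport
    exact ⟨C, hC, fun e y hy hyC => by
      ext i
      simp [h0 e y hy hyC]⟩

lemma metricQuotient_smul (χ : M → ℝ) (hχ : IsLipFun χ) (p : M) :
    metricQuotient hg (V.smul χ hχ) W p = χ p * metricQuotient hg V W p := by
  have hp : (hg p).choose.1.symm ((hg p).choose.1 p) = p :=
    (hg p).choose.1.left_inv (hg p).choose_spec.1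
  simp only [metricQuotient, coordInner, LipHalfDensity.smul, hp]
  ring

/-- The half-density `V` vanishes outside the set `C`. -/
def LipHalfDensity.VanishesOff (V : LipHalfDensity 2 M) (C : Set M) : Prop :=
  ∀ e : atlas (Coord 2) M, ∀ y ∈ e.1.target, e.1.symm y ∉ C → V.coord e y = 0

variable {V} in
lemma LipHalfDensity.VanishesOff.metricQuotient_eq_zero {C : Set M} (hV : V.VanishesOff C) {p : M}
    (hp : p ∉ C) : metricQuotient hg V W p = 0 := by
  have h := (hg p).choose_spec.1
  have := hV (hg p).choose ((hg p).choose.1 p) ((hg p).choose.1.map_source h)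
    (by rwa [(hg p).choose.1.left_inv h])
  simp [metricQuotient, coordInner, this]

end Quotient

/-! ### The integrand as a density -/

section Integrand

variable {M : Type*} [TopologicalSpace M] [ChartedSpace (Coord 2) M]
  (conn : MeasurableConnection 2 M) (V W : LipHalfDensity 2 M)

lemma LipHalfDensity.aemeasurable_coord (e : atlas (Coord 2) M) (i : Fin 2) :
    AEMeasurable (fun y => V.coord e y i) (volume.restrict e.1.target) :=
  (V.locallyLipschitzOn_coord e i).continuousOn.aemeasurable e.1.open_target.measurableSet

lemma aemeasurable_covDeriv (e : atlas (Coord 2) M) (i j : Fin 2) :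
    AEMeasurable (fun y => covDeriv conn V e y i j) (volume.restrict e.1.target) := by
  have hV := V.aemeasurable_coord e
  have hΓ := conn.aemeasurable e
  simp only [covDeriv, Fin.sum_univ_two]
  exact (measurable_pd.aemeasurable.add (((hΓ j 0 i).mul (hV 0)).add ((hΓ j 1 i).mul (hV 1)))).sub
    ((((hΓ 0 0 i).mul (hV j)).add ((hΓ 1 1 i).mul (hV j))).const_mul _)

lemma integrand_eq (e : atlas (Coord 2) M) (y : Coord 2) :
    integrand conn V W e y =
      covDeriv conn V e y 0 0 * covDeriv conn W e y 1 1 +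
      covDeriv conn V e y 1 1 * covDeriv conn W e y 0 0 -
      covDeriv conn V e y 0 1 * covDeriv conn W e y 1 0 -
      covDeriv conn V e y 1 0 * covDeriv conn W e y 0 1 := by
  simp only [integrand, Fin.sum_univ_two]
  ring

lemma isDensity_integrand (hM : IsC11Manifold 2 M) : IsDensity (integrand conn V W) where
  aemeasurable e := by
    have hV := aemeasurable_covDeriv conn V e
    have hW := aemeasurable_covDeriv conn W e
    refine (((((hV 0 0).mul (hW 1 1)).add ((hV 1 1).mul (hW 0 0))).sub
      ((hV 0 1).mul (hW 1 0))).sub ((hV 1 0).mul (hW 0 1))).congr ?_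
    exact ae_of_all _ fun y => (integrand_eq conn V W e y).symm
  transform := ae_integrand_eq conn V W hM

/-- The integrand is additive under splitting the first argument with two functions of sum one. -/
lemma ae_integrand_smul_add (χ χ' : M → ℝ) (hχ : IsLipFun χ) (hχ' : IsLipFun χ')
    (h : ∀ p, χ p + χ' p = 1) (e : atlas (Coord 2) M) :
    ∀ᵐ y ∂(volume.restrict e.1.target), integrand conn V W e y =
      integrand conn (V.smul χ hχ) W e y + integrand conn (V.smul χ' hχ') W e y := by
  filter_upwards [(V.smul χ hχ).ae_differentiableAt e, (V.smul χ' hχ').ae_differentiableAt e]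
    with y h1 h2
  have hc : ∀ z i, V.coord e z i = (V.smul χ hχ).coord e z i + (V.smul χ' hχ').coord e z i :=
    fun z i => by
      change _ = χ _ * _ + χ' _ * _
      rw [← add_mul, h, one_mul]
  have hcov : ∀ i j, covDeriv conn V e y i j =
      covDeriv conn (V.smul χ hχ) e y i j + covDeriv conn (V.smul χ' hχ') e y i j := fun i j => by
    have hp : pd i (fun z => V.coord e z j) y = pd i (fun z => (V.smul χ hχ).coord e z j) y +
        pd i (fun z => (V.smul χ' hχ').coord e z j) y := by
      rw [← pd_add (h1 j) (h2 j)]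
      simp only [hc]
    unfold covDeriv
    rw [hp]
    simp only [hc y, Fin.sum_univ_two]
    ring
  simp only [integrand_eq, hcov]
  ring

variable {V} in
lemma LipHalfDensity.VanishesOff.integrand_eq_zero [T2Space M] {C : Set M} (hC : IsCompact C)
    (hV : V.VanishesOff C) (e : atlas (Coord 2) M) {y : Coord 2} (hy : y ∈ e.1.target)
    (hyC : e.1.symm y ∉ C) : integrand conn V W e y = 0 := by
  have ho : IsOpen (e.1.target ∩ e.1.symm ⁻¹' Cᶜ) :=
    e.1.continuousOn_symm.isOpen_inter_preimage e.1.open_target hC.isClosed.isOpen_compl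
  have hp : ∀ i j, pd i (fun z => V.coord e z j) y = 0 := fun i j => by
    rw [pd_congr (g := fun _ => (0 : ℝ)), pd_const]
    filter_upwards [ho.mem_nhds ⟨hy, hyC⟩] with z hz
    rw [hV e z hz.1 hz.2]
    rfl
  have hcov : ∀ i j, covDeriv conn V e y i j = 0 := fun i j => by
    simp [covDeriv, hp, hV e y hy hyC]
  simp [integrand_eq, hcov]

variable [MeasurableSpace M]

lemma densityMeasure_congr {dens dens' : atlas (Coord 2) M → Coord 2 → ℝ}
    (h : ∀ e, dens e =ᵐ[volume.restrict e.1.target] dens' e) :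
    densityMeasure dens = densityMeasure dens' := by
  unfold densityMeasure
  refine iSup_congr fun e => ?_
  have h' : (fun y => ENNReal.ofReal (dens e y)) =ᵐ[volume.restrict e.1.target]
      fun y => ENNReal.ofReal (dens' e y) := (h e).mono fun y hy => by simp only [hy]
  rw [withDensity_congr_ae h']

lemma densityIntegral_congr {dens dens' : atlas (Coord 2) M → Coord 2 → ℝ}
    (h : ∀ e, dens e =ᵐ[volume.restrict e.1.target] dens' e) :
    densityIntegral dens = densityIntegral dens' := by
  unfold densityIntegral
  rw [densityMeasure_congr h, densityMeasure_congr fun e =>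
    (h e).mono fun y hy => show -dens e y = -dens' e y by rw [hy]]

lemma DensityIntegrable.congr {dens dens' : atlas (Coord 2) M → Coord 2 → ℝ}
    (h : ∀ e, dens e =ᵐ[volume.restrict e.1.target] dens' e) (hi : DensityIntegrable dens) :
    DensityIntegrable dens' := by
  refine ⟨fun e => (hi.1 e).congr (h e), ?_⟩
  rw [← densityMeasure_congr fun e =>
    (h e).mono fun y hy => show |dens e y| = |dens' e y| by rw [hy]]
  exact hi.2

end Integrand

/-! ### The identity in an isothermal chart -/

section Local

variable {M : Type*} [TopologicalSpace M] [ChartedSpace (Coord 2) M] {g : SingularMetric 2 M}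
  {conn : MeasurableConnection 2 M}

/-- In isothermal coordinates, the Christoffel symbols of the Levi-Civita connection are those of a
conformal metric.  This is Koszul's formula. -/
lemma IsLeviCivita.exists_symbol_eq (h : IsLeviCivita g conn) {e : atlas (Coord 2) M}
    {φ : Coord 2 → ℝ} (hφ : IsIsothermal g e φ) :
    ∃ D, IsWeakGradientOn φ D e.1.target ∧ ∀ᵐ y ∂(volume.restrict e.1.target), ∀ i j k,
      conn.Γ e y i j k = conformalSymbol (fun k => D k y) i j k := by
  obtain ⟨D, hD, hDg⟩ := h e φ hφ
  refine ⟨D, hD, ?_⟩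
  filter_upwards [hDg, hφ.2, conn.torsionFree e] with y h1 h2 h3
  have hc := Real.exp_pos (2 * φ y)
  set c := Real.exp (2 * φ y)
  have h4 : ∀ i j k, conn.Γ e y j i k + conn.Γ e y i j k = if i = j then 2 * D k y else 0 := by
    intro i j k
    have := h1 i j k
    rw [h2] at this
    simp only [Matrix.smul_apply, Matrix.one_apply, smul_eq_mul, mul_ite, mul_one, mul_zero,
      ite_mul, zero_mul, Finset.sum_add_distrib, Finset.sum_ite_eq, Finset.sum_ite_eq',
      Finset.mem_univ, if_true] at this
    refine mul_left_cancel₀ hc.ne' ?_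
    rw [mul_add, ← this]
    split_ifs <;> ring
  intro i j k
  have a1 := h4 i j k
  have a2 := h4 i k j
  have a3 := h4 j k i
  have b1 := h3 j i k
  have b2 := h3 i j k
  have b3 := h3 k i j
  have e1 : (if i = j then 2 * D k y else 0) = 2 * if i = j then D k y else 0 := by
    split_ifs <;> simp
  have e2 : (if i = k then 2 * D j y else 0) = 2 * if i = k then D j y else 0 := by
    split_ifs <;> simp
  have e3 : (if j = k then 2 * D i y else 0) = 2 * if j = k then D i y else 0 := by
    split_ifs <;> simp
  rw [e1] at a1
  rw [e2] at a2
  rw [e3] at a3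
  unfold conformalSymbol
  linarith

/-- The terms of the integrand that are quadratic in the gradient `d` of the exponent cancel. What remains
is a combination of Jacobian determinants of the components, and the derivative of their inner product
in the direction `d`. -/
lemma integrand_eq_of_symbol {V W : LipHalfDensity 2 M} {e : atlas (Coord 2) M} {y : Coord 2}
    {d : Fin 2 → ℝ} (h : ∀ i j k, conn.Γ e y i j k = conformalSymbol d i j k) :
    integrand conn V W e y =
      (pd 0 (fun z => V.coord e z 0) y * pd 1 (fun z => W.coord e z 1) y -
        pd 1 (fun z => V.coord e z 0) y * pd 0 (fun z => W.coord e z 1) y) -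
      (pd 0 (fun z => V.coord e z 1) y * pd 1 (fun z => W.coord e z 0) y -
        pd 1 (fun z => V.coord e z 1) y * pd 0 (fun z => W.coord e z 0) y) +
      ∑ k, d k * ∑ i, (V.coord e y i * pd k (fun z => W.coord e z i) y +
        pd k (fun z => V.coord e z i) y * W.coord e y i) := by
  have hc : ∀ (V : LipHalfDensity 2 M) i j, covDeriv conn V e y i j =
      pd i (fun z => V.coord e z j) y + (if i = j then ∑ k, d k * V.coord e y k else 0) -
        d j * V.coord e y i := by
    intro V i j
    simp only [covDeriv, h, conformalSymbol, Fin.sum_univ_two]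
    fin_cases i <;> fin_cases j <;> simp <;> ring
  simp only [integrand_eq, hc, Fin.sum_univ_two]
  simp
  ring

variable {V : LipHalfDensity 2 M} (W : LipHalfDensity 2 M) (hg : HasBoundedIntegralCurvature g)
  [T2Space M]

omit [T2Space M] in
lemma isLipTest_coord {C : Set M} (hC : IsCompact C) (hV : V.VanishesOff C)
    {e : atlas (Coord 2) M} (hCe : C ⊆ e.1.source) (i : Fin 2) :
    IsLipTest (e.1.target.indicator fun y => V.coord e y i) e.1.target := by
  have hs : tsupport (e.1.target.indicator fun y => V.coord e y i) ⊆ e.1 '' C := by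
    refine closure_minimal (fun y hy => ?_)
      (hC.image_of_continuousOn (e.1.continuousOn.mono hCe)).isClosed
    by_cases hye : y ∈ e.1.target
    · by_contra hn
      refine hy ?_
      rw [indicator_of_mem hye,
        hV e y hye fun h => hn ⟨_, h, e.1.right_inv hye⟩]
      rfl
    · exact (hy (indicator_of_notMem hye _)).elim
  refine isLipTest_of_locallyLipschitzOn e.1.open_target
    (locallyLipschitzOn_congr (V.locallyLipschitzOn_coord e i) fun y hy => indicator_of_mem hy _)
    ((hC.image_of_continuousOn (e.1.continuousOn.mono hCe)).of_isClosed_subset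
      (isClosed_tsupport _) hs) (hs.trans ?_)
  rintro _ ⟨p, hp, rfl⟩
  exact e.1.map_source (hCe hp)

lemma integrable_jacobian {Ω : Set (Coord 2)} (hΩ : IsOpen Ω) {f h : Coord 2 → ℝ}
    (hf : IsLipTest f Ω) (hh : LocallyLipschitzOn Ω h) :
    Integrable fun x => pd 0 f x * pd 1 h x - pd 1 f x * pd 0 h x := by
  refine ((hf.integrable_mul_pd (locallyIntegrableOn_pd hΩ hh 1) 0).sub
    (hf.integrable_mul_pd (locallyIntegrableOn_pd hΩ hh 0) 1)).congr ?_
  exact ae_of_all _ fun x => by simp only [Pi.sub_apply]; ring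

omit [T2Space M] in
/-- For a half-density supported in an isothermal chart, the integral of the integrand of `Q`
reduces to the pairing of the gradient of the conformal exponent with that of `g(V, W) / dvol_g`:
the remaining terms are Jacobian determinants. -/
lemma integral_integrand_eq (hM : IsC11Manifold 2 M) {e : atlas (Coord 2) M} {φ : Coord 2 → ℝ}
    (hφ : IsIsothermal g e φ) {D : Fin 2 → Coord 2 → ℝ} (hD : IsWeakGradientOn φ D e.1.target)
    (hΓ : ∀ᵐ y ∂(volume.restrict e.1.target), ∀ i j k,
      conn.Γ e y i j k = conformalSymbol (fun k => D k y) i j k)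
    {C : Set M} (hC : IsCompact C) (hCe : C ⊆ e.1.source) (hV : V.VanishesOff C) :
    IntegrableOn (integrand conn V W e) e.1.target ∧
      ∫ y in e.1.target, integrand conn V W e y =
        gradPairing D (inChart e (metricQuotient hg V W)) := by
  set f := inChart e (metricQuotient hg V W) with hfdef
  have hf : IsLipTest f e.1.target := isLipTest_inChart (isLipFun_metricQuotient V W hg hM) hC hCe
    fun p hp => hV.metricQuotient_eq_zero W hg hp
  have hΩ := e.1.open_target
  set v : Fin 2 → Coord 2 → ℝ := fun i => e.1.target.indicator fun y => V.coord e y i with hvdef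
  have hv : ∀ i, IsLipTest (v i) e.1.target := isLipTest_coord hC hV hCe
  have hw := W.locallyLipschitzOn_coord e
  have i1 := integrable_jacobian hΩ (hv 0) (hw 1)
  have i2 := integrable_jacobian hΩ (hv 1) (hw 0)
  have i3 := (hf.integrable_mul_pd (hD.2.1 0) 0).add (hf.integrable_mul_pd (hD.2.1 1) 1)
  have hG := (i1.sub i2).add i3
  -- `v` is used instead of the components of `V`, to have test functions on the plane
  have hae : (fun y => (pd 0 (v 0) y * pd 1 (fun z => W.coord e z 1) y -
        pd 1 (v 0) y * pd 0 (fun z => W.coord e z 1) y) -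
      (pd 0 (v 1) y * pd 1 (fun z => W.coord e z 0) y -
        pd 1 (v 1) y * pd 0 (fun z => W.coord e z 0) y) +
      (D 0 y * pd 0 f y + D 1 y * pd 1 f y)) =ᵐ[volume.restrict e.1.target]
        integrand conn V W e := by
    filter_upwards [hΓ, V.ae_differentiableAt e, W.ae_differentiableAt e,
      ae_restrict_mem hΩ.measurableSet] with y h1 h2 h3 hy
    have hvy : ∀ k i, pd k (v i) y = pd k (fun z => V.coord e z i) y := fun k i => pd_congr (by
      filter_upwards [hΩ.mem_nhds hy] with z hz using indicator_of_mem hz _)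
    have hfy : ∀ k, pd k f y = ∑ i, (V.coord e y i * pd k (fun z => W.coord e z i) y +
        pd k (fun z => V.coord e z i) y * W.coord e y i) := fun k => by
      have : f =ᶠ[𝓝 y] fun z => ∑ i, V.coord e z i * W.coord e z i := by
        filter_upwards [hΩ.mem_nhds hy] with z hz
        rw [hfdef, inChart_apply hz, metricQuotient_eq V W hg hM hφ hz, Fin.sum_univ_two]
        rfl
      rw [pd_congr this, pd_sum _ _ fun i _ => (h2 i).fun_mul (h3 i)]
      exact Finset.sum_congr rfl fun i _ => pd_mul (h2 i) (h3 i)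
    rw [integrand_eq_of_symbol h1]
    simp only [hvy, hfy, Fin.sum_univ_two]
  refine ⟨hG.integrableOn.congr hae, ?_⟩
  have hz : ∀ y ∉ e.1.target, ∀ k i, pd k (v i) y = 0 := fun y hy k i =>
    pd_eq_zero_of_notMem fun h => hy ((hv i).2.2 h)
  have hzf : ∀ y ∉ e.1.target, ∀ k, pd k f y = 0 := fun y hy k =>
    pd_eq_zero_of_notMem fun h => hy (hf.2.2 h)
  rw [← integral_congr_ae hae, setIntegral_eq_of_tsupport fun y hy => by
      simp only [hz y hy, hzf y hy]; ring]
  have e1 := integral_add (i1.sub i2) i3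
  have e2 := integral_sub i1 i2
  simp only [Pi.sub_apply, Pi.add_apply] at e1
  rw [e1, e2, integral_jacobian_eq_zero hΩ (hv 0) (hw 1),
    integral_jacobian_eq_zero hΩ (hv 1) (hw 0), sub_zero, zero_add]
  rfl

variable [MeasurableSpace M] [BorelSpace M]

omit [T2Space M] in
/-- The defining identity of the curvature measure, for Lipschitz functions. -/
lemma IsCurvatureMeasure.integral_eq {K : SignedRadonMeasure M} (hK : IsCurvatureMeasure g K)
    {e : atlas (Coord 2) M} {φ : Coord 2 → ℝ} (hφ : IsIsothermal g e φ)
    {D : Fin 2 → Coord 2 → ℝ} (hD : IsWeakGradientOn φ D e.1.target) {H : M → ℝ}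
    (hH : IsLipFun H) {C : Set M} (hC : IsCompact C) (hCe : C ⊆ e.1.source)
    (h0 : ∀ p ∉ C, H p = 0) :
    ∫ p, H p ∂K.pos - ∫ p, H p ∂K.neg = gradPairing D (inChart e H) := by
  have hl := isLipTest_inChart hH hC hCe h0
  have hs := e.1.open_source.measurableSet
  have hem : ∀ κ : Measure M, AEMeasurable e.1 (κ.restrict e.1.source) := fun κ =>
    e.1.continuousOn.aemeasurable hs
  have hmap : ∀ (κ : Measure M) {f : Coord 2 → ℝ}, Continuous f →
      ∫ x, f x ∂(Measure.map e.1 (κ.restrict e.1.source)) = ∫ p in e.1.source, f (e.1 p) ∂κ :=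
    fun κ f hf => integral_map (hem κ) hf.aestronglyMeasurable
  have hfin : ∀ κ : Measure M, IsLocallyFiniteMeasure κ → ∀ L : Set (Coord 2), IsCompact L →
      L ⊆ e.1.target → Measure.map e.1 (κ.restrict e.1.source) L < ⊤ := by
    intro κ hκ L hL hLe
    rw [Measure.map_apply_of_aemeasurable (hem κ) hL.isClosed.measurableSet,
      Measure.restrict_apply' hs]
    refine (measure_mono ?_).trans_lt
      ((hL.image_of_continuousOn (e.1.continuousOn_symm.mono hLe)).measure_lt_top (μ := κ))
    rintro p ⟨hp, hpe⟩
    exact ⟨e.1 p, hp, e.1.left_inv hpe⟩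
  have key := integral_sub_integral_eq_of_laplacian e.1.open_target hD
    (hfin K.pos K.locallyFinite_pos) (hfin K.neg K.locallyFinite_neg)
    (fun f hf hc hfs => by rw [hmap _ hf.continuous, hmap _ hf.continuous]; exact hK e φ hφ f hf hc hfs)
    hl
  have hset : ∀ κ : Measure M, ∫ p, H p ∂κ = ∫ p in e.1.source, inChart e H (e.1 p) ∂κ := by
    intro κ
    rw [← setIntegral_eq_integral_of_forall_compl_eq_zero (s := e.1.source)
      fun p hp => h0 p fun h => hp (hCe h)]
    refine setIntegral_congr_fun hs fun p hp => ?_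
    rw [inChart_apply (e.1.map_source hp), e.1.left_inv hp]
  rw [hset, hset, ← hmap _ hl.continuous, ← hmap _ hl.continuous, key]
  rfl

/-- The conclusion for a half-density supported in a single isothermal chart. -/
lemma densityIntegral_integrand_of_chart (hM : IsC11Manifold 2 M) (c : IsothermalCover g)
    (hconn : IsLeviCivita g conn) {e : atlas (Coord 2) M} {φ : Coord 2 → ℝ}
    (hφ : IsIsothermal g e φ) {C : Set M} (hC : IsCompact C) (hCe : C ⊆ e.1.source)
    (hV : V.VanishesOff C) :
    DensityIntegrable (integrand conn V W) ∧
      ∀ K : SignedRadonMeasure M, IsCurvatureMeasure g K →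
        densityIntegral (integrand conn V W) =
          ∫ p, metricQuotient hg V W p ∂K.pos - ∫ p, metricQuotient hg V W p ∂K.neg := by
  obtain ⟨D, hD, hΓ⟩ := hconn.exists_symbol_eq hφ
  have h1 := integral_integrand_eq W hg hM hφ hD hΓ hC hCe hV
  have h2 := densityIntegral_of_chart hM (isDensity_integrand conn V W hM) c.partition e
    (fun e' => by
      filter_upwards [ae_restrict_mem e'.1.open_target.measurableSet] with y hy hye
      exact hV.integrand_eq_zero conn W hC e' hy fun h => hye (hCe h)) h1.1
  refine ⟨h2.1, fun K hK => ?_⟩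
  rw [h2.2, h1.2, hK.integral_eq hφ hD (isLipFun_metricQuotient V W hg hM) hC hCe
    fun p hp => hV.metricQuotient_eq_zero W hg hp]

end Local

/-! ### The identity on the surface -/

section Global

variable {M : Type*} [TopologicalSpace M] [ChartedSpace (Coord 2) M] [T2Space M]
  [MeasurableSpace M] [BorelSpace M] {g : SingularMetric 2 M}
  {conn : MeasurableConnection 2 M} (W : LipHalfDensity 2 M)

omit [ChartedSpace (Coord 2) M] in
lemma SignedRadonMeasure.integrable (K : SignedRadonMeasure M) {H : M → ℝ} (hH : Continuous H)
    {C : Set M} (hC : IsCompact C) (h0 : ∀ p ∉ C, H p = 0) :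
    Integrable H K.pos ∧ Integrable H K.neg := by
  have := K.locallyFinite_pos
  have := K.locallyFinite_neg
  exact ⟨integrable_of_continuous_of_compact hH hC h0, integrable_of_continuous_of_compact hH hC h0⟩

/-- The conclusion for half-densities supported in finitely many sets of an isothermal cover, by
induction on their number: multiplication by the cutoff function of the last set and by its
complement splits off a half-density supported in a single chart. -/
lemma densityIntegral_integrand_of_finite (hg : HasBoundedIntegralCurvature g)
    (hM : IsC11Manifold 2 M) (c : IsothermalCover g) (hconn : IsLeviCivita g conn) (N : ℕ) :
    ∀ (V : LipHalfDensity 2 M) (C : Set M), IsCompact C → V.VanishesOff C →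
      (∀ e : atlas (Coord 2) M, ∀ y ∈ e.1.target, (∀ i < N, e.1.symm y ∉ c.dom i) →
        V.coord e y = 0) →
      DensityIntegrable (integrand conn V W) ∧
      ∀ K : SignedRadonMeasure M, IsCurvatureMeasure g K →
        densityIntegral (integrand conn V W) =
          ∫ p, metricQuotient hg V W p ∂K.pos - ∫ p, metricQuotient hg V W p ∂K.neg := by
  induction N with
  | zero =>
    intro V C hC hVC hV
    refine densityIntegral_integrand_of_chart W hg hM c hconn (c.isothermal 0) isCompact_empty
      (empty_subset _) fun e y hy _ => hV e y hy fun i hi => (Nat.not_lt_zero i hi).elim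
  | succ N ih =>
    intro V C hC hVC hV
    have hχ := c.isLipFun_hat hM N
    have hχ' := (isLipFun_const (1 : ℝ)).sub hχ
    set V₁ := V.smul _ hχ with hV₁
    set V₂ := V.smul _ hχ' with hV₂
    have h1 := densityIntegral_integrand_of_chart (V := V₁) W hg hM c hconn (c.isothermal N)
      (c.isCompact_core N) (c.core_subset N) fun e y hy hyc => by
        ext i
        change c.hat N (e.1.symm y) * V.coord e y i = 0
        rw [c.hat_eq_zero hyc, zero_mul]
    have hV₂C : V₂.VanishesOff C := fun e y hy hyC => by
      ext i
      change (1 - c.hat N (e.1.symm y)) * V.coord e y i = 0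
      rw [hVC e y hy hyC, Pi.zero_apply, mul_zero]
    have hV₁C : V₁.VanishesOff C := fun e y hy hyC => by
      ext i
      change c.hat N (e.1.symm y) * V.coord e y i = 0
      rw [hVC e y hy hyC, Pi.zero_apply, mul_zero]
    have h2 := ih V₂ C hC hV₂C fun e y hy hyN => by
      ext i
      change (1 - c.hat N (e.1.symm y)) * V.coord e y i = 0
      by_cases hp : e.1.symm y ∈ c.dom N
      · rw [c.hat_eq_one hp, sub_self, zero_mul]
      · rw [hV e y hy fun i hi => ?_, Pi.zero_apply, mul_zero]
        rcases Nat.lt_succ_iff_lt_or_eq.1 hi with hi | rfl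
        · exact hyN i hi
        · exact hp
    have hd₁ := isDensity_integrand conn V₁ W hM
    have hd₂ := isDensity_integrand conn V₂ W hM
    have hsum : ∀ e : atlas (Coord 2) M,
        (fun y => integrand conn V₁ W e y + integrand conn V₂ W e y)
          =ᵐ[volume.restrict e.1.target] integrand conn V W e := fun e =>
      (ae_integrand_smul_add conn V W _ _ hχ hχ' (fun p => add_sub_cancel _ _) e).mono
        fun y hy => hy.symm
    refine ⟨(h1.1.add hM c.partition hd₁ hd₂ h2.1).congr hsum, fun K hK => ?_⟩
    have hF : ∀ p, metricQuotient hg V W p =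
        metricQuotient hg V₁ W p + metricQuotient hg V₂ W p := fun p => by
      rw [hV₁, hV₂, metricQuotient_smul, metricQuotient_smul]
      ring
    have i1 := K.integrable (isLipFun_metricQuotient V₁ W hg hM).continuous hC
      fun p hp => hV₁C.metricQuotient_eq_zero W hg hp
    have i2 := K.integrable (isLipFun_metricQuotient V₂ W hg hM).continuous hC
      fun p hp => hV₂C.metricQuotient_eq_zero W hg hp
    rw [← densityIntegral_congr hsum, densityIntegral_add hM c.partition hd₁ hd₂ h1.1 h2.1,
      h1.2 K hK, h2.2 K hK]
    simp only [hF]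
    rw [integral_add i1.1 i2.1, integral_add i1.2 i2.2]
    ring

/-- The conclusion for all half-densities: a compact support is contained in the union of finitely many
sets of an isothermal cover. -/
lemma densityIntegral_integrand_eq (hg : HasBoundedIntegralCurvature g)
    (hM : IsC11Manifold 2 M) (c : IsothermalCover g) (hconn : IsLeviCivita g conn)
    (V : LipHalfDensity 2 M) :
    DensityIntegrable (integrand conn V W) ∧
      ∀ K : SignedRadonMeasure M, IsCurvatureMeasure g K →
        densityIntegral (integrand conn V W) =
          ∫ p, metricQuotient hg V W p ∂K.pos - ∫ p, metricQuotient hg V W p ∂K.neg := by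
  obtain ⟨C, hC, hV⟩ := V.compactSupport
  obtain ⟨N, hN⟩ := c.exists_subset_iUnion_lt hC
  refine densityIntegral_integrand_of_finite W hg hM c hconn N V C hC hV fun e y hy hyN => ?_
  refine hV e y hy fun h => ?_
  obtain ⟨i, hi, hp⟩ := hN _ h
  exact hyN i hi hp

end Global

/-! ### The empty surface -/

section Empty

variable {M : Type*} [TopologicalSpace M] [ChartedSpace (Coord 2) M] [IsEmpty M]

lemma target_eq_empty (e : atlas (Coord 2) M) : e.1.target = ∅ :=
  eq_empty_of_forall_notMem fun y _ => isEmptyElim (e.1.symm y)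

lemma exists_leviCivita_of_isEmpty (g : SingularMetric 2 M) :
    ∃ conn : MeasurableConnection 2 M, IsLeviCivita g conn := by
  have hT : ∀ e e' : atlas (Coord 2) M, (chartTrans e e').source = ∅ := fun e e' =>
    eq_empty_of_forall_notMem fun y _ => isEmptyElim (e.1.symm y)
  refine ⟨{ Γ := fun _ _ _ _ _ => 0
            aemeasurable := fun _ _ _ _ => aemeasurable_const
            torsionFree := fun _ => ae_of_all _ fun _ _ _ _ => rfl
            transform := fun e e' => by simp [hT] }, fun e φ hφ => ?_⟩
  obtain ⟨D, hD⟩ := (hφ.1.exists_weakGradient e.1.open_target).1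
  exact ⟨D, hD, by simp [target_eq_empty]⟩

lemma exists_curvatureMeasure_of_isEmpty [MeasurableSpace M] (g : SingularMetric 2 M) :
    ∃ K : SignedRadonMeasure M, IsCurvatureMeasure g K :=
  ⟨⟨0, 0, inferInstance, inferInstance⟩, fun e φ _ f _ _ _ => by simp [target_eq_empty]⟩

lemma densityMeasure_univ_of_isEmpty [MeasurableSpace M] (dens : atlas (Coord 2) M → Coord 2 → ℝ) :
    densityMeasure dens univ = 0 := by
  rw [eq_empty_of_isEmpty (univ : Set M), measure_empty]

end Empty

end TameConn

theorem proposition4p3 {M : Type*} [TopologicalSpace M] [T2Space M] [SecondCountableTopology M]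
    [MeasurableSpace M] [BorelSpace M] [ChartedSpace (TameConn.Coord 2) M]
    (hM : TameConn.IsC11Manifold 2 M)
    (g : TameConn.SingularMetric 2 M) (hg : TameConn.HasBoundedIntegralCurvature g) :
    (∃ conn : TameConn.MeasurableConnection 2 M, TameConn.IsLeviCivita g conn) ∧
    (∃ K : TameConn.SignedRadonMeasure M, TameConn.IsCurvatureMeasure g K) ∧
    ∀ conn : TameConn.MeasurableConnection 2 M, TameConn.IsLeviCivita g conn →
      TameConn.IsTame conn ∧
      ∀ K : TameConn.SignedRadonMeasure M, TameConn.IsCurvatureMeasure g K →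
        ∀ V W : TameConn.LipHalfDensity 2 M,
          ∃ F : M → ℝ, TameConn.IsLipQuotient g V W F ∧
            MeasureTheory.Integrable F K.pos ∧ MeasureTheory.Integrable F K.neg ∧
            TameConn.Q conn V W = (∫ p, F p ∂K.pos) - ∫ p, F p ∂K.neg := by
  -- isothermal covers are indexed by `ℕ`, so the empty surface is treated separately
  rcases isEmpty_or_nonempty M with hE | hE
  · refine ⟨TameConn.exists_leviCivita_of_isEmpty g, TameConn.exists_curvatureMeasure_of_isEmpty g,
      fun conn _ => ⟨fun V W => ⟨fun e => by simp [TameConn.target_eq_empty],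
        by rw [TameConn.densityMeasure_univ_of_isEmpty]; exact ENNReal.zero_lt_top⟩,
        fun K _ V W => ⟨fun _ => 0, fun e => ?_, integrable_zero _ _ _, integrable_zero _ _ _, ?_⟩⟩⟩
    · simp only [TameConn.target_eq_empty, Measure.restrict_empty, ae_zero]
      exact ⟨TameConn.locallyLipschitzOn_const 0, Filter.eventually_bot⟩
    · simp [TameConn.Q, TameConn.densityIntegral, TameConn.densityMeasure_univ_of_isEmpty]
  · obtain ⟨c⟩ := TameConn.exists_isothermalCover hg
    refine ⟨TameConn.exists_leviCivita hM c, TameConn.exists_curvatureMeasure hM c,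
      fun conn hconn =>
        ⟨fun V W => (TameConn.densityIntegral_integrand_eq W hg hM c hconn V).1,
        fun K hK V W => ⟨TameConn.metricQuotient hg V W,
          TameConn.isLipQuotient_metricQuotient V W hg hM c, ?_⟩⟩⟩
    obtain ⟨C, hC, hV⟩ := V.compactSupport
    have hi := K.integrable (TameConn.isLipFun_metricQuotient V W hg hM).continuous hC
      fun p hp => TameConn.LipHalfDensity.VanishesOff.metricQuotient_eq_zero W hg hV hp
    exact ⟨hi.1, hi.2, (TameConn.densityIntegral_integrand_eq W hg hM c hconn V).2 K hK⟩
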